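/- Let $d\ge 2$, $\langle\xi\rangle=\sqrt{1+|\xi|^2}$, and for $k\ge 0$ let $\|f\|_{L^2_k}=\big(\int_{\mathbb R^d}|f(\xi)|^2\langle\xi\rangle^{2k}\,d\xi\big)^{1/2}$. For $v,v_*\in\mathbb R^d$, $\sigma\in\mathbb S^{d-1}$ put $v'=\frac{v+v_*}2+\frac{|v-v_*|}2\sigma$, $v'_*=\frac{v+v_*}2-\frac{|v-v_*|}2\sigma$, and define $$\mathcal Q^+(f,f)(v)=\frac1{|\mathbb S^{d-1}|}\int_{\mathbb R^d\times\mathbb S^{d-1}}|v-v_*|f(v'_*)f(v')\,dv_*\,d\sigma,\qquad \mathcal Q^-(f,f)(v)=f(v)\int_{\mathbb R^d}|v-v_*|f(v_*)\,dv_*,$$ $$\mathbb B_\alpha(f,f)=(1-\alpha)\mathcal Q^+(f,f)-\mathcal Q^-(f,f).$$ For $\alpha\in(0,1)$ let $\mathscr E_\alpha$ be the set of all nonnegative $\psi$ with $\int\psi\,\langle\xi\rangle^3\,d\xi<\infty$, $\int\psi\,d\xi=1$, $\int\psi\,\xi\,d\xi=0$, $\int\psi\,|\xi|^2\,d\xi=\frac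 d2$, that solve, in the sense of distributions on $\mathbb R^d$, $$\mathbf A_\psi\,\psi+\mathbf B_\psi\,\xi\cdot\nabla_\xi\psi=\mathbb B_\alpha(\psi,\psi),$$ where $$\mathbf A_\psi=-\frac\alpha2\int_{\mathbb R^d}\big(d+2-2|\xi|^2\big)\mathcal Q^-(\psi,\psi)(\xi)\,d\xi,\qquad \mathbf B_\psi=-\frac{\alpha}{2d}\int_{\mathbb R^d}\big(d-2|\xi|^2\big)\mathcal Q^-(\psi,\psi)(\xi)\,d\xi .$$ Let $$\varrho_{3/2}=\frac1{|\mathbb S^{d-1}|}\int_{\mathbb S^{d-1}}\Big[\Big(\frac{1+\hat U\cdot\sigma}2\Big)^{3/2}+\Big(\frac{1-\hat U\cdot\sigma}2\Big)^{3/2}\Big]d\sigma$$ for any unit vector $\hat U$ (the value does not depend on it), and $$\alpha_0=\frac{1-\varrho_{3/2}}{\frac32-\varrho_{3/2}},\qquad \alpha_2=\frac{2\sqrt2}{4\sqrt2+d(\sqrt2-1)},\qquad \underline\alpha=\min(\alpha_0,\alpha_2).$$ Then for every $\alpha_\star<\underline\alpha$ and every real $k\ge 0$, $$\sup_{\alpha\in(0,\alpha_\star)}\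 \sup_{\psi_\alpha\in\mathscr E_\alpha}\|\psi_\alpha\|_{L^2_k}<\infty .$$ That is, there is a finite constant depending only on $d$, $\alpha_\star$ and $k$ that bounds $\|\psi_\alpha\|_{L^2_k}$ for all $\alpha\in(0,\alpha_\star)$ and all $\psi_\alpha\in\mathscr E_\alpha$. -/

import Mathlib

open MeasureTheory

noncomputable section

namespace Annihilation

/-- Velocity space `ℝ^d` with its Euclidean norm. -/
abbrev E (d : ℕ) : Type := EuclideanSpace ℝ (Fin d)

/-- The unit sphere `𝕊^{d-1}`. -/
abbrev Sph (d : ℕ) : Type := Metric.sphere (0 : E d) 1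

/-- The surface measure on `𝕊^{d-1}` (not normalized). -/
def surf (d : ℕ) : Measure (Sph d) := (volume : Measure (E d)).toSphere

/-- The total surface `|𝕊^{d-1}|`. -/
def sphereArea (d : ℕ) : ℝ := (surf d).real Set.univ

/-- The Japanese bracket `⟨ξ⟩ = √(1 + |ξ|²)`. -/
def bracket {d : ℕ} (ξ : E d) : ℝ := Real.sqrt (1 + ‖ξ‖ ^ 2)

/-- Post-collisional velocity `v' = (v + v_*)/2 + (|v - v_*|/2) σ`. -/
def post {d : ℕ} (v vs : E d) (σ : Sph d) : E d :=
  (1 / 2 : ℝ) • (v + vs) + (‖v - vs‖ / 2) • (σ : E d)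

/-- Post-collisional velocity `v'_* = (v + v_*)/2 - (|v - v_*|/2) σ`. -/
def postStar {d : ℕ} (v vs : E d) (σ : Sph d) : E d :=
  (1 / 2 : ℝ) • (v + vs) - (‖v - vs‖ / 2) • (σ : E d)

/-- Gain operator
`𝒬⁺(g,f)(v) = |𝕊^{d-1}|⁻¹ ∫_{ℝ^d × 𝕊^{d-1}} |v - v_*| f(v'_*) g(v') dv_* dσ`. -/
def Qplus {d : ℕ} (g f : E d → ℝ) (v : E d) : ℝ :=
  (1 / sphereArea d) *
    ∫ p : E d × Sph d,
      ‖v - p.1‖ * f (postStar v p.1 p.2) * g (post v p.1 p.2)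
        ∂((volume : Measure (E d)).prod (surf d))

/-- `L(f)(v) = ∫ |v - v_*| f(v_*) dv_*`. -/
def collFreq {d : ℕ} (f : E d → ℝ) (v : E d) : ℝ := ∫ vs : E d, ‖v - vs‖ * f vs

/-- Loss operator `𝒬⁻(g,f) = g L(f)`. -/
def Qminus {d : ℕ} (g f : E d → ℝ) (v : E d) : ℝ := g v * collFreq f v

/-- Annihilation operator `𝔹_α(f,f) = (1-α) 𝒬⁺(f,f) - 𝒬⁻(f,f)`. -/
def annih {d : ℕ} (α : ℝ) (f : E d → ℝ) (v : E d) : ℝ :=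
  (1 - α) * Qplus f f v - Qminus f f v

/-- The coefficient `𝐀_ψ = -(α/2) ∫ (d + 2 - 2|ξ|²) 𝒬⁻(ψ,ψ)(ξ) dξ`. -/
def coefA {d : ℕ} (α : ℝ) (ψ : E d → ℝ) : ℝ :=
  -(α / 2) * ∫ ξ : E d, ((d : ℝ) + 2 - 2 * ‖ξ‖ ^ 2) * Qminus ψ ψ ξ

/-- The coefficient `𝐁_ψ = -(α/(2d)) ∫ (d - 2|ξ|²) 𝒬⁻(ψ,ψ)(ξ) dξ`. -/
def coefB {d : ℕ} (α : ℝ) (ψ : E d → ℝ) : ℝ :=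
  -(α / (2 * (d : ℝ))) * ∫ ξ : E d, ((d : ℝ) - 2 * ‖ξ‖ ^ 2) * Qminus ψ ψ ξ

/-- `ψ` solves `𝐀_ψ ψ + 𝐁_ψ ξ·∇ψ = 𝔹_α(ψ,ψ)` in the sense of distributions on `ℝ^d`; the
transport term is integrated by parts: `-∫ ψ div(φ ξ) dξ = -∫ ψ (d φ + ξ·∇φ) dξ`. -/
def IsWeakSolution {d : ℕ} (α : ℝ) (ψ : E d → ℝ) : Prop :=
  ∀ φ : E d → ℝ, ContDiff ℝ (⊤ : ℕ∞) φ → HasCompactSupport φ →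
    coefA α ψ * (∫ ξ : E d, ψ ξ * φ ξ)
      - coefB α ψ * (∫ ξ : E d, ψ ξ * ((d : ℝ) * φ ξ + fderiv ℝ φ ξ ξ))
      = ∫ ξ : E d, annih α ψ ξ * φ ξ

/-- The set `ℰ_α` of all nonnegative self-similar profiles with unit mass, zero momentum and
energy `d/2`. For nonnegative `ψ` with these moments, `|ξ|² 𝒬⁻(ψ,ψ)` is integrable, that is,
`𝐀_ψ` and `𝐁_ψ` are meaningful, exactly when `ψ` belongs to `L¹_3`. -/
structure IsProfile {d : ℕ} (α : ℝ) (ψ : E d → ℝ) : Prop where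
  nonneg : ∀ᵐ ξ : E d, 0 ≤ ψ ξ
  memL1 : Integrable (fun ξ : E d => ψ ξ * bracket ξ ^ 3)
  mass : ∫ ξ : E d, ψ ξ = 1
  momentum : ∫ ξ : E d, ψ ξ • ξ = 0
  energy : ∫ ξ : E d, ψ ξ * ‖ξ‖ ^ 2 = (d : ℝ) / 2
  solution : IsWeakSolution α ψ

/-- The set `ℰ_α`. -/
def profiles (d : ℕ) (α : ℝ) : Set (E d → ℝ) := {ψ | IsProfile α ψ}

/-- The weighted norm `‖f‖_{L²_k} = (∫ |f|² ⟨ξ⟩^{2k} dξ)^{1/2}`, with values in `[0,∞]`. -/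
def normL2 {d : ℕ} (k : ℝ) (f : E d → ℝ) : ENNReal :=
  eLpNorm (fun ξ : E d => f ξ * bracket ξ ^ k) 2 volume

/-- The unit vector `(1,0,…,0)` of `ℝ^d`. -/
def unitVec (d : ℕ) : E d := WithLp.toLp 2 (fun i : Fin d => if (i : ℕ) = 0 then (1 : ℝ) else 0)

/-- `ϱ_k = |𝕊^{d-1}|⁻¹ ∫_{𝕊^{d-1}} [((1 + Û·σ)/2)^k + ((1 - Û·σ)/2)^k] dσ`; by rotation
invariance the unit vector `Û` is irrelevant and is taken to be `(1,0,…,0)`. -/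
def varrho (d : ℕ) (k : ℝ) : ℝ :=
  (1 / sphereArea d) *
    ∫ σ : Sph d, (((1 + inner ℝ (unitVec d) (σ : E d)) / 2) ^ k
      + ((1 - inner ℝ (unitVec d) (σ : E d)) / 2) ^ k) ∂(surf d)

/-- The threshold `α₀ = (1 - ϱ_{3/2}) / (3/2 - ϱ_{3/2})`. -/
def alpha0 (d : ℕ) : ℝ := (1 - varrho d (3 / 2)) / (3 / 2 - varrho d (3 / 2))

/-- The threshold `α₂ = 2√2 / (4√2 + d(√2 - 1))`. -/
def alpha2 (d : ℕ) : ℝ :=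
  2 * Real.sqrt 2 / (4 * Real.sqrt 2 + (d : ℝ) * (Real.sqrt 2 - 1))

/-- The explicit threshold `min(α₀, α₂)`. -/
def alphaBar (d : ℕ) : ℝ := min (alpha0 d) (alpha2 d)

end Annihilation

end

noncomputable section

namespace Annihilation

open Filter
open scoped ENNReal NNReal Topology

/-! The bound is an energy estimate: test the equation with `ψ w`, where `w = (1 + ε|ξ|²)^K`. The
loss term produces `∫ ψ² ⟨ξ⟩ w` with a positive constant. The gain term is a small multiple of the
same integral plus a constant depending only on moments. Both constants must be uniform in `α` and
`ψ`, and the integral must be known to be finite before it can be absorbed.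

Write `a` for the total collision rate (`rateA`) and `b` for its energy-weighted analogue (`rateB`).
Then `B = α (b - a) / 2` and `A = d B - α a`. Two thresholds enter.

Moments use `α < α₀`. A Povzner inequality with constant `ϱ_{3/2}` (`sphAvg_bracket_pow_le`) turns
the equation tested with `⟨ξ⟩³` into a bound for the fourth moment. The drift contributes the square
of the third moment, which Cauchy–Schwarz bounds by `(3/2) α` times the fourth moment. The condition
`α < α₀` says that `1 - (1 - α) ϱ` exceeds `(3/2) α`. Once the fourth moment is bounded, `b` is
bounded and the higher moments follow by induction (`exists_moment_bound`). The hypothesis gives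
only the third moment. The higher ones are first shown to be finite, with constants depending on the
profile, through truncated powers (`integrable_pow_succ`).

Coercivity uses `α < α₂`. From `a ≤ 2 L(v)` and `a ≤ √2 b` one gets `L - α a - (d/2) B⁻ ≥ γ L` with
`γ > 0` (`coercive`), and the moment bounds give `L(v) ≥ c ⟨v⟩` (`exists_collFreq_lower`).

Since `ψ` is only a distributional solution in a weighted `L¹` space, testing with `ψ` is justified
by dilations, whose generator is `ξ·∇`. The equation becomes an identity for `ψ(eᵗ ξ) - ψ(ξ)` valid
almost everywhere, hence against nonsmooth test functions. For a convex `β` the renormalized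
identity then follows because the resulting function of `t` has a minimum at `t = 0`
(`renormalized`). It is used with a truncated square, so that every integral is finite.

The gain term is estimated through the substitution `σ = 2(e·ω)ω - e`, which gives `v' = v_* +
(u·ω)ω` with `u = v - v_*`. The gain is thereby controlled by averages over spheres with diameter
`[v_*, v]`, restricted to cones (`coneAvg`). These averages are bounded on `L¹` and `L²`, with small
`L¹` constant on narrow cones. They also smooth: expanding the square of an average over two
directions, nearly parallel pairs cost a small multiple of the `L²` norm because caps are small, and
transversal pairs are bounded by the `L¹` norm through a change of variables (`coneAvg_smoothing`).

The gain estimate is used twice. First, for a single profile, a truncation at level `M` and a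
decomposition by the size of `ψ(v_*)` show that the energy is finite (`exists_truncEnergy_bound`),
with constants depending on the profile. Then the smoothing estimate gives a uniform inequality
(`exists_gain_energy_le`), which the finite energy can absorb (`exists_energy_bound`). -/

/-! ### Integration over the sphere: polar coordinates and rotations -/

lemma norm_sph {d : ℕ} (σ : Sph d) : ‖(σ : E d)‖ = 1 := by
  simp

lemma nontrivial_E {d : ℕ} (hd : 2 ≤ d) : Nontrivial (E d) := by
  have : Nonempty (Fin d) := ⟨⟨0, by omega⟩⟩
  infer_instance

instance {d : ℕ} : IsFiniteMeasure (surf d) := by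
  unfold surf; infer_instance

lemma measurable_coe_sph {d : ℕ} : Measurable (fun σ : Sph d => (σ : E d)) :=
  measurable_subtype_coe

/-- Polar coordinates for nonnegative functions. -/
lemma lintegral_polar {d : ℕ} (hd : 2 ≤ d) {F : E d → ℝ≥0∞} (hF : Measurable F) :
    ∫⁻ x, F x = ∫⁻ σ : Sph d, (∫⁻ r in Set.Ioi (0 : ℝ),
      ENNReal.ofReal (r ^ (d - 1)) * F (r • (σ : E d))) ∂surf d := by
  have := nontrivial_E hd
  have h0 : ∫⁻ x, F x = ∫⁻ x : ({0}ᶜ : Set (E d)), F x ∂((volume : Measure (E d)).comap (↑)) := by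
    rw [lintegral_subtype_comap (measurableSet_singleton _).compl, restrict_compl_singleton]
  have hm : Measurable fun p : Sph d × Set.Ioi (0 : ℝ) => F ((p.2 : ℝ) • (p.1 : E d)) := by
    fun_prop
  have h1 := (volume : Measure (E d)).measurePreserving_homeomorphUnitSphereProd.lintegral_comp hm
  rw [h0]
  have h2 : ∀ x : ({0}ᶜ : Set (E d)), F ((((homeomorphUnitSphereProd (E d)) x).2 : ℝ) •
      (((homeomorphUnitSphereProd (E d)) x).1 : E d)) = F x := by
    intro x
    have : ‖(x : E d)‖ ≠ 0 := norm_ne_zero_iff.2 x.2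
    simp [smul_smul, this]
  simp only [h2] at h1
  rw [h1, lintegral_prod _ hm.aemeasurable]
  refine lintegral_congr fun σ => ?_
  rw [Measure.volumeIoiPow, lintegral_withDensity_eq_lintegral_mul _ (by fun_prop) (by fun_prop)]
  simp only [finrank_euclideanSpace_fin, Pi.mul_apply]
  rw [lintegral_subtype_comap measurableSet_Ioi
    (fun r : ℝ => ENNReal.ofReal (r ^ (d - 1)) * F (r • (σ : E d)))]

/-- The radial factor relating the sphere to the unit ball. Only its being positive and finite
matters, since it is cancelled on both sides. -/
lemma lintegral_pow_unit (d : ℕ) :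
    ∃ c : ℝ≥0∞, c ≠ 0 ∧ c ≠ ∞ ∧
      ∫⁻ r in Set.Ioi (0 : ℝ), ENNReal.ofReal (r ^ (d - 1)) * (Set.Iio (1 : ℝ)).indicator 1 r
        = c := by
  refine ⟨_, ?_, ?_, rfl⟩
  · refine (setLIntegral_pos_iff (Measurable.mul (by fun_prop)
      (measurable_one.indicator measurableSet_Iio))).2 ?_ |>.ne'
    refine lt_of_lt_of_le ?_ (measure_mono (s := Set.Ioo (0 : ℝ) 1) ?_)
    · simp
    · intro r hr
      refine ⟨?_, hr.1⟩
      simp only [Function.mem_support]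
      have : (0 : ℝ) < r ^ (d - 1) := pow_pos hr.1 _
      simp [Set.indicator_of_mem, hr.2, this]
  -- The value `∞` on `r ≤ 0` makes the comparison trivial there, and the restricted measure does
  -- not see it.
  · refine ne_of_lt (lt_of_le_of_lt (lintegral_mono
      (g := fun r => (Set.Ioo (0 : ℝ) 1).indicator 1 r + (Set.Iic (0 : ℝ)).indicator (fun _ => ∞) r)
      ?_) ?_)
    · intro r
      by_cases h0 : 0 < r
      · by_cases h1 : r < 1
        · simp [h0, h1, Set.indicator]
          rw [if_neg (by linarith)]
          simp
          exact pow_le_one₀ h0.le h1.le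
        · simp [h1, Set.indicator]
      · simp [Set.indicator, not_lt.1 h0]
    · rw [lintegral_add_left (measurable_one.indicator measurableSet_Ioo)]
      have : ∫⁻ r in Set.Ioi (0 : ℝ), (Set.Iic (0:ℝ)).indicator (fun _ => ∞) r = 0 := by
        rw [lintegral_indicator measurableSet_Iic, Measure.restrict_restrict measurableSet_Iic,
          Set.Iic_inter_Ioi, Set.Ioc_self]
        simp
      rw [this, lintegral_indicator_one measurableSet_Ioo]
      simp only [add_zero]
      exact lt_of_le_of_lt (Measure.restrict_apply_le _ _) (by simp)

/-- Integrals over the sphere as integrals of homogeneous extensions over the ball. -/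
lemma lintegral_sphere_eq {d : ℕ} (hd : 2 ≤ d) :
    ∃ c : ℝ≥0∞, c ≠ 0 ∧ c ≠ ∞ ∧ ∀ F : E d → ℝ≥0∞, Measurable F →
      c * ∫⁻ σ : Sph d, F σ ∂surf d =
        ∫⁻ x : E d, (Metric.ball (0 : E d) 1).indicator (fun x => F (‖x‖⁻¹ • x)) x := by
  obtain ⟨c, hc0, hc1, hc⟩ := lintegral_pow_unit d
  refine ⟨c, hc0, hc1, fun F hF => ?_⟩
  have hm : Measurable fun x : E d => (Metric.ball (0 : E d) 1).indicator
      (fun x => F (‖x‖⁻¹ • x)) x :=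
    (hF.comp (by fun_prop)).indicator measurableSet_ball
  have hF' : Measurable fun σ : Sph d => F σ := hF.comp measurable_coe_sph
  rw [lintegral_polar hd hm, ← lintegral_const_mul _ hF']
  refine lintegral_congr fun σ => ?_
  have hm1 : Measurable fun r : ℝ =>
      ENNReal.ofReal (r ^ (d - 1)) * (Set.Iio (1 : ℝ)).indicator 1 r :=
    Measurable.mul (by fun_prop) (measurable_one.indicator measurableSet_Iio)
  rw [← hc, ← lintegral_mul_const _ hm1]
  refine setLIntegral_congr_fun measurableSet_Ioi fun r hr => ?_
  have hr' : 0 < r := hr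
  have hn : ‖r • (σ : E d)‖ = r := by rw [norm_smul, norm_sph]; simp [abs_of_pos hr']
  by_cases h1 : r < 1
  · simp [Set.indicator, hn, h1, smul_smul, hr'.ne']
  · simp [Set.indicator, hn, h1]

/-- Invariance is inherited from Lebesgue measure on the ball, through the degree-zero homogeneous
extension. -/
lemma lintegral_sphere_isometry {d : ℕ} (hd : 2 ≤ d) (A : E d ≃ₗᵢ[ℝ] E d) {F : E d → ℝ≥0∞}
    (hF : Measurable F) : ∫⁻ σ : Sph d, F (A σ) ∂surf d = ∫⁻ σ : Sph d, F σ ∂surf d := by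
  obtain ⟨c, hc0, hc1, hc⟩ := lintegral_sphere_eq hd
  rw [← ENNReal.mul_right_inj hc0 hc1, hc F hF, hc (fun x => F (A x))
    (hF.comp A.continuous.measurable)]
  have hm : Measurable fun x : E d => (Metric.ball (0 : E d) 1).indicator
      (fun x => F (‖x‖⁻¹ • x)) x :=
    (hF.comp (by fun_prop)).indicator measurableSet_ball
  rw [← (A.measurePreserving).lintegral_comp hm]
  refine lintegral_congr fun x => ?_
  simp [Set.indicator]

lemma exists_basis_first {d : ℕ} (hd : 2 ≤ d) {e : E d} (he : ‖e‖ = 1) :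
    ∃ b : OrthonormalBasis (Fin d) ℝ (E d), b ⟨0, by omega⟩ = e := by
  have hv : Orthonormal ℝ (Set.domRestrict ({⟨0, by omega⟩} : Set (Fin d)) (fun _ => e)) := by
    constructor
    · intro i; simpa using he
    · rintro ⟨i, hi⟩ ⟨j, hj⟩ hij
      exact absurd (Subtype.ext (hi.trans hj.symm)) hij
  obtain ⟨b, hb⟩ := hv.exists_orthonormalBasis_extension_of_card_eq (by simp)
  exact ⟨b, hb _ rfl⟩

lemma exists_isometry_unit {d : ℕ} (hd : 2 ≤ d) {e f : E d} (he : ‖e‖ = 1) (hf : ‖f‖ = 1) :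
    ∃ A : E d ≃ₗᵢ[ℝ] E d, A e = f := by
  obtain ⟨b, hb⟩ := exists_basis_first hd he
  obtain ⟨c, hc⟩ := exists_basis_first hd hf
  refine ⟨b.repr.trans c.repr.symm, ?_⟩
  rw [← hb, ← hc]
  simp

/-! ### The substitution `σ = 2(e·ω)ω - e` -/

/-- The homogeneous extension of the reflection map `ω ↦ 2 (e·ω) ω - e` of the sphere. -/
def coneMap {d : ℕ} (e y : E d) : E d := (2 * inner ℝ e y) • (‖y‖⁻¹ • y) - ‖y‖ • e

/-- The direction `y/|y|` is not Lipschitz at the origin, but its variation multiplied by `|y|` is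
at most `2|y - z|`, and the factor `e·y` supplies that `|y|`. The constant is `4 + 2 + 1`, from the
three terms of the difference. -/
lemma lipschitzWith_coneMap {d : ℕ} {e : E d} (he : ‖e‖ = 1) : LipschitzWith 7 (coneMap e) := by
  refine LipschitzWith.of_dist_le_mul fun y z => ?_
  rw [dist_eq_norm, dist_eq_norm]
  have hz : ‖‖z‖⁻¹ • z‖ ≤ 1 := by
    rw [norm_smul, norm_inv, norm_norm]; exact inv_mul_le_one
  have key : ‖‖y‖ • (‖y‖⁻¹ • y - ‖z‖⁻¹ • z)‖ ≤ 2 * ‖y - z‖ := by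
    have h1 : ‖y‖ • (‖y‖⁻¹ • y - ‖z‖⁻¹ • z) = (y - z) - (‖y‖ - ‖z‖) • (‖z‖⁻¹ • z) := by
      by_cases hy : y = 0
      · by_cases hz : z = 0
        · simp [hy, hz]
        · simp [hy, smul_smul, hz]
      · by_cases hz : z = 0
        · simp [hz, smul_smul, hy]
        · simp only [smul_sub, sub_smul, smul_smul, sub_mul]
          simp [hy, hz]
    rw [h1]
    calc _ ≤ ‖y - z‖ + ‖(‖y‖ - ‖z‖) • (‖z‖⁻¹ • z)‖ := norm_sub_le _ _
      _ ≤ ‖y - z‖ + ‖y - z‖ * 1 := by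
        rw [norm_smul]
        gcongr
        exact abs_norm_sub_norm_le y z
      _ = _ := by ring
  have h2 : coneMap e y - coneMap e z = (2 * inner ℝ e y) • (‖y‖⁻¹ • y - ‖z‖⁻¹ • z)
      + (2 * inner ℝ e (y - z)) • (‖z‖⁻¹ • z) - (‖y‖ - ‖z‖) • e := by
    simp only [coneMap, inner_sub_right]; module
  have h3 : ‖(2 * inner ℝ e y) • (‖y‖⁻¹ • y - ‖z‖⁻¹ • z)‖ ≤ 4 * ‖y - z‖ := by
    have : |inner ℝ e y| ≤ ‖y‖ := by
      simpa [he] using abs_real_inner_le_norm e y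
    rw [norm_smul] at key ⊢
    rw [norm_norm] at key
    rw [Real.norm_eq_abs, abs_mul, abs_two]
    nlinarith [norm_nonneg (‖y‖⁻¹ • y - ‖z‖⁻¹ • z)]
  have h4 : ‖(2 * inner ℝ e (y - z)) • (‖z‖⁻¹ • z)‖ ≤ 2 * ‖y - z‖ := by
    have : |inner ℝ e (y - z)| ≤ ‖y - z‖ := by
      simpa [he] using abs_real_inner_le_norm e (y - z)
    rw [norm_smul, Real.norm_eq_abs, abs_mul, abs_two]
    nlinarith [norm_nonneg (‖z‖⁻¹ • z), abs_nonneg (inner ℝ e (y - z))]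
  have h5 : ‖(‖y‖ - ‖z‖) • e‖ ≤ ‖y - z‖ := by
    rw [norm_smul, he, mul_one]; exact abs_norm_sub_norm_le y z
  rw [h2]
  calc _ ≤ _ := norm_sub_le _ _
    _ ≤ _ := add_le_add (norm_add_le _ _) le_rfl
    _ ≤ 7 * ‖y - z‖ := by linarith

lemma norm_coneMap {d : ℕ} {e : E d} (he : ‖e‖ = 1) (y : E d) : ‖coneMap e y‖ = ‖y‖ := by
  by_cases hy : y = 0
  · simp [coneMap, hy]
  have hy' : ‖y‖ ≠ 0 := by simpa using hy
  rw [← sq_eq_sq₀ (norm_nonneg _) (norm_nonneg _), coneMap, norm_sub_sq_real]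
  simp only [norm_smul, inner_smul_left, inner_smul_right, he, real_inner_comm e y]
  simp [hy', mul_pow, sq_abs]
  rw [real_inner_comm]
  field_simp
  ring

/-- A unit vector `x` is reached from the bisector of `x` and `e`. For `x = -e` the bisector
degenerates and any vector orthogonal to `e` works, which is where `d ≥ 2` enters. -/
lemma coneMap_surjective {d : ℕ} (hd : 2 ≤ d) {e : E d} (he : ‖e‖ = 1) :
    Function.Surjective (coneMap e) := by
  have key : ∀ x : E d, ‖x‖ = 1 → ∃ y : E d, ‖y‖ = 1 ∧ coneMap e y = x := by
    intro x hx
    by_cases h : x + e = 0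
    · obtain ⟨b, hb⟩ := exists_basis_first hd he
      refine ⟨b ⟨1, by omega⟩, b.orthonormal.1 _, ?_⟩
      have : inner ℝ e (b ⟨1, by omega⟩) = 0 := by
        rw [← hb]; exact b.orthonormal.2 (by simp)
      rw [coneMap, this]
      simp [b.orthonormal.1, eq_neg_of_add_eq_zero_left h]
    · have hn : ‖x + e‖ ≠ 0 := by simpa using h
      have hy : ‖‖x + e‖⁻¹ • (x + e)‖ = 1 := by rw [norm_smul]; simp [hn]
      refine ⟨‖x + e‖⁻¹ • (x + e), hy, ?_⟩
      have h2 : inner ℝ e (x + e) = ‖x + e‖ ^ 2 / 2 := by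
        rw [norm_add_sq_real, inner_add_right, real_inner_self_eq_norm_sq, he, hx, real_inner_comm]
        ring
      rw [coneMap, hy, inner_smul_right, h2, smul_smul, smul_smul]
      have : 2 * (‖x + e‖⁻¹ * (‖x + e‖ ^ 2 / 2)) * 1⁻¹ * ‖x + e‖⁻¹ = 1 := by
        field_simp
      rw [this]; simp
  intro x
  by_cases hx : x = 0
  · exact ⟨0, by simp [coneMap, hx]⟩
  have hn : ‖x‖ ≠ 0 := by simpa using hx
  obtain ⟨y, hy, hyx⟩ := key (‖x‖⁻¹ • x) (by rw [norm_smul]; simp [hn])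
  refine ⟨‖x‖ • y, ?_⟩
  have : coneMap e (‖x‖ • y) = ‖x‖ • coneMap e y := by
    simp only [coneMap, norm_smul, inner_smul_right, hy, norm_norm, mul_one, smul_sub, smul_smul]
    congr 2
    field_simp
  rw [this, hyx, smul_smul, mul_inv_cancel₀ hn, one_smul]

/-- Lebesgue measure is a multiple of `d`-dimensional Hausdorff measure, for which Lipschitz images
are controlled directly. This avoids any Jacobian. -/
lemma volume_image_le_of_lipschitz (d : ℕ) :
    ∀ f : E d → E d, LipschitzWith 7 f → ∀ s : Set (E d),
      volume (f '' s) ≤ (7 : ℝ≥0∞) ^ (d : ℝ) * volume s := by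
  intro f hf s
  have h := Measure.isAddLeftInvariant_eq_smul (volume : Measure (E d)) (Measure.hausdorffMeasure (d : ℝ))
  rw [h]
  simp only [Measure.smul_apply, ENNReal.smul_def, smul_eq_mul]
  have := hf.hausdorffMeasure_image_le (d := (d : ℝ)) (by positivity) s
  calc _ ≤ _ := mul_le_mul_right this _
    _ = _ := by simp only [ENNReal.coe_ofNat]; ring

/-- Substitution `σ = 2 (e·ω) ω - e` on the sphere, as an inequality. -/
lemma lintegral_sphere_le_reflect {d : ℕ} (hd : 2 ≤ d) :
    ∃ C : ℝ≥0∞, C ≠ ∞ ∧ ∀ e : E d, ‖e‖ = 1 → ∀ F : E d → ℝ≥0∞, Measurable F →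
      ∫⁻ σ : Sph d, F σ ∂surf d
        ≤ C * ∫⁻ ω : Sph d, F ((2 * inner ℝ e (ω : E d)) • (ω : E d) - e) ∂surf d := by
  obtain ⟨c, hc0, hc1, hc⟩ := lintegral_sphere_eq hd
  refine ⟨(7 : ℝ≥0∞) ^ (d : ℝ), by simp, fun e he F hF => ?_⟩
  rw [← ENNReal.mul_le_mul_iff_right hc0 hc1, hc F hF, mul_left_comm]
  rw [hc (fun x => F ((2 * inner ℝ e x) • x - e)) (hF.comp (by fun_prop))]
  have hcm : Measurable (coneMap e) := (lipschitzWith_coneMap he).continuous.measurable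
  -- Surjectivity gives `s = f(f⁻¹ s)`, so the bound on images bounds the volume by its
  -- push-forward.
  have hle : (volume : Measure (E d)) ≤ ((7 : ℝ≥0∞) ^ (d : ℝ)) • (volume.map (coneMap e)) := by
    refine Measure.le_iff.2 fun s hs => ?_
    rw [Measure.smul_apply, Measure.map_apply hcm hs, smul_eq_mul]
    conv_lhs => rw [← Set.image_preimage_eq s (coneMap_surjective hd he)]
    exact volume_image_le_of_lipschitz d _ (lipschitzWith_coneMap he) _
  refine (lintegral_mono' hle le_rfl).trans ?_
  have hm : Measurable fun x : E d => (Metric.ball (0 : E d) 1).indicator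
      (fun x => F (‖x‖⁻¹ • x)) x :=
    (hF.comp (by fun_prop)).indicator measurableSet_ball
  rw [lintegral_smul_measure, lintegral_map hm hcm, smul_eq_mul]
  have := nontrivial_E hd
  refine mul_le_mul_right (lintegral_mono_ae ?_) _
  filter_upwards [compl_mem_ae_iff.2 (measure_singleton (0 : E d))] with x hx
  have hn : ‖x‖ ≠ 0 := by simpa using hx
  simp only [Set.indicator, Metric.mem_ball, dist_zero_right, norm_coneMap he]
  split_ifs
  · refine le_of_eq (congrArg F ?_)
    simp only [coneMap, inner_smul_right, smul_sub, smul_smul]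
    congr 2
    · field_simp
    · rw [inv_mul_cancel₀ hn, one_smul]
  · exact le_rfl

/-! ### Smallness of polar caps -/

lemma measurable_cap {d : ℕ} (e : E d) (t : ℝ) :
    MeasurableSet {ω : Sph d | t ≤ |inner ℝ e (ω : E d)|} :=
  measurableSet_le measurable_const (by fun_prop)

/-- By equality in Cauchy–Schwarz the poles span a line, which is Lebesgue-null since `d ≥ 2`. -/
lemma surf_pole {d : ℕ} (hd : 2 ≤ d) {e : E d} (he : ‖e‖ = 1) :
    surf d {ω : Sph d | 1 ≤ |inner ℝ e (ω : E d)|} = 0 := by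
  obtain ⟨c, hc0, hc1, hc⟩ := lintegral_sphere_eq hd
  have hm : MeasurableSet {x : E d | 1 ≤ |inner ℝ e x|} :=
    measurableSet_le measurable_const (by fun_prop)
  have h := hc ({x : E d | 1 ≤ |inner ℝ e x|}.indicator 1) (measurable_one.indicator hm)
  have h2 : ∫⁻ σ : Sph d, ({x : E d | 1 ≤ |inner ℝ e x|}.indicator 1 (σ : E d)) ∂surf d
      = surf d {ω : Sph d | 1 ≤ |inner ℝ e (ω : E d)|} := by
    rw [← lintegral_indicator_one (measurable_cap e 1)]; rfl
  rw [h2] at h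
  have h3 : ∫⁻ x : E d, (Metric.ball (0 : E d) 1).indicator
      (fun x => {x : E d | 1 ≤ |inner ℝ e x|}.indicator 1 (‖x‖⁻¹ • x)) x = (0 : ℝ≥0∞) := by
    have hnull : volume ((Submodule.span ℝ {e} : Submodule ℝ (E d)) : Set (E d)) = 0 := by
      refine Measure.addHaar_submodule _ _ fun htop => ?_
      have h1 := finrank_span_singleton (K := ℝ) (v := e) (by rintro rfl; simp at he)
      rw [htop, finrank_top] at h1
      simp at h1; omega
    refine lintegral_eq_zero_of_ae_eq_zero ?_
    rw [Filter.EventuallyEq, ae_iff]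
    refine measure_mono_null (fun x hx => ?_) hnull
    by_contra hxs
    apply hx
    have hx0 : x ≠ 0 := by rintro rfl; exact hxs (Submodule.zero_mem _)
    have hn : 0 < ‖x‖ := by simpa using hx0
    simp only [Set.indicator, Pi.zero_apply, ite_eq_right_iff]
    intro _ h1
    exfalso
    have h1 : 1 ≤ |inner ℝ e (‖x‖⁻¹ • x)| := h1
    rw [inner_smul_right, abs_mul, abs_inv, abs_norm, ← div_eq_inv_mul, le_div_iff₀ hn,
      one_mul] at h1
    have h4 : |inner ℝ e x| = ‖e‖ * ‖x‖ := le_antisymm (abs_real_inner_le_norm _ _) (by simpa [he])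
    have h5 := (norm_inner_eq_norm_iff (𝕜 := ℝ) (x := e) (y := x) (by rintro rfl; simp at he) hx0).1 h4
    obtain ⟨r, _, hr⟩ := h5
    exact hxs (Submodule.mem_span_singleton.2 ⟨r, hr.symm⟩)
  rw [h3] at h
  exact (mul_eq_zero.1 h).resolve_left hc0

/-- Caps around the poles `± e` have small surface, uniformly in `e`. -/
lemma exists_small_cap {d : ℕ} (hd : 2 ≤ d) {ε : ℝ≥0∞} (hε : ε ≠ 0) :
    ∃ κ : ℝ, 0 < κ ∧ κ < 1 ∧ ∀ e : E d, ‖e‖ = 1 →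
      surf d {ω : Sph d | 1 - κ ≤ |inner ℝ e (ω : E d)|} ≤ ε := by
  obtain ⟨e₀, he₀⟩ : ∃ e : E d, ‖e‖ = 1 := by
    have := nontrivial_E hd
    exact exists_norm_eq (E d) zero_le_one
  -- For one fixed axis the caps shrink to the two poles. Rotations then transfer the same `κ` to
  -- every axis.
  have hlim := tendsto_measure_iInter_atTop (μ := surf d)
    (s := fun n : ℕ => {ω : Sph d | 1 - 1 / ((n : ℝ) + 2) ≤ |inner ℝ e₀ (ω : E d)|})
    (fun n => (measurable_cap e₀ _).nullMeasurableSet)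
    (by
      intro m n hmn ω hω
      have hω' : 1 - 1 / ((n : ℝ) + 2) ≤ |inner ℝ e₀ (ω : E d)| := hω
      refine le_trans ?_ hω'
      have : (m : ℝ) ≤ n := by exact_mod_cast hmn
      gcongr)
    ⟨0, measure_ne_top _ _⟩
  have hI : (⋂ n : ℕ, {ω : Sph d | 1 - 1 / ((n : ℝ) + 2) ≤ |inner ℝ e₀ (ω : E d)|})
      ⊆ {ω : Sph d | 1 ≤ |inner ℝ e₀ (ω : E d)|} := by
    intro ω hω
    simp only [Set.mem_iInter, Set.mem_ofPred_eq] at hω ⊢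
    have ht : Filter.Tendsto (fun n : ℕ => 1 - 1 / ((n : ℝ) + 2)) Filter.atTop (nhds (1 - 0)) := by
      refine tendsto_const_nhds.sub ?_
      have := (tendsto_one_div_add_atTop_nhds_zero_nat (𝕜 := ℝ)).comp (Filter.tendsto_add_atTop_nat 1)
      refine this.congr fun n => ?_
      simp only [Function.comp_apply]; push_cast; ring
    rw [sub_zero] at ht
    exact le_of_tendsto' ht hω
  rw [measure_mono_null hI (surf_pole hd he₀)] at hlim
  obtain ⟨n, hn⟩ := ((ENNReal.tendsto_nhds_zero.1 hlim) ε (pos_iff_ne_zero.2 hε)).exists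
  refine ⟨1 / ((n : ℝ) + 2), by positivity, ?_, fun e he => ?_⟩
  · rw [div_lt_one (by positivity)]; linarith [(Nat.cast_nonneg n : (0 : ℝ) ≤ n)]
  · refine le_trans (le_of_eq ?_) hn
    obtain ⟨A, hA⟩ := exists_isometry_unit hd he₀ he
    have hm : Measurable fun x : E d =>
        ({x : E d | 1 - 1 / ((n : ℝ) + 2) ≤ |inner ℝ e x|}.indicator (1 : E d → ℝ≥0∞) x) :=
      measurable_one.indicator (measurableSet_le measurable_const (by fun_prop))
    have := lintegral_sphere_isometry hd A hm
    simp only [Function.comp_apply]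
    rw [← lintegral_indicator_one (measurable_cap e _), ← lintegral_indicator_one (measurable_cap e₀ _)]
    refine (this.symm.trans ?_)
    refine lintegral_congr fun σ => ?_
    simp only [Set.indicator, Set.mem_ofPred_eq, ← hA, LinearIsometryEquiv.inner_map_map, Pi.one_apply]

/-! ### Cone averages and their `L¹` and `L²` bounds -/

/-- The indicator of the double cone `δ |u| ≤ |u·ω|`. -/
def coneKer {d : ℕ} (δ : ℝ) (u ω : E d) : ℝ≥0∞ :=
  if δ * ‖u‖ ≤ |inner ℝ u ω| then 1 else 0

/-- The average of `h` over the part of the sphere with diameter `[0, u]` cut out by a cone. -/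
def coneAvg {d : ℕ} (δ : ℝ) (h : E d → ℝ≥0∞) (u : E d) : ℝ≥0∞ :=
  ∫⁻ ω : Sph d, coneKer δ u ω * h (inner ℝ u (ω : E d) • (ω : E d)) ∂surf d

lemma coneKer_mul_self {d : ℕ} (δ : ℝ) (u ω : E d) :
    coneKer δ u ω * coneKer δ u ω = coneKer δ u ω := by
  unfold coneKer; split_ifs <;> simp

@[fun_prop]
lemma measurable_coneKer {d : ℕ} {X : Type*} [MeasurableSpace X] (δ : ℝ) {f g : X → E d}
    (hf : Measurable f) (hg : Measurable g) : Measurable fun x => coneKer δ (f x) (g x) :=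
  Measurable.ite (measurableSet_le (by fun_prop) (by fun_prop)) measurable_const measurable_const

@[fun_prop]
lemma measurable_coe_sphere {d : ℕ} {X : Type*} [MeasurableSpace X] {f : X → Sph d}
    (hf : Measurable f) : Measurable fun x => (f x : E d) :=
  measurable_subtype_coe.comp hf

lemma measurable_coneAvg {d : ℕ} {X : Type*} [MeasurableSpace X] (δ : ℝ) {h : X → E d → ℝ≥0∞}
    (hh : Measurable fun p : X × E d => h p.1 p.2) {f : X → E d} (hf : Measurable f) :
    Measurable fun x => coneAvg δ (h x) (f x) := by
  have h1 : Measurable fun p : X × Sph d => h p.1 (inner ℝ (f p.1) (p.2 : E d) • (p.2 : E d)) :=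
    hh.comp (f := fun p : X × Sph d => (p.1, inner ℝ (f p.1) (p.2 : E d) • (p.2 : E d)))
      (by fun_prop)
  exact Measurable.lintegral_prod_right' (f := fun p : X × Sph d =>
    coneKer δ (f p.1) p.2 * h p.1 (inner ℝ (f p.1) (p.2 : E d) • (p.2 : E d)))
    (Measurable.mul (by fun_prop) h1)

lemma lintegral_coords {n : ℕ} (b : OrthonormalBasis (Fin (n + 1)) ℝ (E (n + 1)))
    {Φ : ℝ × (Fin n → ℝ) → ℝ≥0∞} (hΦ : Measurable Φ) :
    ∫⁻ u : E (n + 1), Φ (inner ℝ (b 0) u, fun i => inner ℝ (b i.succ) u)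
      = ∫⁻ x : ℝ, ∫⁻ y : Fin n → ℝ, Φ (x, y) := by
  have h1 := (volume_preserving_piFinSuccAbove (fun _ : Fin (n + 1) => ℝ) 0)
  have h2 := (PiLp.volume_preserving_ofLp (Fin (n + 1))).comp b.measurePreserving_repr
  have h3 := (h1.comp h2).lintegral_comp hΦ
  rw [Measure.volume_eq_prod, lintegral_prod _ hΦ.aemeasurable] at h3
  rw [← h3]
  refine lintegral_congr fun u => congrArg Φ ?_
  ext i
  · simp [MeasurableEquiv.piFinSuccAbove, Fin.insertNthEquiv, OrthonormalBasis.repr_apply_apply]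
  · simp [MeasurableEquiv.piFinSuccAbove, Fin.insertNthEquiv, OrthonormalBasis.repr_apply_apply,
      Fin.tail]

lemma lintegral_box {n : ℕ} {ρ : ℝ} (hρ : 0 ≤ ρ) :
    ∫⁻ y : Fin n → ℝ, (if ‖y‖ ≤ ρ then (1 : ℝ≥0∞) else 0) = ENNReal.ofReal ((2 * ρ) ^ n) := by
  have := Real.volume_pi_closedBall (0 : Fin n → ℝ) hρ
  rw [Fintype.card_fin] at this
  rw [← this, ← lintegral_indicator_one Metric.isClosed_closedBall.measurableSet]
  refine lintegral_congr fun y => ?_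
  simp [Set.indicator]

/-- A cone integral over all `u` with fixed axis, in terms of the axial variable. -/
lemma slice_le {d : ℕ} (hd : 2 ≤ d) {δ ρ : ℝ} (hδ : 0 < δ) (hρ : 0 ≤ ρ)
    (hδρ : 1 ≤ δ ^ 2 * (1 + ρ ^ 2)) {ω : E d} (hω : ‖ω‖ = 1)
    {h : E d → ℝ≥0∞} (hh : Measurable h) :
    ∫⁻ u : E d, coneKer δ u ω * h (inner ℝ u ω • ω)
      ≤ ENNReal.ofReal ((2 * ρ) ^ (d - 1)) *
        ∫⁻ r : ℝ, ENNReal.ofReal (|r| ^ (d - 1)) * h (r • ω) := by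
  obtain ⟨n, rfl⟩ : ∃ n, d = n + 1 := ⟨d - 1, by omega⟩
  obtain ⟨b, hb⟩ := exists_basis_first hd hω
  have hb0 : b 0 = ω := hb
  have hm : Measurable fun p : ℝ × (Fin n → ℝ) =>
      (if ‖p.2‖ ≤ |p.1| * ρ then (1 : ℝ≥0∞) else 0) * h (p.1 • ω) :=
    Measurable.mul (Measurable.ite (measurableSet_le (by fun_prop) (by fun_prop))
      measurable_const measurable_const) (hh.comp (by fun_prop))
  have h1 := lintegral_coords b hm
  simp only [hb0] at h1
  have h2 : ∫⁻ u : E (n + 1), coneKer δ u ω * h (inner ℝ u ω • ω) ≤ ∫⁻ u : E (n + 1),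
      (if ‖(fun i : Fin n => inner ℝ (b i.succ) u : Fin n → ℝ)‖ ≤ |inner ℝ ω u| * ρ
        then (1 : ℝ≥0∞) else 0) * h (inner ℝ ω u • ω) := by
    refine lintegral_mono fun u => ?_
    rw [real_inner_comm]
    refine mul_le_mul_left ?_ _
    unfold coneKer
    by_cases hc : δ * ‖u‖ ≤ |inner ℝ u ω|
    · rw [if_pos hc, if_pos]
      rw [pi_norm_le_iff_of_nonneg (by positivity)]
      intro i
      have hsum := b.sum_sq_norm_inner_right u
      rw [Fin.sum_univ_succ, hb0] at hsum
      have hi : ‖(inner ℝ (b i.succ) u : ℝ)‖ ^ 2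
          ≤ ∑ i : Fin n, ‖(inner ℝ (b i.succ) u : ℝ)‖ ^ 2 :=
        Finset.single_le_sum (f := fun i : Fin n => ‖(inner ℝ (b i.succ) u : ℝ)‖ ^ 2)
          (fun _ _ => sq_nonneg _) (Finset.mem_univ i)
      rw [real_inner_comm, Real.norm_eq_abs (inner ℝ u ω)] at hsum
      have hc2 := pow_le_pow_left₀ (by positivity) hc 2
      -- In the cone, `|u|² ≤ (u·ω)²/δ² ≤ (1 + ρ²)(u·ω)²`, so every transverse coordinate is at most
      -- `ρ|u·ω|`. The cross-section is enclosed in a cube.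
      have hu2 : ‖u‖ ^ 2 ≤ (1 + ρ ^ 2) * |inner ℝ u ω| ^ 2 := by
        have h3 := mul_le_mul_of_nonneg_left hc2 (show 0 ≤ 1 + ρ ^ 2 by positivity)
        have h4 := mul_le_mul_of_nonneg_right hδρ (sq_nonneg ‖u‖)
        nlinarith
      refine abs_le_of_sq_le_sq' ?_ (by positivity) |>.2
      rw [real_inner_comm u ω, mul_pow]
      linarith
    · rw [if_neg hc]; exact zero_le
  refine h2.trans (h1.le.trans ?_)
  rw [← lintegral_const_mul _ (by fun_prop)]
  refine lintegral_mono fun r => ?_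
  dsimp only
  rw [lintegral_mul_const _ (Measurable.ite (measurableSet_le (by fun_prop) (by fun_prop))
      measurable_const measurable_const), lintegral_box (by positivity), Nat.add_sub_cancel,
      ← mul_assoc (ENNReal.ofReal _) (ENNReal.ofReal _), ← ENNReal.ofReal_mul (by positivity),
      ← mul_pow]
  refine le_of_eq ?_
  congr 3
  ring

/-- Letting `r` run over the whole line counts each ray twice, by antipodal symmetry. -/
lemma lintegral_polar_two_sided {d : ℕ} (hd : 2 ≤ d) {h : E d → ℝ≥0∞} (hh : Measurable h) :
    ∫⁻ ω : Sph d, (∫⁻ r : ℝ, ENNReal.ofReal (|r| ^ (d - 1)) * h (r • (ω : E d))) ∂surf d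
      = 2 * ∫⁻ x, h x := by
  have hsplit : ∀ ω : E d, ∫⁻ r : ℝ, ENNReal.ofReal (|r| ^ (d - 1)) * h (r • ω)
      = (∫⁻ r in Set.Ioi (0 : ℝ), ENNReal.ofReal (r ^ (d - 1)) * h (r • ω))
        + ∫⁻ r in Set.Ioi (0 : ℝ), ENNReal.ofReal (r ^ (d - 1)) * h (r • (-ω)) := by
    intro ω
    rw [← lintegral_add_compl _ (measurableSet_Ioi (a := (0 : ℝ)))]
    congr 1
    · refine setLIntegral_congr_fun measurableSet_Ioi fun r hr => ?_
      have : (0 : ℝ) < r := hr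
      simp only [abs_of_pos this]
    · have hneg := (Measure.measurePreserving_neg (volume : Measure ℝ)).setLIntegral_comp_preimage
        (s := Set.Ioi (0 : ℝ)) measurableSet_Ioi
        (f := fun r => ENNReal.ofReal (r ^ (d - 1)) * h (r • (-ω))) (by fun_prop)
      rw [← hneg, Set.compl_Ioi]
      have : (Neg.neg ⁻¹' Set.Ioi (0 : ℝ)) = Set.Iio 0 := by ext; simp
      rw [this, setLIntegral_congr Iio_ae_eq_Iic.symm]
      refine setLIntegral_congr_fun measurableSet_Iio fun r hr => ?_
      have : r < 0 := hr
      simp only [abs_of_neg this, smul_neg, neg_smul, neg_neg]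
  have hmeas : Measurable fun ω : E d => ∫⁻ r in Set.Ioi (0 : ℝ),
      ENNReal.ofReal (r ^ (d - 1)) * h (r • ω) :=
    Measurable.lintegral_prod_right' (f := fun p : E d × ℝ =>
      ENNReal.ofReal (p.2 ^ (d - 1)) * h (p.2 • p.1))
      (Measurable.mul (by fun_prop) (hh.comp (by fun_prop)))
  simp only [hsplit]
  have hmeas' : Measurable fun ω : Sph d => ∫⁻ r in Set.Ioi (0 : ℝ),
      ENNReal.ofReal (r ^ (d - 1)) * h (r • (ω : E d)) := hmeas.comp measurable_coe_sph
  rw [lintegral_add_left hmeas']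
  have hneg := lintegral_sphere_isometry hd (LinearIsometryEquiv.neg ℝ) hmeas
  simp only [LinearIsometryEquiv.coe_neg] at hneg
  rw [hneg, ← lintegral_polar hd hh, two_mul]

lemma measurable_slice {d : ℕ} {h : E d → ℝ≥0∞} (hh : Measurable h) :
    Measurable fun p : E d × Sph d => h (inner ℝ p.1 (p.2 : E d) • (p.2 : E d)) :=
  hh.comp (by fun_prop)

/-- `L¹` bound for the cone averages, small on narrow cones. -/
lemma lintegral_coneAvg_le_of {d : ℕ} (hd : 2 ≤ d) {δ ρ : ℝ} (hδ : 0 < δ) (hρ : 0 ≤ ρ)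
    (hδρ : 1 ≤ δ ^ 2 * (1 + ρ ^ 2)) {h : E d → ℝ≥0∞} (hh : Measurable h) :
    ∫⁻ u, coneAvg δ h u ≤ ENNReal.ofReal ((2 * ρ) ^ (d - 1)) * 2 * ∫⁻ x, h x := by
  unfold coneAvg
  rw [lintegral_lintegral_swap (Measurable.mul (by fun_prop) (measurable_slice hh)).aemeasurable]
  rw [mul_assoc, ← lintegral_polar_two_sided hd hh, ← lintegral_const_mul]
  · exact lintegral_mono fun ω => slice_le hd hδ hρ hδρ (norm_sph ω) hh
  · exact Measurable.lintegral_prod_right' (f := fun p : Sph d × ℝ =>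
      ENNReal.ofReal (|p.2| ^ (d - 1)) * h (p.2 • (p.1 : E d)))
      (Measurable.mul (by fun_prop) (hh.comp (by fun_prop)))

/-- The choice `ρ = 1/δ` is admissible for every `δ`. Sharper choices matter only for narrow cones.
-/
lemma lintegral_coneAvg_le {d : ℕ} (hd : 2 ≤ d) {δ : ℝ} (hδ : 0 < δ) {h : E d → ℝ≥0∞}
    (hh : Measurable h) :
    ∫⁻ u, coneAvg δ h u ≤ ENNReal.ofReal ((2 / δ) ^ (d - 1)) * 2 * ∫⁻ x, h x := by
  rw [div_eq_mul_inv]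
  refine lintegral_coneAvg_le_of hd hδ (inv_nonneg.2 hδ.le) ?_ hh
  have : δ ^ 2 * (1 + δ⁻¹ ^ 2) = δ ^ 2 + 1 := by field_simp
  rw [this]
  nlinarith [sq_nonneg δ]

/-- `s` bounds the surface of all caps `|e·ω| ≥ t`. -/
def CapBound (d : ℕ) (t : ℝ) (s : ℝ≥0∞) : Prop :=
  ∀ e : E d, ‖e‖ = 1 → surf d {ω : Sph d | t ≤ |inner ℝ e (ω : E d)|} ≤ s

lemma capBound_univ (d : ℕ) (t : ℝ) : CapBound d t (surf d Set.univ) :=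
  fun _ _ => measure_mono (Set.subset_univ _)

lemma lintegral_coneKer_le {d : ℕ} {δ : ℝ} {s : ℝ≥0∞} (hs : CapBound d δ s) {u : E d}
    (hu : u ≠ 0) : ∫⁻ ω : Sph d, coneKer δ u ω ∂surf d ≤ s := by
  have hn : 0 < ‖u‖ := norm_pos_iff.2 hu
  refine le_trans (le_of_eq ?_) (hs (‖u‖⁻¹ • u) (by rw [norm_smul]; simp [hn.ne']))
  rw [← lintegral_indicator_one (measurable_cap _ _)]
  refine lintegral_congr fun ω => ?_
  simp only [coneKer, Set.indicator, Set.mem_ofPred_eq, inner_smul_left, abs_mul, Pi.one_apply]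
  have : |(starRingEnd ℝ) ‖u‖⁻¹| = ‖u‖⁻¹ := by simp
  simp only [this, ← div_eq_inv_mul, le_div_iff₀ hn]

/-- Cauchy–Schwarz on the sphere. The cone indicator is idempotent, so it can be kept in both
factors. -/
lemma coneAvg_sq_le {d : ℕ} {δ : ℝ} {s : ℝ≥0∞} (hs : CapBound d δ s) {u : E d}
    (hu : u ≠ 0) {h : E d → ℝ≥0∞} (hh : Measurable h) :
    coneAvg δ h u ^ 2 ≤ s * coneAvg δ (fun x => h x ^ 2) u := by
  have hm : Measurable fun ω : Sph d => h (inner ℝ u (ω : E d) • (ω : E d)) :=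
    hh.comp (by fun_prop)
  have hH := ENNReal.lintegral_mul_le_Lp_mul_Lq (surf d) (Real.HolderConjugate.two_two)
    (f := fun ω : Sph d => coneKer δ u ω)
    (g := fun ω : Sph d => coneKer δ u ω * h (inner ℝ u (ω : E d) • (ω : E d)))
    (by fun_prop) (Measurable.mul (by fun_prop) hm).aemeasurable
  have e1 : ∫⁻ ω : Sph d, ((fun ω : Sph d => coneKer δ u ω) *
      fun ω : Sph d => coneKer δ u ω * h (inner ℝ u (ω : E d) • (ω : E d))) ω ∂surf d
      = coneAvg δ h u := by
    refine lintegral_congr fun ω => ?_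
    simp only [Pi.mul_apply, ← mul_assoc, coneKer_mul_self]
  have e2 : ∀ ω : Sph d, coneKer δ u (ω : E d) ^ (2 : ℝ) = coneKer δ u ω := by
    intro ω; rw [ENNReal.rpow_two, sq, coneKer_mul_self]
  have e3 : ∀ ω : Sph d, (coneKer δ u (ω : E d) * h (inner ℝ u (ω : E d) • (ω : E d))) ^ (2 : ℝ)
      = coneKer δ u ω * h (inner ℝ u (ω : E d) • (ω : E d)) ^ 2 := by
    intro ω; rw [ENNReal.rpow_two, mul_pow, sq (coneKer _ _ _), coneKer_mul_self]
  rw [e1] at hH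
  simp only [e2, e3] at hH
  calc coneAvg δ h u ^ 2 ≤ _ := pow_le_pow_left' hH 2
    _ = (∫⁻ ω : Sph d, coneKer δ u ω ∂surf d) * coneAvg δ (fun x => h x ^ 2) u := by
      rw [mul_pow]
      simp only [← ENNReal.rpow_two, ← ENNReal.rpow_mul]
      norm_num [coneAvg]
    _ ≤ _ := mul_le_mul_left (lintegral_coneKer_le hs hu) _

lemma ae_ne_zero {d : ℕ} (hd : 2 ≤ d) : ∀ᵐ u : E d, u ≠ 0 := by
  have := nontrivial_E hd
  exact compl_mem_ae_iff.2 (measure_singleton (0 : E d))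

/-- `L²` bound for the cone averages, small on narrow cones. -/
lemma lintegral_coneAvg_sq_le {d : ℕ} (hd : 2 ≤ d) {δ : ℝ} (hδ : 0 < δ) {s : ℝ≥0∞}
    (hs : CapBound d δ s) {h : E d → ℝ≥0∞} (hh : Measurable h) :
    ∫⁻ u, coneAvg δ h u ^ 2
      ≤ s * (ENNReal.ofReal ((2 / δ) ^ (d - 1)) * 2 * ∫⁻ x, h x ^ 2) := by
  refine le_trans ?_ (mul_le_mul_right (lintegral_coneAvg_le hd hδ (hh.pow_const 2)) s)
  have hm : Measurable fun u => coneAvg δ (fun x => h x ^ 2) u :=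
    measurable_coneAvg (X := E d) δ (h := fun _ x => h x ^ 2) (by fun_prop) measurable_id
  rw [← lintegral_const_mul _ hm]
  refine lintegral_mono_ae ?_
  filter_upwards [ae_ne_zero hd] with u hu using coneAvg_sq_le hs hu hh

/-! ### Smoothing property of the cone averages -/

lemma exists_basis_pair {d : ℕ} (hd : 2 ≤ d) {e f : E d} (he : ‖e‖ = 1) (hf : ‖f‖ = 1)
    (hef : inner ℝ e f = 0) :
    ∃ b : OrthonormalBasis (Fin d) ℝ (E d), b ⟨0, by omega⟩ = e ∧ b ⟨1, by omega⟩ = f := by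
  let v : Fin d → E d := fun i => if (i : ℕ) = 0 then e else f
  have hv : Orthonormal ℝ (Set.domRestrict ({⟨0, by omega⟩, ⟨1, by omega⟩} : Set (Fin d)) v) := by
    constructor
    · intro i
      simp only [Set.domRestrict_apply, v]
      split_ifs <;> assumption
    · rintro ⟨i, hi⟩ ⟨j, hj⟩ hij
      simp only [Set.mem_insert_iff, Set.mem_singleton_iff] at hi hj
      have hij' : i ≠ j := fun h => hij (Subtype.ext h)
      rcases hi with rfl | rfl <;> rcases hj with rfl | rfl
      · exact absurd rfl hij'
      · simpa [v] using hef
      · simpa [v, real_inner_comm] using hef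
      · exact absurd rfl hij'
  obtain ⟨b, hb⟩ := hv.exists_orthonormalBasis_extension_of_card_eq (by simp)
  refine ⟨b, ?_, ?_⟩
  · rw [hb _ (by simp)]; simp [v]
  · rw [hb _ (by simp)]; simp [v]

lemma lintegral_affine {G : ℝ → ℝ≥0∞} (hG : Measurable G) (a : ℝ) {s : ℝ} (hs : 0 < s) :
    ∫⁻ x : ℝ, G (a + s * x) = ENNReal.ofReal s⁻¹ * ∫⁻ t, G t := by
  have h1 : ∫⁻ x : ℝ, G (a + s * x) = ∫⁻ y, G (a + y) ∂(Measure.map (s * ·) volume) := by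
    rw [lintegral_map (by fun_prop) (by fun_prop)]
  rw [h1, Real.map_volume_mul_left hs.ne', lintegral_smul_measure, abs_of_pos (inv_pos.2 hs),
    lintegral_add_left_eq_self, smul_eq_mul]

/-- Change of variables `u ↦ (u·ω, u·η)` for two transversal directions. -/
lemma slice_pair_le {d : ℕ} (hd : 2 ≤ d) {δ κ : ℝ} (hδ : 0 < δ) (hκ : 0 < κ) (hκ1 : κ < 1)
    {ω η : E d} (hω : ‖ω‖ = 1) (hη : ‖η‖ = 1) (hωη : |inner ℝ ω η| < 1 - κ)
    {F G : ℝ → ℝ≥0∞} (hF : Measurable F) (hG : Measurable G) :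
    ∫⁻ u : E d, coneKer δ u ω * (F (inner ℝ u ω) * G (inner ℝ u η))
      ≤ ENNReal.ofReal (κ⁻¹ * (2 / δ) ^ (d - 2)) *
        ((∫⁻ r : ℝ, ENNReal.ofReal (|r| ^ (d - 2)) * F r) * ∫⁻ t, G t) := by
  obtain ⟨n, rfl⟩ : ∃ n, d = n + 1 + 1 := ⟨d - 2, by omega⟩
  set γ : ℝ := inner ℝ ω η with hγ
  have hγ2 : γ ^ 2 < (1 - κ) ^ 2 := sq_lt_sq' (by linarith [abs_lt.1 hωη]) (abs_lt.1 hωη).2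
  have hpos : κ ^ 2 < 1 - γ ^ 2 := by nlinarith
  -- The sine of the angle between the two directions, which is the Jacobian of the change of
  -- variables. Transversality keeps it above `κ`.
  set s : ℝ := Real.sqrt (1 - γ ^ 2) with hs
  have hsκ : κ < s := Real.lt_sqrt_of_sq_lt hpos
  have hs0 : 0 < s := hκ.trans hsκ
  have hs2 : s ^ 2 = 1 - γ ^ 2 := Real.sq_sqrt (by nlinarith)
  have hfn : ‖s⁻¹ • (η - γ • ω)‖ = 1 := by
    have : ‖η - γ • ω‖ ^ 2 = s ^ 2 := by
      rw [norm_sub_sq_real, hs2, inner_smul_right, norm_smul, hη, hω, real_inner_comm, ← hγ]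
      simp; ring
    rw [norm_smul, (sq_eq_sq₀ (norm_nonneg _) hs0.le).1 this]
    simp [abs_of_pos hs0, hs0.ne']
  have horth : inner ℝ ω (s⁻¹ • (η - γ • ω)) = 0 := by
    rw [inner_smul_right, inner_sub_right, inner_smul_right, real_inner_self_eq_norm_sq, hω, ← hγ]
    ring
  obtain ⟨b, hb, hb'⟩ := exists_basis_pair hd hω hfn horth
  have hb0 : b 0 = ω := hb
  have hb1 : b (Fin.succ 0) = s⁻¹ • (η - γ • ω) := hb'
  have hη' : ∀ u : E (n + 1 + 1), inner ℝ u η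
      = γ * inner ℝ ω u + s * inner ℝ (b (Fin.succ 0)) u := by
    intro u
    rw [hb1, inner_smul_left, inner_sub_left, inner_smul_left, real_inner_comm]
    simp only [conj_trivial]
    field_simp
    ring
  have hbox : Measurable fun p : ℝ × (Fin n → ℝ) =>
      (if ‖p.2‖ ≤ |p.1| / δ then (1 : ℝ≥0∞) else 0) :=
    Measurable.ite (measurableSet_le (by fun_prop) (by fun_prop))
      measurable_const measurable_const
  have hm : Measurable fun p : ℝ × (Fin (n + 1) → ℝ) =>
      (if ‖Fin.tail p.2‖ ≤ |p.1| / δ then (1 : ℝ≥0∞) else 0) *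
        (F p.1 * G (γ * p.1 + s * p.2 0)) := by
    have h1 : Measurable fun p : ℝ × (Fin (n + 1) → ℝ) => (p.1, Fin.tail p.2) :=
      Measurable.prodMk measurable_fst (measurable_pi_iff.2 fun i => by
        simp only [Fin.tail]; fun_prop)
    exact Measurable.mul (hbox.comp h1)
      (Measurable.mul (hF.comp measurable_fst) (hG.comp (by fun_prop)))
  have h1 := lintegral_coords b hm
  simp only [hb0] at h1
  have h2 : ∫⁻ u : E (n + 1 + 1), coneKer δ u ω * (F (inner ℝ u ω) * G (inner ℝ u η))
      ≤ ∫⁻ u : E (n + 1 + 1), (if ‖Fin.tail (fun i : Fin (n + 1) =>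
        (inner ℝ (b i.succ) u : ℝ))‖ ≤ |inner ℝ ω u| / δ then (1 : ℝ≥0∞) else 0) *
        (F (inner ℝ ω u) * G (γ * inner ℝ ω u + s * inner ℝ (b (Fin.succ 0)) u)) := by
    refine lintegral_mono fun u => ?_
    dsimp only
    rw [hη', real_inner_comm]
    refine mul_le_mul_left ?_ _
    unfold coneKer
    by_cases hc : δ * ‖u‖ ≤ |inner ℝ u ω|
    · rw [if_pos hc, if_pos]
      rw [pi_norm_le_iff_of_nonneg (by positivity)]
      intro i
      rw [le_div_iff₀ hδ, real_inner_comm u ω]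
      refine le_trans ?_ hc
      rw [mul_comm]
      gcongr
      simpa [b.orthonormal.1, Fin.tail] using abs_real_inner_le_norm (b i.succ.succ) u
    · rw [if_neg hc]; exact zero_le
  refine h2.trans (h1.le.trans ?_)
  -- For fixed `x = u·ω`, the second coordinate carries `G` and is integrated over the whole line.
  -- The remaining `n = d - 2` coordinates only fill a cube of half-side `|x|/δ`.
  have h3 : ∀ x : ℝ, ∫⁻ y : Fin (n + 1) → ℝ,
      (if ‖Fin.tail y‖ ≤ |x| / δ then (1 : ℝ≥0∞) else 0) * (F x * G (γ * x + s * y 0))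
      = ENNReal.ofReal ((2 * (|x| / δ)) ^ n) * F x * (ENNReal.ofReal s⁻¹ * ∫⁻ t, G t) := by
    intro x
    have h4 := (volume_preserving_piFinSuccAbove (fun _ : Fin (n + 1) => ℝ) 0)
    have hm2 : Measurable fun q : ℝ × (Fin n → ℝ) =>
        (if ‖q.2‖ ≤ |x| / δ then (1 : ℝ≥0∞) else 0) * (F x * G (γ * x + s * q.1)) :=
      Measurable.mul (Measurable.ite (measurableSet_le (by fun_prop) (by fun_prop))
        measurable_const measurable_const) (Measurable.mul measurable_const (hG.comp (by fun_prop)))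
    have h5 := h4.lintegral_comp hm2
    rw [Measure.volume_eq_prod, lintegral_prod_symm _ hm2.aemeasurable] at h5
    have h6 : ∀ y : Fin (n + 1) → ℝ, ((MeasurableEquiv.piFinSuccAbove (fun _ => ℝ) 0) y).2
        = Fin.tail y := by
      intro y; ext i
      simp [MeasurableEquiv.piFinSuccAbove, Fin.insertNthEquiv, Fin.tail]
    have h7 : ∀ y : Fin (n + 1) → ℝ, ((MeasurableEquiv.piFinSuccAbove (fun _ => ℝ) 0) y).1
        = y 0 := by
      intro y
      simp [MeasurableEquiv.piFinSuccAbove, Fin.insertNthEquiv]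
    simp only [h6, h7] at h5
    rw [h5, ← lintegral_affine hG (γ * x) hs0, ← lintegral_box (n := n) (ρ := |x| / δ)
      (by positivity)]
    have h8 : ∀ y : Fin n → ℝ, ∫⁻ z : ℝ, (if ‖y‖ ≤ |x| / δ then (1 : ℝ≥0∞) else 0) *
        (F x * G (γ * x + s * z)) = (if ‖y‖ ≤ |x| / δ then (1 : ℝ≥0∞) else 0) *
        (F x * ∫⁻ z : ℝ, G (γ * x + s * z)) := by
      intro y
      rw [lintegral_const_mul _ (by fun_prop), lintegral_const_mul _ (by fun_prop)]
    simp only [h8]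
    rw [lintegral_mul_const _ (Measurable.ite (measurableSet_le (by fun_prop) (by fun_prop))
        measurable_const measurable_const), mul_assoc]
  simp only [h3]
  rw [lintegral_mul_const _ (by fun_prop)]
  have h9 : ∫⁻ r : ℝ, ENNReal.ofReal ((2 * (|r| / δ)) ^ n) * F r
      = ENNReal.ofReal ((2 / δ) ^ n) * ∫⁻ r : ℝ, ENNReal.ofReal (|r| ^ n) * F r := by
    rw [← lintegral_const_mul _ (by fun_prop)]
    refine lintegral_congr fun r => ?_
    rw [← mul_assoc, ← ENNReal.ofReal_mul (by positivity), ← mul_pow]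
    congr 3
    ring
  rw [h9]
  have h10 : ENNReal.ofReal s⁻¹ ≤ ENNReal.ofReal κ⁻¹ := by
    apply ENNReal.ofReal_le_ofReal
    gcongr
  calc _ = ENNReal.ofReal s⁻¹ * (ENNReal.ofReal ((2 / δ) ^ n) *
        ((∫⁻ r : ℝ, ENNReal.ofReal (|r| ^ n) * F r) * ∫⁻ t, G t)) := by ring
    _ ≤ ENNReal.ofReal κ⁻¹ * (ENNReal.ofReal ((2 / δ) ^ n) *
        ((∫⁻ r : ℝ, ENNReal.ofReal (|r| ^ n) * F r) * ∫⁻ t, G t)) := by gcongr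
    _ = _ := by
      rw [← mul_assoc, ← ENNReal.ofReal_mul (by positivity)]
      rfl

lemma lintegral_sq_eq {X : Type*} [MeasurableSpace X] {μ : Measure X} {f : X → ℝ≥0∞}
    (hf : Measurable f) : (∫⁻ x, f x ∂μ) ^ 2 = ∫⁻ x, ∫⁻ y, f x * f y ∂μ ∂μ := by
  simp_rw [lintegral_const_mul _ hf]
  rw [lintegral_mul_const _ hf, sq]

/-- Estimate of the cross term of the square of a cone average in two directions. -/
lemma cross_term_far {d : ℕ} (hd : 2 ≤ d) {δ κ r₀ : ℝ} (hδ : 0 < δ) (hκ : 0 < κ) (hκ1 : κ < 1)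
    (hr₀ : 0 < r₀) {ω η : E d} (hω : ‖ω‖ = 1) (hη : ‖η‖ = 1) (hωη : |inner ℝ ω η| < 1 - κ)
    {h : E d → ℝ≥0∞} (hh : Measurable h) :
    ∫⁻ u : E d, (if r₀ ≤ ‖u‖ then 1 else 0) * ((coneKer δ u ω * h (inner ℝ u ω • ω)) *
        (coneKer δ u η * h (inner ℝ u η • η)))
      ≤ ENNReal.ofReal (κ⁻¹ * (2 / δ) ^ (d - 2) * ((δ * r₀)⁻¹ * ((δ * r₀)⁻¹) ^ (d - 1))) *
        ((∫⁻ r : ℝ, ENNReal.ofReal (|r| ^ (d - 1)) * h (r • ω)) *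
          ∫⁻ r : ℝ, ENNReal.ofReal (|r| ^ (d - 1)) * h (r • η)) := by
  have hρ : 0 < δ * r₀ := by positivity
  have hset : MeasurableSet {r : ℝ | δ * r₀ ≤ |r|} := measurableSet_le measurable_const (by fun_prop)
  -- For `|u| ≥ r₀` in both cones, both `|u·ω|` and `|u·η|` are at least `δ r₀`. Away from zero, the
  -- weights `|r|^(d-2)` and `1` produced by the change of variables are dominated by the polar
  -- weight `|r|^(d-1)`.
  set F : E d → ℝ → ℝ≥0∞ := fun ω r => {r : ℝ | δ * r₀ ≤ |r|}.indicator (fun r => h (r • ω)) r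
    with hFdef
  have hF : ∀ ω, Measurable (F ω) := fun ω =>
    Measurable.indicator (hh.comp (by fun_prop)) hset
  have h1 : ∫⁻ u : E d, (if r₀ ≤ ‖u‖ then 1 else 0) * ((coneKer δ u ω * h (inner ℝ u ω • ω)) *
        (coneKer δ u η * h (inner ℝ u η • η)))
      ≤ ∫⁻ u : E d, coneKer δ u ω * (F ω (inner ℝ u ω) * F η (inner ℝ u η)) := by
    refine lintegral_mono fun u => ?_
    dsimp only
    by_cases hu : r₀ ≤ ‖u‖
    · by_cases h2 : δ * ‖u‖ ≤ |inner ℝ u ω|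
      · by_cases h3 : δ * ‖u‖ ≤ |inner ℝ u η|
        · have e2 : δ * r₀ ≤ |inner ℝ u ω| := le_trans (by gcongr) h2
          have e3 : δ * r₀ ≤ |inner ℝ u η| := le_trans (by gcongr) h3
          simp [hu, coneKer, h2, h3, hFdef, Set.indicator, e2, e3]
        · simp [coneKer, h3]
      · simp [coneKer, h2]
    · simp [hu]
  refine h1.trans ((slice_pair_le hd hδ hκ hκ1 hω hη hωη (hF ω) (hF η)).trans ?_)
  have h4 : ∫⁻ r : ℝ, ENNReal.ofReal (|r| ^ (d - 2)) * F ω r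
      ≤ ENNReal.ofReal (δ * r₀)⁻¹ * ∫⁻ r : ℝ, ENNReal.ofReal (|r| ^ (d - 1)) * h (r • ω) := by
    rw [← lintegral_const_mul _ (by fun_prop)]
    refine lintegral_mono fun r => ?_
    simp only [hFdef]
    by_cases hr : δ * r₀ ≤ |r|
    · rw [Set.indicator_of_mem (show r ∈ {r : ℝ | δ * r₀ ≤ |r|} from hr), ← mul_assoc,
        ← ENNReal.ofReal_mul (by positivity)]
      gcongr
      have : |r| ^ (d - 1) = |r| ^ (d - 2) * |r| := by
        rw [← pow_succ]; congr 1; omega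
      rw [this, ← div_eq_inv_mul, le_div_iff₀ hρ]
      gcongr
    · rw [Set.indicator_of_notMem (show r ∉ {r : ℝ | δ * r₀ ≤ |r|} from hr)]
      simp
  have h5 : ∫⁻ r : ℝ, F η r ≤ ENNReal.ofReal (((δ * r₀)⁻¹) ^ (d - 1)) *
      ∫⁻ r : ℝ, ENNReal.ofReal (|r| ^ (d - 1)) * h (r • η) := by
    rw [← lintegral_const_mul _ (by fun_prop)]
    refine lintegral_mono fun r => ?_
    simp only [hFdef]
    by_cases hr : δ * r₀ ≤ |r|
    · rw [Set.indicator_of_mem (show r ∈ {r : ℝ | δ * r₀ ≤ |r|} from hr), ← mul_assoc,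
        ← ENNReal.ofReal_mul (by positivity), ← mul_pow]
      refine le_mul_of_one_le_left' ?_
      rw [ENNReal.one_le_ofReal]
      refine one_le_pow₀ ?_
      rw [← div_eq_inv_mul, one_le_div hρ]
      exact hr
    · rw [Set.indicator_of_notMem (show r ∉ {r : ℝ | δ * r₀ ≤ |r|} from hr)]
      simp
  rw [ENNReal.ofReal_mul (p := κ⁻¹ * (2 / δ) ^ (d - 2)) (by positivity),
    ENNReal.ofReal_mul (p := (δ * r₀)⁻¹) (by positivity), mul_assoc]
  refine mul_le_mul_right ((mul_le_mul' h4 h5).trans (le_of_eq ?_)) _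
  ring

/-- For nearly parallel directions no gain is available, and `ab ≤ a² + b²` suffices. Smallness
comes later, from the measure of the set of such pairs. -/
lemma cross_term_near {d : ℕ} {δ : ℝ} (c : E d → ℝ≥0∞) (hc : ∀ u, c u ≤ 1) {ω η : E d}
    {h : E d → ℝ≥0∞} (hh : Measurable h) :
    ∫⁻ u : E d, c u * ((coneKer δ u ω * h (inner ℝ u ω • ω)) *
        (coneKer δ u η * h (inner ℝ u η • η)))
      ≤ (∫⁻ u : E d, coneKer δ u ω * h (inner ℝ u ω • ω) ^ 2) +
        ∫⁻ u : E d, coneKer δ u η * h (inner ℝ u η • η) ^ 2 := by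
  rw [← lintegral_add_left (by fun_prop)]
  refine lintegral_mono fun u => ?_
  set a := h (inner ℝ u ω • ω)
  set b := h (inner ℝ u η • η)
  have hab : (coneKer δ u ω * a) * (coneKer δ u η * b)
      ≤ coneKer δ u ω * a ^ 2 + coneKer δ u η * b ^ 2 := by
    have ha : (coneKer δ u ω * a) ^ 2 = coneKer δ u ω * a ^ 2 := by
      rw [mul_pow, sq (coneKer _ _ _), coneKer_mul_self]
    have hb : (coneKer δ u η * b) ^ 2 = coneKer δ u η * b ^ 2 := by
      rw [mul_pow, sq (coneKer _ _ _), coneKer_mul_self]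
    rw [← ha, ← hb]
    rcases le_total (coneKer δ u ω * a) (coneKer δ u η * b) with hle | hle
    · refine le_trans (mul_le_mul_left hle _) ?_
      rw [← sq]; exact le_add_self
    · refine le_trans (mul_le_mul_right hle _) ?_
      rw [← sq]; exact le_self_add
  calc _ ≤ 1 * ((coneKer δ u ω * a) * (coneKer δ u η * b)) := mul_le_mul_left (hc u) _
    _ ≤ _ := by rw [one_mul]; exact hab

lemma lintegral_coneAvg_sq_eq {d : ℕ} (δ : ℝ) {c : E d → ℝ≥0∞} (hc : Measurable c)
    {h : E d → ℝ≥0∞} (hh : Measurable h) :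
    ∫⁻ u, c u * coneAvg δ h u ^ 2 = ∫⁻ ω : Sph d, ∫⁻ η : Sph d, (∫⁻ u : E d,
      c u * ((coneKer δ u ω * h (inner ℝ u (ω : E d) • (ω : E d))) *
        (coneKer δ u η * h (inner ℝ u (η : E d) • (η : E d))))) ∂surf d ∂surf d := by
  have hm : ∀ u, Measurable fun ω : Sph d =>
      coneKer δ u ω * h (inner ℝ u (ω : E d) • (ω : E d)) := fun u =>
    Measurable.mul (by fun_prop) (hh.comp (by fun_prop))
  have hm3 : Measurable fun p : (Sph d × Sph d) × E d =>
      c p.2 * ((coneKer δ p.2 p.1.1 * h (inner ℝ p.2 (p.1.1 : E d) • (p.1.1 : E d))) *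
        (coneKer δ p.2 p.1.2 * h (inner ℝ p.2 (p.1.2 : E d) • (p.1.2 : E d)))) := by
    refine Measurable.mul (hc.comp measurable_snd) (Measurable.mul (Measurable.mul (by fun_prop)
      (hh.comp (by fun_prop))) (Measurable.mul (by fun_prop) (hh.comp (by fun_prop))))
  have h1 : ∀ u, c u * coneAvg δ h u ^ 2 = ∫⁻ p : Sph d × Sph d,
      c u * ((coneKer δ u p.1 * h (inner ℝ u (p.1 : E d) • (p.1 : E d))) *
        (coneKer δ u p.2 * h (inner ℝ u (p.2 : E d) • (p.2 : E d)))) ∂((surf d).prod (surf d)) := by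
    intro u
    rw [coneAvg, lintegral_sq_eq (hm u), lintegral_const_mul]
    · rw [lintegral_prod]
      exact (Measurable.mul ((hm u).comp measurable_fst) ((hm u).comp measurable_snd)).aemeasurable
    · exact Measurable.mul ((hm u).comp measurable_fst) ((hm u).comp measurable_snd)
  simp only [h1]
  have hm4 : Measurable fun p : E d × (Sph d × Sph d) =>
      c p.1 * ((coneKer δ p.1 p.2.1 * h (inner ℝ p.1 (p.2.1 : E d) • (p.2.1 : E d))) *
        (coneKer δ p.1 p.2.2 * h (inner ℝ p.1 (p.2.2 : E d) • (p.2.2 : E d)))) :=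
    hm3.comp measurable_swap
  rw [lintegral_lintegral_swap hm4.aemeasurable, lintegral_prod]
  exact (Measurable.lintegral_prod_right' hm3).aemeasurable

/-- A Schur-type bound: the kernel `N` marks the nearly parallel pairs and has both marginals at
most `s`, while the transversal pairs contribute the factorized term. -/
lemma lintegral_pair_le {X : Type*} [MeasurableSpace X] {μ : Measure X} [SFinite μ]
    {N : X → X → ℝ≥0∞} (hN : Measurable fun p : X × X => N p.1 p.2) {s : ℝ≥0∞}
    (hs : ∀ x, ∫⁻ y, N x y ∂μ ≤ s) (hs' : ∀ y, ∫⁻ x, N x y ∂μ ≤ s)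
    {A D : X → ℝ≥0∞} (hA : Measurable A) (hD : Measurable D) (c : ℝ≥0∞) :
    ∫⁻ x, ∫⁻ y, (N x y * A x + N x y * A y + c * (D x * D y)) ∂μ ∂μ
      ≤ s * (∫⁻ x, A x ∂μ) + s * (∫⁻ x, A x ∂μ) + c * (∫⁻ x, D x ∂μ) ^ 2 := by
  have m2 : Measurable fun p : X × X => N p.1 p.2 * A p.2 := by fun_prop
  have m4 : Measurable fun x => ∫⁻ y, N x y * A y ∂μ := m2.lintegral_prod_right'
  have m3 : Measurable fun p : X × X => c * (D p.1 * D p.2) := by fun_prop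
  have m5 : Measurable fun x => ∫⁻ y, c * (D x * D y) ∂μ := m3.lintegral_prod_right'
  have e : ∀ x, ∫⁻ y, (N x y * A x + N x y * A y + c * (D x * D y)) ∂μ
      = (∫⁻ y, N x y * A x ∂μ) + (∫⁻ y, N x y * A y ∂μ) + ∫⁻ y, c * (D x * D y) ∂μ := by
    intro x
    have m6 : Measurable fun y => N x y * A y := m2.comp measurable_prodMk_left
    rw [lintegral_add_right _ (by fun_prop), lintegral_add_right _ m6]
  simp only [e]
  rw [lintegral_add_right _ m5, lintegral_add_right _ m4]
  refine add_le_add (add_le_add ?_ ?_) (le_of_eq ?_)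
  · rw [← lintegral_const_mul _ hA]
    refine lintegral_mono fun x => ?_
    have m6 : Measurable fun y => N x y := hN.comp measurable_prodMk_left
    dsimp only
    rw [lintegral_mul_const _ m6]
    exact mul_le_mul_left (hs x) _
  · rw [lintegral_lintegral_swap m2.aemeasurable, ← lintegral_const_mul _ hA]
    refine lintegral_mono fun y => ?_
    have m6 : Measurable fun x => N x y := hN.comp measurable_prodMk_right
    dsimp only
    rw [lintegral_mul_const _ m6]
    exact mul_le_mul_left (hs' y) _
  · have e : ∀ x, ∫⁻ y, c * (D x * D y) ∂μ = c * (D x * ∫⁻ y, D y ∂μ) := by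
      intro x
      rw [lintegral_const_mul _ (by fun_prop), lintegral_const_mul _ hD]
    simp only [e]
    rw [lintegral_const_mul _ (by fun_prop), lintegral_mul_const _ hD, sq]

/-- Smoothing of the cone averages: the `L²` norm is controlled by a small multiple of the `L²`
norm and the `L¹` norm. -/
theorem coneAvg_smoothing {d : ℕ} (hd : 2 ≤ d) {δ r₀ : ℝ} (hδ : 0 < δ) (hr₀ : 0 < r₀)
    {ε : ℝ≥0∞} (hε : ε ≠ 0) :
    ∃ C : ℝ≥0∞, C ≠ ∞ ∧ ∀ h : E d → ℝ≥0∞, Measurable h →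
      ∫⁻ u, (if r₀ ≤ ‖u‖ then 1 else 0) * coneAvg δ h u ^ 2
        ≤ ε * (∫⁻ x, h x ^ 2) + C * (∫⁻ x, h x) ^ 2 := by
  set K : ℝ≥0∞ := ENNReal.ofReal ((2 / δ) ^ (d - 1)) * 2 with hK
  have hKtop : K ≠ ∞ := by simp [hK, ENNReal.mul_eq_top]
  -- The diagonal part will cost `2 s K ∫h²`, where `K` is the `L¹` constant of the averages. The
  -- cap size `s` is fixed first, and it determines `κ` and hence `C`.
  obtain ⟨s, hs0, hs⟩ : ∃ s : ℝ≥0∞, s ≠ 0 ∧ 2 * s * K ≤ ε := by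
    by_cases hεt : ε = ∞
    · exact ⟨1, by simp, by simp [hεt]⟩
    · refine ⟨ε / (2 * (K + 1)), ?_, ?_⟩
      · exact ENNReal.div_ne_zero.2 ⟨hε, by simp [ENNReal.mul_eq_top, hKtop]⟩
      · calc 2 * (ε / (2 * (K + 1))) * K ≤ 2 * (ε / (2 * (K + 1))) * (K + 1) := by
              gcongr; exact le_self_add
          _ = (2 * (K + 1)) * (ε / (2 * (K + 1))) := by ring
          _ ≤ ε := ENNReal.mul_div_le
  obtain ⟨κ, hκ, hκ1, hcap⟩ := exists_small_cap hd hs0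
  set C₁ : ℝ := κ⁻¹ * (2 / δ) ^ (d - 2) * ((δ * r₀)⁻¹ * ((δ * r₀)⁻¹) ^ (d - 1)) with hC₁
  refine ⟨ENNReal.ofReal C₁ * 4, by simp [ENNReal.mul_eq_top], fun h hh => ?_⟩
  have hcm : Measurable fun u : E d => (if r₀ ≤ ‖u‖ then (1 : ℝ≥0∞) else 0) :=
    Measurable.ite (measurableSet_le (by fun_prop) (by fun_prop)) measurable_const measurable_const
  rw [lintegral_coneAvg_sq_eq δ hcm hh]
  set A : Sph d → ℝ≥0∞ := fun ω =>
    ∫⁻ u : E d, coneKer δ u ω * h (inner ℝ u (ω : E d) • (ω : E d)) ^ 2 with hA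
  set D : Sph d → ℝ≥0∞ := fun ω =>
    ∫⁻ r : ℝ, ENNReal.ofReal (|r| ^ (d - 1)) * h (r • (ω : E d)) with hD
  have hAm : Measurable A := Measurable.lintegral_prod_right' (f := fun p : Sph d × E d =>
    coneKer δ p.2 p.1 * h (inner ℝ p.2 (p.1 : E d) • (p.1 : E d)) ^ 2)
    (Measurable.mul (by fun_prop) ((hh.comp (by fun_prop)).pow_const 2))
  have hDm : Measurable D := Measurable.lintegral_prod_right' (f := fun p : Sph d × ℝ =>
      ENNReal.ofReal (|p.2| ^ (d - 1)) * h (p.2 • (p.1 : E d)))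
      (Measurable.mul (by fun_prop) (hh.comp (by fun_prop)))
  set N : Sph d → Sph d → ℝ≥0∞ := fun ω η =>
    if 1 - κ ≤ |inner ℝ (ω : E d) (η : E d)| then 1 else 0 with hN
  have hNm : Measurable fun p : Sph d × Sph d => N p.1 p.2 :=
    Measurable.ite (measurableSet_le (by fun_prop) (by fun_prop)) measurable_const measurable_const
  have hNs : ∀ ω, ∫⁻ η, N ω η ∂surf d ≤ s := by
    intro ω
    refine le_trans (le_of_eq ?_) (hcap ω (norm_sph ω))
    rw [← lintegral_indicator_one (measurable_cap _ _)]
    refine lintegral_congr fun η => ?_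
    simp [hN, Set.indicator]
  have hNs' : ∀ η, ∫⁻ ω, N ω η ∂surf d ≤ s := by
    intro η
    refine le_trans (le_of_eq ?_) (hNs η)
    refine lintegral_congr fun ω => ?_
    simp only [hN, real_inner_comm]
  have hpt : ∀ ω η : Sph d, (∫⁻ u : E d, (if r₀ ≤ ‖u‖ then 1 else 0) *
      ((coneKer δ u ω * h (inner ℝ u (ω : E d) • (ω : E d))) *
        (coneKer δ u η * h (inner ℝ u (η : E d) • (η : E d)))))
      ≤ N ω η * A ω + N ω η * A η + ENNReal.ofReal C₁ * (D ω * D η) := by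
    intro ω η
    by_cases hn : 1 - κ ≤ |inner ℝ (ω : E d) (η : E d)|
    · have h1 := cross_term_near (δ := δ) (fun u : E d => if r₀ ≤ ‖u‖ then (1 : ℝ≥0∞) else 0)
        (fun u => by split_ifs <;> simp) (ω := (ω : E d)) (η := (η : E d)) hh
      refine h1.trans (le_trans (le_of_eq ?_) le_self_add)
      simp only [hN, if_pos hn, hA, one_mul]
    · refine (cross_term_far hd hδ hκ hκ1 hr₀ (norm_sph ω) (norm_sph η) (not_le.1 hn) hh).trans ?_
      exact le_add_self
  have hAint : ∫⁻ ω, A ω ∂surf d ≤ K * ∫⁻ x, h x ^ 2 := by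
    have := lintegral_coneAvg_le hd hδ (hh.pow_const 2)
    unfold coneAvg at this
    rw [lintegral_lintegral_swap (Measurable.mul (by fun_prop)
      ((measurable_slice hh).pow_const 2)).aemeasurable] at this
    exact this
  calc _ ≤ ∫⁻ ω, ∫⁻ η, (N ω η * A ω + N ω η * A η + ENNReal.ofReal C₁ * (D ω * D η))
        ∂surf d ∂surf d := lintegral_mono fun ω => lintegral_mono fun η => hpt ω η
    _ ≤ s * (∫⁻ ω, A ω ∂surf d) + s * (∫⁻ ω, A ω ∂surf d) +
        ENNReal.ofReal C₁ * (∫⁻ ω, D ω ∂surf d) ^ 2 :=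
      lintegral_pair_le hNm hNs hNs' hAm hDm _
    _ ≤ s * (K * ∫⁻ x, h x ^ 2) + s * (K * ∫⁻ x, h x ^ 2)
        + ENNReal.ofReal C₁ * (2 * ∫⁻ x, h x) ^ 2 := by
      rw [← lintegral_polar_two_sided hd hh]
      gcongr
    _ = (2 * s * K) * (∫⁻ x, h x ^ 2) + ENNReal.ofReal C₁ * 4 * (∫⁻ x, h x) ^ 2 := by ring
    _ ≤ _ := by gcongr

/-! ### Iterated measurability, brackets and collision kinematics -/

lemma measurable_slice_lintegral {X Y Z : Type*} [MeasurableSpace X] [MeasurableSpace Y]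
    [MeasurableSpace Z] {μ : Measure Z} [SFinite μ] (F : X → Y → Z → ℝ≥0∞)
    (hF : Measurable fun q : (X × Y) × Z => F q.1.1 q.1.2 q.2) (x : X) :
    Measurable fun y => ∫⁻ z, F x y z ∂μ :=
  Measurable.lintegral_prod_right' (f := fun q : Y × Z => F x q.1 q.2)
    (hF.comp (f := fun q : Y × Z => ((x, q.1), q.2)) (by fun_prop))

lemma measurable_slice_right {X Y Z : Type*} [MeasurableSpace X] [MeasurableSpace Y]
    [MeasurableSpace Z] (F : X → Y → Z → ℝ≥0∞)
    (hF : Measurable fun q : (X × Y) × Z => F q.1.1 q.1.2 q.2) (x : X) (y : Y) :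
    Measurable fun z => F x y z :=
  hF.comp (f := fun z : Z => ((x, y), z)) (by fun_prop)

lemma measurable_lintegral_lintegral {X Y Z : Type*} [MeasurableSpace X] [MeasurableSpace Y]
    [MeasurableSpace Z] {μ : Measure Z} [SFinite μ] {ν : Measure Y} [SFinite ν]
    (F : X → Y → Z → ℝ≥0∞) (hF : Measurable fun q : (X × Y) × Z => F q.1.1 q.1.2 q.2) :
    Measurable fun x => ∫⁻ y, ∫⁻ z, F x y z ∂μ ∂ν :=
  Measurable.lintegral_prod_right' (f := fun p : X × Y => ∫⁻ z, F p.1 p.2 z ∂μ)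
    (Measurable.lintegral_prod_right' (f := fun q : (X × Y) × Z => F q.1.1 q.1.2 q.2) hF)

@[fun_prop]
lemma measurable_post {d : ℕ} {X : Type*} [MeasurableSpace X] {f g : X → E d} {s : X → Sph d}
    (hf : Measurable f) (hg : Measurable g) (hs : Measurable s) :
    Measurable fun x => post (f x) (g x) (s x) := by
  unfold post; fun_prop

@[fun_prop]
lemma measurable_postStar {d : ℕ} {X : Type*} [MeasurableSpace X] {f g : X → E d} {s : X → Sph d}
    (hf : Measurable f) (hg : Measurable g) (hs : Measurable s) :
    Measurable fun x => postStar (f x) (g x) (s x) := by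
  unfold postStar; fun_prop

@[fun_prop]
lemma measurable_bracket {d : ℕ} {X : Type*} [MeasurableSpace X] {f : X → E d}
    (hf : Measurable f) : Measurable fun x => bracket (f x) := by
  unfold bracket; fun_prop

lemma bracket_sq {d : ℕ} (ξ : E d) : bracket ξ ^ 2 = 1 + ‖ξ‖ ^ 2 :=
  Real.sq_sqrt (by positivity)

lemma one_le_bracket {d : ℕ} (ξ : E d) : 1 ≤ bracket ξ := by
  unfold bracket
  rw [Real.one_le_sqrt]
  nlinarith [sq_nonneg ‖ξ‖]

lemma bracket_pos {d : ℕ} (ξ : E d) : 0 < bracket ξ := lt_of_lt_of_le one_pos (one_le_bracket ξ)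

lemma norm_le_bracket {d : ℕ} (ξ : E d) : ‖ξ‖ ≤ bracket ξ :=
  Real.le_sqrt_of_sq_le (by linarith)

lemma bracket_le {d : ℕ} (ξ : E d) : bracket ξ ≤ 1 + ‖ξ‖ := by
  unfold bracket
  rw [Real.sqrt_le_left (by positivity)]
  nlinarith [norm_nonneg ξ]

lemma norm_sub_le_bracket_add {d : ℕ} (v w : E d) : ‖v - w‖ ≤ bracket v + bracket w :=
  (norm_sub_le v w).trans (add_le_add (norm_le_bracket v) (norm_le_bracket w))

lemma norm_sub_le_bracket_mul {d : ℕ} (v w : E d) : ‖v - w‖ ≤ 2 * (bracket v * bracket w) := by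
  have := norm_sub_le_bracket_add v w
  nlinarith [one_le_bracket v, one_le_bracket w]

lemma norm_post_sub_postStar {d : ℕ} (v w : E d) (σ : Sph d) :
    ‖post v w σ - postStar v w σ‖ = ‖v - w‖ := by
  have : post v w σ - postStar v w σ = ‖v - w‖ • (σ : E d) := by
    unfold post postStar; module
  rw [this, norm_smul, norm_sph, norm_norm, mul_one]

lemma post_comm {d : ℕ} (v w : E d) (σ : Sph d) : post v w σ = post w v σ := by
  unfold post; rw [add_comm v w, norm_sub_rev]

lemma norm_sq_post {d : ℕ} (v w : E d) (σ : Sph d) :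
    ‖post v w σ‖ ^ 2 = (‖v‖ ^ 2 + ‖w‖ ^ 2) / 2 + ‖v - w‖ / 2 * inner ℝ (v + w) (σ : E d) := by
  unfold post
  rw [norm_add_sq_real]
  simp only [norm_smul, norm_sph, inner_smul_left, inner_smul_right]
  have h1 : ‖v + w‖ ^ 2 + ‖v - w‖ ^ 2 = 2 * (‖v‖ ^ 2 + ‖w‖ ^ 2) := by
    rw [norm_add_sq_real, norm_sub_sq_real]; ring
  simp
  nlinarith

lemma norm_sq_postStar {d : ℕ} (v w : E d) (σ : Sph d) :
    ‖postStar v w σ‖ ^ 2 = (‖v‖ ^ 2 + ‖w‖ ^ 2) / 2 - ‖v - w‖ / 2 * inner ℝ (v + w) (σ : E d) := by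
  unfold postStar
  rw [norm_sub_sq_real]
  simp only [norm_smul, norm_sph, inner_smul_left, inner_smul_right]
  have h1 : ‖v + w‖ ^ 2 + ‖v - w‖ ^ 2 = 2 * (‖v‖ ^ 2 + ‖w‖ ^ 2) := by
    rw [norm_add_sq_real, norm_sub_sq_real]; ring
  simp
  nlinarith

lemma norm_sq_post_le {d : ℕ} (v w : E d) (σ : Sph d) :
    ‖post v w σ‖ ^ 2 ≤ ‖v‖ ^ 2 + ‖w‖ ^ 2 := by
  have h1 := norm_sq_post v w σ
  have h2 := norm_sq_postStar v w σ
  nlinarith [sq_nonneg ‖postStar v w σ‖]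

/-- Energy conservation gives `1 + |v'|² ≤ 1 + |v|² + |w|²`, and the product on the right absorbs
the sum. This makes polynomially growing functions integrable over collisions. -/
lemma bracket_post_le {d : ℕ} (v w : E d) (σ : Sph d) :
    bracket (post v w σ) ≤ bracket v * bracket w := by
  rw [← sq_le_sq₀ (bracket_pos _).le (mul_pos (bracket_pos _) (bracket_pos _)).le, mul_pow,
    bracket_sq, bracket_sq, bracket_sq]
  nlinarith [norm_sq_post_le v w σ, mul_nonneg (sq_nonneg ‖v‖) (sq_nonneg ‖w‖)]

/-! ### The collision change of variables -/

/-- Exchange of the directions of `u` and `σ` at fixed modulus. -/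
lemma lintegral_exchange {d : ℕ} (hd : 2 ≤ d) {G : E d × E d → ℝ≥0∞} (hG : Measurable G) :
    ∫⁻ u, ∫⁻ σ : Sph d, G (u, ‖u‖ • (σ : E d)) ∂surf d
      = ∫⁻ u, ∫⁻ σ : Sph d, G (‖u‖ • (σ : E d), u) ∂surf d := by
  -- In polar coordinates `u = rω` the two arguments become `rω` and `rσ`, and the integral is
  -- symmetric under exchanging `ω` and `σ`.
  have key : ∀ G : E d × E d → ℝ≥0∞, Measurable G →
      ∫⁻ u, ∫⁻ σ : Sph d, G (u, ‖u‖ • (σ : E d)) ∂surf d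
      = ∫⁻ r in Set.Ioi (0 : ℝ), (∫⁻ ω : Sph d, ∫⁻ σ : Sph d, ENNReal.ofReal (r ^ (d - 1)) *
        G (r • (ω : E d), r • (σ : E d)) ∂surf d ∂surf d) := by
    intro G hG
    have hm : Measurable fun u : E d => ∫⁻ σ : Sph d, G (u, ‖u‖ • (σ : E d)) ∂surf d :=
      Measurable.lintegral_prod_right' (f := fun p : E d × Sph d => G (p.1, ‖p.1‖ • (p.2 : E d)))
        (hG.comp (by fun_prop))
    rw [lintegral_polar hd hm]
    have e : ∀ ω : Sph d, ∫⁻ r in Set.Ioi (0 : ℝ), ENNReal.ofReal (r ^ (d - 1)) *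
        (∫⁻ σ : Sph d, G (r • (ω : E d), ‖r • (ω : E d)‖ • (σ : E d)) ∂surf d)
        = ∫⁻ r in Set.Ioi (0 : ℝ), (∫⁻ σ : Sph d, ENNReal.ofReal (r ^ (d - 1)) *
        G (r • (ω : E d), r • (σ : E d)) ∂surf d) := by
      intro ω
      refine setLIntegral_congr_fun measurableSet_Ioi fun r hr => ?_
      have hr' : (0 : ℝ) < r := hr
      have h1 : Measurable fun σ : Sph d => G (r • (ω : E d), r • (σ : E d)) :=
        hG.comp (by fun_prop)
      simp only [norm_smul, norm_sph, Real.norm_eq_abs, abs_of_pos hr', mul_one]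
      rw [lintegral_const_mul _ h1]
    simp only [e]
    rw [lintegral_lintegral_swap]
    refine (Measurable.lintegral_prod_right' (f := fun p : (Sph d × ℝ) × Sph d =>
      ENNReal.ofReal (p.1.2 ^ (d - 1)) * G (p.1.2 • (p.1.1 : E d), p.1.2 • (p.2 : E d)))
      (Measurable.mul (by fun_prop) (hG.comp (by fun_prop)))).aemeasurable
  have hG' : Measurable fun p : E d × E d => G (p.2, p.1) := hG.comp measurable_swap
  rw [key G hG]
  have h2 := key _ hG'
  rw [h2]
  refine setLIntegral_congr_fun measurableSet_Ioi fun r _ => ?_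
  dsimp only
  rw [lintegral_lintegral_swap]
  exact (Measurable.mul (by fun_prop) (hG.comp (by fun_prop))).aemeasurable

/-- Centre of mass and relative velocity. -/
lemma lintegral_center {d : ℕ} {F : E d × E d → ℝ≥0∞} (hF : Measurable F) :
    ∫⁻ v, ∫⁻ w, F (v, w) = ∫⁻ c : E d, ∫⁻ u : E d,
      F (c + (1 / 2 : ℝ) • u, c - (1 / 2 : ℝ) • u) := by
  have m1 : Measurable fun p : E d × E d => F (p.2 + p.1, p.2) := hF.comp (by fun_prop)
  have m2 : Measurable fun p : E d × E d =>
    F (p.2 + (1 / 2 : ℝ) • p.1, p.2 - (1 / 2 : ℝ) • p.1) := hF.comp (by fun_prop)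
  have hF' : Measurable (Function.uncurry fun v w => F (v, w)) := hF
  rw [lintegral_lintegral_swap hF'.aemeasurable]
  have e1 : ∀ w : E d, ∫⁻ v, F (v, w) = ∫⁻ u, F (w + u, w) := fun w =>
    (lintegral_add_left_eq_self (fun v => F (v, w)) w).symm
  simp only [e1]
  have m1' : Measurable (Function.uncurry fun w u : E d => F (w + u, w)) := m1.comp measurable_swap
  rw [lintegral_lintegral_swap m1'.aemeasurable]
  have e2 : ∀ u : E d, ∫⁻ w, F (w + u, w)
      = ∫⁻ c : E d, F (c + (1 / 2 : ℝ) • u, c - (1 / 2 : ℝ) • u) := fun u => by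
    rw [← lintegral_sub_right_eq_self (fun w => F (w + u, w)) ((1 / 2 : ℝ) • u)]
    refine lintegral_congr fun c => ?_
    congr 2
    module
  simp only [e2]
  exact lintegral_lintegral_swap m2.aemeasurable

/-- The pre/post-collisional change of variables. -/
theorem lintegral_collision {d : ℕ} (hd : 2 ≤ d) {Φ : (E d × E d) × (E d × E d) → ℝ≥0∞}
    (hΦ : Measurable Φ) :
    ∫⁻ v, ∫⁻ w, ∫⁻ σ : Sph d, Φ ((v, w), (post v w σ, postStar v w σ)) ∂surf d
      = ∫⁻ v, ∫⁻ w, ∫⁻ σ : Sph d, Φ ((post v w σ, postStar v w σ), (v, w)) ∂surf d := by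
  have m1 : Measurable fun p : E d × E d =>
      ∫⁻ σ : Sph d, Φ ((p.1, p.2), (post p.1 p.2 σ, postStar p.1 p.2 σ)) ∂surf d :=
    Measurable.lintegral_prod_right' (f := fun q : (E d × E d) × Sph d =>
      Φ ((q.1.1, q.1.2), (post q.1.1 q.1.2 q.2, postStar q.1.1 q.1.2 q.2))) (hΦ.comp (by fun_prop))
  have m2 : Measurable fun p : E d × E d =>
      ∫⁻ σ : Sph d, Φ ((post p.1 p.2 σ, postStar p.1 p.2 σ), (p.1, p.2)) ∂surf d :=
    Measurable.lintegral_prod_right' (f := fun q : (E d × E d) × Sph d =>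
      Φ ((post q.1.1 q.1.2 q.2, postStar q.1.1 q.1.2 q.2), (q.1.1, q.1.2))) (hΦ.comp (by fun_prop))
  rw [lintegral_center m1, lintegral_center m2]
  -- At fixed centre of mass a collision only replaces `u` by `|u|σ`.
  refine lintegral_congr fun c => ?_
  have e1 : ∀ (u : E d) (σ : Sph d), post (c + (1 / 2 : ℝ) • u) (c - (1 / 2 : ℝ) • u) σ
      = c + (1 / 2 : ℝ) • (‖u‖ • (σ : E d)) := by
    intro u σ
    have : c + (1 / 2 : ℝ) • u - (c - (1 / 2 : ℝ) • u) = u := by module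
    unfold post
    rw [this]
    module
  have e2 : ∀ (u : E d) (σ : Sph d), postStar (c + (1 / 2 : ℝ) • u) (c - (1 / 2 : ℝ) • u) σ
      = c - (1 / 2 : ℝ) • (‖u‖ • (σ : E d)) := by
    intro u σ
    have : c + (1 / 2 : ℝ) • u - (c - (1 / 2 : ℝ) • u) = u := by module
    unfold postStar
    rw [this]
    module
  simp only [e1, e2]
  exact lintegral_exchange hd (G := fun p : E d × E d =>
    Φ ((c + (1 / 2 : ℝ) • p.1, c - (1 / 2 : ℝ) • p.1),
      (c + (1 / 2 : ℝ) • p.2, c - (1 / 2 : ℝ) • p.2))) (hΦ.comp (by fun_prop))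

lemma surf_univ_ne_zero {d : ℕ} (hd : 2 ≤ d) : surf d Set.univ ≠ 0 := by
  have := nontrivial_E hd
  rw [Measure.measure_univ_ne_zero]
  exact Measure.toSphere_ne_zero _

lemma sphereArea_pos {d : ℕ} (hd : 2 ≤ d) : 0 < sphereArea d :=
  ENNReal.toReal_pos (surf_univ_ne_zero hd) (measure_ne_top _ _)

/-! ### The gain operator with extended values -/

/-- The gain operator with values in `[0, ∞]`. -/
def gain {d : ℕ} (f : E d → ℝ) (v : E d) : ℝ≥0∞ :=
  ENNReal.ofReal (1 / sphereArea d) * ∫⁻ w : E d, ∫⁻ σ : Sph d,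
    ENNReal.ofReal (‖v - w‖ * f (postStar v w σ) * f (post v w σ)) ∂surf d

lemma measurable_gain {d : ℕ} {f : E d → ℝ} (hf : Measurable f) : Measurable (gain f) := by
  unfold gain
  refine Measurable.const_mul ?_ _
  have m1 : Measurable fun q : (E d × E d) × Sph d => ENNReal.ofReal
      (‖q.1.1 - q.1.2‖ * f (postStar q.1.1 q.1.2 q.2) * f (post q.1.1 q.1.2 q.2)) := by
    refine Measurable.ennreal_ofReal (Measurable.mul (Measurable.mul (by fun_prop)
      (hf.comp (by fun_prop))) (hf.comp (by fun_prop)))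
  exact (m1.lintegral_prod_right').lintegral_prod_right'

/-- This holds at every point: where the integral diverges, both sides are zero by convention. -/
lemma Qplus_eq_toReal_gain {d : ℕ} {f : E d → ℝ} (hf : Measurable f) (h0 : ∀ x, 0 ≤ f x)
    (v : E d) : Qplus f f v = (gain f v).toReal := by
  have m1 : Measurable fun q : E d × Sph d =>
      (‖v - q.1‖ * f (postStar v q.1 q.2) * f (post v q.1 q.2)) :=
    Measurable.mul (Measurable.mul (by fun_prop) (hf.comp (by fun_prop))) (hf.comp (by fun_prop))
  unfold Qplus gain
  rw [integral_eq_lintegral_of_nonneg_ae (Filter.Eventually.of_forall fun q =>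
    mul_nonneg (mul_nonneg (norm_nonneg _) (h0 _)) (h0 _)) m1.aestronglyMeasurable,
    lintegral_prod _ m1.ennreal_ofReal.aemeasurable, ENNReal.toReal_mul, ENNReal.toReal_ofReal]
  unfold sphereArea
  positivity

/-- Weak form of the gain operator. -/
lemma lintegral_gain_mul {d : ℕ} (hd : 2 ≤ d) {f : E d → ℝ} (hf : Measurable f)
    {φ : E d → ℝ≥0∞} (hφ : Measurable φ) :
    ∫⁻ v, gain f v * φ v = ENNReal.ofReal (1 / sphereArea d) * ∫⁻ v, ∫⁻ w,
      ENNReal.ofReal (‖v - w‖ * f v * f w) * ∫⁻ σ : Sph d, φ (post v w σ) ∂surf d := by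
  have m1 : Measurable fun q : (E d × E d) × (E d × E d) => ENNReal.ofReal
      (‖q.1.1 - q.1.2‖ * f q.2.2 * f q.2.1) * φ q.1.1 :=
    Measurable.mul (by fun_prop) (hφ.comp (by fun_prop))
  have hc := lintegral_collision hd m1
  have m2 : Measurable fun q : (E d × E d) × Sph d => ENNReal.ofReal
      (‖q.1.1 - q.1.2‖ * f (postStar q.1.1 q.1.2 q.2) * f (post q.1.1 q.1.2 q.2)) :=
    Measurable.ennreal_ofReal (Measurable.mul (Measurable.mul (by fun_prop)
      (hf.comp (by fun_prop))) (hf.comp (by fun_prop)))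
  have e1 : ∀ v, gain f v * φ v = ENNReal.ofReal (1 / sphereArea d) * ∫⁻ w : E d, ∫⁻ σ : Sph d,
      ENNReal.ofReal (‖v - w‖ * f (postStar v w σ) * f (post v w σ)) * φ v ∂surf d := by
    intro v
    unfold gain
    have m3 := measurable_slice_lintegral (μ := surf d) (fun (v w : E d) (σ : Sph d) =>
        ENNReal.ofReal (‖v - w‖ * f (postStar v w σ) * f (post v w σ))) m2 v
    rw [mul_assoc, ← lintegral_mul_const _ m3]
    congr 1
    refine lintegral_congr fun w => ?_
    have m4 := measurable_slice_right (fun (v w : E d) (σ : Sph d) =>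
        ENNReal.ofReal (‖v - w‖ * f (postStar v w σ) * f (post v w σ))) m2 v w
    rw [lintegral_mul_const _ m4]
  simp only [e1]
  rw [lintegral_const_mul]
  · congr 1
    rw [hc]
    refine lintegral_congr fun v => lintegral_congr fun w => ?_
    have m5 : Measurable fun σ : Sph d => φ (post v w σ) := hφ.comp (by fun_prop)
    rw [← lintegral_const_mul _ m5]
    refine lintegral_congr fun σ => ?_
    dsimp only
    rw [norm_post_sub_postStar, mul_assoc, mul_comm (f w), ← mul_assoc]
  · have m6 : Measurable fun q : (E d × E d) × Sph d => ENNReal.ofReal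
      (‖q.1.1 - q.1.2‖ * f (postStar q.1.1 q.1.2 q.2) * f (post q.1.1 q.1.2 q.2)) * φ q.1.1 :=
      m2.mul (hφ.comp (by fun_prop))
    exact measurable_lintegral_lintegral (fun (v w : E d) (σ : Sph d) => ENNReal.ofReal
      (‖v - w‖ * f (postStar v w σ) * f (post v w σ)) * φ v) m6

/-- Post-collisional velocities avoid null sets for almost every collision. -/
lemma Qplus_congr_ae {d : ℕ} (hd : 2 ≤ d) {f g : E d → ℝ} (hfg : f =ᵐ[volume] g) :
    ∀ᵐ v : E d, Qplus f f v = Qplus g g v := by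
  obtain ⟨N, hN, hNm, hN0⟩ := exists_measurable_superset_of_null (ae_iff.1 hfg)
  have hm : Measurable (N.indicator (1 : E d → ℝ≥0∞)) := measurable_one.indicator hNm
  have m1 : Measurable fun q : (E d × E d) × (E d × E d) =>
      N.indicator (1 : E d → ℝ≥0∞) q.2.1 + N.indicator (1 : E d → ℝ≥0∞) q.2.2 :=
    (hm.comp (by fun_prop)).add (hm.comp (by fun_prop))
  have hc := lintegral_collision hd m1
  -- The exceptional set carries no mass before the collision. The collision change of variables
  -- carries this over to the post-collisional velocities.
  have hz : ∫⁻ v : E d, ∫⁻ w : E d, ∫⁻ _ : Sph d,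
      (N.indicator (1 : E d → ℝ≥0∞) v + N.indicator (1 : E d → ℝ≥0∞) w) ∂surf d = 0 := by
    have i0 : ∫⁻ w, N.indicator (1 : E d → ℝ≥0∞) w = 0 := by
      rw [lintegral_indicator_one hNm, hN0]
    have h1 : ∀ᵐ v : E d, N.indicator (1 : E d → ℝ≥0∞) v = 0 := by
      exact (lintegral_eq_zero_iff hm).1 i0
    refine lintegral_eq_zero_of_ae_eq_zero ?_
    filter_upwards [h1] with v hv
    refine lintegral_eq_zero_of_ae_eq_zero ?_
    filter_upwards [h1] with w hw
    simp [hv, hw]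
  dsimp only at hc
  rw [hz] at hc
  set S : E d → E d → Sph d → ℝ≥0∞ := fun v w σ => N.indicator (1 : E d → ℝ≥0∞) (post v w σ)
        + N.indicator (1 : E d → ℝ≥0∞) (postStar v w σ) with hS
  have m2 : Measurable fun q : (E d × E d) × Sph d => S q.1.1 q.1.2 q.2 :=
    (hm.comp (by fun_prop)).add (hm.comp (by fun_prop))
  have hc2 := (lintegral_eq_zero_iff (measurable_lintegral_lintegral (μ := surf d)
    (ν := (volume : Measure (E d))) S m2)).1 hc
  filter_upwards [hc2] with v hv
  have m4 : Measurable fun p : E d × Sph d => S v p.1 p.2 :=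
    m2.comp (f := fun p : E d × Sph d => ((v, p.1), p.2)) (by fun_prop)
  have hv1 : ∫⁻ p : E d × Sph d, S v p.1 p.2 ∂((volume : Measure (E d)).prod (surf d)) = 0 := by
    rw [lintegral_prod _ m4.aemeasurable]; exact hv
  have hv' := (lintegral_eq_zero_iff m4).1 hv1
  unfold Qplus
  congr 1
  refine integral_congr_ae ?_
  filter_upwards [hv'] with p hp
  simp only [hS, Pi.zero_apply, add_eq_zero] at hp
  have a1 : f (post v p.1 p.2) = g (post v p.1 p.2) := by
    by_contra hne
    have : post v p.1 p.2 ∈ N := hN hne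
    simp [this] at hp
  have a2 : f (postStar v p.1 p.2) = g (postStar v p.1 p.2) := by
    by_contra hne
    have : postStar v p.1 p.2 ∈ N := hN hne
    simp [this] at hp
  rw [a1, a2]

/-! ### Profiles as probability measures -/

/-- A profile with a measurable, everywhere nonnegative representative. -/
structure NiceProfile {d : ℕ} (α : ℝ) (ψ : E d → ℝ) : Prop where
  meas : Measurable ψ
  nonneg : ∀ ξ, 0 ≤ ψ ξ
  prof : IsProfile α ψ

/-- Every clause of the definition depends only on the almost-everywhere class. The gain term is the
one nontrivial case, since it evaluates `ψ` at post-collisional points; `Qplus_congr_ae` handles it.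
-/
lemma IsProfile.exists_nice {d : ℕ} (hd : 2 ≤ d) {α : ℝ} {ψ : E d → ℝ} (h : IsProfile α ψ) :
    ∃ ψ' : E d → ℝ, ψ =ᵐ[volume] ψ' ∧ NiceProfile α ψ' := by
  have hbm : Measurable (fun ξ : E d => (bracket ξ ^ 3)⁻¹) := by fun_prop
  have hm : AEStronglyMeasurable ψ volume := by
    refine (h.memL1.1.mul hbm.aestronglyMeasurable).congr (Filter.Eventually.of_forall fun ξ => ?_)
    have := (bracket_pos ξ).ne'
    simp only [Pi.mul_apply]
    field_simp
  set ψ' : E d → ℝ := fun ξ => max (hm.mk ψ ξ) 0 with hψ'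
  have hae : ψ =ᵐ[volume] ψ' := by
    filter_upwards [hm.ae_eq_mk, h.nonneg] with ξ h1 h2
    simp only [hψ']
    rw [← h1, max_eq_left h2]
  have hL : collFreq ψ = collFreq ψ' := by
    funext v
    refine integral_congr_ae ?_
    filter_upwards [hae] with ξ h1
    simp only [h1]
  have hQm : ∀ᵐ ξ, Qminus ψ ψ ξ = Qminus ψ' ψ' ξ := by
    filter_upwards [hae] with ξ h1
    simp only [Qminus, hL, h1]
  have hA : coefA α ψ = coefA α ψ' := by
    unfold coefA
    congr 1
    refine integral_congr_ae ?_
    filter_upwards [hQm] with ξ h1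
    simp only [h1]
  have hB : coefB α ψ = coefB α ψ' := by
    unfold coefB
    congr 1
    refine integral_congr_ae ?_
    filter_upwards [hQm] with ξ h1
    simp only [h1]
  refine ⟨ψ', hae, hm.stronglyMeasurable_mk.measurable.max measurable_const,
    fun ξ => le_max_right _ _, Filter.Eventually.of_forall fun ξ => le_max_right _ _, ?_, ?_, ?_,
    ?_, ?_⟩
  · refine h.memL1.congr ?_
    filter_upwards [hae] with ξ h1
    simp only [h1]
  · rw [← h.mass]
    exact integral_congr_ae hae.symm
  · rw [← h.momentum]
    refine integral_congr_ae ?_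
    filter_upwards [hae] with ξ h1
    simp only [h1]
  · rw [← h.energy]
    refine integral_congr_ae ?_
    filter_upwards [hae] with ξ h1
    simp only [h1]
  · intro φ hφ hc
    rw [← hA, ← hB]
    have e1 : ∫ ξ, ψ' ξ * φ ξ = ∫ ξ, ψ ξ * φ ξ := by
      refine integral_congr_ae ?_
      filter_upwards [hae] with ξ h1
      simp only [h1]
    have e2 : ∫ ξ, ψ' ξ * ((d : ℝ) * φ ξ + fderiv ℝ φ ξ ξ)
        = ∫ ξ, ψ ξ * ((d : ℝ) * φ ξ + fderiv ℝ φ ξ ξ) := by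
      refine integral_congr_ae ?_
      filter_upwards [hae] with ξ h1
      simp only [h1]
    have e3 : ∫ ξ, annih α ψ' ξ * φ ξ = ∫ ξ, annih α ψ ξ * φ ξ := by
      refine integral_congr_ae ?_
      filter_upwards [hQm, Qplus_congr_ae hd hae] with ξ h1 h2
      simp only [annih, h1, h2]
    rw [e1, e2, e3]
    exact h.solution φ hφ hc

/-- The measure with density `ψ`. -/
def law {d : ℕ} (ψ : E d → ℝ) : Measure (E d) := volume.withDensity fun ξ => ENNReal.ofReal (ψ ξ)

section law

variable {d : ℕ} {ψ : E d → ℝ}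

lemma integral_law (hm : Measurable ψ) (h0 : ∀ ξ, 0 ≤ ψ ξ) (g : E d → ℝ) :
    ∫ ξ, g ξ ∂law ψ = ∫ ξ, ψ ξ * g ξ := by
  unfold law
  rw [integral_withDensity_eq_integral_toReal_smul (by fun_prop) (by simp)]
  simp [ENNReal.toReal_ofReal (h0 _)]

lemma integrable_law_iff (hm : Measurable ψ) (h0 : ∀ ξ, 0 ≤ ψ ξ) (g : E d → ℝ) :
    Integrable g (law ψ) ↔ Integrable fun ξ => ψ ξ * g ξ := by
  unfold law
  rw [integrable_withDensity_iff_integrable_smul' (by fun_prop) (by simp)]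
  simp [ENNReal.toReal_ofReal (h0 _)]

lemma lintegral_law (hm : Measurable ψ) {g : E d → ℝ≥0∞} (hg : Measurable g) :
    ∫⁻ ξ, g ξ ∂law ψ = ∫⁻ ξ, ENNReal.ofReal (ψ ξ) * g ξ := by
  unfold law
  rw [lintegral_withDensity_eq_lintegral_mul _ (by fun_prop) hg]
  rfl

end law

namespace NiceProfile

variable {d : ℕ} {α : ℝ} {ψ : E d → ℝ}

lemma integrable_bracket_three (h : NiceProfile α ψ) :
    Integrable (fun ξ => bracket ξ ^ 3) (law ψ) :=
  (integrable_law_iff h.meas h.nonneg _).2 h.prof.memL1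

lemma integrable_pow_of_le {q p : ℕ} (hpq : p ≤ q)
    (hq : Integrable (fun ξ => bracket ξ ^ q) (law ψ)) :
    Integrable (fun ξ => bracket ξ ^ p) (law ψ) := by
  refine hq.mono' (by fun_prop) (Filter.Eventually.of_forall fun ξ => ?_)
  rw [Real.norm_eq_abs, abs_of_nonneg (pow_nonneg (bracket_pos ξ).le _)]
  exact pow_le_pow_right₀ (one_le_bracket ξ) hpq

lemma isProbabilityMeasure (h : NiceProfile α ψ) : IsProbabilityMeasure (law ψ) := by
  have h1 := integrable_pow_of_le (Nat.zero_le 3) h.integrable_bracket_three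
  simp only [pow_zero] at h1
  have h2 : ∫ _, (1 : ℝ) ∂law ψ = 1 := by
    rw [integral_law h.meas h.nonneg]; simpa using h.prof.mass
  have hf : IsFiniteMeasure (law ψ) := by
    rw [integrable_const_iff] at h1
    simpa using h1
  refine ⟨?_⟩
  rw [integral_const, smul_eq_mul, mul_one, measureReal_def] at h2
  rw [← ENNReal.ofReal_toReal (measure_ne_top (law ψ) Set.univ), h2, ENNReal.ofReal_one]

lemma energy_law (h : NiceProfile α ψ) : ∫ ξ, ‖ξ‖ ^ 2 ∂law ψ = (d : ℝ) / 2 := by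
  rw [integral_law h.meas h.nonneg]; exact h.prof.energy

lemma integrable_bracket (h : NiceProfile α ψ) : Integrable (fun ξ => bracket ξ) (law ψ) := by
  simpa using integrable_pow_of_le (p := 1) (by norm_num) h.integrable_bracket_three

lemma integrable_of_le_bracket {q : ℕ} (hq : Integrable (fun ξ => bracket ξ ^ q) (law ψ))
    {g : E d → ℝ} (hg : Measurable g) {C : ℝ} (hC : ∀ ξ, |g ξ| ≤ C * bracket ξ ^ q) :
    Integrable g (law ψ) :=
  (hq.const_mul C).mono' hg.aestronglyMeasurable (Filter.Eventually.of_forall hC)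

lemma integrable_norm_sub (h : NiceProfile α ψ) (v : E d) :
    Integrable (fun w => ‖v - w‖) (law ψ) := by
  refine integrable_of_le_bracket (q := 1) (by simpa using h.integrable_bracket) (by fun_prop)
    (C := 2 * bracket v) fun w => ?_
  rw [abs_of_nonneg (norm_nonneg _), pow_one, mul_assoc]
  exact norm_sub_le_bracket_mul v w

lemma collFreq_eq (h : NiceProfile α ψ) (v : E d) : collFreq ψ v = ∫ w, ‖v - w‖ ∂law ψ := by
  rw [integral_law h.meas h.nonneg]
  unfold collFreq
  refine integral_congr_ae (Filter.Eventually.of_forall fun w => ?_)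
  simp only [mul_comm]

lemma measurable_collFreq (h : NiceProfile α ψ) : Measurable (collFreq ψ) := by
  have hm := h.meas
  have : StronglyMeasurable fun p : E d × E d => ‖p.1 - p.2‖ * ψ p.2 :=
    Measurable.stronglyMeasurable (by fun_prop)
  exact this.integral_prod_right.measurable

lemma collFreq_nonneg (h : NiceProfile α ψ) (v : E d) : 0 ≤ collFreq ψ v :=
  integral_nonneg fun w => mul_nonneg (norm_nonneg _) (h.nonneg w)

lemma integral_bracket_nonneg (q : ℕ) : 0 ≤ ∫ ξ, bracket ξ ^ q ∂law ψ :=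
  integral_nonneg fun ξ => pow_nonneg (bracket_pos ξ).le _

lemma collFreq_le (h : NiceProfile α ψ) (v : E d) :
    collFreq ψ v ≤ bracket v + ∫ ξ, bracket ξ ∂law ψ := by
  have := h.isProbabilityMeasure
  rw [h.collFreq_eq]
  calc _ ≤ ∫ w, (bracket v + bracket w) ∂law ψ :=
        integral_mono (h.integrable_norm_sub v) ((integrable_const _).add h.integrable_bracket)
          fun w => norm_sub_le_bracket_add v w
    _ = _ := by
      rw [integral_add (integrable_const _) h.integrable_bracket]; simp

lemma collFreq_le_mul (h : NiceProfile α ψ) (v : E d) :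
    collFreq ψ v ≤ (1 + ∫ ξ, bracket ξ ∂law ψ) * bracket v := by
  have h0 : 0 ≤ ∫ ξ, bracket ξ ∂law ψ := by simpa using integral_bracket_nonneg (ψ := ψ) 1
  nlinarith [h.collFreq_le v, one_le_bracket v]

end NiceProfile

/-! ### Collision rates and the coefficients of the equation -/

/-- The total collision rate `∫∫ |v - w| ψ(v) ψ(w)`. -/
def rateA {d : ℕ} (ψ : E d → ℝ) : ℝ := ∫ v, collFreq ψ v ∂law ψ

/-- The energy-weighted collision rate `(2/d) ∫∫ |v|² |v - w| ψ(v) ψ(w)`. -/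
def rateB {d : ℕ} (ψ : E d → ℝ) : ℝ := 2 / (d : ℝ) * ∫ v, ‖v‖ ^ 2 * collFreq ψ v ∂law ψ

namespace NiceProfile

variable {d : ℕ} {α : ℝ} {ψ : E d → ℝ}

lemma integrable_collFreq (h : NiceProfile α ψ) : Integrable (collFreq ψ) (law ψ) := by
  refine integrable_of_le_bracket (q := 1) (by simpa using h.integrable_bracket)
    h.measurable_collFreq (C := 1 + ∫ ξ, bracket ξ ∂law ψ) fun v => ?_
  rw [abs_of_nonneg (h.collFreq_nonneg v), pow_one]
  exact h.collFreq_le_mul v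

lemma integrable_mul_collFreq (h : NiceProfile α ψ) {q : ℕ}
    (hq : Integrable (fun ξ => bracket ξ ^ (q + 1)) (law ψ)) {g : E d → ℝ} (hg : Measurable g)
    {C : ℝ} (hC : ∀ ξ, |g ξ| ≤ C * bracket ξ ^ q) :
    Integrable (fun v => g v * collFreq ψ v) (law ψ) := by
  refine integrable_of_le_bracket hq (hg.mul h.measurable_collFreq)
    (C := C * (1 + ∫ ξ, bracket ξ ∂law ψ)) fun v => ?_
  rw [abs_mul, abs_of_nonneg (h.collFreq_nonneg v)]
  calc |g v| * collFreq ψ v ≤ (C * bracket v ^ q) * ((1 + ∫ ξ, bracket ξ ∂law ψ) * bracket v) := by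
        apply mul_le_mul (hC v) (h.collFreq_le_mul v) (h.collFreq_nonneg v)
        exact (abs_nonneg _).trans (hC v)
    _ = _ := by ring

lemma integrable_sq_mul_collFreq (h : NiceProfile α ψ) :
    Integrable (fun v => ‖v‖ ^ 2 * collFreq ψ v) (law ψ) := by
  refine h.integrable_mul_collFreq (q := 2) h.integrable_bracket_three (by fun_prop) (C := 1)
    fun v => ?_
  rw [abs_of_nonneg (by positivity), one_mul]
  gcongr
  exact norm_le_bracket v

lemma integral_Qminus (h : NiceProfile α ψ) (g : E d → ℝ) :
    ∫ ξ, g ξ * Qminus ψ ψ ξ = ∫ ξ, g ξ * collFreq ψ ξ ∂law ψ := by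
  rw [integral_law h.meas h.nonneg]
  refine integral_congr_ae (Filter.Eventually.of_forall fun ξ => ?_)
  simp only [Qminus]; ring

/-- The drift measures the imbalance between the normalized energy and mass loss rates. Its sign is
not known, so both a lower and an upper bound on `rateB` are needed later. -/
lemma coefB_eq (hd : 2 ≤ d) (h : NiceProfile α ψ) :
    coefB α ψ = α / 2 * (rateB ψ - rateA ψ) := by
  have hd0 : (d : ℝ) ≠ 0 := by positivity
  unfold coefB rateA rateB
  rw [h.integral_Qminus]
  have : ∫ ξ, ((d : ℝ) - 2 * ‖ξ‖ ^ 2) * collFreq ψ ξ ∂law ψ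
      = d * (∫ ξ, collFreq ψ ξ ∂law ψ) - 2 * ∫ ξ, ‖ξ‖ ^ 2 * collFreq ψ ξ ∂law ψ := by
    rw [← integral_const_mul, ← integral_const_mul, ← integral_sub
      (h.integrable_collFreq.const_mul _) (h.integrable_sq_mul_collFreq.const_mul _)]
    refine integral_congr_ae (Filter.Eventually.of_forall fun ξ => ?_)
    ring
  rw [this]
  field_simp
  ring

/-- The part `d B` cancels the divergence of `ξ` after integration by parts, so only `-α a` remains
as a zeroth-order coefficient. -/
lemma coefA_eq (hd : 2 ≤ d) (h : NiceProfile α ψ) :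
    coefA α ψ = d * coefB α ψ - α * rateA ψ := by
  have hd0 : (d : ℝ) ≠ 0 := by positivity
  rw [h.coefB_eq hd]
  unfold coefA rateA rateB
  rw [h.integral_Qminus]
  have : ∫ ξ, ((d : ℝ) + 2 - 2 * ‖ξ‖ ^ 2) * collFreq ψ ξ ∂law ψ
      = (d + 2) * (∫ ξ, collFreq ψ ξ ∂law ψ) - 2 * ∫ ξ, ‖ξ‖ ^ 2 * collFreq ψ ξ ∂law ψ := by
    rw [← integral_const_mul, ← integral_const_mul, ← integral_sub
      (h.integrable_collFreq.const_mul _) (h.integrable_sq_mul_collFreq.const_mul _)]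
    refine integral_congr_ae (Filter.Eventually.of_forall fun ξ => ?_)
    ring
  rw [this]
  field_simp
  ring

end NiceProfile

/-! ### Weak form of the gain against the law of the profile -/

/-- The spherical average of `φ` over the post-collisional velocities. -/
def sphAvg {d : ℕ} (φ : E d → ℝ) (v w : E d) : ℝ :=
  (1 / sphereArea d) * ∫ σ : Sph d, φ (post v w σ) ∂surf d

lemma integrable_post {d : ℕ} {φ : E d → ℝ} (hφ : Measurable φ) {C : ℝ} {q : ℕ}
    (hC : ∀ ξ, |φ ξ| ≤ C * bracket ξ ^ q) (v w : E d) :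
    Integrable (fun σ : Sph d => φ (post v w σ)) (surf d) := by
  have hC0 : 0 ≤ C := by
    have := (abs_nonneg _).trans (hC 0)
    have hb := pow_pos (bracket_pos (0 : E d)) q
    by_contra hc
    nlinarith
  refine (integrable_const (C * (bracket v * bracket w) ^ q)).mono'
    (hφ.comp (by fun_prop)).aestronglyMeasurable (Filter.Eventually.of_forall fun σ => ?_)
  rw [Real.norm_eq_abs]
  refine (hC _).trans ?_
  gcongr
  · exact (bracket_pos _).le
  · exact bracket_post_le v w σ

lemma measurable_sphAvg {d : ℕ} {φ : E d → ℝ} (hφ : Measurable φ) :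
    Measurable fun p : E d × E d => sphAvg φ p.1 p.2 := by
  unfold sphAvg
  refine Measurable.const_mul ?_ _
  have : StronglyMeasurable fun q : (E d × E d) × Sph d => φ (post q.1.1 q.1.2 q.2) :=
    Measurable.stronglyMeasurable (hφ.comp (by fun_prop))
  exact this.integral_prod_right.measurable

lemma sphAvg_nonneg {d : ℕ} {φ : E d → ℝ} (h0 : ∀ ξ, 0 ≤ φ ξ) (v w : E d) :
    0 ≤ sphAvg φ v w :=
  mul_nonneg (by unfold sphereArea; positivity) (integral_nonneg fun _ => h0 _)

lemma sphAvg_const {d : ℕ} (hd : 2 ≤ d) (c : ℝ) (v w : E d) : sphAvg (fun _ => c) v w = c := by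
  have := (sphereArea_pos hd).ne'
  unfold sphAvg
  rw [integral_const, smul_eq_mul]
  change 1 / sphereArea d * (sphereArea d * c) = c
  field_simp

lemma sphAvg_le {d : ℕ} (hd : 2 ≤ d) {φ : E d → ℝ} (hφ : Measurable φ) {C : ℝ} {q : ℕ}
    (hC : ∀ ξ, |φ ξ| ≤ C * bracket ξ ^ q) (hC0 : 0 ≤ C) (v w : E d) :
    sphAvg φ v w ≤ C * (bracket v * bracket w) ^ q := by
  rw [← sphAvg_const hd (C * (bracket v * bracket w) ^ q) v w]
  unfold sphAvg
  have := sphereArea_pos hd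
  refine mul_le_mul_of_nonneg_left ?_ (by positivity)
  refine integral_mono (integrable_post hφ hC v w) (integrable_const _) fun σ => ?_
  refine (le_abs_self _).trans ((hC _).trans ?_)
  dsimp only
  gcongr
  · exact (bracket_pos _).le
  · exact bracket_post_le v w σ

lemma ofReal_sphAvg {d : ℕ} {φ : E d → ℝ} (hφ : Measurable φ) (h0 : ∀ ξ, 0 ≤ φ ξ) {C : ℝ}
    {q : ℕ} (hC : ∀ ξ, |φ ξ| ≤ C * bracket ξ ^ q) (v w : E d) :
    ENNReal.ofReal (sphAvg φ v w) = ENNReal.ofReal (1 / sphereArea d) *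
      ∫⁻ σ : Sph d, ENNReal.ofReal (φ (post v w σ)) ∂surf d := by
  unfold sphAvg
  rw [ENNReal.ofReal_mul (by unfold sphereArea; positivity), ofReal_integral_eq_lintegral_ofReal
    (integrable_post hφ hC v w) (Filter.Eventually.of_forall fun σ => h0 _)]

namespace NiceProfile

variable {d : ℕ} {α : ℝ} {ψ : E d → ℝ}

lemma integrable_prod_bracket (h : NiceProfile α ψ) {q p : ℕ}
    (hq : Integrable (fun ξ => bracket ξ ^ q) (law ψ))
    (hp : Integrable (fun ξ => bracket ξ ^ p) (law ψ)) :
    Integrable (fun x : E d × E d => bracket x.1 ^ q * bracket x.2 ^ p)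
      ((law ψ).prod (law ψ)) := by
  have := h.isProbabilityMeasure
  exact hq.mul_prod hp

lemma integrable_rate_sphAvg (hd : 2 ≤ d) (h : NiceProfile α ψ) {q : ℕ}
    (hq : Integrable (fun ξ => bracket ξ ^ (q + 1)) (law ψ)) {φ : E d → ℝ} (hφ : Measurable φ)
    (h0 : ∀ ξ, 0 ≤ φ ξ) {C : ℝ} (hC : ∀ ξ, |φ ξ| ≤ C * bracket ξ ^ q) (hC0 : 0 ≤ C) :
    Integrable (fun x : E d × E d => ‖x.1 - x.2‖ * sphAvg φ x.1 x.2)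
      ((law ψ).prod (law ψ)) := by
  have hm := measurable_sphAvg hφ
  refine ((h.integrable_prod_bracket hq hq).const_mul (2 * C)).mono'
    (Measurable.aestronglyMeasurable (by fun_prop)) (Filter.Eventually.of_forall fun x => ?_)
  rw [Real.norm_eq_abs, abs_of_nonneg (mul_nonneg (norm_nonneg _) (sphAvg_nonneg h0 _ _))]
  calc _ ≤ (2 * (bracket x.1 * bracket x.2)) * (C * (bracket x.1 * bracket x.2) ^ q) := by
        refine mul_le_mul (norm_sub_le_bracket_mul _ _) (sphAvg_le hd hφ hC hC0 _ _)
          (sphAvg_nonneg h0 _ _) ?_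
        have := bracket_pos x.1
        have := bracket_pos x.2
        positivity
    _ = _ := by rw [mul_pow]; ring

lemma lintegral_prod_law (h : NiceProfile α ψ) {F : E d × E d → ℝ≥0∞} (hF : Measurable F) :
    ∫⁻ x, F x ∂(law ψ).prod (law ψ)
      = ∫⁻ v, ∫⁻ w, ENNReal.ofReal (ψ v) * (ENNReal.ofReal (ψ w) * F (v, w)) := by
  have := h.isProbabilityMeasure
  have hψ := h.meas
  rw [lintegral_prod _ hF.aemeasurable, lintegral_law h.meas hF.lintegral_prod_right']
  refine lintegral_congr fun v => ?_
  have hm : Measurable fun w => F (v, w) := hF.comp measurable_prodMk_left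
  rw [lintegral_law h.meas hm, ← lintegral_const_mul _ (by fun_prop)]

lemma lintegral_gain_law (hd : 2 ≤ d) (h : NiceProfile α ψ) {φ : E d → ℝ≥0∞}
    (hφ : Measurable φ) :
    ∫⁻ v, gain ψ v * φ v = ∫⁻ x : E d × E d, ENNReal.ofReal ‖x.1 - x.2‖ *
      (ENNReal.ofReal (1 / sphereArea d) * ∫⁻ σ : Sph d, φ (post x.1 x.2 σ) ∂surf d)
        ∂(law ψ).prod (law ψ) := by
  have hψ := h.meas
  have mφ : Measurable fun q : (E d × E d) × Sph d => φ (post q.1.1 q.1.2 q.2) :=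
    hφ.comp (by fun_prop)
  have mS : Measurable fun p : E d × E d => ∫⁻ σ : Sph d, φ (post p.1 p.2 σ) ∂surf d :=
    mφ.lintegral_prod_right'
  have mI : Measurable fun p : E d × E d => ENNReal.ofReal (‖p.1 - p.2‖ * ψ p.1 * ψ p.2) *
      ∫⁻ σ : Sph d, φ (post p.1 p.2 σ) ∂surf d := Measurable.mul (by fun_prop) mS
  have mI2 : Measurable fun v : E d => ∫⁻ w : E d, ENNReal.ofReal (‖v - w‖ * ψ v * ψ w) *
      ∫⁻ σ : Sph d, φ (post v w σ) ∂surf d := mI.lintegral_prod_right'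
  have mF : Measurable fun x : E d × E d => ENNReal.ofReal ‖x.1 - x.2‖ *
      (ENNReal.ofReal (1 / sphereArea d) * ∫⁻ σ : Sph d, φ (post x.1 x.2 σ) ∂surf d) :=
    Measurable.mul (by fun_prop) (mS.const_mul _)
  have e1 := lintegral_gain_mul hd h.meas hφ
  have e2 := h.lintegral_prod_law mF
  have e3 := lintegral_const_mul (μ := volume) (ENNReal.ofReal (1 / sphereArea d)) mI2
  refine e1.trans (e3.symm.trans (Eq.trans ?_ e2.symm))
  refine lintegral_congr fun v => ?_
  have mv : Measurable fun w : E d => ENNReal.ofReal (‖v - w‖ * ψ v * ψ w) *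
      ∫⁻ σ : Sph d, φ (post v w σ) ∂surf d := mI.comp (f := fun w => (v, w)) (by fun_prop)
  rw [← lintegral_const_mul _ mv]
  refine lintegral_congr fun w => ?_
  rw [ENNReal.ofReal_mul (mul_nonneg (norm_nonneg _) (h.nonneg v)),
    ENNReal.ofReal_mul (norm_nonneg _)]
  ring

lemma lintegral_gain_mul_ofReal (hd : 2 ≤ d) (h : NiceProfile α ψ) {q : ℕ}
    (hq : Integrable (fun ξ => bracket ξ ^ (q + 1)) (law ψ)) {φ : E d → ℝ} (hφ : Measurable φ)
    (h0 : ∀ ξ, 0 ≤ φ ξ) {C : ℝ} (hC : ∀ ξ, |φ ξ| ≤ C * bracket ξ ^ q) (hC0 : 0 ≤ C) :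
    ∫⁻ v, gain ψ v * ENNReal.ofReal (φ v) = ENNReal.ofReal
      (∫ x : E d × E d, ‖x.1 - x.2‖ * sphAvg φ x.1 x.2 ∂(law ψ).prod (law ψ)) := by
  rw [h.lintegral_gain_law hd (by fun_prop), ofReal_integral_eq_lintegral_ofReal
    (h.integrable_rate_sphAvg hd hq hφ h0 hC hC0) (Filter.Eventually.of_forall fun x =>
      mul_nonneg (norm_nonneg _) (sphAvg_nonneg h0 _ _))]
  refine lintegral_congr fun x => ?_
  rw [ENNReal.ofReal_mul (norm_nonneg _), ofReal_sphAvg hφ h0 hC]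

lemma integrable_Qplus_mul (hd : 2 ≤ d) (h : NiceProfile α ψ) {q : ℕ}
    (hq : Integrable (fun ξ => bracket ξ ^ (q + 1)) (law ψ)) {φ : E d → ℝ} (hφ : Measurable φ)
    {C : ℝ} (hC : ∀ ξ, |φ ξ| ≤ C * bracket ξ ^ q) (hC0 : 0 ≤ C) :
    Integrable fun v => Qplus ψ ψ v * φ v := by
  have hg := measurable_gain h.meas
  have h1 := h.lintegral_gain_mul_ofReal hd hq (φ := fun ξ => C * bracket ξ ^ q) (by fun_prop)
    (fun ξ => mul_nonneg hC0 (pow_nonneg (bracket_pos ξ).le _)) (C := C) (q := q) (fun ξ => by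
      rw [abs_of_nonneg (mul_nonneg hC0 (pow_nonneg (bracket_pos ξ).le _))]) hC0
  have heq : (fun v => Qplus ψ ψ v * φ v) = fun v => (gain ψ v).toReal * φ v := by
    funext v; rw [Qplus_eq_toReal_gain h.meas h.nonneg]
  rw [heq]
  refine ⟨Measurable.aestronglyMeasurable (by fun_prop), ?_⟩
  refine lt_of_le_of_lt (lintegral_mono fun v => ?_) (h1.trans_lt ENNReal.ofReal_lt_top)
  rw [enorm_mul, Real.enorm_of_nonneg ENNReal.toReal_nonneg, Real.enorm_eq_ofReal_abs]
  exact mul_le_mul' ENNReal.ofReal_toReal_le (ENNReal.ofReal_le_ofReal (hC v))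

lemma integral_Qplus_mul (hd : 2 ≤ d) (h : NiceProfile α ψ) {q : ℕ}
    (hq : Integrable (fun ξ => bracket ξ ^ (q + 1)) (law ψ)) {φ : E d → ℝ} (hφ : Measurable φ)
    (h0 : ∀ ξ, 0 ≤ φ ξ) {C : ℝ} (hC : ∀ ξ, |φ ξ| ≤ C * bracket ξ ^ q) (hC0 : 0 ≤ C) :
    ∫ v, Qplus ψ ψ v * φ v
      = ∫ x : E d × E d, ‖x.1 - x.2‖ * sphAvg φ x.1 x.2 ∂(law ψ).prod (law ψ) := by
  have hg := measurable_gain h.meas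
  have h1 := h.lintegral_gain_mul_ofReal hd hq hφ h0 hC hC0
  -- Testing with `1` shows that the gain is finite almost everywhere, so that passing to real
  -- values loses nothing.
  have hfin : ∀ᵐ v : E d, gain ψ v < ∞ := by
    have h2 := h.lintegral_gain_mul_ofReal hd (q := 0) (by simpa using h.integrable_bracket)
      (φ := fun _ => 1) (by fun_prop) (fun _ => zero_le_one) (C := 1) (by simp) zero_le_one
    simp only [ENNReal.ofReal_one, mul_one] at h2
    exact ae_lt_top hg (by rw [h2]; exact ENNReal.ofReal_ne_top)
  have heq : (fun v => Qplus ψ ψ v * φ v) = fun v => (gain ψ v).toReal * φ v := by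
    funext v; rw [Qplus_eq_toReal_gain h.meas h.nonneg]
  rw [heq, integral_eq_lintegral_of_nonneg_ae (Filter.Eventually.of_forall fun v =>
    mul_nonneg ENNReal.toReal_nonneg (h0 v)) (Measurable.aestronglyMeasurable (by fun_prop))]
  have h3 : ∫⁻ v, ENNReal.ofReal ((gain ψ v).toReal * φ v)
      = ∫⁻ v, gain ψ v * ENNReal.ofReal (φ v) := by
    refine lintegral_congr_ae ?_
    filter_upwards [hfin] with v hv
    rw [ENNReal.ofReal_mul ENNReal.toReal_nonneg, ENNReal.ofReal_toReal hv.ne]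
  rw [h3, h1, ENNReal.toReal_ofReal]
  exact integral_nonneg fun x => mul_nonneg (norm_nonneg _) (sphAvg_nonneg h0 _ _)

end NiceProfile

/-! ### Test functions of polynomial growth -/

/-- Smooth cutoffs with uniformly bounded radial derivatives. -/
lemma exists_cutoff (d : ℕ) : ∃ (χ : ℕ → E d → ℝ) (K : ℝ), 0 ≤ K ∧
    (∀ n, ContDiff ℝ (⊤ : ℕ∞) (χ n)) ∧ (∀ n, HasCompactSupport (χ n)) ∧
    (∀ n ξ, 0 ≤ χ n ξ) ∧ (∀ n ξ, χ n ξ ≤ 1) ∧ (∀ n ξ, |fderiv ℝ (χ n) ξ ξ| ≤ K) ∧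
    (∀ ξ, ∀ᶠ n in atTop, χ n ξ = 1 ∧ fderiv ℝ (χ n) ξ ξ = 0) := by
  let χ₀ : ContDiffBump (0 : E d) := ⟨1, 2, one_pos, one_lt_two⟩
  have hs : ContDiff ℝ (⊤ : ℕ∞) (χ₀ : E d → ℝ) := χ₀.contDiff
  have hd₀ : Differentiable ℝ (χ₀ : E d → ℝ) := hs.differentiable (by simp)
  have hcont : Continuous fun y : E d => fderiv ℝ (χ₀ : E d → ℝ) y y :=
    (hs.continuous_fderiv (by simp)).clm_apply continuous_id
  have hsupp : HasCompactSupport fun y : E d => fderiv ℝ (χ₀ : E d → ℝ) y y := by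
    refine (χ₀.hasCompactSupport.fderiv (𝕜 := ℝ)).mono fun y hy => ?_
    simp only [Function.mem_support] at hy ⊢
    intro h0; rw [h0] at hy; simp at hy
  obtain ⟨K, hK⟩ := hcont.bounded_above_of_compact_support hsupp
  -- The radial derivative `ξ·∇` commutes with dilations, so one bound `K` serves all scales.
  have hfd : ∀ (n : ℕ) (ξ : E d),
      fderiv ℝ (fun x : E d => χ₀ (((n : ℝ) + 1)⁻¹ • x)) ξ ξ
        = fderiv ℝ (χ₀ : E d → ℝ) (((n : ℝ) + 1)⁻¹ • ξ) (((n : ℝ) + 1)⁻¹ • ξ) := by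
    intro n ξ
    rw [fderiv_comp_smul]
    simp
  refine ⟨fun n x => χ₀ (((n : ℝ) + 1)⁻¹ • x), K, (norm_nonneg _).trans (hK 0), fun n => ?_,
    fun n => ?_, fun n ξ => χ₀.nonneg, fun n ξ => χ₀.le_one, fun n ξ => ?_, fun ξ => ?_⟩
  · exact hs.comp (contDiff_const_smul _)
  · exact χ₀.hasCompactSupport.comp_smul (by positivity)
  · rw [hfd]; exact hK _
  · obtain ⟨N, hN⟩ := exists_nat_gt ‖ξ‖
    filter_upwards [eventually_ge_atTop N] with n hn
    have hlt : ‖((n : ℝ) + 1)⁻¹ • ξ‖ < 1 := by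
      have hn' : (N : ℝ) ≤ n := by exact_mod_cast hn
      have hp : (0 : ℝ) < n + 1 := by positivity
      rw [norm_smul, Real.norm_eq_abs, abs_of_pos (by positivity), ← div_eq_inv_mul,
        div_lt_one hp]
      linarith
    refine ⟨χ₀.one_of_mem_closedBall (by simpa [χ₀] using hlt.le), ?_⟩
    rw [hfd]
    have : (χ₀ : E d → ℝ) =ᶠ[𝓝 (((n : ℝ) + 1)⁻¹ • ξ)] fun _ => 1 :=
      χ₀.eventuallyEq_one_of_mem_ball (by simpa [χ₀] using hlt)
    rw [this.fderiv_eq]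
    simp

namespace NiceProfile

variable {d : ℕ} {α : ℝ} {ψ : E d → ℝ}

lemma abs_le_mul_bracket_of_bounded {φ : E d → ℝ} {C : ℝ} {q : ℕ}
    (hC : ∀ ξ, |φ ξ| ≤ C * bracket ξ ^ q) : 0 ≤ C := by
  have := (abs_nonneg _).trans (hC 0)
  have hb := pow_pos (bracket_pos (0 : E d)) q
  by_contra hc
  nlinarith

lemma integral_Qminus_mul (h : NiceProfile α ψ) (φ : E d → ℝ) :
    ∫ ξ, Qminus ψ ψ ξ * φ ξ = ∫ ξ, φ ξ * collFreq ψ ξ ∂law ψ := by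
  rw [← h.integral_Qminus]
  simp only [mul_comm]

lemma integrable_Qminus_mul (h : NiceProfile α ψ) {q : ℕ}
    (hq : Integrable (fun ξ => bracket ξ ^ (q + 1)) (law ψ)) {g : E d → ℝ} (hg : Measurable g)
    {C : ℝ} (hC : ∀ ξ, |g ξ| ≤ C * bracket ξ ^ q) :
    Integrable fun ξ => Qminus ψ ψ ξ * g ξ := by
  have := (integrable_law_iff h.meas h.nonneg _).1 (h.integrable_mul_collFreq hq hg hC)
  refine this.congr (Eventually.of_forall fun ξ => ?_)
  simp only [Qminus]; ring

lemma integral_annih_mul (hd : 2 ≤ d) (h : NiceProfile α ψ) {q : ℕ}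
    (hq : Integrable (fun ξ => bracket ξ ^ (q + 1)) (law ψ)) {g : E d → ℝ} (hg : Measurable g)
    {C : ℝ} (hC : ∀ ξ, |g ξ| ≤ C * bracket ξ ^ q) :
    ∫ ξ, annih α ψ ξ * g ξ
      = (1 - α) * (∫ ξ, Qplus ψ ψ ξ * g ξ) - ∫ ξ, g ξ * collFreq ψ ξ ∂law ψ := by
  rw [← h.integral_Qminus_mul, ← integral_const_mul, ← integral_sub
    ((h.integrable_Qplus_mul hd hq hg hC (abs_le_mul_bracket_of_bounded hC)).const_mul _)
    (h.integrable_Qminus_mul hq hg hC)]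
  refine integral_congr_ae (Eventually.of_forall fun ξ => ?_)
  simp only [annih]; ring

/-- The weak formulation for test functions of polynomial growth. -/
theorem weak_growth (hd : 2 ≤ d) (h : NiceProfile α ψ) {q : ℕ}
    (hq : Integrable (fun ξ => bracket ξ ^ (q + 1)) (law ψ)) {φ : E d → ℝ}
    (hφ : ContDiff ℝ (⊤ : ℕ∞) φ) {C : ℝ} (hC : ∀ ξ, |φ ξ| ≤ C * bracket ξ ^ q)
    (hC' : ∀ ξ, |fderiv ℝ φ ξ ξ| ≤ C * bracket ξ ^ q) :
    ∫ ξ, φ ξ * collFreq ψ ξ ∂law ψ = (1 - α) * (∫ ξ, Qplus ψ ψ ξ * φ ξ)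
      + α * rateA ψ * (∫ ξ, φ ξ ∂law ψ) + coefB α ψ * ∫ ξ, fderiv ℝ φ ξ ξ ∂law ψ := by
  obtain ⟨χ, K, hK, hχs, hχc, hχ0, hχ1, hχK, hχlim⟩ := exists_cutoff d
  have hC0 := abs_le_mul_bracket_of_bounded hC
  have hq' := integrable_pow_of_le (Nat.le_succ q) hq
  have hφm : Measurable φ := hφ.continuous.measurable
  have hdm : Measurable fun ξ => fderiv ℝ φ ξ ξ :=
    ((hφ.continuous_fderiv (by simp)).clm_apply continuous_id).measurable
  have hχm : ∀ n, Measurable (χ n) := fun n => (hχs n).continuous.measurable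
  have hχdm : ∀ n, Measurable fun ξ => fderiv ℝ (χ n) ξ ξ := fun n =>
    (((hχs n).continuous_fderiv (by simp)).clm_apply continuous_id).measurable
  have hfd : ∀ n ξ, fderiv ℝ (fun x => φ x * χ n x) ξ ξ
      = φ ξ * fderiv ℝ (χ n) ξ ξ + χ n ξ * fderiv ℝ φ ξ ξ := by
    intro n ξ
    have h1 : HasFDerivAt (fun x => φ x * χ n x) _ ξ :=
      ((hφ.differentiable (by simp)) ξ).hasFDerivAt.mul
        (((hχs n).differentiable (by simp)) ξ).hasFDerivAt
    rw [h1.fderiv]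
    simp
  have hbd : ∀ n ξ, |φ ξ * χ n ξ| ≤ C * bracket ξ ^ q := by
    intro n ξ
    rw [abs_mul, abs_of_nonneg (hχ0 n ξ)]
    exact (mul_le_of_le_one_right (abs_nonneg _) (hχ1 n ξ)).trans (hC ξ)
  have hbd' : ∀ n ξ, |φ ξ * fderiv ℝ (χ n) ξ ξ + χ n ξ * fderiv ℝ φ ξ ξ|
      ≤ (C * K + C) * bracket ξ ^ q := by
    intro n ξ
    refine (abs_add_le _ _).trans ?_
    rw [abs_mul, abs_mul, abs_of_nonneg (hχ0 n ξ)]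
    have h1 : |φ ξ| * |fderiv ℝ (χ n) ξ ξ| ≤ C * bracket ξ ^ q * K :=
      mul_le_mul (hC ξ) (hχK n ξ) (abs_nonneg _) ((abs_nonneg _).trans (hC ξ))
    have h2 : χ n ξ * |fderiv ℝ φ ξ ξ| ≤ C * bracket ξ ^ q :=
      (mul_le_of_le_one_left (abs_nonneg _) (hχ1 n ξ)).trans (hC' ξ)
    linarith
  have heq : ∀ n, ∫ ξ, (φ ξ * χ n ξ) * collFreq ψ ξ ∂law ψ
      = (1 - α) * (∫ ξ, Qplus ψ ψ ξ * (φ ξ * χ n ξ))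
        + α * rateA ψ * (∫ ξ, φ ξ * χ n ξ ∂law ψ)
        + coefB α ψ * ∫ ξ, (φ ξ * fderiv ℝ (χ n) ξ ξ + χ n ξ * fderiv ℝ φ ξ ξ) ∂law ψ := by
    intro n
    have h1 := h.prof.solution (fun x => φ x * χ n x) (hφ.mul (hχs n)) (hχc n).mul_left
    have hm1 : Measurable fun ξ => φ ξ * χ n ξ := hφm.mul (hχm n)
    have hm2 : Measurable fun ξ => φ ξ * fderiv ℝ (χ n) ξ ξ + χ n ξ * fderiv ℝ φ ξ ξ :=
      (hφm.mul (hχdm n)).add ((hχm n).mul hdm)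
    rw [h.integral_annih_mul hd hq hm1 (hbd n)] at h1
    simp only [hfd] at h1
    -- Inserting `A = d B - α a` cancels the term `d B ∫ψφ`.
    rw [← integral_law h.meas h.nonneg, ← integral_law h.meas h.nonneg,
      integral_add ((integrable_of_le_bracket hq' hm1 (hbd n)).const_mul _)
        (integrable_of_le_bracket hq' hm2 (hbd' n)),
      integral_const_mul, h.coefA_eq hd] at h1
    linarith
  have t1 : Tendsto (fun n => ∫ ξ, (φ ξ * χ n ξ) * collFreq ψ ξ ∂law ψ) atTop
      (𝓝 (∫ ξ, φ ξ * collFreq ψ ξ ∂law ψ)) := by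
    refine tendsto_integral_of_dominated_convergence
      (fun ξ => (C * bracket ξ ^ q) * collFreq ψ ξ)
      (fun n => ((hφm.mul (hχm n)).mul h.measurable_collFreq).aestronglyMeasurable)
      (h.integrable_mul_collFreq hq (by fun_prop) (C := C) fun ξ => ?_)
      (fun n => Eventually.of_forall fun ξ => ?_) (Eventually.of_forall fun ξ => ?_)
    · rw [abs_of_nonneg (mul_nonneg hC0 (pow_nonneg (bracket_pos ξ).le _))]
    · rw [norm_mul, Real.norm_eq_abs, Real.norm_eq_abs, abs_of_nonneg (h.collFreq_nonneg ξ)]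
      exact mul_le_mul_of_nonneg_right (hbd n ξ) (h.collFreq_nonneg ξ)
    · refine tendsto_const_nhds.congr' ?_
      filter_upwards [hχlim ξ] with n hn
      rw [hn.1, mul_one]
  have t2 : Tendsto (fun n => ∫ ξ, Qplus ψ ψ ξ * (φ ξ * χ n ξ)) atTop
      (𝓝 (∫ ξ, Qplus ψ ψ ξ * φ ξ)) := by
    have hgm : Measurable (Qplus ψ ψ) := by
      have : Qplus ψ ψ = fun v => (gain ψ v).toReal :=
        funext fun v => Qplus_eq_toReal_gain h.meas h.nonneg v
      rw [this]; exact (measurable_gain h.meas).ennreal_toReal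
    have hQ0 : ∀ v, 0 ≤ Qplus ψ ψ v := fun v => by
      rw [Qplus_eq_toReal_gain h.meas h.nonneg]; exact ENNReal.toReal_nonneg
    refine tendsto_integral_of_dominated_convergence
      (fun ξ => Qplus ψ ψ ξ * (C * bracket ξ ^ q))
      (fun n => (hgm.mul (hφm.mul (hχm n))).aestronglyMeasurable)
      (h.integrable_Qplus_mul hd hq (by fun_prop) (C := C) (fun ξ => ?_) hC0)
      (fun n => Eventually.of_forall fun ξ => ?_) (Eventually.of_forall fun ξ => ?_)
    · rw [abs_of_nonneg (mul_nonneg hC0 (pow_nonneg (bracket_pos ξ).le _))]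
    · rw [norm_mul, Real.norm_eq_abs, Real.norm_eq_abs, abs_of_nonneg (hQ0 ξ)]
      exact mul_le_mul_of_nonneg_left (hbd n ξ) (hQ0 ξ)
    · refine tendsto_const_nhds.congr' ?_
      filter_upwards [hχlim ξ] with n hn
      rw [hn.1, mul_one]
  have t3 : Tendsto (fun n => ∫ ξ, φ ξ * χ n ξ ∂law ψ) atTop (𝓝 (∫ ξ, φ ξ ∂law ψ)) := by
    refine tendsto_integral_of_dominated_convergence (fun ξ => C * bracket ξ ^ q)
      (fun n => (hφm.mul (hχm n)).aestronglyMeasurable) (hq'.const_mul _)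
      (fun n => Eventually.of_forall fun ξ => hbd n ξ) (Eventually.of_forall fun ξ => ?_)
    refine tendsto_const_nhds.congr' ?_
    filter_upwards [hχlim ξ] with n hn
    rw [hn.1, mul_one]
  have t4 : Tendsto (fun n => ∫ ξ, (φ ξ * fderiv ℝ (χ n) ξ ξ + χ n ξ * fderiv ℝ φ ξ ξ) ∂law ψ)
      atTop (𝓝 (∫ ξ, fderiv ℝ φ ξ ξ ∂law ψ)) := by
    refine tendsto_integral_of_dominated_convergence (fun ξ => (C * K + C) * bracket ξ ^ q)
      (fun n => ((hφm.mul (hχdm n)).add ((hχm n).mul hdm)).aestronglyMeasurable)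
      (hq'.const_mul _)
      (fun n => Eventually.of_forall fun ξ => hbd' n ξ) (Eventually.of_forall fun ξ => ?_)
    refine tendsto_const_nhds.congr' ?_
    filter_upwards [hχlim ξ] with n hn
    rw [hn.1, hn.2, mul_zero, zero_add, one_mul]
  refine tendsto_nhds_unique t1 ?_
  simp only [heq]
  exact ((t2.const_mul _).add (t3.const_mul _)).add (t4.const_mul _)

end NiceProfile

/-! ### Povzner inequalities -/

lemma integral_sphere_isometry {d : ℕ} (hd : 2 ≤ d) (A : E d ≃ₗᵢ[ℝ] E d) {F : E d → ℝ}
    (hF : Measurable F) (h0 : ∀ x, 0 ≤ F x) :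
    ∫ σ : Sph d, F (A σ) ∂surf d = ∫ σ : Sph d, F σ ∂surf d := by
  have hA : Measurable fun σ : Sph d => F (A σ) :=
    hF.comp (A.continuous.measurable.comp measurable_coe_sph)
  rw [integral_eq_lintegral_of_nonneg_ae (Eventually.of_forall fun σ => h0 _)
      hA.aestronglyMeasurable,
    integral_eq_lintegral_of_nonneg_ae (Eventually.of_forall fun σ => h0 _)
      (hF.comp measurable_coe_sph).aestronglyMeasurable,
    lintegral_sphere_isometry hd A (F := fun x => ENNReal.ofReal (F x)) (by fun_prop)]

lemma integral_sphere_postStar {d : ℕ} (hd : 2 ≤ d) {φ : E d → ℝ} (hφ : Measurable φ)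
    (h0 : ∀ x, 0 ≤ φ x) (v w : E d) :
    ∫ σ : Sph d, φ (postStar v w σ) ∂surf d = ∫ σ : Sph d, φ (post v w σ) ∂surf d := by
  have := integral_sphere_isometry hd (LinearIsometryEquiv.neg ℝ)
    (F := fun x => φ ((1 / 2 : ℝ) • (v + w) + (‖v - w‖ / 2) • x)) (hφ.comp (by fun_prop))
    (fun x => h0 _)
  simpa [post, postStar, sub_eq_add_neg] using this

/-- The map `σ ↦ -σ` exchanges `v'` and `v'_*`, so both have the same average. Bounding the pair
allows energy conservation to be used. -/
lemma sphAvg_le_of_pair {d : ℕ} (hd : 2 ≤ d) {φ : E d → ℝ} (hφ : Measurable φ)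
    (h0 : ∀ x, 0 ≤ φ x) {C : ℝ} {q : ℕ} (hC : ∀ ξ, |φ ξ| ≤ C * bracket ξ ^ q) {v w : E d}
    {G : Sph d → ℝ} (hG : Integrable G (surf d))
    (hp : ∀ σ, φ (post v w σ) + φ (postStar v w σ) ≤ G σ) :
    2 * sphAvg φ v w ≤ (1 / sphereArea d) * ∫ σ, G σ ∂surf d := by
  have hi := integrable_post hφ hC v w
  have hi' : Integrable (fun σ : Sph d => φ (postStar v w σ)) (surf d) := by
    refine (hG.sub hi).mono' (hφ.comp (by fun_prop)).aestronglyMeasurable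
      (Eventually.of_forall fun σ => ?_)
    rw [Real.norm_eq_abs, abs_of_nonneg (h0 _)]
    simp only [Pi.sub_apply]
    linarith [hp σ]
  have h1 : (∫ σ : Sph d, φ (post v w σ) ∂surf d) + ∫ σ : Sph d, φ (postStar v w σ) ∂surf d
      ≤ ∫ σ, G σ ∂surf d := by
    rw [← integral_add hi hi']
    exact integral_mono (hi.add hi') hG hp
  rw [integral_sphere_postStar hd hφ h0] at h1
  have := sphereArea_pos hd
  unfold sphAvg
  calc _ = 1 / sphereArea d * ((∫ σ : Sph d, φ (post v w σ) ∂surf d)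
        + ∫ σ : Sph d, φ (post v w σ) ∂surf d) := by ring
    _ ≤ _ := mul_le_mul_of_nonneg_left h1 (by positivity)

/-- `√(⟨v⟩² + ⟨w⟩²)`. -/
def pairBracket {d : ℕ} (v w : E d) : ℝ := Real.sqrt (bracket v ^ 2 + bracket w ^ 2)

lemma pairBracket_sq {d : ℕ} (v w : E d) : pairBracket v w ^ 2 = bracket v ^ 2 + bracket w ^ 2 :=
  Real.sq_sqrt (by positivity)

lemma pairBracket_nonneg {d : ℕ} (v w : E d) : 0 ≤ pairBracket v w := Real.sqrt_nonneg _

lemma pairBracket_le_add {d : ℕ} (v w : E d) : pairBracket v w ≤ bracket v + bracket w := by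
  refine abs_le_of_sq_le_sq' ?_ ?_ |>.2
  · rw [pairBracket_sq]
    nlinarith [bracket_pos v, bracket_pos w, mul_pos (bracket_pos v) (bracket_pos w)]
  · exact add_nonneg (bracket_pos v).le (bracket_pos w).le

lemma bracket_le_pairBracket {d : ℕ} (v w : E d) : bracket v ≤ pairBracket v w :=
  Real.le_sqrt_of_sq_le (by nlinarith [sq_nonneg (bracket w)])

lemma pairBracket_comm {d : ℕ} (v w : E d) : pairBracket v w = pairBracket w v := by
  unfold pairBracket; rw [add_comm]

lemma bracket_post_sq_add {d : ℕ} (v w : E d) (σ : Sph d) :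
    bracket (post v w σ) ^ 2 + bracket (postStar v w σ) ^ 2 = pairBracket v w ^ 2 := by
  rw [pairBracket_sq, bracket_sq, bracket_sq, bracket_sq, bracket_sq, norm_sq_post,
    norm_sq_postStar]
  ring

/-- The pure powers must keep coefficient one so that the Povzner constant is not degraded. The
cross terms are of lower order in each variable, so the crude factor `3^(n+1)` is harmless. The
induction rearranges each product of cross terms into more unbalanced ones. -/
lemma add_pow_le_cross {x t : ℝ} (hx : 0 ≤ x) (ht : 0 ≤ t) (n : ℕ) :
    (x + t) ^ (n + 1) ≤ x ^ (n + 1) + t ^ (n + 1) + 3 ^ (n + 1) * (x ^ n * t + x * t ^ n) := by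
  have hre : ∀ m : ℕ, x ^ m * t + x * t ^ m ≤ x ^ (m + 1) + t ^ (m + 1) := by
    intro m
    rcases le_total x t with h | h
    · have := pow_le_pow_left₀ hx h m
      nlinarith [mul_nonneg (sub_nonneg.2 this) (sub_nonneg.2 h), pow_succ x m, pow_succ t m]
    · have := pow_le_pow_left₀ ht h m
      nlinarith [mul_nonneg (sub_nonneg.2 this) (sub_nonneg.2 h), pow_succ x m, pow_succ t m]
  rcases n with _ | n
  · simp only [zero_add, pow_one, pow_zero, one_mul, mul_one]; nlinarith
  induction n with
  | zero => norm_num; nlinarith [mul_nonneg hx ht]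
  | succ n ih =>
    have h3 : (0 : ℝ) < 3 ^ (n + 1 + 1) := by positivity
    have h4 : (1 : ℝ) ≤ 3 ^ (n + 1 + 1) := one_le_pow₀ (by norm_num)
    have hs := mul_le_mul_of_nonneg_left ih (add_nonneg hx ht)
    have hc := mul_le_mul_of_nonneg_left (hre n) (mul_nonneg hx ht)
    have e : x * t * (x ^ n * t + x * t ^ n) = x ^ (n + 1) * t ^ 2 + x ^ 2 * t ^ (n + 1) := by ring
    have e' : x * t * (x ^ (n + 1) + t ^ (n + 1)) = x ^ (n + 1 + 1) * t + x * t ^ (n + 1 + 1) := by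
      ring
    rw [e, e'] at hc
    have hS : 0 ≤ x ^ (n + 1 + 1) * t + x * t ^ (n + 1 + 1) := by positivity
    calc (x + t) ^ (n + 1 + 1 + 1) = (x + t) * (x + t) ^ (n + 1 + 1) := by ring
      _ ≤ _ := hs
      _ = x ^ (n + 1 + 1 + 1) + t ^ (n + 1 + 1 + 1)
        + (x ^ (n + 1 + 1) * t + x * t ^ (n + 1 + 1))
        + 3 ^ (n + 1 + 1) * ((x ^ (n + 1 + 1) * t + x * t ^ (n + 1 + 1))
          + (x ^ (n + 1) * t ^ 2 + x ^ 2 * t ^ (n + 1))) := by ring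
      _ ≤ x ^ (n + 1 + 1 + 1) + t ^ (n + 1 + 1 + 1)
        + 3 ^ (n + 1 + 1) * (x ^ (n + 1 + 1) * t + x * t ^ (n + 1 + 1))
        + 3 ^ (n + 1 + 1) * ((x ^ (n + 1 + 1) * t + x * t ^ (n + 1 + 1))
          + (x ^ (n + 1 + 1) * t + x * t ^ (n + 1 + 1))) := by
        gcongr
        exact le_mul_of_one_le_left hS h4
      _ = _ := by ring

lemma pairBracket_pow_le {d : ℕ} (v w : E d) (n : ℕ) :
    pairBracket v w ^ (n + 1) ≤ bracket v ^ (n + 1) + bracket w ^ (n + 1)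
      + 3 ^ (n + 1) * (bracket v ^ n * bracket w + bracket v * bracket w ^ n) :=
  (pow_le_pow_left₀ (pairBracket_nonneg v w) (pairBracket_le_add v w) _).trans
    (add_pow_le_cross (bracket_pos v).le (bracket_pos w).le n)

/-- The symmetric convex profile of the collision kernel. -/
def kerPov (t : ℝ) : ℝ := ((1 + t) / 2) ^ (3 / 2 : ℝ) + ((1 - t) / 2) ^ (3 / 2 : ℝ)

/-- For `|τ| ≤ s` the points `(1 ± τ)/2` are convex combinations of `(1 ± s)/2` with exchanged
weights, so convexity of `x^(3/2)` gives the claim on adding the two inequalities. -/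
lemma kerPov_mono {τ t : ℝ} (h : |τ| ≤ |t|) (ht : |t| ≤ 1) : kerPov τ ≤ kerPov t := by
  have key : ∀ s : ℝ, |τ| ≤ s → s ≤ 1 → kerPov τ ≤ kerPov s := by
    intro s hs hs1
    have h1 := abs_le.1 hs
    rcases eq_or_lt_of_le ((abs_nonneg τ).trans hs) with h0 | h0
    · have : τ = s := by rw [← h0] at h1 ⊢; linarith [h1.1, h1.2]
      rw [this]
    have hc := convexOn_rpow (p := 3 / 2) (by norm_num)
    have ha : 0 ≤ (τ + s) / (2 * s) := div_nonneg (by linarith) (by linarith)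
    have hb : 0 ≤ (s - τ) / (2 * s) := div_nonneg (by linarith) (by linarith)
    have hab : (τ + s) / (2 * s) + (s - τ) / (2 * s) = 1 := by field_simp; ring
    have hx : (1 + s) / 2 ∈ Set.Ici (0 : ℝ) := by rw [Set.mem_Ici]; linarith
    have hy : (1 - s) / 2 ∈ Set.Ici (0 : ℝ) := by rw [Set.mem_Ici]; linarith
    have c1 := hc.2 hx hy ha hb hab
    have c2 := hc.2 hy hx ha hb hab
    simp only [smul_eq_mul] at c1 c2
    have e1 : (τ + s) / (2 * s) * ((1 + s) / 2) + (s - τ) / (2 * s) * ((1 - s) / 2)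
        = (1 + τ) / 2 := by field_simp; ring
    have e2 : (τ + s) / (2 * s) * ((1 - s) / 2) + (s - τ) / (2 * s) * ((1 + s) / 2)
        = (1 - τ) / 2 := by field_simp; ring
    rw [e1] at c1
    rw [e2] at c2
    unfold kerPov
    calc _ ≤ _ := add_le_add c1 c2
      _ = ((τ + s) / (2 * s) + (s - τ) / (2 * s)) *
        (((1 + s) / 2) ^ (3 / 2 : ℝ) + ((1 - s) / 2) ^ (3 / 2 : ℝ)) := by ring
      _ = _ := by rw [hab, one_mul]
  have := key |t| h ht
  rcases abs_choice t with e | e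
  · rwa [e] at this
  · rw [e] at this
    refine this.trans (le_of_eq ?_)
    unfold kerPov
    rw [sub_neg_eq_add, add_comm, ← sub_eq_add_neg]

lemma kerPov_le_one {t : ℝ} (ht : |t| ≤ 1) : kerPov t ≤ 1 := by
  obtain ⟨h1, h2⟩ := abs_le.1 ht
  unfold kerPov
  have a1 := Real.rpow_le_rpow_of_exponent_ge' (x := (1 + t) / 2) (y := 3 / 2) (z := 1)
    (by linarith) (by linarith) (by norm_num) (by norm_num)
  have a2 := Real.rpow_le_rpow_of_exponent_ge' (x := (1 - t) / 2) (y := 3 / 2) (z := 1)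
    (by linarith) (by linarith) (by norm_num) (by norm_num)
  rw [Real.rpow_one] at a1 a2
  linarith

lemma kerPov_nonneg {t : ℝ} (ht : |t| ≤ 1) : 0 ≤ kerPov t := by
  obtain ⟨h1, h2⟩ := abs_le.1 ht
  exact add_nonneg (Real.rpow_nonneg (by linarith) _) (Real.rpow_nonneg (by linarith) _)

@[fun_prop]
lemma measurable_kerPov : Measurable kerPov := by
  unfold kerPov; fun_prop

lemma norm_unitVec {d : ℕ} (hd : 2 ≤ d) : ‖unitVec d‖ = 1 := by
  have : NeZero d := ⟨by omega⟩
  have : unitVec d = EuclideanSpace.single (0 : Fin d) (1 : ℝ) := by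
    ext i
    change (if (i : ℕ) = 0 then (1 : ℝ) else 0) = _
    rw [PiLp.single_apply]
    exact if_congr (by rw [Fin.ext_iff]; rfl) rfl rfl
  rw [this]
  simp

lemma abs_inner_sph_le {d : ℕ} {e : E d} (he : ‖e‖ = 1) (σ : Sph d) :
    |inner ℝ e (σ : E d)| ≤ 1 := by
  have := abs_real_inner_le_norm e (σ : E d)
  rwa [he, norm_sph, one_mul] at this

lemma integrable_kerPov {d : ℕ} {e : E d} (he : ‖e‖ = 1) :
    Integrable (fun σ : Sph d => kerPov (inner ℝ e (σ : E d))) (surf d) := by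
  refine (integrable_const (1 : ℝ)).mono' (Measurable.aestronglyMeasurable (by fun_prop))
    (Eventually.of_forall fun σ => ?_)
  rw [Real.norm_eq_abs, abs_of_nonneg (kerPov_nonneg (abs_inner_sph_le he σ))]
  exact kerPov_le_one (abs_inner_sph_le he σ)

lemma varrho_eq {d : ℕ} (hd : 2 ≤ d) {e : E d} (he : ‖e‖ = 1) :
    varrho d (3 / 2) = (1 / sphereArea d) * ∫ σ : Sph d, kerPov (inner ℝ e (σ : E d)) ∂surf d := by
  obtain ⟨A, hA⟩ := exists_isometry_unit hd he (norm_unitVec hd)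
  -- The absolute value is needed because the invariance lemma requires nonnegativity on the whole
  -- space, and it disappears on the sphere.
  have := integral_sphere_isometry hd A
    (F := fun x => |kerPov (inner ℝ (unitVec d) x)|) (by fun_prop) (fun x => abs_nonneg _)
  have e1 : ∀ x : E d, inner ℝ (unitVec d) (A x) = inner ℝ e x := fun x => by
    rw [← hA, A.inner_map_map]
  simp only [e1] at this
  have e2 : ∀ σ : Sph d, |kerPov (inner ℝ e (σ : E d))| = kerPov (inner ℝ e (σ : E d)) :=
    fun σ => abs_of_nonneg (kerPov_nonneg (abs_inner_sph_le he σ))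
  have e3 : ∀ σ : Sph d, |kerPov (inner ℝ (unitVec d) (σ : E d))|
      = kerPov (inner ℝ (unitVec d) (σ : E d)) :=
    fun σ => abs_of_nonneg (kerPov_nonneg (abs_inner_sph_le (norm_unitVec hd) σ))
  simp only [e2, e3] at this
  rw [this]
  rfl

lemma varrho_le_one {d : ℕ} (hd : 2 ≤ d) : varrho d (3 / 2) ≤ 1 := by
  have hp := sphereArea_pos hd
  rw [varrho_eq hd (norm_unitVec hd)]
  have : ∫ σ : Sph d, kerPov (inner ℝ (unitVec d) (σ : E d)) ∂surf d ≤ ∫ _ : Sph d, 1 ∂surf d :=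
    integral_mono (integrable_kerPov (norm_unitVec hd)) (integrable_const _)
      fun σ => kerPov_le_one (abs_inner_sph_le (norm_unitVec hd) σ)
  rw [integral_const, smul_eq_mul, mul_one] at this
  change _ ≤ sphereArea d at this
  rw [one_div, inv_mul_le_iff₀ hp, mul_one]
  exact this

lemma varrho_nonneg {d : ℕ} (hd : 2 ≤ d) : 0 ≤ varrho d (3 / 2) := by
  have hp := sphereArea_pos hd
  rw [varrho_eq hd (norm_unitVec hd)]
  exact mul_nonneg (by positivity) (integral_nonneg fun σ =>
    kerPov_nonneg (abs_inner_sph_le (norm_unitVec hd) σ))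

/-- Here `τ` is the fraction of the total squared bracket carried by one particle. Since `τ ≤ 1`, a
power `q ≥ 3` costs at most `τ^(3/2)`, so the constant `ϱ_{3/2}` serves all the moments. -/
lemma pow_le_rpow_three_half {X s τ : ℝ} (hX : 0 ≤ X) (hs : 0 ≤ s) (hτ0 : 0 ≤ τ) (hτ1 : τ ≤ 1)
    (h : s ^ 2 = X ^ 2 * τ) {q : ℕ} (hq : 3 ≤ q) : s ^ q ≤ X ^ q * τ ^ (3 / 2 : ℝ) := by
  have hs' : s = X * Real.sqrt τ := by
    refine (pow_left_inj₀ hs (mul_nonneg hX (Real.sqrt_nonneg _)) two_ne_zero).1 ?_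
    rw [mul_pow, Real.sq_sqrt hτ0, h]
  have e : τ ^ (3 / 2 : ℝ) = Real.sqrt τ ^ 3 := by
    rw [Real.sqrt_eq_rpow, ← Real.rpow_natCast, ← Real.rpow_mul hτ0]
    norm_num
  rw [hs', mul_pow, e]
  exact mul_le_mul_of_nonneg_left (pow_le_pow_of_le_one (Real.sqrt_nonneg _)
    (Real.sqrt_le_one.2 hτ1) hq) (pow_nonneg hX _)

/-- A Povzner inequality for powers of the bracket. -/
theorem sphAvg_bracket_pow_le {d : ℕ} (hd : 2 ≤ d) {q : ℕ} (hq : 3 ≤ q) (v w : E d) :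
    2 * sphAvg (fun ξ => bracket ξ ^ q) v w ≤ varrho d (3 / 2) * pairBracket v w ^ q := by
  obtain ⟨e, he, hce⟩ : ∃ e : E d, ‖e‖ = 1 ∧ v + w = ‖v + w‖ • e := by
    by_cases hc : v + w = 0
    · exact ⟨unitVec d, norm_unitVec hd, by simp [hc]⟩
    · refine ⟨‖v + w‖⁻¹ • (v + w), ?_, ?_⟩
      · rw [norm_smul, norm_inv, norm_norm, inv_mul_cancel₀ (norm_ne_zero_iff.2 hc)]
      · rw [smul_smul, mul_inv_cancel₀ (norm_ne_zero_iff.2 hc), one_smul]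
  set X := pairBracket v w with hX
  have hX0 : 0 ≤ X := pairBracket_nonneg v w
  have hX2 : X ^ 2 = 2 + (‖v + w‖ ^ 2 + ‖v - w‖ ^ 2) / 2 := by
    rw [hX, pairBracket_sq, bracket_sq, bracket_sq]
    have := parallelogram_law_with_norm ℝ v w
    nlinarith
  have hXpos : 0 < X ^ 2 := by rw [hX2]; positivity
  have hpair : ∀ σ : Sph d, bracket (post v w σ) ^ q + bracket (postStar v w σ) ^ q
      ≤ X ^ q * kerPov (inner ℝ e (σ : E d)) := by
    intro σ
    -- Chosen so that the two outgoing squared brackets are `X²(1 ± τ)/2`. As `X² ≥ |v - w||v + w|`,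
    -- monotonicity of `kerPov` replaces `τ` by `e·σ`.
    set τ : ℝ := ‖v - w‖ * ‖v + w‖ * inner ℝ e (σ : E d) / X ^ 2 with hτ
    have hin := abs_inner_sph_le he σ
    have hτe : |τ| ≤ |inner ℝ e (σ : E d)| := by
      rw [hτ, abs_div, abs_mul, abs_of_pos hXpos, abs_of_nonneg (by positivity),
        div_le_iff₀ hXpos, mul_comm]
      refine mul_le_mul_of_nonneg_left ?_ (abs_nonneg _)
      nlinarith [sq_nonneg (‖v - w‖ - ‖v + w‖)]
    have hτ1 := abs_le.1 (hτe.trans hin)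
    have hin2 : inner ℝ (v + w) (σ : E d) = ‖v + w‖ * inner ℝ e (σ : E d) := by
      conv_lhs => rw [hce]
      rw [real_inner_smul_left]
    have h1 : bracket (post v w σ) ^ 2 = X ^ 2 * ((1 + τ) / 2) := by
      rw [bracket_sq, norm_sq_post, hin2, hτ]
      have h2 : X ^ 2 = 2 + ‖v‖ ^ 2 + ‖w‖ ^ 2 := by
        rw [hX, pairBracket_sq, bracket_sq, bracket_sq]; ring
      have h3 : X ^ 2 * ((1 + ‖v - w‖ * ‖v + w‖ * inner ℝ e (σ : E d) / X ^ 2) / 2)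
          = (X ^ 2 + ‖v - w‖ * ‖v + w‖ * inner ℝ e (σ : E d)) / 2 := by
        rw [← mul_div_assoc, mul_add, mul_one, mul_div_cancel₀ _ hXpos.ne']
      rw [h3, h2]; ring
    have h2 : bracket (postStar v w σ) ^ 2 = X ^ 2 * ((1 - τ) / 2) := by
      have := bracket_post_sq_add v w σ
      rw [← hX] at this
      linarith
    have b1 := pow_le_rpow_three_half hX0 (bracket_pos (post v w σ)).le (by linarith)
      (by linarith) h1 hq
    have b2 := pow_le_rpow_three_half hX0 (bracket_pos (postStar v w σ)).le (by linarith)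
      (by linarith) h2 hq
    calc _ ≤ X ^ q * kerPov τ := by
          unfold kerPov; rw [mul_add]; exact add_le_add b1 b2
      _ ≤ _ := mul_le_mul_of_nonneg_left (kerPov_mono hτe hin) (pow_nonneg hX0 _)
  refine (sphAvg_le_of_pair hd (φ := fun ξ => bracket ξ ^ q) (by fun_prop)
    (fun ξ => pow_nonneg (bracket_pos ξ).le _) (C := 1) (q := q) (fun ξ => ?_)
    ((integrable_kerPov he).const_mul (X ^ q)) hpair).trans (le_of_eq ?_)
  · rw [abs_of_nonneg (pow_nonneg (bracket_pos ξ).le _), one_mul]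
  · rw [integral_const_mul, varrho_eq hd he]; ring

/-! ### Radial derivatives and truncated powers of the bracket -/

/-- The moment `∫ ψ ⟨ξ⟩^q`. -/
def moment {d : ℕ} (ψ : E d → ℝ) (q : ℕ) : ℝ := ∫ ξ, bracket ξ ^ q ∂law ψ

lemma fderiv_radial {d : ℕ} {F : ℝ → ℝ} {F' : ℝ} {ξ : E d} (hF : HasDerivAt F F' (‖ξ‖ ^ 2)) :
    fderiv ℝ (fun x : E d => F (‖x‖ ^ 2)) ξ ξ = F' * (2 * ‖ξ‖ ^ 2) := by
  have h1 : HasFDerivAt (fun x : E d => ‖x‖ ^ 2) (2 • innerSL ℝ ξ) ξ :=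
    (hasStrictFDerivAt_norm_sq ξ).hasFDerivAt
  have h2 : HasFDerivAt (fun x : E d => F (‖x‖ ^ 2)) _ ξ := hF.comp_hasFDerivAt ξ h1
  rw [h2.fderiv]
  simp

lemma contDiff_bracket {d : ℕ} : ContDiff ℝ (⊤ : ℕ∞) (fun ξ : E d => bracket ξ) := by
  unfold bracket
  refine ContDiff.sqrt (contDiff_const.add (contDiff_norm_sq ℝ)) fun ξ => ?_
  positivity

lemma fderiv_bracket_pow {d : ℕ} (n : ℕ) (ξ : E d) :
    fderiv ℝ (fun x : E d => bracket x ^ (n + 1)) ξ ξ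
      = (n + 1) * bracket ξ ^ n * (‖ξ‖ ^ 2 / bracket ξ) := by
  have h0 : (1 : ℝ) + ‖ξ‖ ^ 2 ≠ 0 := by positivity
  have h1 : HasDerivAt (fun s : ℝ => Real.sqrt (1 + s)) (1 / (2 * Real.sqrt (1 + ‖ξ‖ ^ 2)))
      (‖ξ‖ ^ 2) := ((hasDerivAt_id _).const_add 1).sqrt h0
  have h2 := fderiv_radial (ξ := ξ) (h1.pow (n + 1))
  have h3 : fderiv ℝ (fun x : E d => bracket x ^ (n + 1)) ξ ξ
    = fderiv ℝ (fun x : E d => ((fun s : ℝ => Real.sqrt (1 + s)) ^ (n + 1)) (‖x‖ ^ 2)) ξ ξ := rfl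
  rw [h3, h2]
  have hb : Real.sqrt (1 + ‖ξ‖ ^ 2) = bracket ξ := rfl
  have := bracket_pos ξ
  simp only [hb]
  push_cast
  field_simp

/-- A truncated power of the bracket. -/
def truncPow {d : ℕ} (ε : ℝ) (n : ℕ) (ξ : E d) : ℝ :=
  bracket ξ ^ (n + 1) * (Real.sqrt (1 + ε * bracket ξ ^ 2))⁻¹

section truncPow

variable {d : ℕ} {ε : ℝ}

lemma truncPow_nonneg (n : ℕ) (ξ : E d) : 0 ≤ truncPow ε n ξ :=
  mul_nonneg (pow_nonneg (bracket_pos ξ).le _) (inv_nonneg.2 (Real.sqrt_nonneg _))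

@[fun_prop]
lemma measurable_truncPow (n : ℕ) : Measurable fun ξ : E d => truncPow ε n ξ := by
  unfold truncPow; fun_prop

lemma truncPow_le_pow (hε : 0 ≤ ε) (n : ℕ) (ξ : E d) : truncPow ε n ξ ≤ bracket ξ ^ (n + 1) := by
  refine mul_le_of_le_one_right (pow_nonneg (bracket_pos ξ).le _) (inv_le_one_of_one_le₀ ?_)
  rw [Real.one_le_sqrt]
  nlinarith [mul_nonneg hε (sq_nonneg (bracket ξ))]

/-- For fixed `ε` the truncation grows with one power less, which makes it an admissible test
function when only the lower moment is known. -/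
lemma truncPow_le (hε : 0 < ε) (n : ℕ) (ξ : E d) :
    truncPow ε n ξ ≤ (Real.sqrt ε)⁻¹ * bracket ξ ^ n := by
  have hb := bracket_pos ξ
  have hs : Real.sqrt ε * bracket ξ ≤ Real.sqrt (1 + ε * bracket ξ ^ 2) := by
    refine Real.le_sqrt_of_sq_le ?_
    rw [mul_pow, Real.sq_sqrt hε.le]; linarith
  have hs0 : 0 < Real.sqrt ε * bracket ξ := mul_pos (Real.sqrt_pos.2 hε) hb
  have := inv_anti₀ hs0 hs
  calc _ ≤ bracket ξ ^ (n + 1) * (Real.sqrt ε * bracket ξ)⁻¹ :=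
        mul_le_mul_of_nonneg_left this (pow_nonneg hb.le _)
    _ = _ := by
        rw [mul_inv, pow_succ]; field_simp

lemma contDiff_truncPow (hε : 0 ≤ ε) (n : ℕ) :
    ContDiff ℝ (⊤ : ℕ∞) (fun ξ : E d => truncPow ε n ξ) := by
  unfold truncPow
  have h1 : ∀ ξ : E d, 0 < 1 + ε * bracket ξ ^ 2 := fun ξ => by
    have := mul_nonneg hε (sq_nonneg (bracket ξ)); linarith
  exact (contDiff_bracket.pow _).mul (((contDiff_const.add
    (contDiff_const.mul (contDiff_bracket.pow 2))).sqrt fun ξ => (h1 ξ).ne').inv fun ξ =>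
      (Real.sqrt_pos.2 (h1 ξ)).ne')

/-- The logarithmic radial derivative is a difference of two bounded fractions, so the constant does
not depend on `ε`. -/
lemma abs_fderiv_truncPow_le (hε : 0 ≤ ε) (n : ℕ) (ξ : E d) :
    |fderiv ℝ (fun x : E d => truncPow ε n x) ξ ξ| ≤ (n + 2) * truncPow ε n ξ := by
  have hs : 0 ≤ ‖ξ‖ ^ 2 := sq_nonneg _
  have h0 : (0 : ℝ) < 1 + ‖ξ‖ ^ 2 := by positivity
  have h0' : 0 < 1 + ε * (1 + ‖ξ‖ ^ 2) := by positivity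
  have h1 : HasDerivAt (fun s : ℝ => Real.sqrt (1 + s)) (1 / (2 * Real.sqrt (1 + ‖ξ‖ ^ 2)))
      (‖ξ‖ ^ 2) := ((hasDerivAt_id _).const_add 1).sqrt h0.ne'
  have h2 : HasDerivAt (fun s : ℝ => Real.sqrt (1 + ε * (1 + s)))
      ((ε * 1) / (2 * Real.sqrt (1 + ε * (1 + ‖ξ‖ ^ 2)))) (‖ξ‖ ^ 2) :=
    ((((hasDerivAt_id _).const_add 1).const_mul ε).const_add 1).sqrt h0'.ne'
  have hq := Real.sqrt_pos.2 h0'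
  have hb : Real.sqrt (1 + ‖ξ‖ ^ 2) = bracket ξ := rfl
  have h3 := fderiv_radial (ξ := ξ) ((h1.pow (n + 1)).mul (h2.inv hq.ne'))
  have h4 : fderiv ℝ (fun x : E d => truncPow ε n x) ξ ξ
      = fderiv ℝ (fun x : E d => ((fun s : ℝ => Real.sqrt (1 + s)) ^ (n + 1)
        * (fun s : ℝ => Real.sqrt (1 + ε * (1 + s)))⁻¹) (‖x‖ ^ 2)) ξ ξ := by
    congr 1
    congr 1
    funext x
    simp only [truncPow, bracket_sq]
    rfl
  have hbp := bracket_pos ξ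
  set q := Real.sqrt (1 + ε * (1 + ‖ξ‖ ^ 2)) with hqd
  have hq2 : q ^ 2 = 1 + ε * (1 + ‖ξ‖ ^ 2) := Real.sq_sqrt h0'.le
  have hb2 := bracket_sq ξ
  have h5 : fderiv ℝ (fun x : E d => truncPow ε n x) ξ ξ
      = ((n + 1) * (‖ξ‖ ^ 2 / bracket ξ ^ 2) - ε * ‖ξ‖ ^ 2 / q ^ 2) * truncPow ε n ξ := by
    rw [h4, h3]
    simp only [truncPow, hb2, ← hqd, hb, Pi.pow_apply, Pi.inv_apply, Nat.add_sub_cancel]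
    rw [← hb2]
    push_cast
    field_simp
    ring
  rw [h5, abs_mul, abs_of_nonneg (truncPow_nonneg n ξ)]
  refine mul_le_mul_of_nonneg_right ?_ (truncPow_nonneg n ξ)
  have e1 : ‖ξ‖ ^ 2 / bracket ξ ^ 2 ≤ 1 := by
    rw [div_le_one (by positivity), hb2]; linarith
  have e1' : 0 ≤ ‖ξ‖ ^ 2 / bracket ξ ^ 2 := by positivity
  have e2 : ε * ‖ξ‖ ^ 2 / q ^ 2 ≤ 1 := by
    rw [div_le_one (by positivity), hq2]; nlinarith
  have e2' : 0 ≤ ε * ‖ξ‖ ^ 2 / q ^ 2 := by positivity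
  have hn : (0 : ℝ) ≤ n := Nat.cast_nonneg n
  rw [abs_le]
  constructor <;> nlinarith

/-- The Povzner inequality without gain, for truncated powers. -/
lemma sphAvg_truncPow_le (hd : 2 ≤ d) (hε : 0 < ε) (m : ℕ) (v w : E d) :
    2 * sphAvg (truncPow ε (m + 2)) v w ≤ 1 * (truncPow ε (m + 2) v + truncPow ε (m + 2) w)
      + 3 ^ (m + 3) * (bracket v ^ (m + 2) * bracket w + bracket v * bracket w ^ (m + 2)) := by
  set X := pairBracket v w with hX
  have hX2 : X ^ 2 = bracket v ^ 2 + bracket w ^ 2 := pairBracket_sq v w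
  have hX0 : 0 < X := lt_of_lt_of_le (bracket_pos v) (bracket_le_pairBracket v w)
  -- Since `s/√(1 + ε s²)` increases, everything except a factor `s²` is evaluated at `X`. The two
  -- factors `s²` then add up to `X²` by energy conservation.
  have hmono : ∀ s : ℝ, 0 < s → s ≤ X →
      s ^ (m + 3) * (Real.sqrt (1 + ε * s ^ 2))⁻¹
        ≤ s ^ 2 * (X ^ (m + 1) * (Real.sqrt (1 + ε * X ^ 2))⁻¹) := by
    intro s hs hsX
    have h1 : 0 < Real.sqrt (1 + ε * s ^ 2) := Real.sqrt_pos.2 (by positivity)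
    have h2 : 0 < Real.sqrt (1 + ε * X ^ 2) := Real.sqrt_pos.2 (by positivity)
    have h3 : s * Real.sqrt (1 + ε * X ^ 2) ≤ X * Real.sqrt (1 + ε * s ^ 2) := by
      refine abs_le_of_sq_le_sq' ?_ (by positivity) |>.2
      rw [mul_pow, mul_pow, Real.sq_sqrt (by positivity), Real.sq_sqrt (by positivity)]
      have := pow_le_pow_left₀ hs.le hsX 2
      nlinarith
    have h4 : s * (Real.sqrt (1 + ε * s ^ 2))⁻¹ ≤ X * (Real.sqrt (1 + ε * X ^ 2))⁻¹ := by
      rw [← div_eq_mul_inv, ← div_eq_mul_inv, div_le_div_iff₀ h1 h2]; exact h3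
    calc _ = s ^ 2 * (s ^ m * (s * (Real.sqrt (1 + ε * s ^ 2))⁻¹)) := by ring
      _ ≤ s ^ 2 * (X ^ m * (X * (Real.sqrt (1 + ε * X ^ 2))⁻¹)) := by gcongr
      _ = _ := by ring
  have hpair : ∀ σ : Sph d, truncPow ε (m + 2) (post v w σ) + truncPow ε (m + 2) (postStar v w σ)
      ≤ X ^ (m + 3) * (Real.sqrt (1 + ε * X ^ 2))⁻¹ := by
    intro σ
    have hs := bracket_post_sq_add v w σ
    rw [← hX] at hs
    have b1 : bracket (post v w σ) ≤ X :=
      abs_le_of_sq_le_sq' (by nlinarith [sq_nonneg (bracket (postStar v w σ))]) hX0.le |>.2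
    have b2 : bracket (postStar v w σ) ≤ X :=
      abs_le_of_sq_le_sq' (by nlinarith [sq_nonneg (bracket (post v w σ))]) hX0.le |>.2
    refine (add_le_add (hmono _ (bracket_pos _) b1) (hmono _ (bracket_pos _) b2)).trans
      (le_of_eq ?_)
    rw [← add_mul, hs]; ring
  have h1 := sphAvg_le_of_pair hd (φ := truncPow ε (m + 2)) (by fun_prop)
    (truncPow_nonneg _) (C := 1) (q := m + 3)
    (fun ξ => by rw [abs_of_nonneg (truncPow_nonneg _ _), one_mul]; exact truncPow_le_pow hε.le _ ξ)
    (integrable_const _) hpair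
  have h2 : (1 / sphereArea d) * ∫ _ : Sph d, X ^ (m + 3) * (Real.sqrt (1 + ε * X ^ 2))⁻¹ ∂surf d
      = X ^ (m + 3) * (Real.sqrt (1 + ε * X ^ 2))⁻¹ :=
    sphAvg_const hd (X ^ (m + 3) * (Real.sqrt (1 + ε * X ^ 2))⁻¹) v w
  rw [h2] at h1
  have hi : ∀ s : ℝ, 0 < s → s ≤ X →
      s ^ (m + 3) * (Real.sqrt (1 + ε * X ^ 2))⁻¹ ≤ s ^ (m + 3) * (Real.sqrt (1 + ε * s ^ 2))⁻¹ := by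
    intro s hs hsX
    have h1 : 0 < Real.sqrt (1 + ε * s ^ 2) := Real.sqrt_pos.2 (by positivity)
    gcongr
  have hle1 : (Real.sqrt (1 + ε * X ^ 2))⁻¹ ≤ 1 := by
    refine inv_le_one_of_one_le₀ ?_
    rw [Real.one_le_sqrt]; nlinarith [mul_pos hε (pow_pos hX0 2)]
  have hinv0 : 0 ≤ (Real.sqrt (1 + ε * X ^ 2))⁻¹ := by positivity
  have hcr : 0 ≤ 3 ^ (m + 3) *
      (bracket v ^ (m + 2) * bracket w + bracket v * bracket w ^ (m + 2)) := by
    have := bracket_pos v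
    have := bracket_pos w
    positivity
  calc _ ≤ _ := h1
    _ ≤ (bracket v ^ (m + 3) + bracket w ^ (m + 3) + 3 ^ (m + 3) *
      (bracket v ^ (m + 2) * bracket w + bracket v * bracket w ^ (m + 2)))
        * (Real.sqrt (1 + ε * X ^ 2))⁻¹ :=
      mul_le_mul_of_nonneg_right (pairBracket_pow_le v w (m + 2)) hinv0
    _ = bracket v ^ (m + 3) * (Real.sqrt (1 + ε * X ^ 2))⁻¹
      + bracket w ^ (m + 3) * (Real.sqrt (1 + ε * X ^ 2))⁻¹
      + 3 ^ (m + 3) * (bracket v ^ (m + 2) * bracket w + bracket v * bracket w ^ (m + 2))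
        * (Real.sqrt (1 + ε * X ^ 2))⁻¹ := by ring
    _ ≤ _ := by
      rw [one_mul]
      refine add_le_add (add_le_add (hi _ (bracket_pos v) (bracket_le_pairBracket v w))
        (hi _ (bracket_pos w) ?_)) (mul_le_of_le_one_right hcr hle1)
      rw [hX, pairBracket_comm]
      exact bracket_le_pairBracket w v

end truncPow

/-! ### The moment inequality -/

namespace NiceProfile

variable {d : ℕ} {α : ℝ} {ψ : E d → ℝ}

lemma integrable_norm_law (h : NiceProfile α ψ) : Integrable (fun ξ => ‖ξ‖) (law ψ) :=
  integrable_of_le_bracket (q := 1) (by simpa using h.integrable_bracket) (by fun_prop)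
    (C := 1) fun ξ => by
      rw [abs_of_nonneg (norm_nonneg _), one_mul, pow_one]; exact norm_le_bracket ξ

lemma integral_id_law (h : NiceProfile α ψ) : ∫ ξ, ξ ∂law ψ = 0 := by
  have hm := h.meas
  unfold law
  rw [integral_withDensity_eq_integral_toReal_smul (by fun_prop) (by simp)]
  simp only [ENNReal.toReal_ofReal (h.nonneg _)]
  exact h.prof.momentum

/-- Jensen's inequality: with zero momentum the mean of `v - w` is `v`. -/
lemma norm_le_collFreq (h : NiceProfile α ψ) (v : E d) : ‖v‖ ≤ collFreq ψ v := by
  have := h.isProbabilityMeasure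
  have hid : Integrable (fun w : E d => w) (law ψ) :=
    (integrable_norm_iff (by fun_prop)).1 h.integrable_norm_law
  have h1 : ∫ w, (v - w) ∂law ψ = v := by
    rw [integral_sub (integrable_const _) hid, h.integral_id_law]
    simp
  calc ‖v‖ = ‖∫ w, (v - w) ∂law ψ‖ := by rw [h1]
    _ ≤ ∫ w, ‖v - w‖ ∂law ψ := norm_integral_le_integral_norm _
    _ = _ := (h.collFreq_eq v).symm

lemma integrable_prod_rate (h : NiceProfile α ψ) {q : ℕ}
    (hq : Integrable (fun ξ => bracket ξ ^ (q + 1)) (law ψ)) {g : E d → ℝ} (hg : Measurable g)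
    {C : ℝ} (hC : ∀ ξ, |g ξ| ≤ C * bracket ξ ^ q) :
    Integrable (fun x : E d × E d => ‖x.1 - x.2‖ * g x.1) ((law ψ).prod (law ψ)) := by
  have h1 : Integrable (fun ξ => bracket ξ ^ 1) (law ψ) := by simpa using h.integrable_bracket
  refine ((h.integrable_prod_bracket hq h1).const_mul (2 * C)).mono'
    (Measurable.aestronglyMeasurable (by fun_prop)) (Eventually.of_forall fun x => ?_)
  rw [norm_mul, norm_norm, Real.norm_eq_abs]
  have hb := bracket_pos x.1
  have hb' := bracket_pos x.2
  calc _ ≤ (2 * (bracket x.1 * bracket x.2)) * (C * bracket x.1 ^ q) :=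
        mul_le_mul (norm_sub_le_bracket_mul _ _) (hC _) (abs_nonneg _) (by positivity)
    _ = _ := by ring

lemma integral_prod_rate (h : NiceProfile α ψ) {q : ℕ}
    (hq : Integrable (fun ξ => bracket ξ ^ (q + 1)) (law ψ)) {g : E d → ℝ} (hg : Measurable g)
    {C : ℝ} (hC : ∀ ξ, |g ξ| ≤ C * bracket ξ ^ q) :
    ∫ x : E d × E d, ‖x.1 - x.2‖ * g x.1 ∂(law ψ).prod (law ψ)
      = ∫ v, g v * collFreq ψ v ∂law ψ := by
  have := h.isProbabilityMeasure
  rw [integral_prod _ (h.integrable_prod_rate hq hg hC)]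
  refine integral_congr_ae (Eventually.of_forall fun v => ?_)
  dsimp only
  rw [integral_mul_const, h.collFreq_eq, mul_comm]

lemma integral_prod_rate_swap (h : NiceProfile α ψ) (g : E d × E d → ℝ) :
    ∫ x : E d × E d, ‖x.1 - x.2‖ * g x.swap ∂(law ψ).prod (law ψ)
      = ∫ x : E d × E d, ‖x.1 - x.2‖ * g x ∂(law ψ).prod (law ψ) := by
  have := h.isProbabilityMeasure
  rw [← integral_prod_swap]
  simp only [Prod.fst_swap, Prod.snd_swap, Prod.swap_swap]
  refine integral_congr_ae (Eventually.of_forall fun v => ?_)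
  dsimp only
  rw [norm_sub_rev]

lemma integrable_prod_rate_swap (h : NiceProfile α ψ) {g : E d × E d → ℝ}
    (hg : Integrable (fun x : E d × E d => ‖x.1 - x.2‖ * g x) ((law ψ).prod (law ψ))) :
    Integrable (fun x : E d × E d => ‖x.1 - x.2‖ * g x.swap) ((law ψ).prod (law ψ)) := by
  have := h.isProbabilityMeasure
  refine hg.swap.congr (Eventually.of_forall fun x => ?_)
  simp only [Function.comp, Prod.fst_swap, Prod.snd_swap]
  rw [norm_sub_rev]

/-- The moment inequality deduced from a Povzner estimate. -/
theorem moment_inequality (hd : 2 ≤ d) (h : NiceProfile α ψ) (hα0 : 0 ≤ α) (hα1 : α ≤ 1)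
    {p n : ℕ} (hp : Integrable (fun ξ => bracket ξ ^ (p + 1)) (law ψ))
    (hn : Integrable (fun ξ => bracket ξ ^ (n + 1)) (law ψ)) {φ : E d → ℝ}
    (hφ : ContDiff ℝ (⊤ : ℕ∞) φ) (h0 : ∀ ξ, 0 ≤ φ ξ) {C : ℝ}
    (hC : ∀ ξ, |φ ξ| ≤ C * bracket ξ ^ p) (hC' : ∀ ξ, |fderiv ℝ φ ξ ξ| ≤ C * bracket ξ ^ p)
    {ρ c : ℝ} (hc : 0 ≤ c)
    (hpov : ∀ v w : E d, 2 * sphAvg φ v w ≤ ρ * (φ v + φ w)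
      + c * (bracket v ^ n * bracket w + bracket v * bracket w ^ n)) :
    (1 - (1 - α) * ρ) * ∫ ξ, φ ξ * collFreq ψ ξ ∂law ψ
      ≤ c * (moment ψ (n + 1) * moment ψ 1 + moment ψ n * moment ψ 2)
        + α * rateA ψ * (∫ ξ, φ ξ ∂law ψ) + coefB α ψ * ∫ ξ, fderiv ℝ φ ξ ξ ∂law ψ := by
  have hP := h.isProbabilityMeasure
  have hφm : Measurable φ := hφ.continuous.measurable
  have hC0 := abs_le_mul_bracket_of_bounded hC
  have hweak := h.weak_growth hd hp hφ hC hC'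
  rw [h.integral_Qplus_mul hd hp hφm h0 hC hC0] at hweak
  have i0 := h.integrable_rate_sphAvg hd hp hφm h0 hC hC0
  have i1 := h.integrable_prod_rate hp hφm hC
  have i1' : Integrable (fun x : E d × E d => ‖x.1 - x.2‖ * φ x.2) ((law ψ).prod (law ψ)) :=
    h.integrable_prod_rate_swap (g := fun x => φ x.1) i1
  have e1 := h.integral_prod_rate hp hφm hC
  have e1' : ∫ x : E d × E d, ‖x.1 - x.2‖ * φ x.2 ∂(law ψ).prod (law ψ)
      = ∫ v, φ v * collFreq ψ v ∂law ψ :=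
    (h.integral_prod_rate_swap (fun x => φ x.1)).trans e1
  have j1 : Integrable (fun ξ => bracket ξ ^ 1) (law ψ) := by simpa using h.integrable_bracket
  have j2 : Integrable (fun ξ => bracket ξ ^ 2) (law ψ) :=
    integrable_pow_of_le (by norm_num) h.integrable_bracket_three
  have jn := integrable_pow_of_le (Nat.le_succ n) hn
  have k1 := (h.integrable_prod_bracket hn j1).add (h.integrable_prod_bracket jn j2)
  have hle : ∀ x : E d × E d, ‖x.1 - x.2‖ * (bracket x.1 ^ n * bracket x.2)
      ≤ bracket x.1 ^ (n + 1) * bracket x.2 ^ 1 + bracket x.1 ^ n * bracket x.2 ^ 2 := by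
    intro x
    have hb := bracket_pos x.1
    have hb' := bracket_pos x.2
    calc _ ≤ (bracket x.1 + bracket x.2) * (bracket x.1 ^ n * bracket x.2) :=
          mul_le_mul_of_nonneg_right (norm_sub_le_bracket_add _ _) (by positivity)
      _ = _ := by ring
  have i2 : Integrable (fun x : E d × E d => ‖x.1 - x.2‖ * (bracket x.1 ^ n * bracket x.2))
      ((law ψ).prod (law ψ)) := by
    refine k1.mono' (Measurable.aestronglyMeasurable (by fun_prop))
      (Eventually.of_forall fun x => ?_)
    have hb := bracket_pos x.1
    have hb' := bracket_pos x.2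
    rw [Real.norm_eq_abs, abs_of_nonneg (by positivity)]
    exact hle x
  have i2' : Integrable (fun x : E d × E d => ‖x.1 - x.2‖ * (bracket x.2 ^ n * bracket x.1))
      ((law ψ).prod (law ψ)) :=
    h.integrable_prod_rate_swap (g := fun x => bracket x.1 ^ n * bracket x.2) i2
  have e2' := h.integral_prod_rate_swap (fun x => bracket x.1 ^ n * bracket x.2)
  simp only [Prod.fst_swap, Prod.snd_swap] at e2'
  have e2 : ∫ x : E d × E d, ‖x.1 - x.2‖ * (bracket x.1 ^ n * bracket x.2) ∂(law ψ).prod (law ψ)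
      ≤ moment ψ (n + 1) * moment ψ 1 + moment ψ n * moment ψ 2 := by
    refine (integral_mono i2 k1 hle).trans (le_of_eq ?_)
    simp only [Pi.add_apply]
    rw [integral_add (h.integrable_prod_bracket hn j1) (h.integrable_prod_bracket jn j2),
      integral_prod_mul (fun x : E d => bracket x ^ (n + 1)) (fun x : E d => bracket x ^ 1),
      integral_prod_mul (fun x : E d => bracket x ^ n) (fun x : E d => bracket x ^ 2)]
    rfl
  have i3 : Integrable (fun x : E d × E d => ρ * (‖x.1 - x.2‖ * φ x.1)
      + ρ * (‖x.1 - x.2‖ * φ x.2)) ((law ψ).prod (law ψ)) :=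
    (i1.const_mul ρ).add (i1'.const_mul ρ)
  have i4 : Integrable (fun x : E d × E d => c * (‖x.1 - x.2‖ * (bracket x.1 ^ n * bracket x.2))
      + c * (‖x.1 - x.2‖ * (bracket x.2 ^ n * bracket x.1))) ((law ψ).prod (law ψ)) :=
    (i2.const_mul c).add (i2'.const_mul c)
  have hmain : 2 * ∫ x : E d × E d, ‖x.1 - x.2‖ * sphAvg φ x.1 x.2 ∂(law ψ).prod (law ψ)
      ≤ 2 * ρ * (∫ v, φ v * collFreq ψ v ∂law ψ)
        + 2 * c * (moment ψ (n + 1) * moment ψ 1 + moment ψ n * moment ψ 2) := by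
    calc _ = ∫ x : E d × E d, 2 * (‖x.1 - x.2‖ * sphAvg φ x.1 x.2) ∂(law ψ).prod (law ψ) := by
          rw [integral_const_mul]
      _ ≤ ∫ x : E d × E d, (ρ * (‖x.1 - x.2‖ * φ x.1) + ρ * (‖x.1 - x.2‖ * φ x.2)
          + (c * (‖x.1 - x.2‖ * (bracket x.1 ^ n * bracket x.2))
            + c * (‖x.1 - x.2‖ * (bracket x.2 ^ n * bracket x.1)))) ∂(law ψ).prod (law ψ) := by
          refine integral_mono (i0.const_mul 2) (i3.add i4) fun x => ?_
          have := mul_le_mul_of_nonneg_left (hpov x.1 x.2) (norm_nonneg (x.1 - x.2))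
          dsimp only
          nlinarith
      _ = ρ * (∫ v, φ v * collFreq ψ v ∂law ψ) + ρ * (∫ v, φ v * collFreq ψ v ∂law ψ)
          + (c * (∫ x : E d × E d, ‖x.1 - x.2‖ * (bracket x.1 ^ n * bracket x.2)
              ∂(law ψ).prod (law ψ))
            + c * (∫ x : E d × E d, ‖x.1 - x.2‖ * (bracket x.1 ^ n * bracket x.2)
              ∂(law ψ).prod (law ψ))) := by
          rw [integral_add i3 i4,
            integral_add (i1.const_mul ρ) (i1'.const_mul ρ),
            integral_add (i2.const_mul c) (i2'.const_mul c), integral_const_mul,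
            integral_const_mul, integral_const_mul, integral_const_mul, e1, e1', e2']
      _ ≤ _ := by
          have := mul_le_mul_of_nonneg_left e2 hc
          linarith
  have hK : 0 ≤ c * (moment ψ (n + 1) * moment ψ 1 + moment ψ n * moment ψ 2) := by
    have := integral_bracket_nonneg (ψ := ψ)
    unfold moment
    exact mul_nonneg hc (add_nonneg (mul_nonneg (this _) (this _)) (mul_nonneg (this _) (this _)))
  -- The factor `1 - α` is kept in front of the Povzner constant, and discarded on the lower-order
  -- term.
  have h1 := mul_le_mul_of_nonneg_left hmain (sub_nonneg.2 hα1)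
  have h2 := mul_nonneg hα0 hK
  nlinarith

end NiceProfile

/-! ### Finiteness of all moments, and estimates of the rates by moments -/

namespace NiceProfile

variable {d : ℕ} {α : ℝ} {ψ : E d → ℝ}

lemma rateA_nonneg (h : NiceProfile α ψ) : 0 ≤ rateA ψ :=
  integral_nonneg fun ξ => h.collFreq_nonneg ξ

/-- One more moment, with a bound depending on the profile. -/
lemma integrable_pow_succ (hd : 2 ≤ d) (h : NiceProfile α ψ) (hα0 : 0 < α) (hα1 : α ≤ 1) {m : ℕ}
    (hm : Integrable (fun ξ => bracket ξ ^ (m + 3)) (law ψ)) :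
    Integrable (fun ξ => bracket ξ ^ (m + 4)) (law ψ) := by
  have hP := h.isProbabilityMeasure
  set c : ℝ := 3 ^ (m + 3) with hc
  set R : ℝ := c * (moment ψ (m + 3) * moment ψ 1 + moment ψ (m + 2) * moment ψ 2)
    + α * rateA ψ * moment ψ (m + 3) + |coefB α ψ| * ((m + 4) * moment ψ (m + 3)) with hR
  have key : ∀ ε : ℝ, 0 < ε → ε ≤ 1 →
      ∫ ξ, truncPow ε (m + 2) ξ * ‖ξ‖ ∂law ψ ≤ R / α := by
    intro ε hε hε1
    have hs1 : 0 < Real.sqrt ε := Real.sqrt_pos.2 hε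
    have hC : ∀ ξ : E d, |truncPow ε (m + 2) ξ| ≤ ((m + 4) * (Real.sqrt ε)⁻¹)
        * bracket ξ ^ (m + 2) := by
      intro ξ
      rw [abs_of_nonneg (truncPow_nonneg _ _)]
      refine (truncPow_le hε _ _).trans ?_
      have := bracket_pos ξ
      refine mul_le_mul_of_nonneg_right ?_ (by positivity)
      refine le_mul_of_one_le_left (by positivity) ?_
      have : (0 : ℝ) ≤ m := Nat.cast_nonneg m
      linarith
    have hC' : ∀ ξ : E d, |fderiv ℝ (fun x : E d => truncPow ε (m + 2) x) ξ ξ|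
        ≤ ((m + 4) * (Real.sqrt ε)⁻¹) * bracket ξ ^ (m + 2) := by
      intro ξ
      refine (abs_fderiv_truncPow_le hε.le _ _).trans ?_
      have := mul_le_mul_of_nonneg_left (truncPow_le hε (m + 2) ξ)
        (show (0 : ℝ) ≤ ((m + 2 : ℕ) : ℝ) + 2 by positivity)
      refine this.trans (le_of_eq ?_)
      push_cast; ring
    -- With `ρ = 1` the loss prevails only by the factor `1 - (1 - α) = α`. This is enough for
    -- finiteness at fixed `α > 0`, and gives the bound `R / α`, free of `ε`.
    have hineq := h.moment_inequality hd hα0.le hα1 (p := m + 2) (n := m + 2) hm hm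
      (contDiff_truncPow hε.le (m + 2)) (truncPow_nonneg _) hC hC' (ρ := 1) (c := c)
      (by positivity) (sphAvg_truncPow_le hd hε m)
    have hI : Integrable (fun ξ => truncPow ε (m + 2) ξ) (law ψ) :=
      integrable_of_le_bracket hm (by fun_prop) (C := 1) fun ξ => by
        rw [abs_of_nonneg (truncPow_nonneg _ _), one_mul]; exact truncPow_le_pow hε.le _ ξ
    have b1 : ∫ ξ, truncPow ε (m + 2) ξ ∂law ψ ≤ moment ψ (m + 3) :=
      integral_mono hI hm fun ξ => truncPow_le_pow hε.le _ ξ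
    have b2 : |∫ ξ, fderiv ℝ (fun x : E d => truncPow ε (m + 2) x) ξ ξ ∂law ψ|
        ≤ (m + 4) * moment ψ (m + 3) := by
      unfold moment
      rw [← integral_const_mul]
      refine norm_integral_le_of_norm_le (f := fun ξ =>
        fderiv ℝ (fun x : E d => truncPow ε (m + 2) x) ξ ξ) (hm.const_mul _)
        (Eventually.of_forall fun ξ => ?_)
      refine (abs_fderiv_truncPow_le hε.le _ _).trans ?_
      have := mul_le_mul_of_nonneg_left (truncPow_le_pow hε.le (m + 2) ξ)
        (show (0 : ℝ) ≤ ((m + 2 : ℕ) : ℝ) + 2 by positivity)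
      refine this.trans (le_of_eq ?_)
      push_cast; ring
    have b3 : coefB α ψ * ∫ ξ, fderiv ℝ (fun x : E d => truncPow ε (m + 2) x) ξ ξ ∂law ψ
        ≤ |coefB α ψ| * ((m + 4) * moment ψ (m + 3)) := by
      refine (le_abs_self _).trans ?_
      rw [abs_mul]
      exact mul_le_mul_of_nonneg_left b2 (abs_nonneg _)
    have b4 := mul_le_mul_of_nonneg_left b1 (mul_nonneg hα0.le h.rateA_nonneg)
    have i5 := h.integrable_mul_collFreq (q := m + 2) hm (g := truncPow ε (m + 2)) (by fun_prop) hC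
    have b5 : ∫ ξ, truncPow ε (m + 2) ξ * ‖ξ‖ ∂law ψ
        ≤ ∫ ξ, truncPow ε (m + 2) ξ * collFreq ψ ξ ∂law ψ := by
      have hle : ∀ ξ, truncPow ε (m + 2) ξ * ‖ξ‖ ≤ truncPow ε (m + 2) ξ * collFreq ψ ξ :=
        fun ξ => mul_le_mul_of_nonneg_left (h.norm_le_collFreq ξ) (truncPow_nonneg _ _)
      refine integral_mono (i5.mono' (Measurable.aestronglyMeasurable (by fun_prop))
        (Eventually.of_forall fun ξ => ?_)) i5 hle
      rw [Real.norm_eq_abs, abs_of_nonneg (mul_nonneg (truncPow_nonneg _ _) (norm_nonneg _))]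
      exact hle ξ
    rw [le_div_iff₀ hα0, mul_comm]
    have b6 := mul_le_mul_of_nonneg_left b5 hα0.le
    have : (1 - (1 - α) * 1) = α := by ring
    rw [this] at hineq
    linarith
  have hint : ∀ ε : ℝ, 0 < ε →
      Integrable (fun ξ => truncPow ε (m + 2) ξ * ‖ξ‖) (law ψ) := by
    intro ε hε
    refine integrable_of_le_bracket hm (by fun_prop) (C := (Real.sqrt ε)⁻¹) fun ξ => ?_
    rw [abs_of_nonneg (mul_nonneg (truncPow_nonneg _ _) (norm_nonneg _)), pow_succ, ← mul_assoc]
    exact mul_le_mul (truncPow_le hε _ _) (norm_le_bracket ξ) (norm_nonneg _)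
      ((truncPow_nonneg _ _).trans (truncPow_le hε _ _))
  have hlim : ∀ ξ : E d, Tendsto (fun k : ℕ =>
      ENNReal.ofReal (truncPow (1 / ((k : ℝ) + 1)) (m + 2) ξ * ‖ξ‖)) atTop
      (𝓝 (ENNReal.ofReal (bracket ξ ^ (m + 3) * ‖ξ‖))) := by
    intro ξ
    refine ENNReal.tendsto_ofReal (Tendsto.mul_const _ ?_)
    have h1 : Tendsto (fun k : ℕ => (Real.sqrt (1 + 1 / ((k : ℝ) + 1) * bracket ξ ^ 2))⁻¹) atTop
        (𝓝 (Real.sqrt (1 + 0 * bracket ξ ^ 2))⁻¹) := by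
      refine Tendsto.inv₀ ?_ (by simp)
      exact (Real.continuous_sqrt.tendsto _).comp
        ((tendsto_one_div_add_atTop_nhds_zero_nat.mul_const _).const_add 1)
    simpa [truncPow] using h1.const_mul (bracket ξ ^ (m + 2 + 1))
  -- Fatou's lemma as `ε = 1/(k+1) → 0`.
  have hF : ∫⁻ ξ, ENNReal.ofReal (bracket ξ ^ (m + 3) * ‖ξ‖) ∂law ψ ≤ ENNReal.ofReal (R / α) := by
    calc _ = ∫⁻ ξ, liminf (fun k : ℕ =>
          ENNReal.ofReal (truncPow (1 / ((k : ℝ) + 1)) (m + 2) ξ * ‖ξ‖)) atTop ∂law ψ :=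
          lintegral_congr fun ξ => (hlim ξ).liminf_eq.symm
      _ ≤ liminf (fun k : ℕ => ∫⁻ ξ,
          ENNReal.ofReal (truncPow (1 / ((k : ℝ) + 1)) (m + 2) ξ * ‖ξ‖) ∂law ψ) atTop :=
          lintegral_liminf_le fun k => by fun_prop
      _ ≤ _ := by
          refine liminf_le_of_frequently_le' (Frequently.of_forall fun k => ?_)
          have hk : (0 : ℝ) < 1 / ((k : ℝ) + 1) := by positivity
          have hk1 : 1 / ((k : ℝ) + 1) ≤ 1 := by
            rw [div_le_one (by positivity)]; linarith [Nat.cast_nonneg (α := ℝ) k]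
          rw [← ofReal_integral_eq_lintegral_ofReal (hint _ hk) (Eventually.of_forall fun ξ =>
            mul_nonneg (truncPow_nonneg _ _) (norm_nonneg _))]
          exact ENNReal.ofReal_le_ofReal (key _ hk hk1)
  have hI2 : Integrable (fun ξ => bracket ξ ^ (m + 3) * ‖ξ‖) (law ψ) := by
    refine ⟨Measurable.aestronglyMeasurable (by fun_prop), ?_⟩
    refine lt_of_le_of_lt (le_of_eq (lintegral_congr fun ξ => ?_))
      (hF.trans_lt ENNReal.ofReal_lt_top)
    rw [Real.enorm_of_nonneg (mul_nonneg (pow_nonneg (bracket_pos ξ).le _) (norm_nonneg _))]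
  refine (hI2.add hm).mono' (Measurable.aestronglyMeasurable (by fun_prop))
    (Eventually.of_forall fun ξ => ?_)
  have hb := bracket_pos ξ
  rw [Real.norm_eq_abs, abs_of_nonneg (by positivity)]
  simp only [Pi.add_apply]
  have := mul_le_mul_of_nonneg_left (bracket_le ξ) (pow_nonneg hb.le (m + 3))
  calc bracket ξ ^ (m + 4) = bracket ξ ^ (m + 3) * bracket ξ := by ring
    _ ≤ _ := this
    _ = _ := by ring

/-- Only finiteness is retained here: the constants behind it depend on the profile and involve
`1/α`. -/
theorem integrable_pow (hd : 2 ≤ d) (h : NiceProfile α ψ) (hα0 : 0 < α) (hα1 : α ≤ 1) (q : ℕ) :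
    Integrable (fun ξ => bracket ξ ^ q) (law ψ) := by
  have key : ∀ m : ℕ, Integrable (fun ξ => bracket ξ ^ (m + 3)) (law ψ) := by
    intro m
    induction m with
    | zero => exact h.integrable_bracket_three
    | succ m ih => exact h.integrable_pow_succ hd hα0 hα1 ih
  exact integrable_pow_of_le (by omega) (key q)

lemma moment_nonneg (q : ℕ) : 0 ≤ moment ψ q := integral_bracket_nonneg q

lemma moment_mono (hd : 2 ≤ d) (h : NiceProfile α ψ) (hα0 : 0 < α) (hα1 : α ≤ 1) {p q : ℕ}
    (hpq : p ≤ q) : moment ψ p ≤ moment ψ q :=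
  integral_mono (h.integrable_pow hd hα0 hα1 p) (h.integrable_pow hd hα0 hα1 q)
    fun ξ => pow_le_pow_right₀ (one_le_bracket ξ) hpq

lemma moment_two (h : NiceProfile α ψ) : moment ψ 2 = 1 + (d : ℝ) / 2 := by
  have := h.isProbabilityMeasure
  have h2 : Integrable (fun ξ => bracket ξ ^ 2) (law ψ) :=
    integrable_pow_of_le (by norm_num) h.integrable_bracket_three
  have i2 : Integrable (fun ξ : E d => ‖ξ‖ ^ 2) (law ψ) :=
    integrable_of_le_bracket h2 (by fun_prop) (C := 1) fun ξ => by
      rw [abs_of_nonneg (by positivity), one_mul]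
      exact pow_le_pow_left₀ (norm_nonneg _) (norm_le_bracket ξ) 2
  unfold moment
  simp only [bracket_sq]
  rw [integral_add (integrable_const _) i2, h.energy_law]
  simp

lemma rateA_le (hd : 2 ≤ d) (h : NiceProfile α ψ) (hα0 : 0 < α) (hα1 : α ≤ 1) :
    rateA ψ ≤ 2 * (1 + (d : ℝ) / 2) := by
  have := h.isProbabilityMeasure
  have h1 : rateA ψ ≤ ∫ v, (bracket v + ∫ ξ, bracket ξ ∂law ψ) ∂law ψ :=
    integral_mono h.integrable_collFreq (h.integrable_bracket.add (integrable_const _))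
      fun v => h.collFreq_le v
  rw [integral_add h.integrable_bracket (integrable_const _)] at h1
  have h2 := h.moment_mono hd hα0 hα1 (show 1 ≤ 2 by norm_num)
  rw [h.moment_two] at h2
  unfold moment at h2
  simp only [pow_one] at h2
  simp only [integral_const, probReal_univ, one_smul] at h1
  linarith

/-- The bound on the energy rate in terms of the third absolute moment. -/
lemma rateB_le (hd : 2 ≤ d) (h : NiceProfile α ψ) (hα0 : 0 < α) (hα1 : α ≤ 1) :
    rateB ψ ≤ 2 / (d : ℝ) * ((∫ v, ‖v‖ ^ 3 ∂law ψ) + (1 + (d : ℝ) / 2) * ((d : ℝ) / 2)) := by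
  have := h.isProbabilityMeasure
  have hi : ∀ q : ℕ, Integrable (fun ξ : E d => ‖ξ‖ ^ q) (law ψ) := fun q =>
    integrable_of_le_bracket (h.integrable_pow hd hα0 hα1 q) (by fun_prop) (C := 1) fun ξ => by
      rw [abs_of_nonneg (by positivity), one_mul]
      exact pow_le_pow_left₀ (norm_nonneg _) (norm_le_bracket ξ) q
  have hm1 : ∫ w, ‖w‖ ∂law ψ ≤ 1 + (d : ℝ) / 2 := by
    have h2 := h.moment_mono hd hα0 hα1 (show 1 ≤ 2 by norm_num)
    rw [h.moment_two] at h2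
    refine le_trans (integral_mono h.integrable_norm_law ?_ fun ξ => ?_) h2
    · simpa using h.integrable_bracket
    · simpa using norm_le_bracket ξ
  have hL : ∀ v, collFreq ψ v ≤ ‖v‖ + (1 + (d : ℝ) / 2) := by
    intro v
    rw [h.collFreq_eq]
    calc _ ≤ ∫ w, (‖v‖ + ‖w‖) ∂law ψ :=
          integral_mono (h.integrable_norm_sub v) ((integrable_const _).add h.integrable_norm_law)
            fun w => norm_sub_le v w
      _ = ‖v‖ + ∫ w, ‖w‖ ∂law ψ := by
          rw [integral_add (integrable_const _) h.integrable_norm_law]; simp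
      _ ≤ _ := by linarith
  unfold rateB
  refine mul_le_mul_of_nonneg_left ?_ (by positivity)
  calc _ ≤ ∫ v, (‖v‖ ^ 3 + (1 + (d : ℝ) / 2) * ‖v‖ ^ 2) ∂law ψ := by
        refine integral_mono h.integrable_sq_mul_collFreq ((hi 3).add ((hi 2).const_mul _))
          fun v => ?_
        have := mul_le_mul_of_nonneg_left (hL v) (sq_nonneg ‖v‖)
        dsimp only
        nlinarith
    _ = _ := by
        rw [integral_add (hi 3) ((hi 2).const_mul _), integral_const_mul, h.energy_law]

/-- Cauchy–Schwarz between `|v|` and `|v|²`, obtained by expanding a square. The exact energy `d/2`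
matters, since this constant enters the threshold `α₀`. -/
lemma third_moment_sq_le (hd : 2 ≤ d) (h : NiceProfile α ψ) (hα0 : 0 < α) (hα1 : α ≤ 1) :
    (∫ v, ‖v‖ ^ 3 ∂law ψ) ^ 2 ≤ (d : ℝ) / 2 * moment ψ 4 := by
  have hd0 : (0 : ℝ) < d := by positivity
  have hi : ∀ q : ℕ, Integrable (fun ξ : E d => ‖ξ‖ ^ q) (law ψ) := fun q =>
    integrable_of_le_bracket (h.integrable_pow hd hα0 hα1 q) (by fun_prop) (C := 1) fun ξ => by
      rw [abs_of_nonneg (by positivity), one_mul]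
      exact pow_le_pow_left₀ (norm_nonneg _) (norm_le_bracket ξ) q
  set m3 := ∫ v, ‖v‖ ^ 3 ∂law ψ
  have h4 : ∫ v, ‖v‖ ^ 4 ∂law ψ ≤ moment ψ 4 :=
    integral_mono (hi 4) (h.integrable_pow hd hα0 hα1 4)
      fun ξ => pow_le_pow_left₀ (norm_nonneg _) (norm_le_bracket ξ) 4
  have h1 : 0 ≤ ∫ v, ((d / 2 : ℝ) ^ 2 * ‖v‖ ^ 4 - 2 * (d / 2) * m3 * ‖v‖ ^ 3
      + m3 ^ 2 * ‖v‖ ^ 2) ∂law ψ :=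
    integral_nonneg fun v => by
      have := sq_nonneg ((d / 2 : ℝ) * ‖v‖ ^ 2 - m3 * ‖v‖)
      simp only [Pi.zero_apply]
      nlinarith
  have i1 : Integrable (fun v : E d => (d / 2 : ℝ) ^ 2 * ‖v‖ ^ 4 - 2 * (d / 2) * m3 * ‖v‖ ^ 3)
      (law ψ) := ((hi 4).const_mul _).sub ((hi 3).const_mul _)
  rw [integral_add i1 ((hi 2).const_mul _), integral_sub ((hi 4).const_mul _) ((hi 3).const_mul _), integral_const_mul,
    integral_const_mul, integral_const_mul, h.energy_law] at h1
  have h2 : (d / 2 : ℝ) * m3 ^ 2 ≤ (d / 2) * (d / 2 * moment ψ 4) := by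
    have := mul_le_mul_of_nonneg_left h4 (sq_nonneg (d / 2 : ℝ))
    nlinarith
  exact le_of_mul_le_mul_left h2 (by positivity)

/-- The moment inequality for powers of the bracket. -/
lemma moment_inequality_pow (hd : 2 ≤ d) (h : NiceProfile α ψ) (hα0 : 0 < α) (hα1 : α ≤ 1)
    {n : ℕ} (hn : 2 ≤ n) :
    (1 - (1 - α) * varrho d (3 / 2)) * (moment ψ (n + 2) - moment ψ (n + 1))
      ≤ 3 ^ (n + 1) * (moment ψ (n + 1) * moment ψ 1 + moment ψ n * moment ψ 2)
        + α * rateA ψ * moment ψ (n + 1) + α / 2 * rateB ψ *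
          ∫ ξ, (n + 1) * bracket ξ ^ n * (‖ξ‖ ^ 2 / bracket ξ) ∂law ψ := by
  have hI := h.integrable_pow hd hα0 hα1
  have hb1 : ∀ ξ : E d, ‖ξ‖ ^ 2 / bracket ξ ≤ bracket ξ := by
    intro ξ
    rw [div_le_iff₀ (bracket_pos ξ), ← pow_two, bracket_sq]; linarith
  have hD0 : ∀ ξ : E d, 0 ≤ ((n : ℝ) + 1) * bracket ξ ^ n * (‖ξ‖ ^ 2 / bracket ξ) := fun ξ => by
    have := bracket_pos ξ; positivity
  have hDle : ∀ ξ : E d, ((n : ℝ) + 1) * bracket ξ ^ n * (‖ξ‖ ^ 2 / bracket ξ)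
      ≤ (n + 1) * bracket ξ ^ (n + 1) := fun ξ => by
    have := bracket_pos ξ
    calc _ ≤ ((n : ℝ) + 1) * bracket ξ ^ n * bracket ξ := by gcongr; exact hb1 ξ
      _ = _ := by ring
  have hpov : ∀ v w : E d, 2 * sphAvg (fun ξ => bracket ξ ^ (n + 1)) v w
      ≤ varrho d (3 / 2) * (bracket v ^ (n + 1) + bracket w ^ (n + 1))
      + 3 ^ (n + 1) * (bracket v ^ n * bracket w + bracket v * bracket w ^ n) := by
    intro v w
    have hv := bracket_pos v
    have hw := bracket_pos w
    have h1 := sphAvg_bracket_pow_le hd (q := n + 1) (by omega) v w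
    have h2 := mul_le_mul_of_nonneg_left (pairBracket_pow_le v w n) (varrho_nonneg hd)
    have h3 : varrho d (3 / 2) * (3 ^ (n + 1) * (bracket v ^ n * bracket w
        + bracket v * bracket w ^ n)) ≤ 3 ^ (n + 1) * (bracket v ^ n * bracket w
        + bracket v * bracket w ^ n) :=
      mul_le_of_le_one_left (by positivity) (varrho_le_one hd)
    linarith
  have hineq := h.moment_inequality hd hα0.le hα1 (p := n + 1) (n := n) (hI _) (hI _)
    (contDiff_bracket.pow (n + 1)) (fun ξ => pow_nonneg (bracket_pos ξ).le _) (C := n + 1)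
    (fun ξ => by
      have := bracket_pos ξ
      rw [abs_of_nonneg (by positivity)]
      exact le_mul_of_one_le_left (by positivity) (by linarith [Nat.cast_nonneg (α := ℝ) n]))
    (fun ξ => by
      rw [fderiv_bracket_pow, abs_of_nonneg (hD0 ξ)]
      exact hDle ξ)
    (ρ := varrho d (3 / 2)) (c := 3 ^ (n + 1)) (by positivity) hpov
  simp only [fderiv_bracket_pow] at hineq
  have hρ : 0 ≤ 1 - (1 - α) * varrho d (3 / 2) := by
    have := varrho_le_one hd
    have := varrho_nonneg hd
    nlinarith
  have i1 : Integrable (fun ξ => bracket ξ ^ (n + 1) * collFreq ψ ξ) (law ψ) :=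
    h.integrable_mul_collFreq (q := n + 1) (hI _) (by fun_prop) (C := 1) fun ξ => by
      rw [abs_of_nonneg (pow_nonneg (bracket_pos ξ).le _), one_mul]
  -- From `L(ξ) ≥ |ξ| ≥ ⟨ξ⟩ - 1`.
  have h5 : moment ψ (n + 2) - moment ψ (n + 1) ≤ ∫ ξ, bracket ξ ^ (n + 1) * collFreq ψ ξ ∂law ψ := by
    unfold moment
    rw [← integral_sub (hI _) (hI _)]
    refine integral_mono ((hI _).sub (hI _)) i1 fun ξ => ?_
    have h1 := mul_le_mul_of_nonneg_left (h.norm_le_collFreq ξ) (pow_nonneg (bracket_pos ξ).le (n + 1))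
    have h2 := mul_le_mul_of_nonneg_left (bracket_le ξ) (pow_nonneg (bracket_pos ξ).le (n + 1))
    have h3 : bracket ξ ^ (n + 2) = bracket ξ ^ (n + 1) * bracket ξ := by ring
    simp only [h3]
    linarith
  -- The contribution `-α a/2` has a favourable sign, because the radial derivative of the weight is
  -- nonnegative.
  have h6 : coefB α ψ ≤ α / 2 * rateB ψ := by
    rw [h.coefB_eq hd]
    have := mul_nonneg hα0.le h.rateA_nonneg
    linarith
  have h7 : 0 ≤ ∫ ξ, ((n : ℝ) + 1) * bracket ξ ^ n * (‖ξ‖ ^ 2 / bracket ξ) ∂law ψ :=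
    integral_nonneg hD0
  have h8 := mul_le_mul_of_nonneg_right h6 h7
  have h9 := mul_le_mul_of_nonneg_left h5 hρ
  have h10 : ∫ ξ, bracket ξ ^ (n + 1) ∂law ψ = moment ψ (n + 1) := rfl
  rw [h10] at hineq
  linarith

end NiceProfile

/-! ### Uniform moment bounds below the first threshold -/

lemma alpha0_lt_one {d : ℕ} (hd : 2 ≤ d) : alpha0 d < 1 := by
  have := varrho_le_one hd
  unfold alpha0
  rw [div_lt_one (by linarith)]
  linarith

/-- The gap left by the Povzner constant below the threshold. -/
lemma exists_povzner_gap {d : ℕ} (hd : 2 ≤ d) {αs : ℝ} (hαs : αs < alpha0 d) :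
    ∃ κ : ℝ, 0 < κ ∧ ∀ α, 0 < α → α < αs →
      κ + 3 / 2 * α ≤ 1 - (1 - α) * varrho d (3 / 2) := by
  have hρ1 := varrho_le_one hd
  set ρ := varrho d (3 / 2) with hρ
  -- By definition of `α₀`, `1 - (1 - α)ρ - (3/2)α = (3/2 - ρ)(α₀ - α)`.
  refine ⟨(3 / 2 - ρ) * (alpha0 d - αs), mul_pos (by linarith) (by linarith), fun α h0 h1 => ?_⟩
  have e : (3 / 2 - ρ) * alpha0 d = 1 - ρ := by
    unfold alpha0
    rw [← hρ]
    exact mul_div_cancel₀ _ (by linarith)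
  rw [mul_sub, e]
  nlinarith

set_option maxHeartbeats 600000 in
/-- The fourth moment is bounded uniformly over the profiles. -/
lemma exists_moment_four_bound {d : ℕ} (hd : 2 ≤ d) {αs : ℝ} (hαs : αs < alpha0 d) :
    ∃ C : ℝ, ∀ (α : ℝ) (ψ : E d → ℝ), 0 < α → α < αs → NiceProfile α ψ → moment ψ 4 ≤ C := by
  obtain ⟨κ, hκ0, hκα⟩ := exists_povzner_gap hd hαs
  have hρ1 := varrho_le_one hd
  have hρ0 := varrho_nonneg hd
  set ρ := varrho d (3 / 2) with hρ
  have hd0 : (0 : ℝ) < d := by positivity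
  have hα1 : ∀ α, α < αs → α ≤ 1 := fun α h1 => by
    have := alpha0_lt_one hd; linarith
  set D : ℝ := 1 + (d : ℝ) / 2 with hD
  have hDpos : 0 < D := by positivity
  set K1 : ℝ := 1 + 27 * D + 2 * D + 3 / 2 * (D + 1) with hK1
  set K0 : ℝ := 27 * D ^ 2 + 3 / 4 * D * d with hK0
  have hK1p : 0 < K1 := by positivity
  refine ⟨(K0 + K1 ^ 2 / (2 * κ) * D) / (κ / 2), fun α ψ h0 h1 h => ?_⟩
  have hα := hα1 α h1
  have hI := h.integrable_pow hd h0 hα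
  have hineq := h.moment_inequality_pow hd h0 hα (n := 2) le_rfl
  have hm1 : moment ψ 1 ≤ D := by
    rw [hD, ← h.moment_two]; exact h.moment_mono hd h0 hα (by norm_num)
  have hm2 : moment ψ 2 = D := h.moment_two
  have hm3 : 0 ≤ moment ψ 3 := NiceProfile.moment_nonneg 3
  have hm4 : 0 ≤ moment ψ 4 := NiceProfile.moment_nonneg 4
  set m3 := ∫ v, ‖v‖ ^ 3 ∂law ψ with hm3d
  have hi : ∀ q : ℕ, Integrable (fun ξ : E d => ‖ξ‖ ^ q) (law ψ) := fun q =>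
    NiceProfile.integrable_of_le_bracket (hI q) (by fun_prop) (C := 1) fun ξ => by
      rw [abs_of_nonneg (by positivity), one_mul]
      exact pow_le_pow_left₀ (norm_nonneg _) (norm_le_bracket ξ) q
  have hm30 : 0 ≤ m3 := integral_nonneg fun v => by positivity
  have hm3' : m3 ≤ moment ψ 3 := integral_mono (hi 3) (hI 3)
    fun ξ => pow_le_pow_left₀ (norm_nonneg _) (norm_le_bracket ξ) 3
  have hJ : ∫ ξ, (((2 : ℕ) : ℝ) + 1) * bracket ξ ^ 2 * (‖ξ‖ ^ 2 / bracket ξ) ∂law ψ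
      ≤ 3 * (m3 + d / 2) := by
    rw [← h.energy_law, hm3d, ← integral_add (hi 3) (hi 2), ← integral_const_mul]
    refine integral_mono_of_nonneg (Eventually.of_forall fun ξ => ?_)
      (((hi 3).add (hi 2)).const_mul 3) (Eventually.of_forall fun ξ => ?_)
    · have := bracket_pos ξ; simp only [Pi.zero_apply]; positivity
    · have hb := bracket_pos ξ
      have e : (((2 : ℕ) : ℝ) + 1) * bracket ξ ^ 2 * (‖ξ‖ ^ 2 / bracket ξ)
          = 3 * (bracket ξ * ‖ξ‖ ^ 2) := by push_cast; field_simp; ring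
      dsimp only
      rw [e]
      have := mul_le_mul_of_nonneg_right (bracket_le ξ) (sq_nonneg ‖ξ‖)
      nlinarith
  have hJ0 : 0 ≤ ∫ ξ, (((2 : ℕ) : ℝ) + 1) * bracket ξ ^ 2 * (‖ξ‖ ^ 2 / bracket ξ) ∂law ψ :=
    integral_nonneg fun ξ => by have := bracket_pos ξ; positivity
  have hb := h.rateB_le hd h0 hα
  rw [← hm3d, ← hD] at hb
  have ha := h.rateA_le hd h0 hα
  rw [← hD] at ha
  have hcs := h.third_moment_sq_le hd h0 hα
  rw [← hm3d] at hcs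
  -- The critical term. Both factors are affine in the third moment `m3`, so their product contains
  -- `(3α/d) m3² ≤ (3/2) α m4` by Cauchy–Schwarz. This is of the same order as the left side and
  -- forces `α < α₀`.
  have hT : α / 2 * rateB ψ * (∫ ξ, (((2 : ℕ) : ℝ) + 1) * bracket ξ ^ 2 * (‖ξ‖ ^ 2 / bracket ξ)
      ∂law ψ) ≤ 3 / 2 * α * moment ψ 4 + 3 / 2 * (D + 1) * moment ψ 3 + 3 / 4 * D * d := by
    have hB : α / 2 * rateB ψ ≤ α / d * (m3 + D * (d / 2)) := by
      have := mul_le_mul_of_nonneg_left hb (show 0 ≤ α / 2 by linarith)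
      refine this.trans (le_of_eq ?_)
      ring
    have hB0 : 0 ≤ α / d * (m3 + D * (d / 2)) := by positivity
    calc _ ≤ α / d * (m3 + D * (d / 2)) * (3 * (m3 + d / 2)) :=
          mul_le_mul hB hJ hJ0 hB0
      _ = 3 * α / d * m3 ^ 2 + 3 / 2 * (D + 1) * (α * m3) + 3 / 4 * D * (α * d) := by
          field_simp; ring
      _ ≤ 3 * α / d * (d / 2 * moment ψ 4) + 3 / 2 * (D + 1) * (1 * moment ψ 3)
          + 3 / 4 * D * (1 * d) := by gcongr
      _ = _ := by field_simp
  have hA : α * rateA ψ * moment ψ 3 ≤ 1 * (2 * D) * moment ψ 3 := by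
    refine mul_le_mul_of_nonneg_right (mul_le_mul hα ha h.rateA_nonneg zero_le_one) hm3
  have hX : (3 : ℝ) ^ 3 * (moment ψ 3 * moment ψ 1 + moment ψ 2 * moment ψ 2)
      ≤ 27 * (moment ψ 3 * D + D ^ 2) := by
    rw [hm2]
    have := mul_le_mul_of_nonneg_left hm1 hm3
    nlinarith
  -- Interpolation of the third moment between the second, which is known, and the fourth, half of
  -- whose surplus `κ` is spent.
  have hyoung : K1 * moment ψ 3 ≤ κ / 2 * moment ψ 4 + K1 ^ 2 / (2 * κ) * D := by
    rw [← hm2]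
    unfold moment
    rw [← integral_const_mul, ← integral_const_mul, ← integral_const_mul,
      ← integral_add ((hI 4).const_mul _) ((hI 2).const_mul _)]
    refine integral_mono ((hI 3).const_mul _) (((hI 4).const_mul _).add ((hI 2).const_mul _))
      fun ξ => ?_
    dsimp only
    have e : κ / 2 * bracket ξ ^ 4 + K1 ^ 2 / (2 * κ) * bracket ξ ^ 2 - K1 * bracket ξ ^ 3
        = 1 / (2 * κ) * (κ * bracket ξ ^ 2 - K1 * bracket ξ) ^ 2 := by field_simp; ring
    have : 0 ≤ 1 / (2 * κ) * (κ * bracket ξ ^ 2 - K1 * bracket ξ) ^ 2 := by positivity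
    linarith
  have hk := hκα α h0 h1
  have hk1 : 1 - (1 - α) * ρ ≤ 1 := by nlinarith
  have hl : (κ + 3 / 2 * α) * moment ψ 4 - moment ψ 3
      ≤ (1 - (1 - α) * ρ) * (moment ψ 4 - moment ψ 3) := by
    have := mul_le_mul_of_nonneg_right hk hm4
    have := mul_le_mul_of_nonneg_right hk1 hm3
    nlinarith
  norm_num only [Nat.reduceAdd] at hineq hT hX
  rw [le_div_iff₀ (by positivity)]
  rw [hK1] at hyoung
  nlinarith

set_option maxHeartbeats 600000 in
/-- All moments are bounded uniformly over the profiles. -/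
theorem exists_moment_bound {d : ℕ} (hd : 2 ≤ d) {αs : ℝ} (hαs : αs < alpha0 d) (q : ℕ) :
    ∃ C : ℝ, ∀ (α : ℝ) (ψ : E d → ℝ), 0 < α → α < αs → NiceProfile α ψ → moment ψ q ≤ C := by
  have h4 := exists_moment_four_bound hd hαs
  obtain ⟨κ, hκ0, hκα⟩ := exists_povzner_gap hd hαs
  have hρ1 := varrho_le_one hd
  have hρ0 := varrho_nonneg hd
  set ρ := varrho d (3 / 2) with hρ
  have hd0 : (0 : ℝ) < d := by positivity
  have hα1 : ∀ α, α < αs → α ≤ 1 := fun α h1 => by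
    have := alpha0_lt_one hd; linarith
  set D : ℝ := 1 + (d : ℝ) / 2 with hD
  have hDpos : 0 < D := by positivity
  have hsucc : ∀ n : ℕ, ∃ C : ℝ, ∀ (α : ℝ) (ψ : E d → ℝ), 0 < α → α < αs → NiceProfile α ψ →
      moment ψ (n + 4) ≤ C := by
    intro n
    induction n with
    | zero => exact h4
    | succ n ih =>
      obtain ⟨C4, hC4⟩ := h4
      obtain ⟨C, hC⟩ := ih
      set R : ℝ := 3 ^ (n + 4) * (|C| * D + |C| * D) + 2 * D * |C|
        + (1 / d * (|C4| + D * (d / 2))) * ((n + 4) * |C|) with hR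
      refine ⟨R / κ + |C|, fun α ψ h0 h1 h => ?_⟩
      have hα := hα1 α h1
      have hI := h.integrable_pow hd h0 hα
      have hineq := h.moment_inequality_pow hd h0 hα (n := n + 3) (by omega)
      have hm1 : moment ψ 1 ≤ D := by
        rw [hD, ← h.moment_two]; exact h.moment_mono hd h0 hα (by norm_num)
      have hm2 : moment ψ 2 = D := h.moment_two
      have hmC : moment ψ (n + 4) ≤ |C| := (hC α ψ h0 h1 h).trans (le_abs_self _)
      have hm3C : moment ψ (n + 3) ≤ |C| :=
        (h.moment_mono hd h0 hα (by omega)).trans hmC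
      have hmC4 : moment ψ 4 ≤ |C4| := (hC4 α ψ h0 h1 h).trans (le_abs_self _)
      have hp : ∀ q, 0 ≤ moment ψ q := fun q => NiceProfile.moment_nonneg q
      have hm3 : ∫ v, ‖v‖ ^ 3 ∂law ψ ≤ |C4| := by
        refine le_trans ?_ hmC4
        refine (integral_mono_of_nonneg (Eventually.of_forall fun ξ => ?_) (hI 4)
          (Eventually.of_forall fun ξ => ?_))
        · simp only [Pi.zero_apply]; positivity
        · exact (pow_le_pow_left₀ (norm_nonneg _) (norm_le_bracket ξ) 3).trans
            (pow_le_pow_right₀ (one_le_bracket ξ) (by norm_num))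
      have hb := h.rateB_le hd h0 hα
      rw [← hD] at hb
      have ha := h.rateA_le hd h0 hα
      rw [← hD] at ha
      have hJ0 : 0 ≤ ∫ ξ, (((n + 3 : ℕ) : ℝ) + 1) * bracket ξ ^ (n + 3)
          * (‖ξ‖ ^ 2 / bracket ξ) ∂law ψ :=
        integral_nonneg fun ξ => by have := bracket_pos ξ; positivity
      have hJ : ∫ ξ, (((n + 3 : ℕ) : ℝ) + 1) * bracket ξ ^ (n + 3)
          * (‖ξ‖ ^ 2 / bracket ξ) ∂law ψ ≤ (n + 4) * |C| := by
        have h5 : ∫ ξ, (((n + 3 : ℕ) : ℝ) + 1) * bracket ξ ^ (n + 3)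
          * (‖ξ‖ ^ 2 / bracket ξ) ∂law ψ ≤ (n + 4) * moment ψ (n + 4) := by
          unfold moment
          rw [← integral_const_mul]
          refine integral_mono_of_nonneg (Eventually.of_forall fun ξ => ?_)
            ((hI _).const_mul _) (Eventually.of_forall fun ξ => ?_)
          · have := bracket_pos ξ; simp only [Pi.zero_apply]; positivity
          · have hb := bracket_pos ξ
            have hb1 : ‖ξ‖ ^ 2 / bracket ξ ≤ bracket ξ := by
              rw [div_le_iff₀ hb, ← pow_two, bracket_sq]; linarith
            dsimp only
            calc _ ≤ (((n + 3 : ℕ) : ℝ) + 1) * bracket ξ ^ (n + 3) * bracket ξ := by gcongr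
              _ = _ := by push_cast; ring
        exact h5.trans (mul_le_mul_of_nonneg_left hmC (by positivity))
      -- The fourth moment bounds `rateB`, so the drift now costs only the moment of the induction
      -- hypothesis, and a gap `κ` without the term `(3/2)α` would suffice.
      have hT : α / 2 * rateB ψ * (∫ ξ, (((n + 3 : ℕ) : ℝ) + 1) * bracket ξ ^ (n + 3)
          * (‖ξ‖ ^ 2 / bracket ξ) ∂law ψ) ≤ (1 / d * (|C4| + D * (d / 2))) * ((n + 4) * |C|) := by
        have hB : α / 2 * rateB ψ ≤ 1 / d * (|C4| + D * (d / 2)) := by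
          calc α / 2 * rateB ψ ≤ α / 2 * (2 / d * (|C4| + D * (d / 2))) := by
                refine mul_le_mul_of_nonneg_left (hb.trans ?_) (by linarith)
                gcongr
            _ = α * (1 / d * (|C4| + D * (d / 2))) := by ring
            _ ≤ _ := mul_le_of_le_one_left (by positivity) hα
        exact mul_le_mul hB hJ hJ0 (by positivity)
      have hA : α * rateA ψ * moment ψ (n + 4) ≤ 1 * (2 * D) * |C| :=
        mul_le_mul (mul_le_mul hα ha h.rateA_nonneg zero_le_one) hmC (hp _) (by positivity)
      have hX : (3 : ℝ) ^ (n + 4) * (moment ψ (n + 4) * moment ψ 1 + moment ψ (n + 3) * moment ψ 2)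
          ≤ 3 ^ (n + 4) * (|C| * D + |C| * D) := by
        rw [hm2]
        refine mul_le_mul_of_nonneg_left (add_le_add ?_ ?_) (by positivity)
        · exact mul_le_mul hmC hm1 (hp _) (abs_nonneg _)
        · exact mul_le_mul_of_nonneg_right hm3C hDpos.le
      have hk : κ ≤ 1 - (1 - α) * ρ := by linarith [hκα α h0 h1]
      have hmm : 0 ≤ moment ψ (n + 5) - moment ψ (n + 4) :=
        sub_nonneg.2 (h.moment_mono hd h0 hα (by omega))
      have hkk := mul_le_mul_of_nonneg_right hk hmm
      have hfin : κ * (moment ψ (n + 5) - moment ψ (n + 4)) ≤ R := by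
        refine hkk.trans ?_
        refine le_trans hineq ?_
        rw [hR]
        linarith
      have : moment ψ (n + 5) - moment ψ (n + 4) ≤ R / κ := by
        rw [le_div_iff₀ hκ0, mul_comm]; exact hfin
      change moment ψ (n + 5) ≤ _
      linarith
  obtain ⟨C, hC⟩ := hsucc q
  refine ⟨C, fun α ψ h0 h1 h => (h.moment_mono hd h0 (hα1 α h1) (by omega)).trans (hC α ψ h0 h1 h)⟩

/-! ### Bounds on the collision rates and lower bound on the collision frequency -/

namespace NiceProfile

variable {d : ℕ} {α : ℝ} {ψ : E d → ℝ}

lemma integrable_prod_norm_sub (h : NiceProfile α ψ) :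
    Integrable (fun x : E d × E d => ‖x.1 - x.2‖) ((law ψ).prod (law ψ)) := by
  simpa using h.integrable_prod_rate (q := 0) (by simpa using h.integrable_bracket)
    (g := fun _ => 1) (by fun_prop) (C := 1) (by simp)

lemma rateA_eq (h : NiceProfile α ψ) :
    rateA ψ = ∫ x : E d × E d, ‖x.1 - x.2‖ ∂(law ψ).prod (law ψ) := by
  have := h.integral_prod_rate (q := 0) (by simpa using h.integrable_bracket)
    (g := fun _ => 1) (by fun_prop) (C := 1) (by simp)
  simp only [mul_one, one_mul] at this
  rw [this]; rfl

lemma integrable_norm_sq_law (h : NiceProfile α ψ) :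
    Integrable (fun ξ : E d => ‖ξ‖ ^ 2) (law ψ) :=
  integrable_of_le_bracket (integrable_pow_of_le (by norm_num) h.integrable_bracket_three)
    (by fun_prop) (C := 1) (q := 2) fun ξ => by
      rw [abs_of_nonneg (by positivity), one_mul]
      exact pow_le_pow_left₀ (norm_nonneg _) (norm_le_bracket ξ) 2

lemma integrable_prod_norm_sub_sq (h : NiceProfile α ψ) :
    Integrable (fun x : E d × E d => ‖x.1 - x.2‖ ^ 2) ((law ψ).prod (law ψ)) := by
  have h2 : Integrable (fun ξ => bracket ξ ^ 2) (law ψ) :=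
    integrable_pow_of_le (by norm_num) h.integrable_bracket_three
  refine ((h.integrable_prod_bracket h2 h2).const_mul 4).mono'
    (Measurable.aestronglyMeasurable (by fun_prop)) (Eventually.of_forall fun x => ?_)
  rw [Real.norm_eq_abs, abs_of_nonneg (by positivity)]
  calc _ ≤ (2 * (bracket x.1 * bracket x.2)) ^ 2 :=
        pow_le_pow_left₀ (norm_nonneg _) (norm_sub_le_bracket_mul _ _) 2
    _ = _ := by ring

/-- Zero momentum removes the cross term, and each particle contributes `d/2`. -/
lemma integral_prod_norm_sub_sq (h : NiceProfile α ψ) :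
    ∫ x : E d × E d, ‖x.1 - x.2‖ ^ 2 ∂(law ψ).prod (law ψ) = d := by
  have := h.isProbabilityMeasure
  have hid : Integrable (fun w : E d => w) (law ψ) :=
    (integrable_norm_iff (by fun_prop)).1 h.integrable_norm_law
  rw [integral_prod _ h.integrable_prod_norm_sub_sq]
  have h1 : ∀ v : E d, ∫ w, ‖v - w‖ ^ 2 ∂law ψ = ‖v‖ ^ 2 + (d : ℝ) / 2 := by
    intro v
    have hin : Integrable (fun w : E d => inner ℝ v w) (law ψ) := hid.const_inner v
    have e : ∀ w : E d, ‖v - w‖ ^ 2 = (‖v‖ ^ 2 + ‖w‖ ^ 2) - 2 * inner ℝ v w := fun w => by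
      rw [norm_sub_sq_real]; ring
    have i1 : Integrable (fun w : E d => ‖v‖ ^ 2 + ‖w‖ ^ 2) (law ψ) :=
      (integrable_const _).add h.integrable_norm_sq_law
    simp only [e]
    rw [integral_sub i1 (hin.const_mul 2),
      integral_add (integrable_const _) h.integrable_norm_sq_law, integral_const_mul,
      integral_inner hid, h.integral_id_law, h.energy_law]
    simp
  simp only [h1]
  rw [integral_add h.integrable_norm_sq_law (integrable_const _), h.energy_law]
  simp

/-- The variance of `|v - w|` is nonnegative and its second moment is `d`. -/
lemma rateA_le_sqrt (h : NiceProfile α ψ) : rateA ψ ≤ Real.sqrt d := by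
  have := h.isProbabilityMeasure
  refine Real.le_sqrt_of_sq_le ?_
  have h1 : 0 ≤ ∫ x : E d × E d, (‖x.1 - x.2‖ ^ 2 - 2 * rateA ψ * ‖x.1 - x.2‖ + rateA ψ ^ 2)
      ∂(law ψ).prod (law ψ) :=
    integral_nonneg fun x => by
      have := sq_nonneg (‖x.1 - x.2‖ - rateA ψ)
      simp only [Pi.zero_apply]
      nlinarith
  have i1 : Integrable (fun x : E d × E d => ‖x.1 - x.2‖ ^ 2 - 2 * rateA ψ * ‖x.1 - x.2‖)
      ((law ψ).prod (law ψ)) :=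
    h.integrable_prod_norm_sub_sq.sub (h.integrable_prod_norm_sub.const_mul _)
  rw [integral_add i1 (integrable_const _), integral_sub h.integrable_prod_norm_sub_sq
    (h.integrable_prod_norm_sub.const_mul _), integral_const_mul, ← h.rateA_eq,
    h.integral_prod_norm_sub_sq] at h1
  simp only [integral_const, probReal_univ, one_smul] at h1
  nlinarith

/-- Triangle inequality through the point `v`, averaged over both particles. It lets the
zeroth-order terms be absorbed pointwise by the collision frequency. -/
lemma rateA_le_two_mul_collFreq (h : NiceProfile α ψ) (v : E d) :
    rateA ψ ≤ 2 * collFreq ψ v := by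
  have := h.isProbabilityMeasure
  have i1 := h.integrable_norm_sub v
  have j1 : Integrable (fun x : E d × E d => ‖v - x.1‖) ((law ψ).prod (law ψ)) := i1.comp_fst _
  have j2 : Integrable (fun x : E d × E d => ‖v - x.2‖) ((law ψ).prod (law ψ)) := i1.comp_snd _
  rw [h.rateA_eq]
  calc _ ≤ ∫ x : E d × E d, (‖v - x.1‖ + ‖v - x.2‖) ∂(law ψ).prod (law ψ) := by
        refine integral_mono h.integrable_prod_norm_sub (j1.add j2) fun x => ?_
        have : x.1 - x.2 = (v - x.2) - (v - x.1) := by abel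
        dsimp only
        rw [this, add_comm]
        exact norm_sub_le _ _
    _ = _ := by
        rw [integral_add j1 j2, integral_fun_fst (fun w => ‖v - w‖),
          integral_fun_snd (fun w => ‖v - w‖), h.collFreq_eq]
        simp
        ring

/-- After `L(v) ≥ |v|` this is Jensen's inequality for the third moment given the energy. It follows
from `r³ ≥ (3/2) s r² - s³/2` with `s² = d/2`, the tangent inequality for `r³` as a function of
`r²`. -/
lemma sqrt_le_rateB (hd : 2 ≤ d) (h : NiceProfile α ψ) : Real.sqrt (d / 2) ≤ rateB ψ := by
  have hd0 : (0 : ℝ) < d := by positivity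
  have := h.isProbabilityMeasure
  set s := Real.sqrt ((d : ℝ) / 2) with hs
  have hs0 : 0 ≤ s := Real.sqrt_nonneg _
  have hs2 : s ^ 2 = d / 2 := Real.sq_sqrt (by positivity)
  have h1 : s ^ 3 ≤ ∫ v, ‖v‖ ^ 2 * collFreq ψ v ∂law ψ := by
    calc s ^ 3 = ∫ v, (3 / 2 * s * ‖v‖ ^ 2 - s ^ 3 / 2) ∂law ψ := by
          rw [integral_sub (h.integrable_norm_sq_law.const_mul _) (integrable_const _),
            integral_const_mul, h.energy_law, ← hs2]
          simp
          ring
      _ ≤ _ := by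
          refine integral_mono ((h.integrable_norm_sq_law.const_mul _).sub (integrable_const _))
            h.integrable_sq_mul_collFreq fun v => ?_
          dsimp only
          have h2 := mul_le_mul_of_nonneg_left (h.norm_le_collFreq v) (sq_nonneg ‖v‖)
          have h3 : 0 ≤ (‖v‖ - s) ^ 2 * (2 * ‖v‖ + s) :=
            mul_nonneg (sq_nonneg _) (by positivity)
          nlinarith
  unfold rateB
  calc s = 2 / d * s ^ 3 := by
        rw [pow_succ, hs2]; field_simp
    _ ≤ _ := mul_le_mul_of_nonneg_left h1 (by positivity)

lemma rateA_le_sqrt_two_mul_rateB (hd : 2 ≤ d) (h : NiceProfile α ψ) :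
    rateA ψ ≤ Real.sqrt 2 * rateB ψ := by
  have h1 := mul_le_mul_of_nonneg_left (h.sqrt_le_rateB hd) (Real.sqrt_nonneg 2)
  rw [← Real.sqrt_mul (by norm_num), mul_div_cancel₀ _ two_ne_zero] at h1
  exact h.rateA_le_sqrt.trans h1

/-- A lower bound on the total collision rate in terms of the third moment. -/
lemma le_rateA (h : NiceProfile α ψ) {K : ℝ} (hK : 0 < K) :
    (d : ℝ) - 8 * moment ψ 3 ^ 2 / K ≤ K * rateA ψ := by
  have := h.isProbabilityMeasure
  have k3 := h.integrable_prod_bracket h.integrable_bracket_three h.integrable_bracket_three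
  have e3 : ∫ x : E d × E d, bracket x.1 ^ 3 * bracket x.2 ^ 3 ∂(law ψ).prod (law ψ)
      = moment ψ 3 * moment ψ 3 :=
    integral_prod_mul (fun x : E d => bracket x ^ 3) (fun x : E d => bracket x ^ 3)
  have h1 : ∫ x : E d × E d, ‖x.1 - x.2‖ ^ 2 ∂(law ψ).prod (law ψ)
      ≤ ∫ x : E d × E d, (K * ‖x.1 - x.2‖ + 8 / K * (bracket x.1 ^ 3 * bracket x.2 ^ 3))
        ∂(law ψ).prod (law ψ) := by
    refine integral_mono h.integrable_prod_norm_sub_sq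
      ((h.integrable_prod_norm_sub.const_mul K).add (k3.const_mul _)) fun x => ?_
    dsimp only
    set u := ‖x.1 - x.2‖
    have hu : 0 ≤ u := norm_nonneg _
    have hu3 : u ^ 3 ≤ 8 * (bracket x.1 ^ 3 * bracket x.2 ^ 3) := by
      calc _ ≤ (2 * (bracket x.1 * bracket x.2)) ^ 3 :=
            pow_le_pow_left₀ hu (norm_sub_le_bracket_mul _ _) 3
        _ = _ := by ring
    -- The first term dominates for `u ≤ K`, the second for `u ≥ K`.
    have h2 : u ^ 2 ≤ K * u + u ^ 3 / K := by
      have e : K * u + u ^ 3 / K - u ^ 2 = u / K * ((K - u) ^ 2 + K * u) := by field_simp; ring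
      have : 0 ≤ u / K * ((K - u) ^ 2 + K * u) := by positivity
      linarith
    have h3 : u ^ 3 / K ≤ 8 * (bracket x.1 ^ 3 * bracket x.2 ^ 3) / K := by gcongr
    calc _ ≤ _ := h2
      _ ≤ _ := add_le_add_right h3 _
      _ = _ := by ring
  rw [h.integral_prod_norm_sub_sq, integral_add (h.integrable_prod_norm_sub.const_mul K)
    (k3.const_mul _), integral_const_mul, integral_const_mul, ← h.rateA_eq, e3] at h1
  have : 8 / K * (moment ψ 3 * moment ψ 3) = 8 * moment ψ 3 ^ 2 / K := by ring
  linarith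

end NiceProfile

/-- The collision frequency is bounded below by the bracket, uniformly over the profiles. -/
theorem exists_collFreq_lower {d : ℕ} (hd : 2 ≤ d) {αs : ℝ} (hαs : αs < alpha0 d) :
    ∃ c : ℝ, 0 < c ∧ ∀ (α : ℝ) (ψ : E d → ℝ), 0 < α → α < αs → NiceProfile α ψ →
      ∀ v, c * bracket v ≤ collFreq ψ v := by
  have hd0 : (0 : ℝ) < d := by positivity
  obtain ⟨C, hC⟩ := exists_moment_bound hd hαs 3
  -- Chosen so that the third-moment error is at most half of `∫∫|v - w|² = d`.
  set K : ℝ := 16 * (C ^ 2 + 1) / d with hK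
  have hK0 : 0 < K := by positivity
  set a := (d : ℝ) / 2 / K with ha
  have ha0 : 0 < a := by positivity
  refine ⟨min 1 (a / 2) / 2, by positivity, fun α ψ h0 h1 h v => ?_⟩
  have hM := hC α ψ h0 h1 h
  have hM0 : 0 ≤ moment ψ 3 := NiceProfile.moment_nonneg 3
  have h2 := h.le_rateA hK0
  have h3 : 8 * moment ψ 3 ^ 2 / K ≤ d / 2 := by
    rw [div_le_iff₀ hK0, hK]
    have : (d : ℝ) / 2 * (16 * (C ^ 2 + 1) / d) = 8 * (C ^ 2 + 1) := by field_simp; ring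
    rw [this]
    nlinarith
  have h4 : a ≤ rateA ψ := by
    rw [ha, div_le_iff₀ hK0]; linarith
  -- The bound `a/2 ≤ L(v)` serves for small `v` and `|v| ≤ L(v)` for large `v`; their sum dominates
  -- a multiple of `⟨v⟩`.
  have h5 := h.rateA_le_two_mul_collFreq v
  have h6 := h.norm_le_collFreq v
  have h7 := bracket_le v
  have h8 : min 1 (a / 2) ≤ 1 := min_le_left _ _
  have h9 : min 1 (a / 2) ≤ a / 2 := min_le_right _ _
  have h10 : 0 < min 1 (a / 2) := by positivity
  have h11 := mul_le_mul_of_nonneg_left h7 h10.le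
  have h12 := mul_le_mul_of_nonneg_right h8 (norm_nonneg v)
  linarith

/-! ### Coercivity below the second threshold -/

/-- The threshold `α₂` is the reciprocal of the factor in parentheses. -/
lemma alpha2_gap {d : ℕ} {αs : ℝ} (hαs : αs < alpha2 d) :
    αs * (2 + (d : ℝ) / 2 * (1 - 1 / Real.sqrt 2)) < 1 := by
  have hs : 0 < Real.sqrt 2 := Real.sqrt_pos.2 (by norm_num)
  have hs1 : 1 ≤ Real.sqrt 2 := Real.one_le_sqrt.2 (by norm_num)
  have hden : 0 < 4 * Real.sqrt 2 + (d : ℝ) * (Real.sqrt 2 - 1) := by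
    have : 0 ≤ (d : ℝ) * (Real.sqrt 2 - 1) := mul_nonneg (Nat.cast_nonneg d) (by linarith)
    linarith
  unfold alpha2 at hαs
  rw [lt_div_iff₀ hden] at hαs
  have e : αs * (2 + (d : ℝ) / 2 * (1 - 1 / Real.sqrt 2))
      = αs * (4 * Real.sqrt 2 + (d : ℝ) * (Real.sqrt 2 - 1)) / (2 * Real.sqrt 2) := by
    field_simp; ring
  rw [e, div_lt_one (by positivity)]
  exact hαs

/-- Coercivity of the loss term below the second threshold. -/
theorem NiceProfile.coercive {d : ℕ} (hd : 2 ≤ d) {α αs : ℝ} {ψ : E d → ℝ} (h : NiceProfile α ψ)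
    (hα0 : 0 < α) (hα : α < αs) (v : E d) :
    (1 - αs * (2 + (d : ℝ) / 2 * (1 - 1 / Real.sqrt 2))) * collFreq ψ v
      ≤ collFreq ψ v - α * rateA ψ - d / 2 * max 0 (-coefB α ψ) := by
  have hs : 0 < Real.sqrt 2 := Real.sqrt_pos.2 (by norm_num)
  have hs1 : 1 ≤ Real.sqrt 2 := Real.one_le_sqrt.2 (by norm_num)
  have h5 := h.rateA_le_two_mul_collFreq v
  have ha := h.rateA_nonneg
  have hL := h.collFreq_nonneg v
  have h6 : 0 ≤ 1 - 1 / Real.sqrt 2 := by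
    rw [sub_nonneg, div_le_one hs]; exact hs1
  -- A negative drift is limited by `b ≥ a/√2`.
  have h7 : max 0 (-coefB α ψ) ≤ α / 2 * (rateA ψ * (1 - 1 / Real.sqrt 2)) := by
    refine max_le (by positivity) ?_
    rw [h.coefB_eq hd]
    have h8 := h.rateA_le_sqrt_two_mul_rateB hd
    have h9 : rateA ψ / Real.sqrt 2 ≤ rateB ψ := by
      rw [div_le_iff₀ hs]; linarith
    have h10 : rateA ψ * (1 - 1 / Real.sqrt 2) = rateA ψ - rateA ψ / Real.sqrt 2 := by ring
    rw [h10]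
    have := mul_le_mul_of_nonneg_left h9 (show 0 ≤ α / 2 by linarith)
    nlinarith
  have hdn : (0 : ℝ) ≤ d := Nat.cast_nonneg d
  have h11 := mul_le_mul_of_nonneg_left h7 (show 0 ≤ (d : ℝ) / 2 by positivity)
  have h12 : α * rateA ψ + d / 2 * (α / 2 * (rateA ψ * (1 - 1 / Real.sqrt 2)))
      = α * (2 + (d : ℝ) / 2 * (1 - 1 / Real.sqrt 2)) * (rateA ψ / 2) := by ring
  have hP : 0 ≤ 2 + (d : ℝ) / 2 * (1 - 1 / Real.sqrt 2) := by positivity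
  have h13 : α * (2 + (d : ℝ) / 2 * (1 - 1 / Real.sqrt 2)) * (rateA ψ / 2)
      ≤ αs * (2 + (d : ℝ) / 2 * (1 - 1 / Real.sqrt 2)) * collFreq ψ v := by
    refine mul_le_mul (mul_le_mul_of_nonneg_right hα.le hP) (by linarith) (by positivity) ?_
    exact mul_nonneg (by linarith) hP
  linarith

/-! ### Dilations acting on weighted integrable functions -/

section dilation

variable {d : ℕ} {f φ : E d → ℝ} {q : ℕ} {C : ℝ}

lemma bracket_exp_smul_le (t : ℝ) (ξ : E d) :
    bracket (Real.exp t • ξ) ≤ Real.exp |t| * bracket ξ := by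
  refine abs_le_of_sq_le_sq' ?_ (by have := bracket_pos ξ; positivity) |>.2
  rw [mul_pow, bracket_sq, bracket_sq, norm_smul, mul_pow, Real.norm_eq_abs, sq_abs]
  have h1 : Real.exp t ^ 2 ≤ Real.exp |t| ^ 2 := by gcongr; exact le_abs_self t
  have h2 : 1 ≤ Real.exp |t| ^ 2 := one_le_pow₀ (Real.one_le_exp (abs_nonneg t))
  nlinarith [mul_le_mul_of_nonneg_right h1 (sq_nonneg ‖ξ‖)]

lemma abs_dil_le (hC : ∀ ξ, |φ ξ| ≤ C * bracket ξ ^ q) (t : ℝ) (ξ : E d) :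
    |φ (Real.exp t • ξ)| ≤ C * Real.exp |t| ^ q * bracket ξ ^ q := by
  refine (hC _).trans ?_
  rw [mul_assoc, ← mul_pow]
  refine mul_le_mul_of_nonneg_left ?_ (NiceProfile.abs_le_mul_bracket_of_bounded hC)
  exact pow_le_pow_left₀ (bracket_pos _).le (bracket_exp_smul_le t ξ) q

lemma integral_dil_mul (f φ : E d → ℝ) (t : ℝ) :
    ∫ ξ, f (Real.exp t • ξ) * φ ξ
      = Real.exp (-(d * t)) * ∫ ξ, f ξ * φ (Real.exp (-t) • ξ) := by
  have h1 := Measure.integral_comp_smul (volume : Measure (E d))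
    (fun η => f η * φ (Real.exp (-t) • η)) (Real.exp t)
  have h2 : ∀ ξ : E d, Real.exp (-t) • Real.exp t • ξ = ξ := fun ξ => by
    rw [smul_smul, ← Real.exp_add]; simp
  simp only [h2] at h1
  rw [h1, finrank_euclideanSpace_fin, smul_eq_mul, ← Real.exp_nat_mul, ← Real.exp_neg,
    abs_of_pos (Real.exp_pos _)]

lemma integrable_of_mul_bracket (hf : Measurable f)
    (hfq : Integrable fun ξ => f ξ * bracket ξ ^ q) (hφ : Measurable φ)
    (hC : ∀ ξ, |φ ξ| ≤ C * bracket ξ ^ q) : Integrable fun ξ => f ξ * φ ξ := by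
  refine (hfq.norm.const_mul C).mono' (hf.mul hφ).aestronglyMeasurable
    (Eventually.of_forall fun ξ => ?_)
  rw [norm_mul, norm_mul, Real.norm_eq_abs, Real.norm_eq_abs, Real.norm_eq_abs,
    abs_of_nonneg (pow_nonneg (bracket_pos ξ).le q)]
  have := mul_le_mul_of_nonneg_left (hC ξ) (abs_nonneg (f ξ))
  linarith

lemma integrable_mul_dil (hf : Measurable f) (hfq : Integrable fun ξ => f ξ * bracket ξ ^ q)
    (hφ : Measurable φ) (hC : ∀ ξ, |φ ξ| ≤ C * bracket ξ ^ q) (t : ℝ) :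
    Integrable fun ξ => f ξ * φ (Real.exp t • ξ) :=
  integrable_of_mul_bracket hf hfq (hφ.comp (by fun_prop)) (abs_dil_le hC t)

lemma integrable_dil_mul (hf : Measurable f) (hfq : Integrable fun ξ => f ξ * bracket ξ ^ q)
    (hφ : Measurable φ) (hC : ∀ ξ, |φ ξ| ≤ C * bracket ξ ^ q) (t : ℝ) :
    Integrable fun ξ => f (Real.exp t • ξ) * φ ξ := by
  have h1 := (integrable_comp_smul_iff (volume : Measure (E d))
    (fun η => f η * φ (Real.exp (-t) • η)) (Real.exp_pos t).ne').2
      (integrable_mul_dil hf hfq hφ hC (-t))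
  refine h1.congr (Eventually.of_forall fun ξ => ?_)
  have : Real.exp (-t) • Real.exp t • ξ = ξ := by
    rw [smul_smul, ← Real.exp_add]; simp
  simp only [this]

/-- A change of variables moves the dilation onto the smooth factor, so `f` needs no regularity. -/
lemma hasDerivAt_dil (hf : Measurable f) (hfq : Integrable fun ξ => f ξ * bracket ξ ^ q)
    (hφ : ContDiff ℝ (⊤ : ℕ∞) φ) (hC : ∀ ξ, |φ ξ| ≤ C * bracket ξ ^ q)
    (hC' : ∀ ξ, |fderiv ℝ φ ξ ξ| ≤ C * bracket ξ ^ q) (t : ℝ) :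
    HasDerivAt (fun s : ℝ => ∫ ξ, f (Real.exp s • ξ) * φ ξ)
      (-∫ ξ, f (Real.exp t • ξ) * ((d : ℝ) * φ ξ + fderiv ℝ φ ξ ξ)) t := by
  have hφm : Measurable φ := hφ.continuous.measurable
  have hdm : Measurable fun ξ => fderiv ℝ φ ξ ξ :=
    ((hφ.continuous_fderiv (by simp)).clm_apply continuous_id).measurable
  have hC0 := NiceProfile.abs_le_mul_bracket_of_bounded hC
  have hD : ∀ (s : ℝ) (ξ : E d), HasDerivAt
      (fun s : ℝ => f ξ * (Real.exp (-(d * s)) * φ (Real.exp (-s) • ξ)))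
      (f ξ * -(Real.exp (-(d * s)) * ((d : ℝ) * φ (Real.exp (-s) • ξ)
        + fderiv ℝ φ (Real.exp (-s) • ξ) (Real.exp (-s) • ξ)))) s := by
    intro s ξ
    have h1 : HasDerivAt (fun s : ℝ => Real.exp (-s) • ξ) (-Real.exp (-s) • ξ) s := by
      have := ((hasDerivAt_id s).neg.exp).smul_const ξ
      simpa using this
    have h2 : HasDerivAt (fun s : ℝ => Real.exp (-(d * s))) (Real.exp (-(d * s)) * (-(d * 1))) s :=
      (((hasDerivAt_id s).const_mul (d : ℝ)).neg).exp
    have h3 : HasDerivAt (fun s : ℝ => φ (Real.exp (-s) • ξ))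
        (fderiv ℝ φ (Real.exp (-s) • ξ) (-Real.exp (-s) • ξ)) s :=
      ((hφ.differentiable (by simp)) _).hasFDerivAt.comp_hasDerivAt s h1
    refine ((h2.mul h3).const_mul (f ξ)).congr_deriv ?_
    rw [neg_smul, map_neg]; ring
  have hrw : (fun s : ℝ => ∫ ξ, f (Real.exp s • ξ) * φ ξ)
      = fun s => ∫ ξ, f ξ * (Real.exp (-(d * s)) * φ (Real.exp (-s) • ξ)) := by
    funext s
    rw [integral_dil_mul, ← integral_const_mul]
    refine integral_congr_ae (Eventually.of_forall fun ξ => ?_)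
    dsimp only; ring
  have hrw' : -∫ ξ, f (Real.exp t • ξ) * ((d : ℝ) * φ ξ + fderiv ℝ φ ξ ξ)
      = ∫ ξ, f ξ * -(Real.exp (-(d * t)) * ((d : ℝ) * φ (Real.exp (-t) • ξ)
        + fderiv ℝ φ (Real.exp (-t) • ξ) (Real.exp (-t) • ξ))) := by
    rw [integral_dil_mul f (fun ξ => (d : ℝ) * φ ξ + fderiv ℝ φ ξ ξ), ← integral_const_mul,
      ← integral_neg]
    refine integral_congr_ae (Eventually.of_forall fun ξ => ?_)
    dsimp only; ring
  rw [hrw, hrw']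
  set R : ℝ := |t| + 1 with hR
  have hR0 : 0 ≤ R := by positivity
  refine (hasDerivAt_integral_of_dominated_loc_of_deriv_le (s := Metric.ball t 1)
    (F' := fun s ξ => f ξ * -(Real.exp (-(d * s)) * ((d : ℝ) * φ (Real.exp (-s) • ξ)
        + fderiv ℝ φ (Real.exp (-s) • ξ) (Real.exp (-s) • ξ))))
    (bound := fun ξ => (Real.exp (d * R) * ((d + 1) * C * Real.exp R ^ q)) * ‖f ξ * bracket ξ ^ q‖)
    (Metric.ball_mem_nhds t one_pos)
    (Eventually.of_forall fun s => ?_) ?_ ?_ (Eventually.of_forall fun ξ s hs => ?_)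
    (hfq.norm.const_mul _) (Eventually.of_forall fun ξ s _ => hD s ξ)).2
  · exact (hf.mul ((hφm.comp (by fun_prop)).const_mul _)).aestronglyMeasurable
  · refine ((integrable_mul_dil hf hfq hφm hC (-t)).const_mul (Real.exp (-(d * t)))).congr
      (Eventually.of_forall fun ξ => ?_)
    dsimp only; ring
  · have m1 : Measurable fun ξ : E d => φ (Real.exp (-t) • ξ) := hφm.comp (by fun_prop)
    have m2 : Measurable fun ξ : E d => fderiv ℝ φ (Real.exp (-t) • ξ) (Real.exp (-t) • ξ) :=
      hdm.comp (f := fun ξ => Real.exp (-t) • ξ) (by fun_prop)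
    exact Measurable.aestronglyMeasurable (by fun_prop)
  · have hsR : |s| ≤ R := by
      have : |s - t| < 1 := by simpa [Real.dist_eq] using hs
      have := abs_sub_abs_le_abs_sub s t
      linarith
    have hb := pow_nonneg (bracket_pos ξ).le q
    have e1 : Real.exp (-(d * s)) ≤ Real.exp (d * R) := by
      refine Real.exp_le_exp.2 ?_
      have h1 := (neg_le_abs s).trans hsR
      have := mul_le_mul_of_nonneg_left h1 (Nat.cast_nonneg (α := ℝ) d)
      linarith
    have e2 : Real.exp |(-s)| ^ q ≤ Real.exp R ^ q := by
      rw [abs_neg]; gcongr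
    have e3 : C * Real.exp |(-s)| ^ q * bracket ξ ^ q ≤ C * Real.exp R ^ q * bracket ξ ^ q := by
      gcongr
    have e4 := (abs_dil_le hC (-s) ξ).trans e3
    have e5 := (abs_dil_le (φ := fun ξ => fderiv ℝ φ ξ ξ) hC' (-s) ξ).trans e3
    have e6 : |(d : ℝ) * φ (Real.exp (-s) • ξ)
        + fderiv ℝ φ (Real.exp (-s) • ξ) (Real.exp (-s) • ξ)|
        ≤ (d + 1) * C * Real.exp R ^ q * bracket ξ ^ q := by
      refine (abs_add_le _ _).trans ?_
      rw [abs_mul, abs_of_nonneg (Nat.cast_nonneg (α := ℝ) d)]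
      have := mul_le_mul_of_nonneg_left e4 (Nat.cast_nonneg (α := ℝ) d)
      linarith
    rw [norm_mul, norm_neg, norm_mul, norm_mul, Real.norm_eq_abs, Real.norm_eq_abs,
      Real.norm_eq_abs, Real.norm_eq_abs, abs_of_pos (Real.exp_pos _), abs_of_nonneg hb]
    calc _ ≤ |f ξ| * (Real.exp (d * R) * ((d + 1) * C * Real.exp R ^ q * bracket ξ ^ q)) := by
          gcongr
      _ = _ := by ring

lemma integral_abs_dil_mul_le (hfq : Integrable fun ξ => f ξ * bracket ξ ^ q)
    (hC : ∀ ξ, |φ ξ| ≤ C * bracket ξ ^ q) {t R : ℝ} (ht : |t| ≤ R) :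
    ∫ ξ, |f (Real.exp t • ξ) * φ ξ|
      ≤ Real.exp (d * R) * (C * Real.exp R ^ q) * ∫ ξ, |f ξ| * bracket ξ ^ q := by
  have hC0 := NiceProfile.abs_le_mul_bracket_of_bounded hC
  have hfq' : Integrable fun ξ => |f ξ| * bracket ξ ^ q := by
    refine hfq.norm.congr (Eventually.of_forall fun ξ => ?_)
    dsimp only
    rw [norm_mul, Real.norm_eq_abs, Real.norm_eq_abs,
      abs_of_nonneg (pow_nonneg (bracket_pos ξ).le q)]
  simp only [abs_mul]
  rw [integral_dil_mul (fun ξ => |f ξ|) (fun ξ => |φ ξ|), mul_assoc]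
  have e1 : Real.exp (-(d * t)) ≤ Real.exp (d * R) := by
    refine Real.exp_le_exp.2 ?_
    have := mul_le_mul_of_nonneg_left ((neg_le_abs t).trans ht) (Nat.cast_nonneg (α := ℝ) d)
    linarith
  refine mul_le_mul e1 ?_ (integral_nonneg fun ξ => by positivity) (Real.exp_pos _).le
  rw [← integral_const_mul]
  refine integral_mono_of_nonneg (Eventually.of_forall fun ξ => by
    simp only [Pi.zero_apply]; positivity) (hfq'.const_mul _) (Eventually.of_forall fun ξ => ?_)
  have hb := pow_nonneg (bracket_pos ξ).le q
  have e2 : C * Real.exp |(-t)| ^ q * bracket ξ ^ q ≤ C * Real.exp R ^ q * bracket ξ ^ q := by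
    rw [abs_neg]; gcongr
  have := mul_le_mul_of_nonneg_left ((abs_dil_le hC (-t) ξ).trans e2) (abs_nonneg (f ξ))
  dsimp only
  linarith

/-- Justifies exchanging the integrals in the dilation parameter and in `ξ`. -/
lemma integrable_prod_dil (hf : Measurable f) (hfq : Integrable fun ξ => f ξ * bracket ξ ^ q)
    (hφ : Measurable φ) (hC : ∀ ξ, |φ ξ| ≤ C * bracket ξ ^ q) (t : ℝ) :
    Integrable (Function.uncurry fun (s : ℝ) (ξ : E d) => f (Real.exp s • ξ) * φ ξ)
      ((volume.restrict (Set.uIoc 0 t)).prod volume) := by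
  have m1 : Measurable fun p : ℝ × E d => f (Real.exp p.1 • p.2) := hf.comp (by fun_prop)
  have hm : Measurable (Function.uncurry fun (s : ℝ) (ξ : E d) => f (Real.exp s • ξ) * φ ξ) := by
    change Measurable fun p : ℝ × E d => f (Real.exp p.1 • p.2) * φ p.2
    fun_prop
  rw [integrable_prod_iff hm.aestronglyMeasurable]
  refine ⟨Eventually.of_forall fun s => integrable_dil_mul hf hfq hφ hC s, ?_⟩
  refine Integrable.mono' (g := fun _ => Real.exp (d * |t|) * (C * Real.exp |t| ^ q)
    * ∫ ξ, |f ξ| * bracket ξ ^ q) ?_ ?_ ?_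
  · have : IsFiniteMeasure (volume.restrict (Set.uIoc (0 : ℝ) t)) :=
      ⟨by rw [Measure.restrict_apply_univ, Set.uIoc]; exact measure_Ioc_lt_top⟩
    exact integrable_const _
  · exact (hm.stronglyMeasurable.norm.integral_prod_right).aestronglyMeasurable
  · refine (ae_restrict_iff' measurableSet_uIoc).2 (Eventually.of_forall fun s hs => ?_)
    rw [Real.norm_eq_abs, abs_of_nonneg (integral_nonneg fun ξ => norm_nonneg _)]
    refine integral_abs_dil_mul_le hfq hC ?_
    rcases Set.mem_uIoc.1 hs with h | h
    · rw [abs_of_pos h.1]; exact h.2.trans (le_abs_self t)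
    · rw [abs_of_nonpos h.2]; exact (neg_le_neg h.1.le).trans (neg_le_abs t)

/-- Dilations act continuously on weighted integrable functions. -/
lemma continuousAt_dil (hf : Measurable f) (hfq : Integrable fun ξ => f ξ * bracket ξ ^ q)
    (hφ : Measurable φ) (hC : ∀ ξ, |φ ξ| ≤ C * bracket ξ ^ q) :
    ContinuousAt (fun t : ℝ => ∫ ξ, f (Real.exp t • ξ) * φ ξ) 0 := by
  have hC0 := NiceProfile.abs_le_mul_bracket_of_bounded hC
  set K : ℝ := Real.exp (d * 1) * (C * Real.exp 1 ^ q) with hK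
  have hK0 : 0 ≤ K := by positivity
  rw [Metric.continuousAt_iff]
  intro ε hε
  -- The test factor is merely measurable, so continuity must come from `f`: it is approximated in
  -- weighted `L¹` by a continuous function of compact support, uniformly for `|t| ≤ 1`.
  obtain ⟨g, hgs, hg, hgc, hgi⟩ := hfq.exists_hasCompactSupport_integral_sub_le
    (ε := ε / (4 * (K + 1))) (by positivity)
  have hbc : Continuous fun ξ : E d => bracket ξ ^ q := contDiff_bracket.continuous.pow q
  set g' : E d → ℝ := fun ξ => g ξ / bracket ξ ^ q with hg'
  have hg'c : Continuous g' := hgc.div hbc fun ξ => (pow_pos (bracket_pos ξ) q).ne'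
  have hg's : HasCompactSupport g' := by
    refine hgs.mono fun ξ hξ => ?_
    simp only [hg', Function.mem_support] at hξ ⊢
    intro h0; rw [h0, zero_div] at hξ; exact hξ rfl
  have hg'q : ∀ ξ, g' ξ * bracket ξ ^ q = g ξ := fun ξ =>
    div_mul_cancel₀ _ (pow_pos (bracket_pos ξ) q).ne'
  have hg'i : Integrable fun ξ => g' ξ * bracket ξ ^ q := by simpa only [hg'q] using hgi
  have hdm : Measurable fun ξ => f ξ - g' ξ := hf.sub hg'c.measurable
  have hdi : Integrable fun ξ => (f ξ - g' ξ) * bracket ξ ^ q := by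
    refine (hfq.sub hg'i).congr (Eventually.of_forall fun ξ => ?_)
    simp only [Pi.sub_apply]; ring
  have hdε : ∫ ξ, |f ξ - g' ξ| * bracket ξ ^ q ≤ ε / (4 * (K + 1)) := by
    refine le_trans (le_of_eq (integral_congr_ae (Eventually.of_forall fun ξ => ?_))) hg
    dsimp only
    rw [← hg'q ξ, ← sub_mul, norm_mul, Real.norm_eq_abs, Real.norm_eq_abs,
      abs_of_nonneg (pow_nonneg (bracket_pos ξ).le q)]
  have hclose : ∀ t : ℝ, |t| ≤ 1 →
      |(∫ ξ, f (Real.exp t • ξ) * φ ξ) - ∫ ξ, g' (Real.exp t • ξ) * φ ξ| ≤ ε / 4 := by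
    intro t ht
    rw [← integral_sub (integrable_dil_mul hf hfq hφ hC t)
      (integrable_dil_mul hg'c.measurable hg'i hφ hC t)]
    refine (abs_integral_le_integral_abs).trans ?_
    have h1 := integral_abs_dil_mul_le hdi hC ht
    rw [← hK] at h1
    calc _ = ∫ ξ, |(f (Real.exp t • ξ) - g' (Real.exp t • ξ)) * φ ξ| := by
          simp only [sub_mul]
      _ ≤ _ := h1
      _ ≤ K * (ε / (4 * (K + 1))) := by gcongr
      _ = K / (K + 1) * (ε / 4) := by field_simp
      _ ≤ 1 * (ε / 4) := by
          refine mul_le_mul_of_nonneg_right ?_ (by positivity)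
          rw [div_le_one (by positivity)]; linarith
      _ = _ := one_mul _
  have hcont : ContinuousAt (fun t : ℝ => ∫ ξ, g' (Real.exp t • ξ) * φ ξ) 0 := by
    obtain ⟨B, hB⟩ := hg'c.bounded_above_of_compact_support hg's
    obtain ⟨r, hr⟩ := hg's.isCompact.isBounded.subset_closedBall (0 : E d)
    have hB0 : 0 ≤ B := (norm_nonneg _).trans (hB 0)
    refine continuousAt_of_dominated (bound := (Metric.closedBall (0 : E d)
      (Real.exp 1 * r)).indicator fun ξ => B * (C * bracket ξ ^ q))
      (Eventually.of_forall fun t => ?_) ?_ ?_ (Eventually.of_forall fun ξ => ?_)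
    · exact ((hg'c.measurable.comp (by fun_prop)).mul hφ).aestronglyMeasurable
    · filter_upwards [Metric.ball_mem_nhds (0 : ℝ) one_pos] with t ht
      refine Eventually.of_forall fun ξ => ?_
      by_cases hξ : ξ ∈ Metric.closedBall (0 : E d) (Real.exp 1 * r)
      · rw [Set.indicator_of_mem hξ, norm_mul]
        exact mul_le_mul (hB _) (hC ξ) (norm_nonneg _) hB0
      · rw [Set.indicator_of_notMem hξ]
        have : g' (Real.exp t • ξ) = 0 := by
          by_contra hne
          have h1 := hr (subset_tsupport g' (Function.mem_support.2 hne))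
          rw [mem_closedBall_zero_iff, norm_smul, Real.norm_eq_abs,
            abs_of_pos (Real.exp_pos t)] at h1
          refine hξ ?_
          rw [mem_closedBall_zero_iff]
          have ht' : |t| < 1 := by simpa [Real.dist_eq] using ht
          have h2 : Real.exp (-t) ≤ Real.exp 1 :=
            Real.exp_le_exp.2 ((neg_le_abs t).trans ht'.le)
          have hr0 : 0 ≤ r := (by positivity : 0 ≤ Real.exp t * ‖ξ‖).trans h1
          calc ‖ξ‖ = Real.exp (-t) * (Real.exp t * ‖ξ‖) := by
                rw [← mul_assoc, ← Real.exp_add]; simp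
            _ ≤ Real.exp (-t) * r := by gcongr
            _ ≤ _ := by gcongr
        rw [this]; simp
    · rw [integrable_indicator_iff measurableSet_closedBall]
      exact ((continuous_const.mul (continuous_const.mul hbc)).continuousOn).integrableOn_compact
        (isCompact_closedBall _ _)
    · refine Continuous.continuousAt ?_
      exact (hg'c.comp (Real.continuous_exp.smul continuous_const)).mul continuous_const
  obtain ⟨δ, hδ, hδ'⟩ := Metric.continuousAt_iff.1 hcont (ε / 4) (by positivity)
  refine ⟨min δ 1, by positivity, fun t ht => ?_⟩
  have h1 := hδ' (lt_of_lt_of_le ht (min_le_left _ _))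
  have ht1 : |t| ≤ 1 := by
    have := lt_of_lt_of_le ht (min_le_right _ _)
    rw [Real.dist_eq, sub_zero] at this; exact this.le
  have h2 := hclose t ht1
  have h3 := hclose 0 (by simp)
  rw [Real.dist_eq] at h1 ⊢
  rw [abs_lt] at h1 ⊢
  rw [abs_le] at h2 h3
  constructor <;> linarith [h1.1, h1.2, h2.1, h2.2, h3.1, h3.2]

end dilation

/-! ### Renormalization of the transport equation -/

/-- The right-hand side `𝔹_α(ψ,ψ) - 𝐀_ψ ψ` of the transport equation. -/
def transportSource {d : ℕ} (α : ℝ) (ψ : E d → ℝ) (ξ : E d) : ℝ := annih α ψ ξ - coefA α ψ * ψ ξ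

/-- A `C¹` convex function, quadratic on `[0, M]` and affine beyond. -/
def truncSq (M s : ℝ) : ℝ := 2 * s * min s M - min s M ^ 2

/-- The tangent inequality for a convex function with derivative `2 min(s, M)`. -/
lemma truncSq_convex (M r s : ℝ) : 2 * min s M * (r - s) ≤ truncSq M r - truncSq M s := by
  unfold truncSq
  rcases le_total s M with hs | hs <;> rcases le_total r M with hr | hr
  · rw [min_eq_left hs, min_eq_left hr]; nlinarith [sq_nonneg (r - s)]
  · rw [min_eq_left hs, min_eq_right hr]
    nlinarith [mul_nonneg (sub_nonneg.2 hs) (sub_nonneg.2 hr), sq_nonneg (M - s)]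
  · rw [min_eq_right hs, min_eq_left hr]; nlinarith [sq_nonneg (M - r)]
  · rw [min_eq_right hs, min_eq_right hr]; nlinarith

/-- Together with `truncSq_le`, compares the renormalization with the quantity `s min(s, M)`
produced by testing. The two agree only below the truncation level. -/
lemma mul_min_le_truncSq {M s : ℝ} (hM : 0 ≤ M) (hs : 0 ≤ s) : s * min s M ≤ truncSq M s := by
  unfold truncSq
  nlinarith [mul_nonneg (sub_nonneg.2 (min_le_left s M)) (le_min hs hM)]

lemma truncSq_le {M s : ℝ} : truncSq M s ≤ 2 * (s * min s M) := by
  unfold truncSq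
  nlinarith [sq_nonneg (min s M)]

namespace NiceProfile

variable {d : ℕ} {α : ℝ} {ψ : E d → ℝ}

lemma measurable_Qplus (h : NiceProfile α ψ) : Measurable (Qplus ψ ψ) := by
  have : Qplus ψ ψ = fun v => (gain ψ v).toReal :=
    funext fun v => Qplus_eq_toReal_gain h.meas h.nonneg v
  rw [this]; exact (measurable_gain h.meas).ennreal_toReal

lemma measurable_annih (h : NiceProfile α ψ) : Measurable (annih α ψ) := by
  unfold annih Qminus
  exact (h.measurable_Qplus.const_mul _).sub (h.meas.mul h.measurable_collFreq)

lemma measurable_transportSource (h : NiceProfile α ψ) : Measurable (transportSource α ψ) :=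
  h.measurable_annih.sub (h.meas.const_mul _)

lemma integrable_mul_bracket_pow (hd : 2 ≤ d) (h : NiceProfile α ψ) (hα0 : 0 < α) (hα1 : α ≤ 1)
    (q : ℕ) : Integrable fun ξ => ψ ξ * bracket ξ ^ q :=
  (integrable_law_iff h.meas h.nonneg _).1 (h.integrable_pow hd hα0 hα1 q)

lemma integrable_annih_mul_bracket (hd : 2 ≤ d) (h : NiceProfile α ψ) (hα0 : 0 < α) (hα1 : α ≤ 1)
    (q : ℕ) : Integrable fun ξ => annih α ψ ξ * bracket ξ ^ q := by
  have hC : ∀ ξ : E d, |bracket ξ ^ q| ≤ 1 * bracket ξ ^ q := fun ξ => by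
    rw [abs_of_nonneg (pow_nonneg (bracket_pos ξ).le q), one_mul]
  have i1 := h.integrable_Qplus_mul hd (h.integrable_pow hd hα0 hα1 (q + 1)) (by fun_prop) hC
    zero_le_one
  have i2 := h.integrable_Qminus_mul (h.integrable_pow hd hα0 hα1 (q + 1)) (by fun_prop) hC
  refine ((i1.const_mul (1 - α)).sub i2).congr (Eventually.of_forall fun ξ => ?_)
  simp only [annih, Pi.sub_apply]; ring

lemma integrable_transportSource_mul_bracket (hd : 2 ≤ d) (h : NiceProfile α ψ) (hα0 : 0 < α)
    (hα1 : α ≤ 1) (q : ℕ) : Integrable fun ξ => transportSource α ψ ξ * bracket ξ ^ q := by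
  refine ((h.integrable_annih_mul_bracket hd hα0 hα1 q).sub
    ((h.integrable_mul_bracket_pow hd hα0 hα1 q).const_mul (coefA α ψ))).congr
      (Eventually.of_forall fun ξ => ?_)
  simp only [transportSource, Pi.sub_apply]; ring

lemma weak_transport (hd : 2 ≤ d) (h : NiceProfile α ψ) (hα0 : 0 < α) (hα1 : α ≤ 1) {φ : E d → ℝ}
    (hφ : ContDiff ℝ (⊤ : ℕ∞) φ) (hc : HasCompactSupport φ) :
    -(coefB α ψ * ∫ ξ, ψ ξ * ((d : ℝ) * φ ξ + fderiv ℝ φ ξ ξ))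
      = ∫ ξ, transportSource α ψ ξ * φ ξ := by
  obtain ⟨C, hC⟩ := hφ.continuous.bounded_above_of_compact_support hc
  have hC' : ∀ ξ, |φ ξ| ≤ C * bracket ξ ^ 0 := fun ξ => by simpa using hC ξ
  have hφm := hφ.continuous.measurable
  have i1 := integrable_of_mul_bracket h.measurable_annih
    (h.integrable_annih_mul_bracket hd hα0 hα1 0) hφm hC'
  have i2 := integrable_of_mul_bracket h.meas
    (h.integrable_mul_bracket_pow hd hα0 hα1 0) hφm hC'
  have e : ∫ ξ, transportSource α ψ ξ * φ ξ
      = (∫ ξ, annih α ψ ξ * φ ξ) - coefA α ψ * ∫ ξ, ψ ξ * φ ξ := by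
    rw [← integral_const_mul, ← integral_sub i1 (i2.const_mul _)]
    refine integral_congr_ae (Eventually.of_forall fun ξ => ?_)
    simp only [transportSource]; ring
  rw [e, ← h.prof.solution φ hφ hc]
  ring

/-- The equation integrated along the dilation flow: formally `B ∂ₜ ψ(eᵗξ)` is the source evaluated
at `eᵗξ`. -/
lemma dilation_smooth (hd : 2 ≤ d) (h : NiceProfile α ψ) (hα0 : 0 < α) (hα1 : α ≤ 1)
    {φ : E d → ℝ} (hφ : ContDiff ℝ (⊤ : ℕ∞) φ) (hc : HasCompactSupport φ) (t : ℝ) :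
    coefB α ψ * ((∫ ξ, ψ (Real.exp t • ξ) * φ ξ) - ∫ ξ, ψ ξ * φ ξ)
      = ∫ s in (0 : ℝ)..t, ∫ ξ, transportSource α ψ (Real.exp s • ξ) * φ ξ := by
  have hcd : Continuous fun y : E d => fderiv ℝ φ y y :=
    (hφ.continuous_fderiv (by simp)).clm_apply continuous_id
  have hsd : HasCompactSupport fun y : E d => fderiv ℝ φ y y := by
    refine (hc.fderiv (𝕜 := ℝ)).mono fun y hy => ?_
    simp only [Function.mem_support] at hy ⊢
    intro h0; rw [h0] at hy; simp at hy
  obtain ⟨C₁, hC₁⟩ := hφ.continuous.bounded_above_of_compact_support hc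
  obtain ⟨C₂, hC₂⟩ := hcd.bounded_above_of_compact_support hsd
  have hC : ∀ ξ, |φ ξ| ≤ max C₁ C₂ * bracket ξ ^ 0 := fun ξ => by
    simpa using Or.inl (hC₁ ξ)
  have hC' : ∀ ξ, |fderiv ℝ φ ξ ξ| ≤ max C₁ C₂ * bracket ξ ^ 0 := fun ξ => by
    simpa using Or.inr (hC₂ ξ)
  have hw : ∀ s : ℝ, -(coefB α ψ * ∫ ξ, ψ (Real.exp s • ξ) * ((d : ℝ) * φ ξ + fderiv ℝ φ ξ ξ))
      = ∫ ξ, transportSource α ψ (Real.exp s • ξ) * φ ξ := by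
    intro s
    rw [integral_dil_mul (transportSource α ψ) φ,
      integral_dil_mul ψ (fun ξ => (d : ℝ) * φ ξ + fderiv ℝ φ ξ ξ)]
    have h1 := h.weak_transport hd hα0 hα1 (φ := fun x => φ (Real.exp (-s) • x))
      (hφ.comp (contDiff_const_smul _)) (hc.comp_smul (Real.exp_pos _).ne')
    have h2 : ∀ ξ, fderiv ℝ (fun x => φ (Real.exp (-s) • x)) ξ ξ
        = fderiv ℝ φ (Real.exp (-s) • ξ) (Real.exp (-s) • ξ) := by
      intro ξ
      rw [fderiv_comp_smul]
      simp
    simp only [h2] at h1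
    rw [← h1]
    ring
  have hder : ∀ s : ℝ, HasDerivAt (fun s : ℝ => coefB α ψ * ∫ ξ, ψ (Real.exp s • ξ) * φ ξ)
      (∫ ξ, transportSource α ψ (Real.exp s • ξ) * φ ξ) s := by
    intro s
    refine ((hasDerivAt_dil h.meas (h.integrable_mul_bracket_pow hd hα0 hα1 0) hφ hC hC' s).const_mul
      (coefB α ψ)).congr_deriv ?_
    rw [← hw s]; ring
  have hcont : Continuous fun s : ℝ => ∫ ξ, transportSource α ψ (Real.exp s • ξ) * φ ξ :=
    continuous_iff_continuousAt.2 fun s => (hasDerivAt_dil h.measurable_transportSource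
      (h.integrable_transportSource_mul_bracket hd hα0 hα1 0) hφ hC hC' s).continuousAt
  rw [intervalIntegral.integral_eq_sub_of_hasDerivAt (fun s _ => hder s)
    (hcont.intervalIntegrable _ _)]
  simp only [Real.exp_zero, one_smul]
  ring

lemma dilation_ae (hd : 2 ≤ d) (h : NiceProfile α ψ) (hα0 : 0 < α) (hα1 : α ≤ 1) (t : ℝ) :
    ∀ᵐ ξ, coefB α ψ * (ψ (Real.exp t • ξ) - ψ ξ)
      = ∫ s in (0 : ℝ)..t, transportSource α ψ (Real.exp s • ξ) := by
  have iψ : Integrable ψ := by simpa using h.integrable_mul_bracket_pow hd hα0 hα1 0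
  have iψt : Integrable fun ξ => ψ (Real.exp t • ξ) :=
    (integrable_comp_smul_iff _ ψ (Real.exp_pos t).ne').2 iψ
  have hone : ∀ ξ : E d, |(1 : ℝ)| ≤ 1 * bracket ξ ^ 0 := fun ξ => by simp
  have ip := integrable_prod_dil h.measurable_transportSource
    (h.integrable_transportSource_mul_bracket hd hα0 hα1 0) (φ := fun _ => 1) measurable_const hone t
  have is : Integrable fun ξ => ∫ s in (0 : ℝ)..t, transportSource α ψ (Real.exp s • ξ) := by
    have := ip.integral_prod_right
    simp only [Function.uncurry, mul_one] at this
    simp only [intervalIntegral.intervalIntegral_eq_integral_uIoc]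
    exact this.smul (if (0 : ℝ) ≤ t then (1 : ℝ) else -1)
  refine ae_eq_of_integral_contDiff_smul_eq ((iψt.sub iψ).const_mul _).locallyIntegrable
    is.locallyIntegrable fun φ hφ hc => ?_
  obtain ⟨C, hC⟩ := hφ.continuous.bounded_above_of_compact_support hc
  have hC' : ∀ ξ, |φ ξ| ≤ C * bracket ξ ^ 0 := fun ξ => by simpa using hC ξ
  have hφm := hφ.continuous.measurable
  have hsm := h.dilation_smooth hd hα0 hα1 hφ hc t
  rw [intervalIntegral_integral_swap (integrable_prod_dil h.measurable_transportSource
    (h.integrable_transportSource_mul_bracket hd hα0 hα1 0) hφm hC' t), ← integral_sub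
    (integrable_dil_mul h.meas (h.integrable_mul_bracket_pow hd hα0 hα1 0) hφm hC' t)
    (integrable_of_mul_bracket h.meas (h.integrable_mul_bracket_pow hd hα0 hα1 0) hφm hC'),
    ← integral_const_mul] at hsm
  refine Eq.trans (integral_congr_ae (Eventually.of_forall fun ξ => ?_)) (hsm.trans
    (integral_congr_ae (Eventually.of_forall fun ξ => ?_)))
  · simp only [smul_eq_mul]; ring
  · simp only [smul_eq_mul]
    rw [intervalIntegral.integral_mul_const, mul_comm]

/-- The pointwise form of the identity admits nonsmooth test functions, in particular ones built
from `ψ` itself. -/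
lemma dilation_weak (hd : 2 ≤ d) (h : NiceProfile α ψ) (hα0 : 0 < α) (hα1 : α ≤ 1)
    {φ : E d → ℝ} (hφ : Measurable φ) {C : ℝ} {q : ℕ} (hC : ∀ ξ, |φ ξ| ≤ C * bracket ξ ^ q)
    (t : ℝ) :
    ∫ ξ, coefB α ψ * (ψ (Real.exp t • ξ) - ψ ξ) * φ ξ
      = ∫ s in (0 : ℝ)..t, ∫ ξ, transportSource α ψ (Real.exp s • ξ) * φ ξ := by
  rw [intervalIntegral_integral_swap (integrable_prod_dil h.measurable_transportSource
    (h.integrable_transportSource_mul_bracket hd hα0 hα1 q) hφ hC t)]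
  refine integral_congr_ae ?_
  filter_upwards [h.dilation_ae hd hα0 hα1 t] with ξ hξ
  rw [hξ, intervalIntegral.integral_mul_const]

/-- The renormalized transport identity. -/
theorem renormalized (hd : 2 ≤ d) (h : NiceProfile α ψ) (hα0 : 0 < α) (hα1 : α ≤ 1)
    {w : E d → ℝ} (hw : ContDiff ℝ (⊤ : ℕ∞) w) (hw0 : ∀ ξ, 0 ≤ w ξ) {C : ℝ} {q : ℕ}
    (hC : ∀ ξ, |w ξ| ≤ C * bracket ξ ^ q) (hC' : ∀ ξ, |fderiv ℝ w ξ ξ| ≤ C * bracket ξ ^ q)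
    {M : ℝ} (hM : 0 ≤ M) :
    -(coefB α ψ * ∫ ξ, truncSq M (ψ ξ) * ((d : ℝ) * w ξ + fderiv ℝ w ξ ξ))
      = ∫ ξ, transportSource α ψ ξ * (2 * min (ψ ξ) M * w ξ) := by
  have hψ := h.meas
  have hwm := hw.continuous.measurable
  have hC0 := abs_le_mul_bracket_of_bounded hC
  set B := coefB α ψ with hB
  set φ : E d → ℝ := fun ξ => 2 * min (ψ ξ) M * w ξ with hφd
  have hφm : Measurable φ := by fun_prop
  have hT0 : ∀ ξ, 0 ≤ min (ψ ξ) M := fun ξ => le_min (h.nonneg ξ) hM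
  have hφC : ∀ ξ, |φ ξ| ≤ (2 * M * C) * bracket ξ ^ q := by
    intro ξ
    simp only [hφd]
    rw [abs_mul, abs_of_nonneg (mul_nonneg zero_le_two (hT0 ξ)), mul_assoc (2 * M)]
    exact mul_le_mul (mul_le_mul_of_nonneg_left (min_le_right _ _) zero_le_two) (hC ξ)
      (abs_nonneg _) (by positivity)
  have hβm : Measurable fun ξ => truncSq M (ψ ξ) := by unfold truncSq; fun_prop
  have hβ0 : ∀ ξ, 0 ≤ truncSq M (ψ ξ) := fun ξ =>
    (mul_nonneg (h.nonneg ξ) (hT0 ξ)).trans (mul_min_le_truncSq hM (h.nonneg ξ))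
  have hβi : Integrable fun ξ => truncSq M (ψ ξ) * bracket ξ ^ q := by
    refine ((h.integrable_mul_bracket_pow hd hα0 hα1 q).const_mul (2 * M)).mono'
      (Measurable.aestronglyMeasurable (by fun_prop)) (Eventually.of_forall fun ξ => ?_)
    have hb := pow_nonneg (bracket_pos ξ).le q
    rw [Real.norm_eq_abs, abs_of_nonneg (mul_nonneg (hβ0 ξ) hb)]
    have h1 := mul_le_mul_of_nonneg_left (min_le_right (ψ ξ) M) (h.nonneg ξ)
    have h2 : truncSq M (ψ ξ) ≤ 2 * M * ψ ξ := truncSq_le.trans (by linarith)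
    have := mul_le_mul_of_nonneg_right h2 hb
    linarith
  have hψi := h.integrable_mul_bracket_pow hd hα0 hα1 q
  have hsi := h.integrable_transportSource_mul_bracket hd hα0 hα1 q
  have hsm := h.measurable_transportSource
  have hK : ContinuousAt (fun t : ℝ => ∫ ξ, transportSource α ψ (Real.exp t • ξ) * φ ξ) 0 :=
    continuousAt_dil hsm hsi hφm hφC
  have hKm : StronglyMeasurable
      fun t : ℝ => ∫ ξ, transportSource α ψ (Real.exp t • ξ) * φ ξ := by
    have m1 : Measurable fun p : ℝ × E d => transportSource α ψ (Real.exp p.1 • p.2) :=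
      hsm.comp (by fun_prop)
    have m2 : StronglyMeasurable fun p : ℝ × E d =>
      transportSource α ψ (Real.exp p.1 • p.2) * φ p.2 := Measurable.stronglyMeasurable (by fun_prop)
    exact m2.integral_prod_right
  have hprim : HasDerivAt (fun t : ℝ => ∫ ξ, B * (ψ (Real.exp t • ξ) - ψ ξ) * φ ξ)
      (∫ ξ, transportSource α ψ ξ * φ ξ) 0 := by
    have h1 := intervalIntegral.integral_hasDerivAt_right (a := 0) (b := 0) (by simp)
      hKm.stronglyMeasurableAtFilter hK
    simp only [Real.exp_zero, one_smul] at h1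
    refine h1.congr_of_eventuallyEq (Eventually.of_forall fun t => ?_)
    exact h.dilation_weak hd hα0 hα1 hφm hφC t
  -- Without drift there is nothing to differentiate: the source is then orthogonal to every
  -- admissible test function.
  by_cases hB0 : B = 0
  · rw [hB0] at hprim ⊢
    simp only [zero_mul, integral_zero] at hprim
    rw [zero_mul, neg_zero]
    exact (hasDerivAt_const (0 : ℝ) (0 : ℝ)).unique hprim
  have hβd := hasDerivAt_dil hβm hβi hw hC hC' 0
  simp only [Real.exp_zero, one_smul] at hβd
  -- Convexity makes `F` minimal at `t = 0`, and its derivative there is the defect of the identity.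
  -- The factor `B²` keeps the inequality valid for either sign of `B`.
  set F : ℝ → ℝ := fun t => B ^ 2 * (∫ ξ, truncSq M (ψ (Real.exp t • ξ)) * w ξ)
    - B * ∫ ξ, B * (ψ (Real.exp t • ξ) - ψ ξ) * φ ξ with hF
  have hFd : HasDerivAt F (B ^ 2 * (-∫ ξ, truncSq M (ψ ξ) * ((d : ℝ) * w ξ + fderiv ℝ w ξ ξ))
      - B * ∫ ξ, transportSource α ψ ξ * φ ξ) 0 :=
    (hβd.const_mul _).sub (hprim.const_mul _)
  have hmin : IsLocalMin F 0 := by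
    refine Eventually.of_forall fun t => ?_
    have i1 := integrable_dil_mul hβm hβi hwm hC t
    have i0 := integrable_of_mul_bracket hβm hβi hwm hC
    have j1 := integrable_dil_mul h.meas hψi hφm hφC t
    have j0 := integrable_of_mul_bracket h.meas hψi hφm hφC
    have e1 : ∫ ξ, B * (ψ (Real.exp t • ξ) - ψ ξ) * φ ξ
        = B * ((∫ ξ, ψ (Real.exp t • ξ) * φ ξ) - ∫ ξ, ψ ξ * φ ξ) := by
      rw [← integral_sub j1 j0, ← integral_const_mul]
      refine integral_congr_ae (Eventually.of_forall fun ξ => ?_)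
      dsimp only; ring
    have hle : (∫ ξ, ψ (Real.exp t • ξ) * φ ξ) - ∫ ξ, ψ ξ * φ ξ
        ≤ (∫ ξ, truncSq M (ψ (Real.exp t • ξ)) * w ξ) - ∫ ξ, truncSq M (ψ ξ) * w ξ := by
      rw [← integral_sub j1 j0, ← integral_sub i1 i0]
      refine integral_mono (j1.sub j0) (i1.sub i0) fun ξ => ?_
      have := mul_le_mul_of_nonneg_right (truncSq_convex M (ψ (Real.exp t • ξ)) (ψ ξ)) (hw0 ξ)
      simp only [hφd]
      nlinarith
    simp only [hF, Real.exp_zero, one_smul, sub_self, mul_zero, zero_mul, integral_zero, sub_zero]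
    rw [e1]
    have := mul_le_mul_of_nonneg_left hle (sq_nonneg B)
    nlinarith
  have h0 := hmin.hasDerivAt_eq_zero hFd
  have h1 : B * (B * (-∫ ξ, truncSq M (ψ ξ) * ((d : ℝ) * w ξ + fderiv ℝ w ξ ξ))
      - ∫ ξ, transportSource α ψ ξ * φ ξ) = 0 := by rw [← h0]; ring
  rcases mul_eq_zero.1 h1 with h2 | h2
  · exact absurd h2 hB0
  · rw [sub_eq_zero] at h2
    rw [← h2]; ring

end NiceProfile

/-! ### The weighted energy inequality -/

/-- The polynomial weight `(1 + ε|ξ|²)^K`. -/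
def weight {d : ℕ} (ε : ℝ) (K : ℕ) (ξ : E d) : ℝ := (1 + ε * ‖ξ‖ ^ 2) ^ K

section weight

variable {d : ℕ} {ε : ℝ} {K : ℕ}

@[fun_prop]
lemma measurable_weight {X : Type*} [MeasurableSpace X] {f : X → E d} (hf : Measurable f) :
    Measurable fun x => weight ε K (f x) := by
  unfold weight; fun_prop

lemma one_le_weight (hε : 0 ≤ ε) (ξ : E d) : 1 ≤ weight ε K ξ :=
  one_le_pow₀ (le_add_of_nonneg_right (by positivity))

lemma weight_pos (hε : 0 ≤ ε) (ξ : E d) : 0 < weight ε K ξ :=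
  lt_of_lt_of_le one_pos (one_le_weight hε ξ)

lemma weight_le (hε : 0 ≤ ε) (hε1 : ε ≤ 1) (ξ : E d) : weight ε K ξ ≤ bracket ξ ^ (2 * K) := by
  rw [pow_mul, bracket_sq]
  unfold weight
  have := mul_le_mul_of_nonneg_right hε1 (sq_nonneg ‖ξ‖)
  gcongr
  linarith

lemma le_weight (hε : 0 ≤ ε) (hε1 : ε ≤ 1) (ξ : E d) : ε ^ K * bracket ξ ^ (2 * K) ≤ weight ε K ξ := by
  rw [pow_mul, bracket_sq, ← mul_pow]
  unfold weight
  gcongr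
  linarith

/-- Submultiplicativity with constant one, from `|v'|² ≤ |v|² + |w|²`. -/
lemma weight_post_le (hε : 0 ≤ ε) (v w : E d) (σ : Sph d) :
    weight ε K (post v w σ) ≤ weight ε K v * weight ε K w := by
  unfold weight
  rw [← mul_pow]
  refine pow_le_pow_left₀ (by positivity) ?_ K
  have := mul_le_mul_of_nonneg_left (norm_sq_post_le v w σ) hε
  have : 0 ≤ (ε * ‖v‖ ^ 2) * (ε * ‖w‖ ^ 2) := by positivity
  nlinarith

lemma contDiff_weight : ContDiff ℝ (⊤ : ℕ∞) (fun ξ : E d => weight ε K ξ) := by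
  unfold weight
  exact (contDiff_const.add (contDiff_const.mul (contDiff_norm_sq ℝ))).pow K

lemma fderiv_weight (ξ : E d) : fderiv ℝ (fun x : E d => weight ε K x) ξ ξ
    = (K : ℝ) * (1 + ε * ‖ξ‖ ^ 2) ^ (K - 1) * (2 * (ε * ‖ξ‖ ^ 2)) := by
  have h1 : HasDerivAt (fun s : ℝ => 1 + ε * s) (ε * 1) (‖ξ‖ ^ 2) :=
    ((hasDerivAt_id _).const_mul ε).const_add 1
  have h2 := fderiv_radial (ξ := ξ) (h1.pow K)
  have h3 : fderiv ℝ (fun x : E d => weight ε K x) ξ ξ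
    = fderiv ℝ (fun x : E d => ((fun s : ℝ => 1 + ε * s) ^ K) (‖x‖ ^ 2)) ξ ξ := rfl
  rw [h3, h2]
  ring

lemma fderiv_weight_nonneg (hε : 0 ≤ ε) (ξ : E d) :
    0 ≤ fderiv ℝ (fun x : E d => weight ε K x) ξ ξ := by
  rw [fderiv_weight]; positivity

/-- The drift of the weight is small with `√ε`, at the price of a factor `|ξ|` that the collision
frequency absorbs. This is why the weight carries `ε`. -/
lemma fderiv_weight_le (hε : 0 ≤ ε) (ξ : E d) :
    fderiv ℝ (fun x : E d => weight ε K x) ξ ξ ≤ K * Real.sqrt ε * ‖ξ‖ * weight ε K ξ := by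
  rw [fderiv_weight]
  unfold weight
  rcases K with _ | n
  · simp
  rw [Nat.add_sub_cancel]
  have hs := Real.sq_sqrt hε
  -- This is `2x² ≤ x(1 + x²)` with `x = √ε|ξ|`.
  have h1 : 2 * (ε * ‖ξ‖ ^ 2) ≤ Real.sqrt ε * ‖ξ‖ * (1 + ε * ‖ξ‖ ^ 2) := by
    have h2 : 0 ≤ Real.sqrt ε * ‖ξ‖ * (1 - Real.sqrt ε * ‖ξ‖) ^ 2 := by positivity
    have h3 : Real.sqrt ε * ‖ξ‖ * (1 - Real.sqrt ε * ‖ξ‖) ^ 2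
        = Real.sqrt ε * ‖ξ‖ * (1 + Real.sqrt ε ^ 2 * ‖ξ‖ ^ 2)
          - 2 * (Real.sqrt ε ^ 2 * ‖ξ‖ ^ 2) := by ring
    rw [h3, hs] at h2
    linarith
  have h4 := mul_le_mul_of_nonneg_left h1
    (show 0 ≤ ((n + 1 : ℕ) : ℝ) * (1 + ε * ‖ξ‖ ^ 2) ^ n by positivity)
  refine h4.trans (le_of_eq ?_)
  ring

lemma fderiv_weight_le' (hε : 0 ≤ ε) (ξ : E d) :
    fderiv ℝ (fun x : E d => weight ε K x) ξ ξ ≤ 2 * K * weight ε K ξ := by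
  rw [fderiv_weight]
  unfold weight
  rcases K with _ | n
  · simp
  rw [Nat.add_sub_cancel]
  have h4 := mul_le_mul_of_nonneg_left (show 2 * (ε * ‖ξ‖ ^ 2) ≤ 2 * (1 + ε * ‖ξ‖ ^ 2) by linarith)
    (show 0 ≤ ((n + 1 : ℕ) : ℝ) * (1 + ε * ‖ξ‖ ^ 2) ^ n by positivity)
  refine h4.trans (le_of_eq ?_)
  ring

end weight

lemma alpha_le_one {d : ℕ} (hd : 2 ≤ d) {α αs : ℝ} (hαs : αs < alpha0 d) (h1 : α < αs) :
    α ≤ 1 := by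
  have := alpha0_lt_one hd
  linarith

lemma exists_coefB_bound {d : ℕ} (hd : 2 ≤ d) {αs : ℝ} (hαs : αs < alpha0 d) :
    ∃ C : ℝ, ∀ (α : ℝ) (ψ : E d → ℝ), 0 < α → α < αs → NiceProfile α ψ → |coefB α ψ| ≤ C := by
  obtain ⟨C, hC⟩ := exists_moment_bound hd hαs 3
  refine ⟨2 / (d : ℝ) * (C + (1 + (d : ℝ) / 2) * ((d : ℝ) / 2)) + 2 * (1 + (d : ℝ) / 2),
    fun α ψ h0 h1 h => ?_⟩
  have hα := alpha_le_one hd hαs h1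
  have ha := h.rateA_le hd h0 hα
  have hb := h.rateB_le hd h0 hα
  have ha0 := h.rateA_nonneg
  have hb0 := (Real.sqrt_nonneg _).trans (h.sqrt_le_rateB hd)
  have h3 : ∫ v, ‖v‖ ^ 3 ∂law ψ ≤ C := by
    refine le_trans ?_ (hC α ψ h0 h1 h)
    refine integral_mono_of_nonneg (Eventually.of_forall fun ξ => ?_) h.integrable_bracket_three
      (Eventually.of_forall fun ξ => ?_)
    · simp only [Pi.zero_apply]; positivity
    · exact pow_le_pow_left₀ (norm_nonneg _) (norm_le_bracket ξ) 3
  have h4 : rateB ψ ≤ 2 / (d : ℝ) * (C + (1 + (d : ℝ) / 2) * ((d : ℝ) / 2)) := by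
    refine hb.trans ?_
    gcongr
  rw [h.coefB_eq hd, abs_mul, abs_of_nonneg (by linarith : 0 ≤ α / 2)]
  have h5 : |rateB ψ - rateA ψ| ≤ rateB ψ + rateA ψ := by
    rw [abs_le]; constructor <;> linarith
  have h6 := mul_le_mul_of_nonneg_right (show α / 2 ≤ 1 by linarith) (abs_nonneg (rateB ψ - rateA ψ))
  linarith

namespace NiceProfile

variable {d : ℕ} {α : ℝ} {ψ : E d → ℝ}

/-- The weighted energy inequality with explicit constants. -/
lemma weighted_inequality (hd : 2 ≤ d) (h : NiceProfile α ψ) (hα0 : 0 < α) (hα1 : α ≤ 1)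
    {γ : ℝ} (hγ0 : 0 ≤ γ)
    (hγ : ∀ v, γ * collFreq ψ v ≤ collFreq ψ v - α * rateA ψ - d / 2 * max 0 (-coefB α ψ))
    {ε : ℝ} (hε : 0 ≤ ε) (hε1 : ε ≤ 1) {K : ℕ} (hB : |coefB α ψ| * (K * Real.sqrt ε) ≤ γ / 2)
    {c : ℝ} (hc : ∀ v, c * bracket v ≤ collFreq ψ v) {M : ℝ} (hM : 0 ≤ M) :
    γ * c / 2 * ∫ ξ, ψ ξ * min (ψ ξ) M * (bracket ξ * weight ε K ξ)
      ≤ ∫ ξ, Qplus ψ ψ ξ * (min (ψ ξ) M * weight ε K ξ) := by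
  have hψ := h.meas
  have hT0 : ∀ ξ, 0 ≤ min (ψ ξ) M := fun ξ => le_min (h.nonneg ξ) hM
  have hw0 : ∀ ξ : E d, 0 ≤ weight ε K ξ := fun ξ => (weight_pos hε ξ).le
  have hw1 : ∀ ξ : E d, |weight ε K ξ| ≤ (2 * K + 1) * bracket ξ ^ (2 * K) := by
    intro ξ
    rw [abs_of_nonneg (hw0 ξ)]
    refine (weight_le hε hε1 ξ).trans (le_mul_of_one_le_left (pow_nonneg (bracket_pos ξ).le _) ?_)
    have : (0 : ℝ) ≤ K := Nat.cast_nonneg K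
    linarith
  have hw2 : ∀ ξ : E d, |fderiv ℝ (fun x : E d => weight ε K x) ξ ξ|
      ≤ (2 * K + 1) * bracket ξ ^ (2 * K) := by
    intro ξ
    rw [abs_of_nonneg (fderiv_weight_nonneg hε ξ)]
    have hb := pow_nonneg (bracket_pos ξ).le (2 * K)
    have := mul_le_mul_of_nonneg_left (weight_le (K := K) hε hε1 ξ)
      (show (0 : ℝ) ≤ 2 * K by positivity)
    have := fderiv_weight_le' (K := K) hε ξ
    linarith
  have hren := h.renormalized hd hα0 hα1 contDiff_weight hw0 hw1 hw2 hM
  set B := coefB α ψ with hBd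
  set a := rateA ψ with ha
  have hwd : Measurable fun ξ : E d => fderiv ℝ (fun x : E d => weight ε K x) ξ ξ :=
    ((contDiff_weight.continuous_fderiv (by simp)).clm_apply continuous_id).measurable
  have hLm := h.measurable_collFreq
  have hQm := h.measurable_Qplus
  have hI : ∀ q : ℕ, Integrable fun ξ => ψ ξ * bracket ξ ^ q :=
    h.integrable_mul_bracket_pow hd hα0 hα1
  have gT : ∀ ξ, |min (ψ ξ) M * weight ε K ξ| ≤ (M * (2 * K + 1)) * bracket ξ ^ (2 * K) := by
    intro ξ
    rw [abs_mul, abs_of_nonneg (hT0 ξ), mul_assoc]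
    exact mul_le_mul (min_le_right _ _) (hw1 ξ) (abs_nonneg _) hM
  have gTm : Measurable fun ξ => min (ψ ξ) M * weight ε K ξ := by fun_prop
  have iQ : Integrable fun ξ => Qplus ψ ψ ξ * (min (ψ ξ) M * weight ε K ξ) :=
    h.integrable_Qplus_mul hd (h.integrable_pow hd hα0 hα1 _) gTm gT
      (abs_le_mul_bracket_of_bounded gT)
  have iL : Integrable fun ξ => Qminus ψ ψ ξ * (min (ψ ξ) M * weight ε K ξ) :=
    h.integrable_Qminus_mul (h.integrable_pow hd hα0 hα1 _) gTm gT
  have iT : Integrable fun ξ => ψ ξ * (min (ψ ξ) M * weight ε K ξ) :=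
    integrable_of_mul_bracket hψ (hI (2 * K)) gTm gT
  have hβm : Measurable fun ξ => truncSq M (ψ ξ) := by unfold truncSq; fun_prop
  have hβ0 : ∀ ξ, 0 ≤ truncSq M (ψ ξ) := fun ξ =>
    (mul_nonneg (h.nonneg ξ) (hT0 ξ)).trans (mul_min_le_truncSq hM (h.nonneg ξ))
  have hβi : Integrable fun ξ => truncSq M (ψ ξ) * bracket ξ ^ (2 * K) := by
    refine ((hI (2 * K)).const_mul (2 * M)).mono'
      (Measurable.aestronglyMeasurable (by fun_prop)) (Eventually.of_forall fun ξ => ?_)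
    have hb := pow_nonneg (bracket_pos ξ).le (2 * K)
    rw [Real.norm_eq_abs, abs_of_nonneg (mul_nonneg (hβ0 ξ) hb)]
    have h1 := mul_le_mul_of_nonneg_left (min_le_right (ψ ξ) M) (h.nonneg ξ)
    have h2 : truncSq M (ψ ξ) ≤ 2 * M * ψ ξ := truncSq_le.trans (by linarith)
    have := mul_le_mul_of_nonneg_right h2 hb
    linarith
  have iβ : Integrable fun ξ => truncSq M (ψ ξ) * weight ε K ξ :=
    integrable_of_mul_bracket hβm hβi (by fun_prop) hw1
  have iβd : Integrable fun ξ => truncSq M (ψ ξ) * fderiv ℝ (fun x : E d => weight ε K x) ξ ξ :=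
    integrable_of_mul_bracket hβm hβi hwd hw2
  have e1 : ∫ ξ, truncSq M (ψ ξ) * ((d : ℝ) * weight ε K ξ
        + fderiv ℝ (fun x : E d => weight ε K x) ξ ξ)
      = d * (∫ ξ, truncSq M (ψ ξ) * weight ε K ξ)
        + ∫ ξ, truncSq M (ψ ξ) * fderiv ℝ (fun x : E d => weight ε K x) ξ ξ := by
    rw [← integral_const_mul, ← integral_add (iβ.const_mul _) iβd]
    refine integral_congr_ae (Eventually.of_forall fun ξ => ?_)
    dsimp only; ring
  have e2 : ∫ ξ, transportSource α ψ ξ * (2 * min (ψ ξ) M * weight ε K ξ)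
      = 2 * (1 - α) * (∫ ξ, Qplus ψ ψ ξ * (min (ψ ξ) M * weight ε K ξ))
        - (2 * (∫ ξ, Qminus ψ ψ ξ * (min (ψ ξ) M * weight ε K ξ))
          + 2 * (d * B - α * a) * ∫ ξ, ψ ξ * (min (ψ ξ) M * weight ε K ξ)) := by
    have i3 : Integrable fun ξ => 2 * (Qminus ψ ψ ξ * (min (ψ ξ) M * weight ε K ξ))
        + 2 * (d * B - α * a) * (ψ ξ * (min (ψ ξ) M * weight ε K ξ)) :=
      (iL.const_mul _).add (iT.const_mul _)
    rw [← integral_const_mul, ← integral_const_mul, ← integral_const_mul,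
      ← integral_add (iL.const_mul _) (iT.const_mul _),
      ← integral_sub (iQ.const_mul _) i3]
    refine integral_congr_ae (Eventually.of_forall fun ξ => ?_)
    simp only [transportSource, annih, h.coefA_eq hd]
    rw [← hBd, ← ha]
    ring
  rw [e1, e2] at hren
  set X := ∫ ξ, Qminus ψ ψ ξ * (min (ψ ξ) M * weight ε K ξ) with hX
  set Y := ∫ ξ, ψ ξ * (min (ψ ξ) M * weight ε K ξ) with hY
  set Q := ∫ ξ, Qplus ψ ψ ξ * (min (ψ ξ) M * weight ε K ξ) with hQ
  set S := ∫ ξ, truncSq M (ψ ξ) * weight ε K ξ with hS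
  set D := ∫ ξ, truncSq M (ψ ξ) * fderiv ℝ (fun x : E d => weight ε K x) ξ ξ with hDd
  have hQ0 : 0 ≤ Q := integral_nonneg fun ξ => mul_nonneg (by
    rw [Qplus_eq_toReal_gain h.meas h.nonneg]; exact ENNReal.toReal_nonneg)
    (mul_nonneg (hT0 ξ) (hw0 ξ))
  have hX0 : 0 ≤ X := integral_nonneg fun ξ => mul_nonneg
    (mul_nonneg (h.nonneg ξ) (h.collFreq_nonneg ξ)) (mul_nonneg (hT0 ξ) (hw0 ξ))
  have hYS1 : Y ≤ S := integral_mono iT iβ fun ξ => by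
    have := mul_le_mul_of_nonneg_right (mul_min_le_truncSq hM (h.nonneg ξ)) (hw0 ξ)
    dsimp only; linarith
  have hYS2 : S ≤ 2 * Y := by
    rw [hY, ← integral_const_mul]
    refine integral_mono iβ (iT.const_mul 2) fun ξ => ?_
    have := mul_le_mul_of_nonneg_right (truncSq_le (M := M) (s := ψ ξ)) (hw0 ξ)
    dsimp only; linarith
  have hD0 : 0 ≤ D := integral_nonneg fun ξ => mul_nonneg (hβ0 ξ) (fderiv_weight_nonneg hε ξ)
  have hDX : D ≤ 2 * (K * Real.sqrt ε) * X := by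
    rw [hX, ← integral_const_mul]
    refine integral_mono iβd (iL.const_mul _) fun ξ => ?_
    have h1 : fderiv ℝ (fun x : E d => weight ε K x) ξ ξ
        ≤ K * Real.sqrt ε * (collFreq ψ ξ * weight ε K ξ) := by
      refine (fderiv_weight_le hε ξ).trans ?_
      have := mul_le_mul_of_nonneg_right (h.norm_le_collFreq ξ) (hw0 ξ)
      have := mul_le_mul_of_nonneg_left this (show 0 ≤ K * Real.sqrt ε by positivity)
      linarith
    have h2 := mul_le_mul (truncSq_le (M := M) (s := ψ ξ)) h1 (fderiv_weight_nonneg hε ξ)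
      (mul_nonneg zero_le_two (mul_nonneg (h.nonneg ξ) (hT0 ξ)))
    simp only [Qminus]
    refine h2.trans (le_of_eq ?_)
    ring
  have hcoer : γ * X ≤ X - (α * a + d / 2 * max 0 (-B)) * Y := by
    rw [hX, hY, ← integral_const_mul, ← integral_const_mul, ← integral_sub iL (iT.const_mul _)]
    refine integral_mono (iL.const_mul _) (iL.sub (iT.const_mul _)) fun ξ => ?_
    have := mul_le_mul_of_nonneg_right (hγ ξ)
      (mul_nonneg (h.nonneg ξ) (mul_nonneg (hT0 ξ) (hw0 ξ)))
    simp only [Qminus]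
    linarith
  have hXc : c * ∫ ξ, ψ ξ * min (ψ ξ) M * (bracket ξ * weight ε K ξ) ≤ X := by
    rw [hX, ← integral_const_mul]
    have hm : Measurable fun ξ => bracket ξ * (min (ψ ξ) M * weight ε K ξ) := by fun_prop
    have i3 : Integrable fun ξ => ψ ξ * (bracket ξ * (min (ψ ξ) M * weight ε K ξ)) := by
      refine integrable_of_mul_bracket hψ (hI (2 * K + 1)) hm (C := M * (2 * K + 1)) fun ξ => ?_
      rw [abs_mul, abs_of_pos (bracket_pos ξ), pow_succ]
      have := mul_le_mul_of_nonneg_left (gT ξ) (bracket_pos ξ).le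
      linarith
    refine integral_mono (Integrable.const_mul (i3.congr (Eventually.of_forall fun ξ => ?_)) c)
      iL fun ξ => ?_
    · dsimp only; ring
    · have := mul_le_mul_of_nonneg_right (hc ξ)
        (mul_nonneg (h.nonneg ξ) (mul_nonneg (hT0 ξ) (hw0 ξ)))
      simp only [Qminus]
      linarith
  have hBD : |B| * D ≤ γ * X := by
    calc |B| * D ≤ |B| * (2 * (K * Real.sqrt ε) * X) := mul_le_mul_of_nonneg_left hDX (abs_nonneg _)
      _ = 2 * (|B| * (K * Real.sqrt ε)) * X := by ring
      _ ≤ 2 * (γ / 2) * X := by gcongr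
      _ = _ := by ring
  have hBD' : B * D ≤ |B| * D := mul_le_mul_of_nonneg_right (le_abs_self B) hD0
  have hdn : (0 : ℝ) ≤ d := Nat.cast_nonneg d
  -- Since `Y ≤ S ≤ 2Y`, the combination `2Y - S` lies between `0` and `Y`. Only the negative part
  -- of the drift can hurt.
  have hneg : -(d * max 0 (-B) * Y) ≤ d * B * (2 * Y - S) := by
    have h1 : -max 0 (-B) ≤ B := by linarith [le_max_right 0 (-B)]
    have h2 : 0 ≤ max 0 (-B) := le_max_left _ _
    have h3 : 0 ≤ 2 * Y - S := by linarith
    have h4 : -max 0 (-B) * (2 * Y - S) ≤ B * (2 * Y - S) := mul_le_mul_of_nonneg_right h1 h3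
    have h5 : max 0 (-B) * (2 * Y - S) ≤ max 0 (-B) * Y :=
      mul_le_mul_of_nonneg_left (by linarith) h2
    have h6 := mul_le_mul_of_nonneg_left h4 hdn
    have h7 := mul_le_mul_of_nonneg_left h5 hdn
    linarith
  -- The identity reads `2(1-α)Q = 2X - 2αaY + dB(2Y - S) - BD`. Coercivity keeps `2γX`, of which
  -- the weight derivative takes `γX`.
  have hfin : γ * X ≤ 2 * Q := by
    have : (1 - α) * Q ≤ Q := mul_le_of_le_one_left hQ0 (by linarith)
    linarith
  have := mul_le_mul_of_nonneg_left hXc hγ0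
  linarith

end NiceProfile

/-- The weighted energy inequality with constants uniform over the profiles. -/
theorem exists_weighted_inequality {d : ℕ} (hd : 2 ≤ d) {αs : ℝ} (hαs : αs < alphaBar d) (K : ℕ) :
    ∃ ε c : ℝ, 0 < ε ∧ ε ≤ 1 ∧ 0 < c ∧ ∀ (α : ℝ) (ψ : E d → ℝ), 0 < α → α < αs →
      NiceProfile α ψ → ∀ M : ℝ, 0 ≤ M →
        c * ∫ ξ, ψ ξ * min (ψ ξ) M * (bracket ξ * weight ε K ξ)
          ≤ ∫ ξ, Qplus ψ ψ ξ * (min (ψ ξ) M * weight ε K ξ) := by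
  have h0 : αs < alpha0 d := hαs.trans_le (min_le_left _ _)
  have h2 : αs < alpha2 d := hαs.trans_le (min_le_right _ _)
  obtain ⟨CB, hCB⟩ := exists_coefB_bound hd h0
  obtain ⟨c, hc0, hc⟩ := exists_collFreq_lower hd h0
  have hgap := alpha2_gap h2
  set γ := 1 - αs * (2 + (d : ℝ) / 2 * (1 - 1 / Real.sqrt 2)) with hγ
  have hγ0 : 0 < γ := by linarith
  -- Here `r = √ε`, small enough that the drift of the weight costs at most `γ/2`.
  set r : ℝ := min 1 (γ / (2 * ((|CB| + 1) * (K + 1)))) with hr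
  have hr0 : 0 < r := by positivity
  have hr1 : r ≤ 1 := min_le_left _ _
  refine ⟨r ^ 2, γ * c / 2, by positivity, pow_le_one₀ hr0.le hr1, by positivity,
    fun α ψ hα0 hα h M hM => ?_⟩
  refine h.weighted_inequality hd hα0 (alpha_le_one hd h0 hα) hγ0.le
    (fun v => h.coercive hd hα0 hα v) (by positivity) (pow_le_one₀ hr0.le hr1) ?_
    (hc α ψ hα0 hα h) hM
  rw [Real.sqrt_sq hr0.le]
  have h3 := (hCB α ψ hα0 hα h).trans (le_abs_self CB)
  have h4 : r ≤ γ / (2 * ((|CB| + 1) * (K + 1))) := min_le_right _ _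
  calc |coefB α ψ| * (K * r) ≤ (|CB| + 1) * ((K + 1) * (γ / (2 * ((|CB| + 1) * (K + 1))))) := by
        gcongr <;> linarith
    _ = γ / 2 := by field_simp

/-! ### Spherical caps and the gain term -/

/-- The indicator of the spherical cap `t |u| ≤ u·σ`. -/
def capKer {d : ℕ} (t : ℝ) (u σ : E d) : ℝ≥0∞ := if t * ‖u‖ ≤ inner ℝ u σ then 1 else 0

section capKer

variable {d : ℕ}

@[fun_prop]
lemma measurable_capKer {X : Type*} [MeasurableSpace X] (t : ℝ) {f g : X → E d}
    (hf : Measurable f) (hg : Measurable g) : Measurable fun x => capKer t (f x) (g x) :=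
  Measurable.ite (measurableSet_le (by fun_prop) (by fun_prop)) measurable_const measurable_const

lemma capKer_le_one (t : ℝ) (u σ : E d) : capKer t u σ ≤ 1 := by
  unfold capKer; split_ifs <;> simp

lemma lintegral_capKer_le {t : ℝ} {s : ℝ≥0∞} (hs : CapBound d t s) {u : E d} (hu : u ≠ 0) :
    ∫⁻ σ : Sph d, capKer t u σ ∂surf d ≤ s := by
  refine le_trans (lintegral_mono fun σ => ?_) (lintegral_coneKer_le hs hu)
  unfold capKer coneKer
  by_cases h : t * ‖u‖ ≤ inner ℝ u (σ : E d)
  · rw [if_pos h, if_pos (h.trans (le_abs_self _))]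
  · rw [if_neg h]; exact zero_le

/-- Spherical integrals of `v'` over a cap are controlled by cone averages centred at `v_*`. -/
lemma exists_lintegral_cap_le (hd : 2 ≤ d) :
    ∃ C : ℝ≥0∞, C ≠ ∞ ∧ ∀ (v w : E d), v ≠ w → ∀ (δ : ℝ), 0 ≤ δ → ∀ G : E d → ℝ≥0∞,
      Measurable G →
      ∫⁻ σ : Sph d, capKer (2 * δ ^ 2 - 1) (v - w) σ * G (post v w σ) ∂surf d
        ≤ C * coneAvg δ (fun y => G (w + y)) (v - w) := by
  obtain ⟨C, hC, h⟩ := lintegral_sphere_le_reflect hd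
  refine ⟨C, hC, fun v w hvw δ hδ G hG => ?_⟩
  have hu : 0 < ‖v - w‖ := norm_pos_iff.2 (sub_ne_zero.2 hvw)
  set u := v - w with hud
  set e : E d := ‖u‖⁻¹ • u with he
  have hen : ‖e‖ = 1 := by rw [he, norm_smul, norm_inv, norm_norm, inv_mul_cancel₀ hu.ne']
  have hue : u = ‖u‖ • e := by rw [he, smul_smul, mul_inv_cancel₀ hu.ne', one_smul]
  have hF : Measurable fun x : E d => capKer (2 * δ ^ 2 - 1) u x *
      G ((1 / 2 : ℝ) • (v + w) + (‖u‖ / 2) • x) :=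
    Measurable.mul (by fun_prop) (hG.comp (by fun_prop))
  refine (h e hen _ hF).trans ?_
  refine mul_le_mul_right (lintegral_mono fun ω => ?_) C
  dsimp only
  have hω := norm_sph ω
  have hin : inner ℝ u (ω : E d) = ‖u‖ * inner ℝ e (ω : E d) := by
    conv_lhs => rw [hue]
    rw [real_inner_smul_left]
  -- In the variable `ω`, the velocity `v'` is `v_*` plus the projection of `u` on `ω`. Moreover
  -- `e·σ = 2(e·ω)² - 1`, so the cap of parameter `2δ² - 1` becomes the cone of parameter `δ`.
  have hpost : (1 / 2 : ℝ) • (v + w) + (‖u‖ / 2) • ((2 * inner ℝ e (ω : E d)) • (ω : E d) - e)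
      = w + inner ℝ u (ω : E d) • (ω : E d) := by
    have h1 : (‖u‖ / 2) • e = (1 / 2 : ℝ) • u := by
      rw [he, smul_smul]; congr 1; field_simp
    rw [smul_sub, h1, hud, hin]
    module
  rw [hpost]
  refine mul_le_mul_left ?_ _
  unfold capKer coneKer
  by_cases hc : (2 * δ ^ 2 - 1) * ‖u‖
      ≤ inner ℝ u ((2 * inner ℝ e (ω : E d)) • (ω : E d) - e)
  · rw [if_pos hc, if_pos]
    have hue2 : inner ℝ u e = ‖u‖ := by
      conv_lhs => rw [hue]
      rw [real_inner_smul_left, real_inner_self_eq_norm_sq, hen]; ring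
    rw [inner_sub_right, real_inner_smul_right, hin, hue2] at hc
    have h2 : δ ^ 2 ≤ inner ℝ e (ω : E d) ^ 2 := by
      have h3 : (2 * δ ^ 2) * ‖u‖ ≤ (2 * inner ℝ e (ω : E d) ^ 2) * ‖u‖ := by nlinarith
      have := le_of_mul_le_mul_right h3 hu
      linarith
    have h4 : δ ≤ |inner ℝ e (ω : E d)| := by
      rw [← sq_abs (inner ℝ e (ω : E d))] at h2
      exact abs_le_of_sq_le_sq' h2 (abs_nonneg _) |>.2
    rw [hin, abs_mul, abs_of_pos hu, mul_comm δ]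
    exact mul_le_mul_of_nonneg_left h4 hu.le
  · rw [if_neg hc]; exact zero_le

/-- Change of variables `v ↦ v'` at fixed `v_*`, over a cap. -/
lemma exists_lintegral_post_le (hd : 2 ≤ d) :
    ∃ C : ℝ≥0∞, C ≠ ∞ ∧ ∀ (δ ρ : ℝ), 0 < δ → 0 ≤ ρ → 1 ≤ δ ^ 2 * (1 + ρ ^ 2) →
      ∀ (w : E d) (G : E d → ℝ≥0∞), Measurable G →
      ∫⁻ v, ∫⁻ σ : Sph d, capKer (2 * δ ^ 2 - 1) (v - w) σ * G (post v w σ) ∂surf d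
        ≤ C * (ENNReal.ofReal ((2 * ρ) ^ (d - 1)) * ∫⁻ x, G x) := by
  obtain ⟨C, hC, h⟩ := exists_lintegral_cap_le hd
  have := nontrivial_E hd
  refine ⟨C * 2, ENNReal.mul_ne_top hC (by simp), fun δ ρ hδ hρ hδρ w G hG => ?_⟩
  have hGw : Measurable fun y => G (w + y) := hG.comp (by fun_prop)
  have mc : Measurable fun u => coneAvg δ (fun y => G (w + y)) u :=
    measurable_coneAvg (X := E d) δ (h := fun _ y => G (w + y)) (hG.comp (by fun_prop))
      measurable_id
  have hne : ∀ᵐ v : E d, v ≠ w := compl_mem_ae_iff.2 (measure_singleton w)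
  calc _ ≤ ∫⁻ v, C * coneAvg δ (fun y => G (w + y)) (v - w) := by
        refine lintegral_mono_ae ?_
        filter_upwards [hne] with v hv using h v w hv δ hδ.le G hG
    _ = C * ∫⁻ u, coneAvg δ (fun y => G (w + y)) u := by
        rw [lintegral_sub_right_eq_self (fun u => C * coneAvg δ (fun y => G (w + y)) u) w,
          lintegral_const_mul _ mc]
    _ ≤ C * (ENNReal.ofReal ((2 * ρ) ^ (d - 1)) * 2 * ∫⁻ y, G (w + y)) :=
        mul_le_mul_right (lintegral_coneAvg_le_of hd hδ hρ hδρ hGw) C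
    _ = _ := by
        rw [lintegral_add_left_eq_self]; ring

/-- A cap and the complementary cap around the opposite pole cover the sphere. -/
lemma one_le_capKer_add {t : ℝ} (u σ : E d) : 1 ≤ capKer t u σ + capKer (-t) (-u) σ := by
  unfold capKer
  rw [norm_neg, inner_neg_left]
  by_cases h : t * ‖u‖ ≤ inner ℝ u σ
  · rw [if_pos h]; exact le_self_add
  · rw [if_neg h, if_pos (by linarith [not_le.1 h])]; simp

/-- Restriction of the gain term to `σ·(v - v_*) ≥ 0` by symmetry. -/
lemma lintegral_gain_half (hd : 2 ≤ d) {f : E d → ℝ} (hf : Measurable f) {φ : E d → ℝ≥0∞}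
    (hφ : Measurable φ) :
    ∫⁻ v, gain f v * φ v ≤ ENNReal.ofReal (1 / sphereArea d) * (2 * ∫⁻ w, ∫⁻ v,
      ENNReal.ofReal (‖v - w‖ * f v * f w) *
        ∫⁻ σ : Sph d, capKer 0 (v - w) σ * φ (post v w σ) ∂surf d) := by
  rw [lintegral_gain_mul hd hf hφ]
  refine mul_le_mul_right ?_ _
  have m0 : Measurable fun q : (E d × E d) × Sph d =>
      capKer 0 (q.1.1 - q.1.2) q.2 * φ (post q.1.1 q.1.2 q.2) :=
    Measurable.mul (by fun_prop) (hφ.comp (by fun_prop))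
  have m1 : Measurable fun p : E d × E d =>
      ∫⁻ σ : Sph d, capKer 0 (p.1 - p.2) σ * φ (post p.1 p.2 σ) ∂surf d := m0.lintegral_prod_right'
  set I : E d → E d → ℝ≥0∞ := fun v w => ENNReal.ofReal (‖v - w‖ * f v * f w) *
    ∫⁻ σ : Sph d, capKer 0 (v - w) σ * φ (post v w σ) ∂surf d with hI
  have mI : Measurable fun p : E d × E d => I p.1 p.2 := Measurable.mul (by fun_prop) m1
  have hswap : ∫⁻ w, ∫⁻ v, I v w = ∫⁻ v, ∫⁻ w, I v w :=
    lintegral_lintegral_swap (f := fun w v => I v w)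
      (mI.comp (f := fun p : E d × E d => (p.2, p.1)) (by fun_prop)).aemeasurable
  have hle : ∀ v w : E d, ENNReal.ofReal (‖v - w‖ * f v * f w) *
      ∫⁻ σ : Sph d, φ (post v w σ) ∂surf d ≤ I v w + I w v := by
    intro v w
    have hm : Measurable fun σ : Sph d => capKer 0 (v - w) σ * φ (post v w σ) :=
      m0.comp (f := fun σ => ((v, w), σ)) (by fun_prop)
    have e2 : I w v = ENNReal.ofReal (‖v - w‖ * f v * f w) *
        ∫⁻ σ : Sph d, capKer 0 (-(v - w)) σ * φ (post v w σ) ∂surf d := by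
      simp only [hI, neg_sub]
      rw [norm_sub_rev w v, mul_right_comm]
      congr 1
      exact lintegral_congr fun σ => by rw [post_comm]
    rw [e2]
    simp only [hI]
    rw [← mul_add, ← lintegral_add_left hm]
    refine mul_le_mul_right (lintegral_mono fun σ => ?_) _
    rw [← add_mul]
    have := one_le_capKer_add (t := 0) (v - w) (σ : E d)
    rw [neg_zero] at this
    exact le_mul_of_one_le_left' this
  have mI1 : Measurable fun v : E d => ∫⁻ w, I v w := mI.lintegral_prod_right'
  calc _ ≤ ∫⁻ v, ∫⁻ w, (I v w + I w v) := lintegral_mono fun v => lintegral_mono fun w => hle v w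
    _ = ∫⁻ v, ((∫⁻ w, I v w) + ∫⁻ w, I w v) := by
        refine lintegral_congr fun v => ?_
        have mv : Measurable fun w => I v w := mI.comp (f := fun w => (v, w)) (by fun_prop)
        rw [lintegral_add_left mv]
    _ = (∫⁻ v, ∫⁻ w, I v w) + ∫⁻ v, ∫⁻ w, I w v := lintegral_add_left mI1 _
    _ = _ := by rw [hswap, ← two_mul]

/-- On the forward hemisphere `v'` stays away from `v_*`. -/
lemma norm_post_sub_sq (v w : E d) (σ : Sph d) :
    ‖post v w σ - w‖ ^ 2 = ‖v - w‖ * (‖v - w‖ + inner ℝ (v - w) (σ : E d)) / 2 := by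
  have h1 : post v w σ - w = (1 / 2 : ℝ) • ((v - w) + ‖v - w‖ • (σ : E d)) := by
    unfold post; module
  rw [h1, norm_smul, mul_pow, norm_add_sq_real, real_inner_smul_right, norm_smul, norm_norm,
    norm_sph]
  simp only [Real.norm_eq_abs]
  norm_num
  ring

/-- On the cap `|v' - w| ≥ δ|v - w|`, so the relative velocity can be paid by `v'` and `w`, without
any weight at `v`. -/
lemma norm_sub_le_of_cap {δ : ℝ} {v w : E d} {σ : Sph d}
    (h : (2 * δ ^ 2 - 1) * ‖v - w‖ ≤ inner ℝ (v - w) (σ : E d)) :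
    δ * ‖v - w‖ ≤ 2 * (bracket (post v w σ) * bracket w) := by
  refine le_trans ?_ (norm_sub_le_bracket_mul _ _)
  refine abs_le_of_sq_le_sq' ?_ (norm_nonneg _) |>.2
  rw [norm_post_sub_sq, mul_pow]
  nlinarith [norm_nonneg (v - w)]

lemma norm_sub_le_of_half {v w : E d} {σ : Sph d} (h : 0 ≤ inner ℝ (v - w) (σ : E d)) :
    ‖v - w‖ ≤ 3 * (bracket (post v w σ) * bracket w) := by
  have h2 : (2 / 3 : ℝ) * ‖v - w‖ ≤ 2 * (bracket (post v w σ) * bracket w) := by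
    -- Any `δ` with `2δ² ≤ 1` is admissible; `2/3` yields the integer constant `3`.
    refine norm_sub_le_of_cap ?_
    refine le_trans ?_ h
    nlinarith [norm_nonneg (v - w)]
  linarith

end capKer

/-! ### Finiteness of the weighted energy of a single profile -/

/-- The density `ψ min(ψ, M) ⟨ξ⟩ w` of the truncated weighted energy. -/
def truncEnergy {d : ℕ} (ε : ℝ) (K : ℕ) (ψ : E d → ℝ) (M : ℝ) (ξ : E d) : ℝ≥0∞ :=
  ENNReal.ofReal (ψ ξ * min (ψ ξ) M * (bracket ξ * weight ε K ξ))

/-- The weighted mass density `ψ ⟨ξ⟩ w`. -/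
def massDensity {d : ℕ} (ε : ℝ) (K : ℕ) (ψ : E d → ℝ) (ξ : E d) : ℝ≥0∞ :=
  ENNReal.ofReal (ψ ξ * (bracket ξ * weight ε K ξ))

section integrated

variable {d : ℕ} {ε : ℝ} {K : ℕ} {ψ : E d → ℝ}

lemma measurable_truncEnergy (hψ : Measurable ψ) (M : ℝ) :
    Measurable (truncEnergy ε K ψ M) := by
  unfold truncEnergy; fun_prop

lemma measurable_massDensity (hψ : Measurable ψ) : Measurable (massDensity ε K ψ) := by
  unfold massDensity; fun_prop

/-- Replaces Young's inequality and stays inside the truncated energy. -/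
lemma mul_min_le_add {a b M : ℝ} (ha : 0 ≤ a) (hb : 0 ≤ b) (hM : 0 ≤ M) :
    a * min b M ≤ a * min a M + b * min b M := by
  rcases le_total a b with h | h
  · have := mul_le_mul_of_nonneg_right h (le_min hb hM)
    have := mul_nonneg ha (le_min ha hM)
    linarith
  · have := mul_le_mul_of_nonneg_left (min_le_min_right M h) ha
    have := mul_nonneg hb (le_min hb hM)
    linarith

/-- The product `ψ(v) min(ψ(v'), M)` splits into truncated energies at `v` and at `v'`. In each, the
rate is bounded with a bracket at that same velocity and one at `w`; at `v'` this requires the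
forward hemisphere. -/
lemma rate_trunc_le (hε : 0 ≤ ε) (h0 : ∀ ξ, 0 ≤ ψ ξ) {M : ℝ} (hM : 0 ≤ M) {t : ℝ} (ht : 0 ≤ t)
    (v w : E d) (σ : Sph d) :
    ENNReal.ofReal (‖v - w‖ * ψ v * ψ w) * (capKer t (v - w) σ *
        ENNReal.ofReal (min (ψ (post v w σ)) M * weight ε K (post v w σ)))
      ≤ massDensity ε K ψ w * (2 * (capKer t (v - w) σ * truncEnergy ε K ψ M v)
        + 3 * (capKer t (v - w) σ * truncEnergy ε K ψ M (post v w σ))) := by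
  unfold capKer
  split_ifs with hc
  swap
  · simp
  have hin : 0 ≤ inner ℝ (v - w) (σ : E d) := (mul_nonneg ht (norm_nonneg _)).trans hc
  unfold truncEnergy massDensity
  set z := post v w σ with hz
  have hT : ∀ ξ, 0 ≤ min (ψ ξ) M := fun ξ => le_min (h0 ξ) hM
  have hw : ∀ ξ : E d, 1 ≤ weight ε K ξ := fun ξ => one_le_weight hε ξ
  have hw0 : ∀ ξ : E d, 0 ≤ weight ε K ξ := fun ξ => zero_le_one.trans (hw ξ)
  have hb : ∀ ξ : E d, 0 ≤ bracket ξ := fun ξ => (bracket_pos ξ).le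
  have h23 : ∀ x : ℝ, (2 : ℝ≥0∞) * ENNReal.ofReal x = ENNReal.ofReal (2 * x) := fun x => by
    rw [ENNReal.ofReal_mul zero_le_two, ENNReal.ofReal_ofNat]
  have h33 : ∀ x : ℝ, (3 : ℝ≥0∞) * ENNReal.ofReal x = ENNReal.ofReal (3 * x) := fun x => by
    rw [ENNReal.ofReal_mul zero_le_three, ENNReal.ofReal_ofNat]
  rw [one_mul, one_mul, one_mul, h23, h33, ← ENNReal.ofReal_mul (mul_nonneg (mul_nonneg (norm_nonneg _)
      (h0 v)) (h0 w)), ← ENNReal.ofReal_add, ← ENNReal.ofReal_mul (mul_nonneg (h0 w)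
      (mul_nonneg (hb w) (hw0 w)))]
  rotate_left
  · exact mul_nonneg zero_le_two (mul_nonneg (mul_nonneg (h0 v) (hT v)) (mul_nonneg (hb v) (hw0 v)))
  · exact mul_nonneg zero_le_three (mul_nonneg (mul_nonneg (h0 z) (hT z))
      (mul_nonneg (hb z) (hw0 z)))
  refine ENNReal.ofReal_le_ofReal ?_
  have e1 := norm_sub_le_bracket_mul v w
  have e2 := norm_sub_le_of_half hin
  have e3 : weight ε K z ≤ weight ε K v * weight ε K w := weight_post_le hε v w σ
  rw [← hz] at e2
  have a1 : ‖v - w‖ * weight ε K z ≤ 2 * (bracket v * bracket w) * (weight ε K v * weight ε K w) :=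
    mul_le_mul e1 e3 (hw0 z) (mul_nonneg zero_le_two (mul_nonneg (hb v) (hb w)))
  have a2 : ‖v - w‖ * weight ε K z
      ≤ 3 * (bracket z * bracket w) * (weight ε K z * weight ε K w) :=
    mul_le_mul e2 (le_mul_of_one_le_right (hw0 z) (hw w)) (hw0 z)
      (mul_nonneg zero_le_three (mul_nonneg (hb z) (hb w)))
  calc ‖v - w‖ * ψ v * ψ w * (min (ψ z) M * weight ε K z)
      = (ψ v * min (ψ z) M) * (ψ w * (‖v - w‖ * weight ε K z)) := by ring
    _ ≤ (ψ v * min (ψ v) M + ψ z * min (ψ z) M) * (ψ w * (‖v - w‖ * weight ε K z)) :=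
        mul_le_mul_of_nonneg_right (mul_min_le_add (h0 v) (h0 z) hM)
          (mul_nonneg (h0 w) (mul_nonneg (norm_nonneg _) (hw0 z)))
    _ = (ψ v * min (ψ v) M * ψ w) * (‖v - w‖ * weight ε K z)
        + (ψ z * min (ψ z) M * ψ w) * (‖v - w‖ * weight ε K z) := by ring
    _ ≤ (ψ v * min (ψ v) M * ψ w) * (2 * (bracket v * bracket w) * (weight ε K v * weight ε K w))
        + (ψ z * min (ψ z) M * ψ w)
          * (3 * (bracket z * bracket w) * (weight ε K z * weight ε K w)) :=
        add_le_add
          (mul_le_mul_of_nonneg_left a1 (mul_nonneg (mul_nonneg (h0 v) (hT v)) (h0 w)))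
          (mul_le_mul_of_nonneg_left a2 (mul_nonneg (mul_nonneg (h0 z) (hT z)) (h0 w)))
    _ = _ := by ring

/-- The constant has two parts: the surface of the cap for the energy at `v`, and the cone constant
`(2ρ)^(d-1)` for the energy at `v'`. Both are small for narrow caps. -/
lemma exists_lintegral_cap_trunc_le (hd : 2 ≤ d) :
    ∃ C : ℝ≥0∞, C ≠ ∞ ∧ ∀ {ε : ℝ} {K : ℕ} {ψ : E d → ℝ}, 0 ≤ ε → Measurable ψ → (∀ ξ, 0 ≤ ψ ξ) →
      ∀ {M : ℝ}, 0 ≤ M → ∀ {δ ρ : ℝ} {s : ℝ≥0∞}, 0 < δ → 0 ≤ ρ → 1 ≤ δ ^ 2 * (1 + ρ ^ 2) →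
      0 ≤ 2 * δ ^ 2 - 1 → CapBound d (2 * δ ^ 2 - 1) s → ∀ w : E d,
      ∫⁻ v, ENNReal.ofReal (‖v - w‖ * ψ v * ψ w) * ∫⁻ σ : Sph d, capKer (2 * δ ^ 2 - 1) (v - w) σ *
          ENNReal.ofReal (min (ψ (post v w σ)) M * weight ε K (post v w σ)) ∂surf d
        ≤ massDensity ε K ψ w * ((2 * s + 3 * (C * ENNReal.ofReal ((2 * ρ) ^ (d - 1))))
          * ∫⁻ v, truncEnergy ε K ψ M v) := by
  obtain ⟨C, hC, h⟩ := exists_lintegral_post_le hd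
  have := nontrivial_E hd
  refine ⟨C, hC, fun {ε K ψ} hε hψ h0 {M} hM {δ ρ s} hδ hρ hδρ ht hs w => ?_⟩
  set t := 2 * δ ^ 2 - 1 with htd
  have hH := measurable_truncEnergy (ε := ε) (K := K) hψ M
  set H := truncEnergy ε K ψ M with hHd
  have n1 : Measurable fun p : E d × Sph d => 2 * (capKer t (p.1 - w) p.2 * H p.1) :=
    Measurable.const_mul (Measurable.mul (by fun_prop) (hH.comp measurable_fst)) 2
  have n2 : Measurable fun p : E d × Sph d => 3 * (capKer t (p.1 - w) p.2 * H (post p.1 w p.2)) :=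
    Measurable.const_mul (Measurable.mul (by fun_prop) (hH.comp (by fun_prop))) 3
  have n12 : Measurable fun p : E d × Sph d => 2 * (capKer t (p.1 - w) p.2 * H p.1) +
      3 * (capKer t (p.1 - w) p.2 * H (post p.1 w p.2)) := n1.add n2
  have hpt : ∀ v : E d, ENNReal.ofReal (‖v - w‖ * ψ v * ψ w) * ∫⁻ σ : Sph d, capKer t (v - w) σ *
          ENNReal.ofReal (min (ψ (post v w σ)) M * weight ε K (post v w σ)) ∂surf d
        ≤ massDensity ε K ψ w * ∫⁻ σ : Sph d, (2 * (capKer t (v - w) σ * H v)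
          + 3 * (capKer t (v - w) σ * H (post v w σ))) ∂surf d := by
    intro v
    have n3 : Measurable fun σ : Sph d => capKer t (v - w) σ *
          ENNReal.ofReal (min (ψ (post v w σ)) M * weight ε K (post v w σ)) := by
      have : Measurable fun σ : Sph d => ψ (post v w σ) := hψ.comp (by fun_prop)
      fun_prop
    have n4 : Measurable fun σ : Sph d => 2 * (capKer t (v - w) σ * H v) +
      3 * (capKer t (v - w) σ * H (post v w σ)) := n12.comp (f := fun σ => (v, σ)) (by fun_prop)
    rw [← lintegral_const_mul _ n3, ← lintegral_const_mul _ n4]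
    exact lintegral_mono fun σ => rate_trunc_le hε h0 hM ht v w σ
  have n5 : Measurable fun v => ∫⁻ σ : Sph d, (2 * (capKer t (v - w) σ * H v)
          + 3 * (capKer t (v - w) σ * H (post v w σ))) ∂surf d := n12.lintegral_prod_right'
  refine (lintegral_mono hpt).trans ?_
  rw [lintegral_const_mul _ n5]
  refine mul_le_mul_right ?_ _
  have hne : ∀ᵐ v : E d, v ≠ w := compl_mem_ae_iff.2 (measure_singleton w)
  have n6 : Measurable fun p : E d × Sph d => capKer t (p.1 - w) p.2 * H (post p.1 w p.2) :=
    Measurable.mul (by fun_prop) (hH.comp (by fun_prop))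
  have n7 : Measurable fun v => ∫⁻ σ : Sph d, capKer t (v - w) σ * H (post v w σ) ∂surf d :=
    n6.lintegral_prod_right'
  have hs1 : ∀ᵐ v : E d, ∫⁻ σ : Sph d, (2 * (capKer t (v - w) σ * H v)
          + 3 * (capKer t (v - w) σ * H (post v w σ))) ∂surf d
        ≤ 2 * s * H v + 3 * ∫⁻ σ : Sph d, capKer t (v - w) σ * H (post v w σ) ∂surf d := by
    filter_upwards [hne] with v hv
    have k1 : Measurable fun σ : Sph d => 2 * (capKer t (v - w) σ * H v) :=
      n1.comp (f := fun σ => (v, σ)) (by fun_prop)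
    have k2 : Measurable fun σ : Sph d => capKer t (v - w) σ * H (post v w σ) :=
      n6.comp (f := fun σ => (v, σ)) (by fun_prop)
    have k3 : Measurable fun σ : Sph d => capKer t (v - w) σ := by fun_prop
    rw [lintegral_add_left k1, lintegral_const_mul _ k2, lintegral_const_mul _ (k3.mul_const _),
      lintegral_mul_const _ k3, ← mul_assoc]
    gcongr
    exact lintegral_capKer_le hs (sub_ne_zero.2 hv)
  refine (lintegral_mono_ae hs1).trans ?_
  rw [lintegral_add_left (hH.const_mul _), lintegral_const_mul _ hH, lintegral_const_mul _ n7,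
    add_mul]
  refine add_le_add le_rfl ?_
  calc _ ≤ 3 * (C * (ENNReal.ofReal ((2 * ρ) ^ (d - 1)) * ∫⁻ x, H x)) :=
        mul_le_mul_right (h δ ρ hδ hρ hδρ w H hH) 3
    _ = _ := by ring

/-- Away from grazing directions with `ψ(w) ≤ N`, one factor is bounded. The integration in `w` is
then converted into one in `v'` at fixed `v`, which leaves only mass integrals, with no dependence
on `M`. -/
lemma exists_lintegral_far_le (hd : 2 ≤ d) :
    ∃ C : ℝ≥0∞, C ≠ ∞ ∧ ∀ {ε : ℝ} {K : ℕ} {ψ : E d → ℝ}, 0 ≤ ε → Measurable ψ → (∀ ξ, 0 ≤ ψ ξ) →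
      ∀ {M N : ℝ}, 0 ≤ M → 0 ≤ N → ∀ {δ ρ : ℝ}, 0 < δ → 0 ≤ ρ → 1 ≤ δ ^ 2 * (1 + ρ ^ 2) →
      ∫⁻ w, {w | ψ w ≤ N}.indicator 1 w * ∫⁻ v, ENNReal.ofReal (‖v - w‖ * ψ v * ψ w) *
        ∫⁻ σ : Sph d, capKer (2 * δ ^ 2 - 1) (w - v) σ *
          ENNReal.ofReal (min (ψ (post v w σ)) M * weight ε K (post v w σ)) ∂surf d
        ≤ ENNReal.ofReal (N * (2 / δ)) * ((∫⁻ v, massDensity ε K ψ v) *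
          (C * (ENNReal.ofReal ((2 * ρ) ^ (d - 1)) * ∫⁻ v, massDensity ε K ψ v))) := by
  obtain ⟨C, hC, h⟩ := exists_lintegral_post_le hd
  refine ⟨C, hC, fun {ε K ψ} hε hψ h0 {M N} hM hN {δ ρ} hδ hρ hδρ => ?_⟩
  set t := 2 * δ ^ 2 - 1 with htd
  have hG := measurable_massDensity (ε := ε) (K := K) hψ
  set G := massDensity ε K ψ with hGd
  have m1 : Measurable fun q : (E d × E d) × Sph d =>
      capKer t (q.1.1 - q.1.2) q.2 * G (post q.1.1 q.1.2 q.2) :=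
    Measurable.mul (by fun_prop) (hG.comp (by fun_prop))
  have m2 : Measurable fun p : E d × E d =>
      ∫⁻ σ : Sph d, capKer t (p.1 - p.2) σ * G (post p.1 p.2 σ) ∂surf d := m1.lintegral_prod_right'
  have m3 : Measurable fun p : E d × E d => ENNReal.ofReal (N * (2 / δ)) * (G p.2 *
      ∫⁻ σ : Sph d, capKer t (p.1 - p.2) σ * G (post p.1 p.2 σ) ∂surf d) :=
    Measurable.const_mul (Measurable.mul (hG.comp measurable_snd) m2) _
  have hpt : ∀ w v : E d, {w | ψ w ≤ N}.indicator 1 w * (ENNReal.ofReal (‖v - w‖ * ψ v * ψ w) *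
        ∫⁻ σ : Sph d, capKer t (w - v) σ *
          ENNReal.ofReal (min (ψ (post v w σ)) M * weight ε K (post v w σ)) ∂surf d)
      ≤ ENNReal.ofReal (N * (2 / δ)) * (G v *
          ∫⁻ σ : Sph d, capKer t (w - v) σ * G (post w v σ) ∂surf d) := by
    intro w v
    by_cases hw : ψ w ≤ N
    swap
    · simp [hw]
    have hi : {w | ψ w ≤ N}.indicator (1 : E d → ℝ≥0∞) w = 1 := by simp [hw]
    have n3 : Measurable fun σ : Sph d => capKer t (w - v) σ *
          ENNReal.ofReal (min (ψ (post v w σ)) M * weight ε K (post v w σ)) := by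
      have : Measurable fun σ : Sph d => ψ (post v w σ) := hψ.comp (by fun_prop)
      fun_prop
    have n4 : Measurable fun σ : Sph d => capKer t (w - v) σ * G (post w v σ) :=
      m1.comp (f := fun σ => ((w, v), σ)) (by fun_prop)
    rw [hi, one_mul, ← lintegral_const_mul _ n3, ← mul_assoc, ← lintegral_const_mul _ n4]
    refine lintegral_mono fun σ => ?_
    unfold capKer
    split_ifs with hc
    swap
    · simp
    rw [one_mul, one_mul, hGd]
    unfold massDensity
    rw [post_comm w v σ]
    have e1 := norm_sub_le_of_cap hc
    rw [post_comm w v σ, norm_sub_rev] at e1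
    set z := post v w σ with hz
    have hb : ∀ ξ : E d, 0 ≤ bracket ξ := fun ξ => (bracket_pos ξ).le
    have hw0 : ∀ ξ : E d, 0 ≤ weight ε K ξ := fun ξ => zero_le_one.trans (one_le_weight hε ξ)
    have hNδ : 0 ≤ N * (2 / δ) := by positivity
    rw [← ENNReal.ofReal_mul hNδ, ← ENNReal.ofReal_mul (mul_nonneg hNδ
      (mul_nonneg (h0 v) (mul_nonneg (hb v) (hw0 v)))),
      ← ENNReal.ofReal_mul (mul_nonneg (mul_nonneg (norm_nonneg _) (h0 v)) (h0 w))]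
    refine ENNReal.ofReal_le_ofReal ?_
    have e2 : ‖v - w‖ ≤ 2 / δ * (bracket z * bracket v) := by
      rw [div_mul_eq_mul_div, le_div_iff₀ hδ, mul_comm]; exact e1
    have p1 : 0 ≤ 2 / δ * (bracket z * bracket v) :=
      mul_nonneg (by positivity) (mul_nonneg (hb z) (hb v))
    calc ‖v - w‖ * ψ v * ψ w * (min (ψ z) M * weight ε K z)
        ≤ (2 / δ * (bracket z * bracket v)) * ψ v * N * (ψ z * weight ε K z) := by
          have q1 : ‖v - w‖ * ψ v * ψ w ≤ (2 / δ * (bracket z * bracket v)) * ψ v * N :=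
            mul_le_mul (mul_le_mul_of_nonneg_right e2 (h0 v)) hw (h0 w) (mul_nonneg p1 (h0 v))
          exact mul_le_mul q1 (mul_le_mul_of_nonneg_right (min_le_left _ _) (hw0 z))
            (mul_nonneg (le_min (h0 z) hM) (hw0 z)) (mul_nonneg (mul_nonneg p1 (h0 v)) hN)
      _ = (2 / δ * (bracket z * bracket v)) * ψ v * N * (ψ z * weight ε K z) * 1 := by ring
      _ ≤ (2 / δ * (bracket z * bracket v)) * ψ v * N * (ψ z * weight ε K z) * weight ε K v :=
          mul_le_mul_of_nonneg_left (one_le_weight hε v)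
            (mul_nonneg (mul_nonneg (mul_nonneg p1 (h0 v)) hN) (mul_nonneg (h0 z) (hw0 z)))
      _ = _ := by ring
  have k0 : Measurable fun p : E d × E d => ENNReal.ofReal (‖p.2 - p.1‖ * ψ p.2 * ψ p.1) *
        ∫⁻ σ : Sph d, capKer t (p.1 - p.2) σ *
          ENNReal.ofReal (min (ψ (post p.2 p.1 σ)) M * weight ε K (post p.2 p.1 σ)) ∂surf d := by
    have k1 : Measurable fun q : (E d × E d) × Sph d => ψ (post q.1.2 q.1.1 q.2) :=
      hψ.comp (by fun_prop)
    have k2 : Measurable fun q : (E d × E d) × Sph d => capKer t (q.1.1 - q.1.2) q.2 *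
        ENNReal.ofReal (min (ψ (post q.1.2 q.1.1 q.2)) M * weight ε K (post q.1.2 q.1.1 q.2)) := by
      fun_prop
    exact Measurable.mul (by fun_prop) k2.lintegral_prod_right'
  calc _ ≤ ∫⁻ w, ∫⁻ v, ENNReal.ofReal (N * (2 / δ)) * (G v *
          ∫⁻ σ : Sph d, capKer t (w - v) σ * G (post w v σ) ∂surf d) := by
        refine lintegral_mono fun w => ?_
        rw [← lintegral_const_mul]
        · exact lintegral_mono fun v => hpt w v
        · exact k0.comp (f := fun v => (w, v)) (by fun_prop)
    _ = ∫⁻ v, ∫⁻ w, ENNReal.ofReal (N * (2 / δ)) * (G v *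
          ∫⁻ σ : Sph d, capKer t (w - v) σ * G (post w v σ) ∂surf d) :=
        lintegral_lintegral_swap (f := fun w v => ENNReal.ofReal (N * (2 / δ)) * (G v *
          ∫⁻ σ : Sph d, capKer t (w - v) σ * G (post w v σ) ∂surf d)) m3.aemeasurable
    _ ≤ ∫⁻ v, ENNReal.ofReal (N * (2 / δ)) * (G v *
          (C * (ENNReal.ofReal ((2 * ρ) ^ (d - 1)) * ∫⁻ x, G x))) := by
        refine lintegral_mono fun v => ?_
        have m4 : Measurable fun w => ∫⁻ σ : Sph d, capKer t (w - v) σ * G (post w v σ) ∂surf d :=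
          m2.comp (f := fun w => (w, v)) (by fun_prop)
        dsimp only
        rw [lintegral_const_mul _ (m4.const_mul _), lintegral_const_mul _ m4]
        gcongr
        exact h δ ρ hδ hρ hδρ v G hG
    _ = _ := by
        rw [lintegral_const_mul _ (hG.mul_const _), lintegral_mul_const _ hG]

end integrated

lemma exists_mul_le_of_ne_zero {L η : ℝ≥0∞} (hL : L ≠ ∞) (hη : η ≠ 0) :
    ∃ x : ℝ≥0∞, x ≠ 0 ∧ x ≠ ∞ ∧ L * x ≤ η := by
  have h1 : L + 1 ≠ ∞ := ENNReal.add_ne_top.2 ⟨hL, ENNReal.one_ne_top⟩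
  have h0 : L + 1 ≠ 0 := by simp
  have hm : min η 1 ≠ ∞ := ne_top_of_le_ne_top ENNReal.one_ne_top (min_le_right _ _)
  refine ⟨min η 1 / (L + 1), ?_, ENNReal.div_ne_top hm h0, ?_⟩
  · refine (ENNReal.div_pos ?_ h1).ne'
    exact (lt_min (pos_iff_ne_zero.2 hη) one_pos).ne'
  · calc L * (min η 1 / (L + 1)) ≤ (L + 1) * (min η 1 / (L + 1)) :=
          mul_le_mul_left le_self_add _
      _ = min η 1 := ENNReal.mul_div_cancel h0 h1
      _ ≤ η := min_le_left _ _

/-- Absorption needs `X` finite. This is the reason for the truncation and for the profile-dependent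
step that precedes the uniform one. -/
lemma absorb_half {X D : ℝ≥0∞} {c : ℝ} (hc : 0 ≤ c) (hX : X ≠ ∞)
    (h : ENNReal.ofReal c * X ≤ ENNReal.ofReal (c / 2) * X + D) :
    ENNReal.ofReal (c / 2) * X ≤ D := by
  have e : ENNReal.ofReal c = ENNReal.ofReal (c / 2) + ENNReal.ofReal (c / 2) := by
    rw [← ENNReal.ofReal_add (by positivity) (by positivity), add_halves]
  rw [e, add_mul] at h
  exact (ENNReal.add_le_add_iff_left (ENNReal.mul_ne_top ENNReal.ofReal_ne_top hX)).1 h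

lemma exists_cap_parameters {d : ℕ} (hd : 2 ≤ d) {L C η : ℝ≥0∞} (hL : L ≠ ∞) (hC : C ≠ ∞)
    (hη : η ≠ 0) :
    ∃ (δ δ' ρ : ℝ) (s : ℝ≥0∞), 0 < δ ∧ 0 < δ' ∧ δ ^ 2 + δ' ^ 2 = 1 ∧ 0 ≤ 2 * δ ^ 2 - 1 ∧ 0 ≤ ρ ∧
      1 ≤ δ ^ 2 * (1 + ρ ^ 2) ∧ CapBound d (2 * δ ^ 2 - 1) s ∧
      L * (2 * s + 3 * (C * ENNReal.ofReal ((2 * ρ) ^ (d - 1)))) ≤ η := by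
  have hη2 : η / 2 ≠ 0 := (ENNReal.half_pos hη).ne'
  obtain ⟨s, hs0, hs1, hs⟩ := exists_mul_le_of_ne_zero (L := L * 2)
    (ENNReal.mul_ne_top hL (by simp)) hη2
  obtain ⟨x, hx0, hx1, hx⟩ := exists_mul_le_of_ne_zero (L := L * 3 * C)
    (ENNReal.mul_ne_top (ENNReal.mul_ne_top hL (by simp)) hC) hη2
  obtain ⟨κ, hκ0, hκ1, hκ⟩ := exists_small_cap hd hs0
  have hxr : 0 < x.toReal := ENNReal.toReal_pos hx0 hx1
  set ρ : ℝ := min x.toReal 1 / 2 with hρ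
  have hρ0 : 0 < ρ := by positivity
  have h2ρ : 2 * ρ = min x.toReal 1 := by rw [hρ]; ring
  -- The value of `δ²`: the first bound places the cap `2δ² - 1` inside the small cap, the second
  -- gives `δ²(1 + ρ²) ≥ 1`.
  set m : ℝ := max (1 - κ / 2) (1 / (1 + ρ ^ 2)) with hm
  have hm1 : m < 1 := by
    refine max_lt (by linarith) ?_
    rw [div_lt_one (by positivity)]
    have := pow_pos hρ0 2
    linarith
  have hmκ : 1 - κ / 2 ≤ m := le_max_left _ _
  have hmρ : 1 / (1 + ρ ^ 2) ≤ m := le_max_right _ _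
  have hm0 : 0 < m := by linarith
  refine ⟨Real.sqrt m, Real.sqrt (1 - m), ρ, s, Real.sqrt_pos.2 hm0,
    Real.sqrt_pos.2 (by linarith), ?_, ?_, hρ0.le, ?_, ?_, ?_⟩
  · rw [Real.sq_sqrt hm0.le, Real.sq_sqrt (by linarith)]; ring
  · rw [Real.sq_sqrt hm0.le]; linarith
  · rw [Real.sq_sqrt hm0.le]
    rwa [div_le_iff₀ (by positivity)] at hmρ
  · rw [Real.sq_sqrt hm0.le]
    intro e he
    refine (measure_mono fun ω hω => ?_).trans (hκ e he)
    simp only [Set.mem_ofPred_eq] at hω ⊢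
    linarith
  · have hpow : ENNReal.ofReal ((2 * ρ) ^ (d - 1)) ≤ x := by
      refine ENNReal.ofReal_le_of_le_toReal ?_
      calc (2 * ρ) ^ (d - 1) ≤ 2 * ρ :=
            pow_le_of_le_one (by positivity) (h2ρ ▸ min_le_right _ _) (by omega)
        _ ≤ x.toReal := h2ρ ▸ min_le_left _ _
    calc L * (2 * s + 3 * (C * ENNReal.ofReal ((2 * ρ) ^ (d - 1))))
        ≤ L * (2 * s + 3 * (C * x)) := by gcongr
      _ = L * 2 * s + L * 3 * C * x := by ring
      _ ≤ η / 2 + η / 2 := add_le_add hs hx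
      _ = η := ENNReal.add_halves η

section qualitative

variable {d : ℕ} {α ε : ℝ} {K : ℕ} {ψ : E d → ℝ}

/-- Dominated convergence. The level `N` depends on `ψ`, so bounds obtained through it are not
uniform over the profiles. -/
lemma exists_tail_le {g : E d → ℝ≥0∞} (hg : Measurable g) (hgi : ∫⁻ x, g x ≠ ∞)
    (hψ : Measurable ψ) {L η : ℝ≥0∞} (hL : L ≠ ∞) (hη : η ≠ 0) :
    ∃ N : ℝ, 0 ≤ N ∧ L * ∫⁻ x, {x | N < ψ x}.indicator 1 x * g x ≤ η := by
  have hm : ∀ n : ℕ, Measurable fun x => {x | (n : ℝ) < ψ x}.indicator (1 : E d → ℝ≥0∞) x * g x :=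
    fun n => (measurable_one.indicator (measurableSet_lt measurable_const hψ)).mul hg
  have hlim : Tendsto (fun n : ℕ => ∫⁻ x, {x | (n : ℝ) < ψ x}.indicator 1 x * g x) atTop
      (𝓝 (∫⁻ _ : E d, 0)) := by
    refine tendsto_lintegral_of_dominated_convergence g hm (fun n => Eventually.of_forall fun x => ?_)
      hgi (Eventually.of_forall fun x => ?_)
    · by_cases hx : (n : ℝ) < ψ x <;> simp [hx]
    · refine tendsto_const_nhds.congr' ?_
      obtain ⟨n, hn⟩ := exists_nat_ge (ψ x)
      filter_upwards [eventually_ge_atTop n] with k hk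
      have : ¬ (k : ℝ) < ψ x := not_lt.2 (hn.trans (Nat.cast_le.2 hk))
      simp [this]
  rw [lintegral_zero] at hlim
  have h2 := ENNReal.Tendsto.const_mul hlim (Or.inr hL)
  rw [mul_zero] at h2
  obtain ⟨n, hn⟩ := (h2.eventually_le_const (pos_iff_ne_zero.2 hη)).exists
  exact ⟨n, Nat.cast_nonneg n, hn⟩

namespace NiceProfile

lemma lintegral_massDensity_le (hd : 2 ≤ d) (h : NiceProfile α ψ) (hα0 : 0 < α) (hα1 : α ≤ 1)
    (hε : 0 ≤ ε) (hε1 : ε ≤ 1) :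
    ∫⁻ ξ, massDensity ε K ψ ξ ≤ ENNReal.ofReal (moment ψ (2 * K + 1)) := by
  unfold moment massDensity
  rw [integral_law h.meas h.nonneg, ofReal_integral_eq_lintegral_ofReal
    (h.integrable_mul_bracket_pow hd hα0 hα1 _) (Eventually.of_forall fun ξ =>
      mul_nonneg (h.nonneg ξ) (pow_nonneg (bracket_pos ξ).le _))]
  refine lintegral_mono fun ξ => ENNReal.ofReal_le_ofReal ?_
  refine mul_le_mul_of_nonneg_left ?_ (h.nonneg ξ)
  rw [pow_succ, mul_comm]
  exact mul_le_mul_of_nonneg_right (weight_le hε hε1 ξ) (bracket_pos ξ).le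

lemma lintegral_truncEnergy_ne_top (hd : 2 ≤ d) (h : NiceProfile α ψ) (hα0 : 0 < α) (hα1 : α ≤ 1)
    (hε : 0 ≤ ε) (hε1 : ε ≤ 1) {M : ℝ} (hM : 0 ≤ M) : ∫⁻ ξ, truncEnergy ε K ψ M ξ ≠ ∞ := by
  have hm := measurable_massDensity (ε := ε) (K := K) h.meas
  have hle : ∫⁻ ξ, truncEnergy ε K ψ M ξ ≤ ENNReal.ofReal M * ∫⁻ ξ, massDensity ε K ψ ξ := by
    rw [← lintegral_const_mul _ hm]
    refine lintegral_mono fun ξ => ?_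
    unfold truncEnergy massDensity
    rw [← ENNReal.ofReal_mul hM]
    refine ENNReal.ofReal_le_ofReal ?_
    have hw : 0 ≤ ψ ξ * (bracket ξ * weight ε K ξ) :=
      mul_nonneg (h.nonneg ξ) (mul_nonneg (bracket_pos ξ).le (weight_pos hε ξ).le)
    calc _ = min (ψ ξ) M * (ψ ξ * (bracket ξ * weight ε K ξ)) := by ring
      _ ≤ _ := mul_le_mul_of_nonneg_right (min_le_right _ _) hw
  refine ne_top_of_le_ne_top (ENNReal.mul_ne_top ENNReal.ofReal_ne_top ?_) hle
  exact ne_top_of_le_ne_top ENNReal.ofReal_ne_top (h.lintegral_massDensity_le hd hα0 hα1 hε hε1)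

lemma weighted_inequality_lintegral (h : NiceProfile α ψ) (hε : 0 ≤ ε) {c M : ℝ} (hc : 0 ≤ c)
    (hM : 0 ≤ M) (hX : ∫⁻ ξ, truncEnergy ε K ψ M ξ ≠ ∞)
    (hI : c * ∫ ξ, ψ ξ * min (ψ ξ) M * (bracket ξ * weight ε K ξ)
          ≤ ∫ ξ, Qplus ψ ψ ξ * (min (ψ ξ) M * weight ε K ξ)) :
    ENNReal.ofReal c * ∫⁻ ξ, truncEnergy ε K ψ M ξ
      ≤ ∫⁻ ξ, gain ψ ξ * ENNReal.ofReal (min (ψ ξ) M * weight ε K ξ) := by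
  have hψ := h.meas
  have hQ := h.measurable_Qplus
  have hQ0 : ∀ ξ, Qplus ψ ψ ξ = (gain ψ ξ).toReal := Qplus_eq_toReal_gain h.meas h.nonneg
  have hT : ∀ ξ, 0 ≤ min (ψ ξ) M := fun ξ => le_min (h.nonneg ξ) hM
  have e1 : ∫ ξ, ψ ξ * min (ψ ξ) M * (bracket ξ * weight ε K ξ)
      = (∫⁻ ξ, truncEnergy ε K ψ M ξ).toReal := by
    refine integral_eq_lintegral_of_nonneg_ae (Eventually.of_forall fun ξ => ?_)
      (Measurable.aestronglyMeasurable (by fun_prop))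
    exact mul_nonneg (mul_nonneg (h.nonneg ξ) (hT ξ))
      (mul_nonneg (bracket_pos ξ).le (weight_pos hε ξ).le)
  have e2 : ∫ ξ, Qplus ψ ψ ξ * (min (ψ ξ) M * weight ε K ξ)
      = (∫⁻ ξ, ENNReal.ofReal (Qplus ψ ψ ξ * (min (ψ ξ) M * weight ε K ξ))).toReal := by
    refine integral_eq_lintegral_of_nonneg_ae (Eventually.of_forall fun ξ => ?_)
      (Measurable.aestronglyMeasurable (by fun_prop))
    show 0 ≤ Qplus ψ ψ ξ * (min (ψ ξ) M * weight ε K ξ)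
    rw [hQ0]
    exact mul_nonneg ENNReal.toReal_nonneg (mul_nonneg (hT ξ) (weight_pos hε ξ).le)
  calc ENNReal.ofReal c * ∫⁻ ξ, truncEnergy ε K ψ M ξ
      = ENNReal.ofReal (c * ∫ ξ, ψ ξ * min (ψ ξ) M * (bracket ξ * weight ε K ξ)) := by
        rw [e1, ENNReal.ofReal_mul hc, ENNReal.ofReal_toReal hX]
    _ ≤ ENNReal.ofReal (∫ ξ, Qplus ψ ψ ξ * (min (ψ ξ) M * weight ε K ξ)) :=
        ENNReal.ofReal_le_ofReal hI
    _ ≤ ∫⁻ ξ, ENNReal.ofReal (Qplus ψ ψ ξ * (min (ψ ξ) M * weight ε K ξ)) := by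
        rw [e2]; exact ENNReal.ofReal_toReal_le
    _ ≤ _ := by
        refine lintegral_mono fun ξ => ?_
        dsimp only
        rw [hQ0, ENNReal.ofReal_mul ENNReal.toReal_nonneg]
        exact mul_le_mul_left ENNReal.ofReal_toReal_le _

/-- Three pieces of the gain: `ψ(w)` large, small by the tail of the mass; `ψ(w)` bounded with a
narrow cap, small by the cap; `ψ(w)` bounded away from the cap, finite independently of `M`. The
first two are absorbed. -/
theorem exists_truncEnergy_bound (hd : 2 ≤ d) (h : NiceProfile α ψ) (hα0 : 0 < α) (hα1 : α ≤ 1)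
    (hε : 0 ≤ ε) (hε1 : ε ≤ 1) {c : ℝ} (hc : 0 < c)
    (hI : ∀ M : ℝ, 0 ≤ M → ENNReal.ofReal c * ∫⁻ ξ, truncEnergy ε K ψ M ξ
      ≤ ∫⁻ ξ, gain ψ ξ * ENNReal.ofReal (min (ψ ξ) M * weight ε K ξ)) :
    ∃ B : ℝ≥0∞, B ≠ ∞ ∧ ∀ M : ℝ, 0 ≤ M → ∫⁻ ξ, truncEnergy ε K ψ M ξ ≤ B := by
  obtain ⟨C₁, hC₁, h₁⟩ := exists_lintegral_cap_trunc_le hd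
  obtain ⟨C₂, hC₂, h₂⟩ := exists_lintegral_far_le hd
  have hψ := h.meas
  set A : ℝ≥0∞ := ENNReal.ofReal (1 / sphereArea d) * 2 with hA
  have hAt : A ≠ ∞ := ENNReal.mul_ne_top ENNReal.ofReal_ne_top (by simp)
  have hgm := measurable_massDensity (ε := ε) (K := K) hψ
  have hgt : ∫⁻ ξ, massDensity ε K ψ ξ ≠ ∞ :=
    ne_top_of_le_ne_top ENNReal.ofReal_ne_top (h.lintegral_massDensity_le hd hα0 hα1 hε hε1)
  set g := massDensity ε K ψ with hg
  -- The constant for the full forward hemisphere, where `δ² = 1/2` and `ρ = 1`.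
  set P : ℝ≥0∞ := 2 * surf d Set.univ + 3 * (C₁ * ENNReal.ofReal ((2 * 1) ^ (d - 1))) with hP
  have hPt : P ≠ ∞ := by
    rw [hP]
    exact ENNReal.add_ne_top.2 ⟨ENNReal.mul_ne_top (by simp) (measure_ne_top _ _),
      ENNReal.mul_ne_top (by simp) (ENNReal.mul_ne_top hC₁ ENNReal.ofReal_ne_top)⟩
  have hη : ENNReal.ofReal (c / 4) ≠ 0 := (ENNReal.ofReal_pos.2 (by positivity)).ne'
  obtain ⟨N, hN0, hN⟩ := exists_tail_le hgm hgt hψ (ENNReal.mul_ne_top hAt hPt) hη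
  obtain ⟨δ, δ', ρ, s, hδ, hδ', hδδ, ht, hρ, hδρ, hs, hsmall⟩ :=
    exists_cap_parameters hd (ENNReal.mul_ne_top hAt hgt) hC₁ hη
  set F : ℝ≥0∞ := ENNReal.ofReal (N * (2 / δ')) * ((∫⁻ v, g v) *
          (C₂ * (ENNReal.ofReal ((2 * (1 / δ')) ^ (d - 1)) * ∫⁻ v, g v))) with hF
  have hFt : F ≠ ∞ := ENNReal.mul_ne_top ENNReal.ofReal_ne_top (ENNReal.mul_ne_top hgt
    (ENNReal.mul_ne_top hC₂ (ENNReal.mul_ne_top ENNReal.ofReal_ne_top hgt)))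
  refine ⟨A * F / ENNReal.ofReal (c / 2), ENNReal.div_ne_top (ENNReal.mul_ne_top hAt hFt)
    (ENNReal.ofReal_pos.2 (by positivity)).ne', fun M hM => ?_⟩
  have hXt := h.lintegral_truncEnergy_ne_top (K := K) hd hα0 hα1 hε hε1 hM
  set X := ∫⁻ ξ, truncEnergy ε K ψ M ξ with hX
  rw [ENNReal.le_div_iff_mul_le (Or.inl (ENNReal.ofReal_pos.2 (by positivity)).ne')
    (Or.inl ENNReal.ofReal_ne_top), mul_comm]
  refine absorb_half hc.le hXt ((hI M hM).trans ?_)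
  have hφm : Measurable fun ξ => ENNReal.ofReal (min (ψ ξ) M * weight ε K ξ) := by fun_prop
  refine (lintegral_gain_half hd hψ hφm).trans ?_
  set φ : E d → ℝ≥0∞ := fun ξ => ENNReal.ofReal (min (ψ ξ) M * weight ε K ξ) with hφ
  let J : (E d → E d → ℝ≥0∞) → E d → ℝ≥0∞ := fun k w => ∫⁻ v,
    ENNReal.ofReal (‖v - w‖ * ψ v * ψ w) * ∫⁻ σ : Sph d, k (v - w) σ * φ (post v w σ) ∂surf d
  have mJ2 : ∀ t : ℝ, ∀ a : ℝ, Measurable fun p : E d × E d =>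
      ENNReal.ofReal (‖p.2 - p.1‖ * ψ p.2 * ψ p.1) *
        ∫⁻ σ : Sph d, capKer t (a • (p.2 - p.1)) σ * φ (post p.2 p.1 σ) ∂surf d := fun t a => by
    have k2 : Measurable fun q : (E d × E d) × Sph d =>
        capKer t (a • (q.1.2 - q.1.1)) q.2 * φ (post q.1.2 q.1.1 q.2) :=
      Measurable.mul (by fun_prop) (hφm.comp (by fun_prop))
    exact Measurable.mul (by fun_prop) k2.lintegral_prod_right'
  have mJ : ∀ t a : ℝ, Measurable (J fun u σ => capKer t (a • u) σ) := fun t a =>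
    (mJ2 t a).lintegral_prod_right'
  have mJ1 : ∀ t : ℝ, Measurable (J (capKer t)) := fun t => by simpa using mJ t 1
  have mJ0 : ∀ t : ℝ, Measurable (J fun u σ => capKer t (-u) σ) := fun t => by simpa using mJ t (-1)
  have mσ : ∀ (t : ℝ) (v w : E d), Measurable fun σ : Sph d =>
      capKer t (v - w) σ * φ (post v w σ) := fun t v w =>
    Measurable.mul (by fun_prop) (hφm.comp (by fun_prop))
  have mi1 : Measurable ({w | N < ψ w}.indicator (1 : E d → ℝ≥0∞)) :=
    measurable_one.indicator (measurableSet_lt measurable_const hψ)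
  have mi2 : Measurable ({w | ψ w ≤ N}.indicator (1 : E d → ℝ≥0∞)) :=
    measurable_one.indicator (measurableSet_le hψ measurable_const)
  have hJsplit : ∀ t w, J (capKer 0) w
      ≤ J (capKer t) w + J (fun u σ => capKer (-t) (-u) σ) w := by
    intro t w
    have m1 : Measurable fun v => ENNReal.ofReal (‖v - w‖ * ψ v * ψ w) *
        ∫⁻ σ : Sph d, capKer t (v - w) σ * φ (post v w σ) ∂surf d := by
      have := (mJ2 t 1).comp (f := fun v : E d => (w, v)) (by fun_prop)
      simpa [Function.comp_def] using this
    simp only [J]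
    rw [← lintegral_add_left m1]
    refine lintegral_mono fun v => ?_
    dsimp only
    rw [← mul_add, ← lintegral_add_left (mσ t v w)]
    refine mul_le_mul_right (lintegral_mono fun σ => ?_) _
    rw [← add_mul]
    exact mul_le_mul_left ((capKer_le_one 0 _ _).trans (one_le_capKer_add _ _)) _
  set t := 2 * δ ^ 2 - 1 with htd
  have hpt : ∀ w, J (capKer 0) w ≤ {w | N < ψ w}.indicator 1 w * J (capKer 0) w
      + (J (capKer t) w + {w | ψ w ≤ N}.indicator 1 w * J (fun u σ => capKer (-t) (-u) σ) w) := by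
    intro w
    by_cases hw : N < ψ w
    · simp [hw]
    · simpa [hw, not_lt.1 hw] using hJsplit t w
  have b1 : ∫⁻ w, {w | N < ψ w}.indicator 1 w * J (capKer 0) w
      ≤ (∫⁻ w, {w | N < ψ w}.indicator 1 w * g w) * (P * X) := by
    have mig : Measurable fun w => {w | N < ψ w}.indicator 1 w * g w := mi1.mul hgm
    rw [← lintegral_mul_const _ mig]
    refine lintegral_mono fun w => ?_
    rw [mul_assoc]
    refine mul_le_mul_right ?_ _
    have hq : 2 * Real.sqrt (1 / 2) ^ 2 - 1 = 0 := by
      rw [Real.sq_sqrt (by norm_num)]; norm_num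
    have := h₁ hε hψ h.nonneg hM (δ := Real.sqrt (1 / 2)) (ρ := 1) (K := K)
      (Real.sqrt_pos.2 (by norm_num)) zero_le_one
      (by rw [Real.sq_sqrt (by norm_num)]; norm_num) hq.ge (capBound_univ d _) w
    rw [hq] at this
    exact this
  have b2 : ∫⁻ w, J (capKer t) w
      ≤ (∫⁻ w, g w) * ((2 * s + 3 * (C₁ * ENNReal.ofReal ((2 * ρ) ^ (d - 1)))) * X) := by
    rw [← lintegral_mul_const _ hgm]
    exact lintegral_mono fun w => h₁ hε hψ h.nonneg hM hδ hρ hδρ ht hs w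
  have b3 : ∫⁻ w, {w | ψ w ≤ N}.indicator 1 w * J (fun u σ => capKer (-t) (-u) σ) w ≤ F := by
    -- Since `δ² + δ'² = 1`, the complementary cap is again of the standard form, with the roles of
    -- `v` and `w` exchanged.
    have ht' : -t = 2 * δ' ^ 2 - 1 := by rw [htd]; linarith
    have hρ' : 1 ≤ δ' ^ 2 * (1 + (1 / δ') ^ 2) := by
      have : δ' ^ 2 * (1 + (1 / δ') ^ 2) = δ' ^ 2 + 1 := by field_simp
      rw [this]; linarith [sq_nonneg δ']
    have := h₂ (K := K) hε hψ h.nonneg hM hN0 hδ' (by positivity) hρ'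
    rw [← ht'] at this
    refine le_trans (le_of_eq ?_) this
    simp only [J, neg_sub, hφ]
  have m3 : Measurable fun w => {w | ψ w ≤ N}.indicator (1 : E d → ℝ≥0∞) w *
      J (fun u σ => capKer (-t) (-u) σ) w := mi2.mul (mJ0 _)
  have hsum : ∫⁻ w, J (capKer 0) w ≤ (∫⁻ w, {w | N < ψ w}.indicator 1 w * g w) * (P * X)
      + ((∫⁻ w, g w) * ((2 * s + 3 * (C₁ * ENNReal.ofReal ((2 * ρ) ^ (d - 1)))) * X) + F) := by
    refine (lintegral_mono hpt).trans ?_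
    have miJ : Measurable fun w => {w | N < ψ w}.indicator 1 w * J (capKer 0) w := mi1.mul (mJ1 0)
    rw [lintegral_add_left miJ, lintegral_add_left (mJ1 t)]
    exact add_le_add b1 (add_le_add b2 b3)
  have hc4 : ENNReal.ofReal (c / 2) = ENNReal.ofReal (c / 4) + ENNReal.ofReal (c / 4) := by
    rw [← ENNReal.ofReal_add (by positivity) (by positivity)]; congr 1; ring
  calc _ = A * ∫⁻ w, J (capKer 0) w := by rw [hA, mul_assoc]
    _ ≤ A * ((∫⁻ w, {w | N < ψ w}.indicator 1 w * g w) * (P * X)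
      + ((∫⁻ w, g w) * ((2 * s + 3 * (C₁ * ENNReal.ofReal ((2 * ρ) ^ (d - 1)))) * X) + F)) :=
        mul_le_mul_right hsum A
    _ = (A * P * ∫⁻ w, {w | N < ψ w}.indicator 1 w * g w) * X
      + (A * (∫⁻ w, g w)) * (2 * s + 3 * (C₁ * ENNReal.ofReal ((2 * ρ) ^ (d - 1)))) * X
        + A * F := by ring
    _ ≤ ENNReal.ofReal (c / 4) * X + ENNReal.ofReal (c / 4) * X + A * F := by gcongr
    _ = _ := by rw [hc4, add_mul]

end NiceProfile

end qualitative

/-! ### Uniform gain estimate by smoothing -/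

/-- The density `ψ² ⟨ξ⟩ w` of the weighted energy. -/
def energyDensity {d : ℕ} (ε : ℝ) (K : ℕ) (ψ : E d → ℝ) (ξ : E d) : ℝ≥0∞ :=
  ENNReal.ofReal (ψ ξ * ψ ξ * (bracket ξ * weight ε K ξ))

/-- The square root `ψ (⟨ξ⟩ w)^{1/2}` of the energy density. -/
def rootDensity {d : ℕ} (ε : ℝ) (K : ℕ) (ψ : E d → ℝ) (ξ : E d) : ℝ≥0∞ :=
  ENNReal.ofReal (ψ ξ * Real.sqrt (bracket ξ * weight ε K ξ))

section smoothing

variable {d : ℕ} {ε : ℝ} {K : ℕ} {ψ : E d → ℝ}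

lemma measurable_rootDensity (hψ : Measurable ψ) : Measurable (rootDensity ε K ψ) := by
  unfold rootDensity; fun_prop

lemma one_le_bracket_mul_weight (hε : 0 ≤ ε) (ξ : E d) : 1 ≤ bracket ξ * weight ε K ξ :=
  one_le_mul_of_one_le_of_one_le (one_le_bracket ξ) (one_le_weight hε ξ)

lemma rootDensity_sq (hε : 0 ≤ ε) (h0 : ∀ ξ, 0 ≤ ψ ξ) (ξ : E d) :
    rootDensity ε K ψ ξ ^ 2 = energyDensity ε K ψ ξ := by
  unfold rootDensity energyDensity
  have hp : 0 ≤ bracket ξ * weight ε K ξ := zero_le_one.trans (one_le_bracket_mul_weight hε ξ)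
  rw [← ENNReal.ofReal_pow (mul_nonneg (h0 ξ) (Real.sqrt_nonneg _)), mul_pow, Real.sq_sqrt hp, sq]

lemma rootDensity_le_massDensity (hε : 0 ≤ ε) (h0 : ∀ ξ, 0 ≤ ψ ξ) (ξ : E d) :
    rootDensity ε K ψ ξ ≤ massDensity ε K ψ ξ := by
  refine ENNReal.ofReal_le_ofReal (mul_le_mul_of_nonneg_left ?_ (h0 ξ))
  have h1 := one_le_bracket_mul_weight (K := K) hε ξ
  rw [Real.sqrt_le_left (zero_le_one.trans h1)]
  exact le_self_pow₀ h1 two_ne_zero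

lemma mul_le_weighted_sq_add {a b η : ℝ≥0∞} (h0 : η ≠ 0) (ht : η ≠ ∞) :
    a * b ≤ η * a ^ 2 + η⁻¹ * b ^ 2 := by
  rcases le_total b (η * a) with h | h
  · calc a * b ≤ a * (η * a) := mul_le_mul_right h a
      _ = η * a ^ 2 := by ring
      _ ≤ _ := le_self_add
  · have h2 : a ≤ η⁻¹ * b := by
      calc a = η⁻¹ * (η * a) := by rw [← mul_assoc, ENNReal.inv_mul_cancel h0 ht, one_mul]
        _ ≤ _ := mul_le_mul_right h _
    calc a * b ≤ (η⁻¹ * b) * b := mul_le_mul_left h2 b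
      _ = η⁻¹ * b ^ 2 := by rw [mul_assoc, sq]
      _ ≤ _ := le_add_self

/-- A geometric mean of two bounds, one paid at `v` and one at `v'`, so that each carries the square
root of its weight and the remainder sits at `w`. The value `3` comes from `2·3 ≤ 3²`; for small
relative velocities the rate itself may be used. -/
lemma rate_weight_post_le (hε : 0 ≤ ε) {v w : E d} {σ : Sph d}
    (hc : 0 ≤ inner ℝ (v - w) (σ : E d)) {m : ℝ} (hm : ‖v - w‖ ≤ m ∨ 3 ≤ m) :
    ‖v - w‖ * weight ε K (post v w σ) ≤ m * (Real.sqrt (bracket v * weight ε K v) *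
      Real.sqrt (bracket (post v w σ) * weight ε K (post v w σ)) *
        (bracket w * weight ε K w)) := by
  have e1 := norm_sub_le_bracket_mul v w
  have e2 := norm_sub_le_of_half hc
  have e3 : weight ε K (post v w σ) ≤ weight ε K v * weight ε K w := weight_post_le hε v w σ
  set z := post v w σ
  have hw : ∀ ξ : E d, 1 ≤ weight ε K ξ := fun ξ => one_le_weight hε ξ
  have hw0 : ∀ ξ : E d, 0 < weight ε K ξ := fun ξ => weight_pos hε ξ
  have hb : ∀ ξ : E d, 0 < bracket ξ := bracket_pos
  have hb1 : ∀ ξ : E d, 1 ≤ bracket ξ := one_le_bracket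
  have hn := norm_nonneg (v - w)
  have hm0 : 0 ≤ m := by rcases hm with h | h <;> linarith
  have hbw : ∀ ξ : E d, 0 < bracket ξ * weight ε K ξ := fun ξ => mul_pos (hb ξ) (hw0 ξ)
  have hR : 0 ≤ m * (Real.sqrt (bracket v * weight ε K v) *
      Real.sqrt (bracket z * weight ε K z) * (bracket w * weight ε K w)) :=
    mul_nonneg hm0 (mul_nonneg (mul_nonneg (Real.sqrt_nonneg _) (Real.sqrt_nonneg _)) (hbw w).le)
  refine (abs_le_of_sq_le_sq' ?_ hR).2
  have hsq : (m * (Real.sqrt (bracket v * weight ε K v) *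
      Real.sqrt (bracket z * weight ε K z) * (bracket w * weight ε K w))) ^ 2
      = m ^ 2 * ((bracket v * bracket z * bracket w ^ 2) *
        (weight ε K v * weight ε K z * weight ε K w ^ 2)) := by
    rw [mul_pow, mul_pow, mul_pow, Real.sq_sqrt (hbw v).le, Real.sq_sqrt (hbw z).le]
    ring
  rw [hsq, mul_pow]
  have hW : weight ε K z ^ 2 ≤ weight ε K v * weight ε K z * weight ε K w ^ 2 := by
    calc weight ε K z ^ 2 = weight ε K z * weight ε K z := sq _
      _ ≤ (weight ε K v * weight ε K w) * weight ε K z := mul_le_mul_of_nonneg_right e3 (hw0 z).le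
      _ = (weight ε K v * weight ε K z * weight ε K w) * 1 := by ring
      _ ≤ (weight ε K v * weight ε K z * weight ε K w) * weight ε K w :=
          mul_le_mul_of_nonneg_left (hw w)
            (mul_pos (mul_pos (hw0 v) (hw0 z)) (hw0 w)).le
      _ = _ := by ring
  have hB : ‖v - w‖ ^ 2 ≤ m ^ 2 * (bracket v * bracket z * bracket w ^ 2) := by
    have hB1 : 1 ≤ bracket v * bracket z * bracket w ^ 2 :=
      one_le_mul_of_one_le_of_one_le (one_le_mul_of_one_le_of_one_le (hb1 v) (hb1 z))
        (one_le_pow₀ (hb1 w))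
    rcases hm with h | h
    · calc ‖v - w‖ ^ 2 ≤ m ^ 2 := pow_le_pow_left₀ hn h 2
        _ ≤ _ := le_mul_of_one_le_right (sq_nonneg _) hB1
    · calc ‖v - w‖ ^ 2 = ‖v - w‖ * ‖v - w‖ := sq _
        _ ≤ (2 * (bracket v * bracket w)) * (3 * (bracket z * bracket w)) :=
            mul_le_mul e1 e2 hn (mul_pos two_pos (mul_pos (hb v) (hb w))).le
        _ = 6 * (bracket v * bracket z * bracket w ^ 2) := by ring
        _ ≤ m ^ 2 * (bracket v * bracket z * bracket w ^ 2) :=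
            mul_le_mul_of_nonneg_right (by nlinarith) (zero_le_one.trans hB1)
  calc ‖v - w‖ ^ 2 * weight ε K z ^ 2
      ≤ (m ^ 2 * (bracket v * bracket z * bracket w ^ 2)) *
        (weight ε K v * weight ε K z * weight ε K w ^ 2) :=
        mul_le_mul hB hW (sq_nonneg _) ((sq_nonneg _).trans hB)
    _ = _ := by ring

/-- The collision rate after absorption of the weights: at most `3`, and at most `r` for relative
velocities below `r`. -/
def rateCut {d : ℕ} (r : ℝ) (u : E d) : ℝ≥0∞ := if r ≤ ‖u‖ then 3 else ENNReal.ofReal r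

@[fun_prop]
lemma measurable_rateCut {X : Type*} [MeasurableSpace X] (r : ℝ) {f : X → E d}
    (hf : Measurable f) : Measurable fun x => rateCut r (f x) :=
  Measurable.ite (measurableSet_le measurable_const (by fun_prop)) measurable_const measurable_const

lemma rate_root_le (hε : 0 ≤ ε) (h0 : ∀ ξ, 0 ≤ ψ ξ) (r : ℝ) (v w : E d) (σ : Sph d) :
    ENNReal.ofReal (‖v - w‖ * ψ v * ψ w) * (capKer 0 (v - w) σ *
        ENNReal.ofReal (ψ (post v w σ) * weight ε K (post v w σ)))
      ≤ (massDensity ε K ψ w * (rateCut r (v - w) * rootDensity ε K ψ v)) *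
        (capKer 0 (v - w) σ * rootDensity ε K ψ (post v w σ)) := by
  unfold capKer
  split_ifs with hc
  swap
  · simp
  rw [zero_mul] at hc
  have hw0 : ∀ ξ : E d, 0 ≤ weight ε K ξ := fun ξ => (weight_pos hε ξ).le
  have hb : ∀ ξ : E d, 0 ≤ bracket ξ := fun ξ => (bracket_pos ξ).le
  obtain ⟨m, hm, hmr⟩ : ∃ m : ℝ, (‖v - w‖ ≤ m ∨ 3 ≤ m) ∧ rateCut r (v - w) = ENNReal.ofReal m := by
    unfold rateCut
    by_cases h : r ≤ ‖v - w‖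
    · exact ⟨3, Or.inr le_rfl, by rw [if_pos h, ENNReal.ofReal_ofNat]⟩
    · exact ⟨r, Or.inl (not_le.1 h).le, by rw [if_neg h]⟩
  have hm0 : 0 ≤ m := by rcases hm with h | h <;> linarith [norm_nonneg (v - w)]
  have key := rate_weight_post_le (K := K) hε hc hm
  rw [one_mul, one_mul, hmr]
  unfold massDensity rootDensity
  set z := post v w σ
  have q1 : 0 ≤ ψ w * (bracket w * weight ε K w) := mul_nonneg (h0 w) (mul_nonneg (hb w) (hw0 w))
  have q2 : 0 ≤ ψ v * Real.sqrt (bracket v * weight ε K v) := mul_nonneg (h0 v) (Real.sqrt_nonneg _)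
  rw [← ENNReal.ofReal_mul (mul_nonneg (mul_nonneg (norm_nonneg _) (h0 v)) (h0 w)),
    ← ENNReal.ofReal_mul hm0, ← ENNReal.ofReal_mul q1,
    ← ENNReal.ofReal_mul (mul_nonneg q1 (mul_nonneg hm0 q2))]
  refine ENNReal.ofReal_le_ofReal ?_
  calc ‖v - w‖ * ψ v * ψ w * (ψ z * weight ε K z)
      = (ψ v * ψ w * ψ z) * (‖v - w‖ * weight ε K z) := by ring
    _ ≤ (ψ v * ψ w * ψ z) * (m * (Real.sqrt (bracket v * weight ε K v) *
      Real.sqrt (bracket z * weight ε K z) * (bracket w * weight ε K w))) :=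
        mul_le_mul_of_nonneg_left key (mul_nonneg (mul_nonneg (h0 v) (h0 w)) (h0 z))
    _ = _ := by ring

/-- For each `w`, the gain becomes the pairing of the root density with its own cone average, both
centred at `w`. This form makes the smoothing estimate applicable. -/
lemma exists_gain_weight_le (hd : 2 ≤ d) :
    ∃ C : ℝ≥0∞, C ≠ ∞ ∧ ∀ {ε : ℝ} {K : ℕ} {ψ : E d → ℝ}, 0 ≤ ε → Measurable ψ → (∀ ξ, 0 ≤ ψ ξ) →
      ∀ r : ℝ, ∫⁻ ξ, gain ψ ξ * ENNReal.ofReal (ψ ξ * weight ε K ξ)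
        ≤ C * ∫⁻ w, massDensity ε K ψ w * ∫⁻ u, rateCut r u * (rootDensity ε K ψ (w + u) *
          coneAvg (Real.sqrt (1 / 2)) (fun y => rootDensity ε K ψ (w + y)) u) := by
  obtain ⟨C, hC, h⟩ := exists_lintegral_cap_le hd
  have := nontrivial_E hd
  refine ⟨ENNReal.ofReal (1 / sphereArea d) * 2 * C, ENNReal.mul_ne_top
    (ENNReal.mul_ne_top ENNReal.ofReal_ne_top (by simp)) hC, fun {ε K ψ} hε hψ h0 r => ?_⟩
  have hφm : Measurable fun ξ => ENNReal.ofReal (ψ ξ * weight ε K ξ) := by fun_prop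
  refine (lintegral_gain_half hd hψ hφm).trans ?_
  have hf := measurable_rootDensity (ε := ε) (K := K) hψ
  have hgm := measurable_massDensity (ε := ε) (K := K) hψ
  set f := rootDensity ε K ψ with hfd
  set δ := Real.sqrt (1 / 2) with hδ
  have hq : 2 * δ ^ 2 - 1 = 0 := by
    rw [hδ, Real.sq_sqrt (by norm_num)]; norm_num
  have hmc : Measurable fun p : E d × E d => coneAvg δ (fun y => f (p.1 + y)) p.2 :=
    measurable_coneAvg (X := E d × E d) δ (h := fun p y => f (p.1 + y))
      (hf.comp (by fun_prop)) measurable_snd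
  have hmi : Measurable fun p : E d × E d => rateCut r p.2 * (f (p.1 + p.2) *
      coneAvg δ (fun y => f (p.1 + y)) p.2) :=
    Measurable.mul (by fun_prop) (Measurable.mul (hf.comp (by fun_prop)) hmc)
  have hinner : ∀ w, ∫⁻ v, ENNReal.ofReal (‖v - w‖ * ψ v * ψ w) *
        ∫⁻ σ : Sph d, capKer 0 (v - w) σ * ENNReal.ofReal (ψ (post v w σ) *
          weight ε K (post v w σ)) ∂surf d
      ≤ C * (massDensity ε K ψ w * ∫⁻ u, rateCut r u * (f (w + u) *
          coneAvg δ (fun y => f (w + y)) u)) := by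
    intro w
    have hmw : Measurable fun u : E d => rateCut r u * (f (w + u) *
        coneAvg δ (fun y => f (w + y)) u) := hmi.comp (f := fun u => (w, u)) (by fun_prop)
    have hne : ∀ᵐ v : E d, v ≠ w := compl_mem_ae_iff.2 (measure_singleton w)
    rw [← lintegral_sub_right_eq_self (fun u : E d => rateCut r u * (f (w + u) *
        coneAvg δ (fun y => f (w + y)) u)) w, ← mul_assoc, ← lintegral_const_mul]
    swap
    · exact hmw.comp (f := fun v => v - w) (by fun_prop)
    refine lintegral_mono_ae ?_
    filter_upwards [hne] with v hv
    have n1 : Measurable fun σ : Sph d => capKer 0 (v - w) σ * ENNReal.ofReal (ψ (post v w σ) *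
          weight ε K (post v w σ)) :=
      Measurable.mul (by fun_prop) (hφm.comp (by fun_prop))
    have n2 : Measurable fun σ : Sph d => capKer 0 (v - w) σ * f (post v w σ) :=
      Measurable.mul (by fun_prop) (hf.comp (by fun_prop))
    have hcap := h v w hv δ (Real.sqrt_nonneg _) f hf
    rw [hq] at hcap
    rw [add_sub_cancel]
    calc _ = ∫⁻ σ : Sph d, ENNReal.ofReal (‖v - w‖ * ψ v * ψ w) * (capKer 0 (v - w) σ *
          ENNReal.ofReal (ψ (post v w σ) * weight ε K (post v w σ))) ∂surf d :=
          (lintegral_const_mul _ n1).symm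
      _ ≤ ∫⁻ σ : Sph d, (massDensity ε K ψ w * (rateCut r (v - w) * f v)) *
        (capKer 0 (v - w) σ * f (post v w σ)) ∂surf d :=
          lintegral_mono fun σ => rate_root_le hε h0 r v w σ
      _ = (massDensity ε K ψ w * (rateCut r (v - w) * f v)) *
        ∫⁻ σ : Sph d, capKer 0 (v - w) σ * f (post v w σ) ∂surf d := lintegral_const_mul _ n2
      _ ≤ (massDensity ε K ψ w * (rateCut r (v - w) * f v)) *
        (C * coneAvg δ (fun y => f (w + y)) (v - w)) := mul_le_mul_right hcap _
      _ = _ := by ring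
  have hm1 : Measurable fun w => massDensity ε K ψ w * ∫⁻ u, rateCut r u * (f (w + u) *
          coneAvg δ (fun y => f (w + y)) u) := hgm.mul hmi.lintegral_prod_right'
  rw [mul_assoc (ENNReal.ofReal _ * 2), ← lintegral_const_mul _ hm1, mul_assoc]
  gcongr with w
  exact hinner w

/-- Small relative velocities are small through the rate `r` and the plain `L²` bound; the others
through Young's inequality and the smoothing estimate, which requires `|u| ≥ r`. Each of the three
losses gets a third of `τ`. -/
lemma exists_lintegral_rateCut_le (hd : 2 ≤ d) {δ : ℝ} (hδ : 0 < δ) {L τ : ℝ≥0∞} (hL : L ≠ ∞)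
    (hτ : τ ≠ 0) :
    ∃ (r : ℝ) (T D : ℝ≥0∞), D ≠ ∞ ∧ L * T ≤ τ ∧ ∀ h : E d → ℝ≥0∞, Measurable h →
      ∫⁻ u, rateCut r u * (h u * coneAvg δ h u) ≤ T * (∫⁻ u, h u ^ 2) + D * (∫⁻ u, h u) ^ 2 := by
  have hτ3 : τ / 3 ≠ 0 := (ENNReal.div_pos hτ (by simp)).ne'
  set B : ℝ≥0∞ := surf d Set.univ * (ENNReal.ofReal ((2 / δ) ^ (d - 1)) * 2) with hB
  have hBt : B ≠ ∞ := ENNReal.mul_ne_top (measure_ne_top _ _)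
    (ENNReal.mul_ne_top ENNReal.ofReal_ne_top (by simp))
  obtain ⟨x, hx0, hxt, hx⟩ := exists_mul_le_of_ne_zero (L := L * (1 + B))
    (ENNReal.mul_ne_top hL (ENNReal.add_ne_top.2 ⟨ENNReal.one_ne_top, hBt⟩)) hτ3
  obtain ⟨η, hη0, hηt, hη⟩ := exists_mul_le_of_ne_zero (L := L * 3)
    (ENNReal.mul_ne_top hL (by simp)) hτ3
  have hηi : η⁻¹ ≠ ∞ := ENNReal.inv_ne_top.2 hη0
  obtain ⟨e, he0, -, he⟩ := exists_mul_le_of_ne_zero (L := L * 3 * η⁻¹)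
    (ENNReal.mul_ne_top (ENNReal.mul_ne_top hL (by simp)) hηi) hτ3
  have hr : 0 < x.toReal := ENNReal.toReal_pos hx0 hxt
  obtain ⟨C, hC, hsm⟩ := coneAvg_smoothing hd hδ hr he0
  refine ⟨x.toReal, (1 + B) * x + 3 * η + 3 * η⁻¹ * e, 3 * η⁻¹ * C,
    ENNReal.mul_ne_top (ENNReal.mul_ne_top (by simp) hηi) hC, ?_, fun h hh => ?_⟩
  · calc L * ((1 + B) * x + 3 * η + 3 * η⁻¹ * e)
        = L * (1 + B) * x + L * 3 * η + L * 3 * η⁻¹ * e := by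
          simp only [mul_add, add_mul, mul_assoc]
      _ ≤ τ / 3 + τ / 3 + τ / 3 := add_le_add (add_le_add hx hη) he
      _ = τ := ENNReal.add_thirds τ
  have hmN : Measurable fun u => coneAvg δ h u :=
    measurable_coneAvg (X := E d) δ (h := fun _ => h) (hh.comp measurable_snd) measurable_id
  have hm2 : Measurable fun u => h u ^ 2 := by fun_prop
  have hmN2 : Measurable fun u => coneAvg δ h u ^ 2 := by fun_prop
  have hmI : Measurable fun u : E d => (if x.toReal ≤ ‖u‖ then (1 : ℝ≥0∞) else 0) *
      coneAvg δ h u ^ 2 :=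
    Measurable.mul (Measurable.ite (measurableSet_le measurable_const (by fun_prop))
      measurable_const measurable_const) hmN2
  have hpt : ∀ u : E d, rateCut x.toReal u * (h u * coneAvg δ h u)
      ≤ (x * h u ^ 2 + x * coneAvg δ h u ^ 2) + (3 * η * h u ^ 2 + 3 * η⁻¹ *
        ((if x.toReal ≤ ‖u‖ then (1 : ℝ≥0∞) else 0) * coneAvg δ h u ^ 2)) := by
    intro u
    unfold rateCut
    split_ifs with hu
    · refine le_trans ?_ le_add_self
      calc 3 * (h u * coneAvg δ h u) ≤ 3 * (η * h u ^ 2 + η⁻¹ * coneAvg δ h u ^ 2) :=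
            mul_le_mul_right (mul_le_weighted_sq_add hη0 hηt) 3
        _ = _ := by rw [mul_add, one_mul, mul_assoc, mul_assoc]
    · refine le_trans ?_ le_self_add
      rw [ENNReal.ofReal_toReal hxt, ← mul_add]
      refine mul_le_mul_right ?_ x
      simpa using mul_le_weighted_sq_add (a := h u) (b := coneAvg δ h u) one_ne_zero
        ENNReal.one_ne_top
  have hE2 := lintegral_coneAvg_sq_le hd hδ (capBound_univ d δ) hh
  have p1 : Measurable fun u => x * h u ^ 2 := hm2.const_mul x
  have p2 : Measurable fun u => x * coneAvg δ h u ^ 2 := hmN2.const_mul x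
  have p3 : Measurable fun u => 3 * η * h u ^ 2 := hm2.const_mul _
  have p12 : Measurable fun u => x * h u ^ 2 + x * coneAvg δ h u ^ 2 := p1.add p2
  refine (lintegral_mono hpt).trans ?_
  rw [lintegral_add_left p12, lintegral_add_left p1, lintegral_add_left p3,
    lintegral_const_mul _ hm2, lintegral_const_mul _ hmN2, lintegral_const_mul _ hm2,
    lintegral_const_mul _ hmI]
  set X := ∫⁻ u, h u ^ 2 with hX
  calc _ ≤ (x * X + x * (surf d Set.univ * (ENNReal.ofReal ((2 / δ) ^ (d - 1)) * 2 * X)))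
        + (3 * η * X + 3 * η⁻¹ * (e * X + C * (∫⁻ u, h u) ^ 2)) :=
        add_le_add (add_le_add le_rfl (mul_le_mul_right hE2 x))
          (add_le_add le_rfl (mul_le_mul_right (hsm h hh) _))
    _ = _ := by
        rw [hB]
        generalize η⁻¹ = y
        ring

/-- The gain term is dominated by a small multiple of the weighted energy. -/
theorem exists_gain_energy_le (hd : 2 ≤ d) {m τ : ℝ≥0∞} (hm : m ≠ ∞) (hτ : τ ≠ 0) :
    ∃ D : ℝ≥0∞, D ≠ ∞ ∧ ∀ {ε : ℝ} {K : ℕ} {ψ : E d → ℝ}, 0 ≤ ε → Measurable ψ → (∀ ξ, 0 ≤ ψ ξ) →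
      ∫⁻ ξ, massDensity ε K ψ ξ ≤ m →
      ∫⁻ ξ, gain ψ ξ * ENNReal.ofReal (ψ ξ * weight ε K ξ)
        ≤ τ * (∫⁻ ξ, energyDensity ε K ψ ξ) + D := by
  obtain ⟨C, hC, h⟩ := exists_gain_weight_le hd
  obtain ⟨r, T, D, hD, hT, hr⟩ := exists_lintegral_rateCut_le hd (δ := Real.sqrt (1 / 2))
    (Real.sqrt_pos.2 (by norm_num)) (ENNReal.mul_ne_top hC hm) hτ
  refine ⟨C * m * (D * m ^ 2), ENNReal.mul_ne_top (ENNReal.mul_ne_top hC hm)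
    (ENNReal.mul_ne_top hD (ENNReal.pow_ne_top hm)), fun {ε K ψ} hε hψ h0 hG => ?_⟩
  refine (h hε hψ h0 r).trans ?_
  have hf := measurable_rootDensity (ε := ε) (K := K) hψ
  have hgm := measurable_massDensity (ε := ε) (K := K) hψ
  set X := ∫⁻ ξ, energyDensity ε K ψ ξ with hX
  have hF : ∫⁻ ξ, rootDensity ε K ψ ξ ≤ m :=
    (lintegral_mono fun ξ => rootDensity_le_massDensity hε h0 ξ).trans hG
  have hb : ∀ w, ∫⁻ u, rateCut r u * (rootDensity ε K ψ (w + u) *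
          coneAvg (Real.sqrt (1 / 2)) (fun y => rootDensity ε K ψ (w + y)) u)
        ≤ T * X + D * m ^ 2 := by
    intro w
    refine (hr (fun y => rootDensity ε K ψ (w + y)) (hf.comp (by fun_prop))).trans ?_
    rw [lintegral_add_left_eq_self (fun y => rootDensity ε K ψ y ^ 2) w,
      lintegral_add_left_eq_self (fun y => rootDensity ε K ψ y) w]
    simp only [rootDensity_sq hε h0]
    gcongr
  calc _ ≤ C * ∫⁻ w, massDensity ε K ψ w * (T * X + D * m ^ 2) := by
        gcongr with w
        exact hb w
    _ = C * ((∫⁻ w, massDensity ε K ψ w) * (T * X + D * m ^ 2)) := by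
        rw [lintegral_mul_const _ hgm]
    _ ≤ C * (m * (T * X + D * m ^ 2)) := by gcongr
    _ = (C * m * T) * X + C * m * (D * m ^ 2) := by ring
    _ ≤ _ := by gcongr

end smoothing

/-! ### Removal of the truncation and conclusion -/

section energy

variable {d : ℕ} {α ε : ℝ} {K : ℕ} {ψ : E d → ℝ}

lemma tendsto_truncEnergy (hε : 0 ≤ ε) (hψ : Measurable ψ) (h0 : ∀ ξ, 0 ≤ ψ ξ) :
    Tendsto (fun n : ℕ => ∫⁻ ξ, truncEnergy ε K ψ n ξ) atTop
      (𝓝 (∫⁻ ξ, energyDensity ε K ψ ξ)) := by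
  refine lintegral_tendsto_of_tendsto_of_monotone
    (fun n => (measurable_truncEnergy hψ _).aemeasurable) (Eventually.of_forall fun ξ => ?_)
    (Eventually.of_forall fun ξ => ?_)
  · intro a b hab
    refine ENNReal.ofReal_le_ofReal (mul_le_mul_of_nonneg_right (mul_le_mul_of_nonneg_left
      (min_le_min_left _ (Nat.cast_le.2 hab)) (h0 ξ)) ?_)
    exact zero_le_one.trans (one_le_bracket_mul_weight hε ξ)
  · refine tendsto_const_nhds.congr' ?_
    obtain ⟨n, hn⟩ := exists_nat_ge (ψ ξ)
    filter_upwards [eventually_ge_atTop n] with k hk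
    unfold truncEnergy energyDensity
    rw [min_eq_left (hn.trans (Nat.cast_le.2 hk))]

namespace NiceProfile

lemma lintegral_energy_ne_top (hd : 2 ≤ d) (h : NiceProfile α ψ) (hα0 : 0 < α) (hα1 : α ≤ 1)
    (hε : 0 ≤ ε) (hε1 : ε ≤ 1) {c : ℝ} (hc : 0 < c)
    (hI : ∀ M : ℝ, 0 ≤ M → ENNReal.ofReal c * ∫⁻ ξ, truncEnergy ε K ψ M ξ
      ≤ ∫⁻ ξ, gain ψ ξ * ENNReal.ofReal (min (ψ ξ) M * weight ε K ξ)) :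
    ∫⁻ ξ, energyDensity ε K ψ ξ ≠ ∞ := by
  obtain ⟨B, hB, hle⟩ := h.exists_truncEnergy_bound hd hα0 hα1 hε hε1 hc hI
  exact ne_top_of_le_ne_top hB (le_of_tendsto' (tendsto_truncEnergy hε h.meas h.nonneg)
    fun n => hle n (Nat.cast_nonneg n))

lemma energy_le_gain (h : NiceProfile α ψ) (hε : 0 ≤ ε) {c : ℝ}
    (hI : ∀ M : ℝ, 0 ≤ M → ENNReal.ofReal c * ∫⁻ ξ, truncEnergy ε K ψ M ξ
      ≤ ∫⁻ ξ, gain ψ ξ * ENNReal.ofReal (min (ψ ξ) M * weight ε K ξ)) :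
    ENNReal.ofReal c * ∫⁻ ξ, energyDensity ε K ψ ξ
      ≤ ∫⁻ ξ, gain ψ ξ * ENNReal.ofReal (ψ ξ * weight ε K ξ) := by
  refine le_of_tendsto' (ENNReal.Tendsto.const_mul (tendsto_truncEnergy hε h.meas h.nonneg)
    (Or.inr ENNReal.ofReal_ne_top)) fun n => (hI n (Nat.cast_nonneg n)).trans ?_
  refine lintegral_mono fun ξ => mul_le_mul_right (ENNReal.ofReal_le_ofReal ?_) _
  exact mul_le_mul_of_nonneg_right (min_le_left _ _) (weight_pos hε ξ).le

end NiceProfile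

end energy

/-- Uniform bound for the weighted energy of the profiles. -/
theorem exists_energy_bound {d : ℕ} (hd : 2 ≤ d) {αs : ℝ} (hαs : αs < alphaBar d) (K : ℕ) :
    ∃ (ε : ℝ) (B : ℝ≥0∞), 0 < ε ∧ ε ≤ 1 ∧ B ≠ ∞ ∧ ∀ (α : ℝ) (ψ : E d → ℝ), 0 < α → α < αs →
      NiceProfile α ψ → ∫⁻ ξ, energyDensity ε K ψ ξ ≤ B := by
  have h0 : αs < alpha0 d := hαs.trans_le (min_le_left _ _)
  obtain ⟨ε, c, hε, hε1, hc, hI⟩ := exists_weighted_inequality hd hαs K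
  obtain ⟨m, hm⟩ := exists_moment_bound hd h0 (2 * K + 1)
  obtain ⟨D, hD, hgain⟩ := exists_gain_energy_le hd (m := ENNReal.ofReal m)
    (τ := ENNReal.ofReal (c / 2)) ENNReal.ofReal_ne_top (ENNReal.ofReal_pos.2 (by positivity)).ne'
  have hc2 : ENNReal.ofReal (c / 2) ≠ 0 := (ENNReal.ofReal_pos.2 (by positivity)).ne'
  refine ⟨ε, D / ENNReal.ofReal (c / 2), hε, hε1, ENNReal.div_ne_top hD hc2,
    fun α ψ hα0 hα h => ?_⟩
  have hα1 := alpha_le_one hd h0 hα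
  have hlow : ∀ M : ℝ, 0 ≤ M → ENNReal.ofReal c * ∫⁻ ξ, truncEnergy ε K ψ M ξ
      ≤ ∫⁻ ξ, gain ψ ξ * ENNReal.ofReal (min (ψ ξ) M * weight ε K ξ) := fun M hM =>
    h.weighted_inequality_lintegral hε.le hc.le hM
      (h.lintegral_truncEnergy_ne_top hd hα0 hα1 hε.le hε1 hM) (hI α ψ hα0 hα h M hM)
  rw [ENNReal.le_div_iff_mul_le (Or.inl hc2) (Or.inl ENNReal.ofReal_ne_top), mul_comm]
  refine absorb_half hc.le (h.lintegral_energy_ne_top hd hα0 hα1 hε.le hε1 hc hlow) ?_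
  refine (h.energy_le_gain hε.le hlow).trans (hgain hε.le h.meas h.nonneg ?_)
  exact (h.lintegral_massDensity_le hd hα0 hα1 hε.le hε1).trans
    (ENNReal.ofReal_le_ofReal (hm α ψ hα0 hα h))

/-- The weight dominates `ε^K ⟨ξ⟩^(2K)`, so fixing a small `ε` costs only a constant. -/
lemma normL2_le_of_energy {d : ℕ} {ε : ℝ} (hε : 0 < ε) (hε1 : ε ≤ 1) {K : ℕ} {k : ℝ} (hk : k ≤ K)
    (ψ : E d → ℝ) :
    normL2 k ψ ≤ (ENNReal.ofReal (ε ^ K)⁻¹ * ∫⁻ ξ, energyDensity ε K ψ ξ) ^ (1 / 2 : ℝ) := by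
  unfold normL2
  rw [eLpNorm_eq_lintegral_rpow_enorm_toReal two_ne_zero ENNReal.ofNat_ne_top, ENNReal.toReal_ofNat]
  refine ENNReal.rpow_le_rpow ?_ (by norm_num)
  rw [← lintegral_const_mul' _ _ ENNReal.ofReal_ne_top]
  refine lintegral_mono fun ξ => ?_
  have hb := one_le_bracket ξ
  have hb0 := bracket_pos ξ
  have hεK : 0 < ε ^ K := pow_pos hε K
  unfold energyDensity
  dsimp only
  rw [Real.enorm_eq_ofReal_abs, ENNReal.rpow_ofNat, ← ENNReal.ofReal_pow (abs_nonneg _), sq_abs,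
    ← ENNReal.ofReal_mul (inv_nonneg.2 hεK.le)]
  refine ENNReal.ofReal_le_ofReal ?_
  have h1 : bracket ξ ^ k ≤ bracket ξ ^ K := by
    rw [← Real.rpow_natCast]; exact Real.rpow_le_rpow_of_exponent_le hb hk
  have h2 : (bracket ξ ^ k) ^ 2 ≤ bracket ξ ^ (2 * K) := by
    rw [mul_comm 2 K, pow_mul]; exact pow_le_pow_left₀ (Real.rpow_nonneg hb0.le k) h1 2
  have h3 := le_weight (K := K) hε.le hε1 ξ
  have h4 : weight ε K ξ ≤ bracket ξ * weight ε K ξ :=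
    le_mul_of_one_le_left (weight_pos hε.le ξ).le hb
  rw [mul_pow, inv_mul_eq_div, le_div_iff₀ hεK]
  calc ψ ξ ^ 2 * (bracket ξ ^ k) ^ 2 * ε ^ K = ψ ξ ^ 2 * (ε ^ K * (bracket ξ ^ k) ^ 2) := by ring
    _ ≤ ψ ξ ^ 2 * (bracket ξ * weight ε K ξ) := mul_le_mul_of_nonneg_left
        ((mul_le_mul_of_nonneg_left h2 hεK.le).trans (h3.trans h4)) (sq_nonneg _)
    _ = _ := by ring

end Annihilation

end

theorem proposition2p5 (d : ℕ) (hd : 2 ≤ d) (αs : ℝ) (hαs : αs < Annihilation.alphaBar d)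
    (k : ℝ) (hk : 0 ≤ k) :
    ∃ C : NNReal, ∀ α ∈ Set.Ioo (0 : ℝ) αs, ∀ ψ ∈ Annihilation.profiles d α,
      Annihilation.normL2 k ψ ≤ (C : ENNReal) := by
  obtain ⟨K, hK⟩ := exists_nat_ge k
  obtain ⟨ε, B, hε, hε1, hB, h⟩ := Annihilation.exists_energy_bound hd hαs K
  have hfin : (ENNReal.ofReal (ε ^ K)⁻¹ * B) ^ (1 / 2 : ℝ) ≠ ⊤ :=
    ENNReal.rpow_ne_top_of_nonneg (by norm_num) (ENNReal.mul_ne_top ENNReal.ofReal_ne_top hB)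
  refine ⟨((ENNReal.ofReal (ε ^ K)⁻¹ * B) ^ (1 / 2 : ℝ)).toNNReal, fun α hα ψ hψ => ?_⟩
  rw [ENNReal.coe_toNNReal hfin]
  obtain ⟨ψ', hae, hn⟩ := Annihilation.IsProfile.exists_nice hd hψ
  have hcongr : Annihilation.normL2 k ψ = Annihilation.normL2 k ψ' :=
    MeasureTheory.eLpNorm_congr_ae (hae.mono fun ξ hξ => by simp only [hξ])
  rw [hcongr]
  refine (Annihilation.normL2_le_of_energy hε hε1 hK ψ').trans ?_
  gcongr
  exact h α ψ' hα.1 hα.2 hn
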